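/- Setting. Let $X$ be a smooth (irreducible) projective variety over $\mathbb{C}$, $U\subset X$ a nonempty open subvariety with reduced complement $S=X\setminus U$, and $f\in\Gamma(U,\mathcal{O}_U)$, regarded as a rational function on $X$. Let $P$ and $Z$ be the pole divisor and the zero divisor of $f$ on $X$, with multiplicities. Assume that $X$ is a non-degenerate compactification of $(U,f)$: $S$ is a normal crossing divisor (not necessarily with smooth components), and there is an open neighbourhood $V$ of the support of $P$ such that $Z\cap V$ is smooth and $Z+S$ is a reduced normal crossing divisor on $V$. For $\mu\in\mathbb{Q}$ let $\lfloor\mu P\rfloor$ be the divisor obtained by rounding down the coefficients of $\mu P$. For $\Theta\in\{\mathrm{d}+\mathrm{d}f,\ \mathrm{d}f\}$ (where $\mathrm{d}f$ stands for $\omega\mapsto \mathrm{d}f\wedge\omega$), $\alpha\in\mathbb{Q}$ and an integer $p\ge 0$, the Kontsevich sheaf is $$\Omega_f^p(\alpha)=\ker\Big\{\Theta\colon \Omega_X^p(\log S)(\lfloor\alpha P\rfloor)\to \Omega_X^{p+1}(*S)/\Omega_X^{p+1}(\log S)(\lfloor\alpha P\rfloor)\Big\},\qquad \Omega_f^p=\Omega_f^p(0).$$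 For $\lambda\in\mathbb{Q}$ let $F^\lambda(\Theta)$ be the complex with differential $\Theta$ whose term in degree $i\geq 0$ is $\Omega_X^i(\log S)(\lfloor(i-\lambda)P\rfloor)$ if $i-\lambda\ge 0$, and $0$ otherwise. For a complex $C^\bullet$ and $p\in\mathbb{Z}$, $(C^\bullet)_{\bullet\ge p}$ denotes the subcomplex whose terms are $C^i$ for $i\ge p$ and $0$ for $i<p$. Proposition. (i) For all $\alpha\in\mathbb{Q}$ and all integers $p\ge 0$ (forms of negative degree being zero), $\Omega_f^p(\alpha)$ is the same for both choices of $\Theta$, it is a locally free $\mathcal{O}_X$-module of rank $\binom{\dim X}{p}$, and multiplication of forms by functions induces an isomorphism $$\Omega_f^p\otimes_{\mathcal{O}_X}\mathcal{O}_X(\lfloor\alpha P\rfloor)\;\cong\;\Omega_f^p(\alpha).$$ (ii) For both $\Theta\in\{\mathrm{d}+\mathrm{d}f,\ \mathrm{d}f\}$, the following are inclusions of complexes of sheaves on $X$ (with differential $\Theta$), and they are quasi-isomorphisms: $$F^0(\Theta)\to F^{-\alpha}(\Theta)\quad(\alpha\in\mathbb{Q},\ \alpha\ge 0),$$ $$(\Omega_f^\bullet(\alpha),\Theta)\to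 F^{-\alpha}(\Theta)\quad(\alpha\in\mathbb{Q},\ \alpha\ge 0),$$ $$(\Omega_f^\bullet(\alpha),\Theta)_{\bullet\ge p}\to F^{-\alpha+p}(\Theta)\quad(\alpha\in\mathbb{Q},\ 0\le\alpha<1,\ p\in\mathbb{Z}).$$ -/

import Mathlib

noncomputable section

open scoped KaehlerDifferential

namespace KahlerForms

variable (k A : Type) [CommRing k] [CommRing A] [Algebra k A]

/-- The algebra `⋀ Ω_{A/k}` of Kähler differential forms. -/
abbrev Forms : Type := ExteriorAlgebra A (Ω[A⁄k])

/-- The exterior algebra on `A ε ⊕ Ω_{A/k}`. -/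
abbrev EpsForms : Type := ExteriorAlgebra A (A × Ω[A⁄k])

/-- The generator `ε`. -/
def eps : EpsForms k A := ExteriorAlgebra.ι A (1, 0)

/-- The derivation `b ↦ db` into `EpsForms`. -/
def epsD : Derivation k A (EpsForms k A) :=
  ((ExteriorAlgebra.ι A).comp (LinearMap.inr A A (Ω[A⁄k]))).compDer (KaehlerDifferential.D k A)

lemma epsD_apply (a : A) :
    epsD k A a = ExteriorAlgebra.ι A (0, KaehlerDifferential.D k A a) := rfl

lemma ι_anticomm {M : Type} [AddCommGroup M] [Module A M] (v w : M) :
    ExteriorAlgebra.ι A v * ExteriorAlgebra.ι A w =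
      - (ExteriorAlgebra.ι A w * ExteriorAlgebra.ι A v) :=
  eq_neg_of_add_eq_zero_left (ExteriorAlgebra.ι_add_mul_swap v w)

lemma epsD_eps (a : A) : epsD k A a * eps k A = - (eps k A * epsD k A a) := ι_anticomm A _ _

lemma epsD_epsD (a b : A) : epsD k A a * epsD k A b = - (epsD k A b * epsD k A a) :=
  ι_anticomm A _ _

lemma eps_eps : eps k A * eps k A = 0 := ExteriorAlgebra.ι_sq_zero _

/-- The ring homomorphism `a ↦ a + ε da`. -/
def epsHom : A →+* EpsForms k A where
  toFun a := algebraMap A _ a + eps k A * epsD k A a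
  map_one' := by simp
  map_zero' := by simp
  map_add' a b := by rw [map_add, map_add, mul_add]; abel
  map_mul' a b := by
    have h2 : eps k A * epsD k A a * (eps k A * epsD k A b) = 0 := by
      rw [mul_assoc, ← mul_assoc (epsD k A a), epsD_eps, neg_mul, mul_neg, ← mul_assoc,
        ← mul_assoc, eps_eps]
      simp
    rw [Derivation.leibniz, add_mul, mul_add, mul_add, mul_add, h2, map_mul,
      ← Algebra.commutes b (eps k A * epsD k A a), ← Algebra.smul_def, ← Algebra.smul_def,
      ← Algebra.smul_def, mul_smul_comm, mul_smul_comm]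
    abel

lemma epsHom_apply (a : A) :
    epsHom k A a = algebraMap A _ a + eps k A * epsD k A a := rfl

lemma epsHom_comm (a : A) (x : EpsForms k A) : epsHom k A a * x = x * epsHom k A a := by
  induction x using ExteriorAlgebra.induction with
  | algebraMap r => exact (Algebra.commutes _ _).symm
  | ι v =>
    have h1 : eps k A * ExteriorAlgebra.ι A v = - (ExteriorAlgebra.ι A v * eps k A) :=
      ι_anticomm A _ _
    have h2 : epsD k A a * ExteriorAlgebra.ι A v = - (ExteriorAlgebra.ι A v * epsD k A a) :=
      ι_anticomm A _ _
    rw [epsHom_apply, add_mul, mul_add, Algebra.commutes a, mul_assoc, h2, mul_neg, ← mul_assoc,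
      h1, neg_mul, neg_neg, mul_assoc]
  | mul x y hx hy => rw [← mul_assoc, hx, mul_assoc, hy, mul_assoc]
  | add x y hx hy => rw [mul_add, add_mul, hx, hy]

/-- `EpsForms` as an `A`-algebra via `a ↦ a + ε da`. -/
def Twisted : Type := EpsForms k A

instance : Ring (Twisted k A) := inferInstanceAs (Ring (EpsForms k A))

/-- The identity, as a ring isomorphism. -/
def toTwisted : EpsForms k A ≃+* Twisted k A := RingEquiv.refl _

instance : Algebra A (Twisted k A) :=
  ((toTwisted k A).toRingHom.comp (epsHom k A)).toAlgebra' (epsHom_comm k A)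

instance : Algebra k (Twisted k A) :=
  ((algebraMap A (Twisted k A)).comp (algebraMap k A)).toAlgebra' fun _ x => epsHom_comm k A _ x

instance : IsScalarTower k A (Twisted k A) := IsScalarTower.of_algebraMap_eq' rfl

lemma twisted_smul (a : A) (x : EpsForms k A) :
    a • toTwisted k A x = toTwisted k A (a • x + eps k A * epsD k A a * x) := by
  rw [Algebra.smul_def, Algebra.smul_def a x, ← add_mul, map_mul]
  rfl

lemma twisted_smul' (c : k) (x : EpsForms k A) :
    c • toTwisted k A x = toTwisted k A (c • x) := by
  rw [← algebraMap_smul A c (toTwisted k A x), twisted_smul]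
  simp

/-- The derivation `b ↦ db` into `Twisted`; it lifts to `ω ↦ ω + ε dω` on `Ω_{A/k}`. -/
def twistedDer : Derivation k A (Twisted k A) where
  toFun b := toTwisted k A (epsD k A b)
  map_add' a b := by rw [map_add, map_add]
  map_smul' c b := by rw [RingHom.id_apply, twisted_smul', Derivation.map_smul]
  map_one_eq_zero' := by
    change toTwisted k A (epsD k A 1) = 0
    simp
  leibniz' a b := by
    change toTwisted k A (epsD k A (a * b)) = a • toTwisted k A (epsD k A b) +
      b • toTwisted k A (epsD k A a)
    rw [twisted_smul, twisted_smul, ← map_add, Derivation.leibniz, mul_assoc, mul_assoc,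
      epsD_epsD k A a b, mul_neg]
    congr 1
    abel

/-- The `A`-linear map `Ω → Twisted`, `ω ↦ ω + ε dω`. -/
def twistedι : Ω[A⁄k] →ₗ[A] Twisted k A := (twistedDer k A).liftKaehlerDifferential

lemma twistedι_D (b : A) :
    twistedι k A (KaehlerDifferential.D k A b) = toTwisted k A (epsD k A b) :=
  (twistedDer k A).liftKaehlerDifferential_comp_D b

lemma twistedι_anti (v w : Ω[A⁄k]) :
    twistedι k A v * twistedι k A w = - (twistedι k A w * twistedι k A v) := by
  have hv : v ∈ Submodule.span A (Set.range (KaehlerDifferential.D k A)) := by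
    rw [KaehlerDifferential.span_range_derivation]; trivial
  have hw : w ∈ Submodule.span A (Set.range (KaehlerDifferential.D k A)) := by
    rw [KaehlerDifferential.span_range_derivation]; trivial
  induction hv using Submodule.span_induction with
  | mem x hx =>
    obtain ⟨a, rfl⟩ := hx
    induction hw using Submodule.span_induction with
    | mem y hy =>
      obtain ⟨b, rfl⟩ := hy
      rw [twistedι_D, twistedι_D, ← map_mul (toTwisted k A), ← map_mul (toTwisted k A), epsD_epsD,
        map_neg]
    | zero => simp
    | add x y _ _ hx hy => rw [map_add, mul_add, add_mul, hx, hy]; abel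
    | smul a x _ hx => rw [map_smul, mul_smul_comm, smul_mul_assoc, hx, smul_neg]
  | zero => simp
  | add x y _ _ hx hy => rw [map_add, mul_add, add_mul, hx, hy]; abel
  | smul a x _ hx => rw [map_smul, mul_smul_comm, smul_mul_assoc, hx, smul_neg]

lemma twistedι_sq (v : Ω[A⁄k]) : twistedι k A v * twistedι k A v = 0 := by
  have hv : v ∈ Submodule.span A (Set.range (KaehlerDifferential.D k A)) := by
    rw [KaehlerDifferential.span_range_derivation]; trivial
  induction hv using Submodule.span_induction with
  | mem x hx =>
    obtain ⟨a, rfl⟩ := hx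
    rw [twistedι_D, ← map_mul (toTwisted k A), epsD_apply, ExteriorAlgebra.ι_sq_zero, map_zero]
  | zero => simp
  | add x y _ _ hx hy =>
    rw [map_add, mul_add, add_mul, add_mul, hx, hy, twistedι_anti k A x y]; abel
  | smul a x _ hx => rw [map_smul, mul_smul_comm, smul_mul_assoc, hx, smul_zero, smul_zero]

/-- The algebra homomorphism `ω ↦ ω + ε dω`. -/
def twistedLift : Forms k A →ₐ[A] Twisted k A :=
  ExteriorAlgebra.lift A ⟨twistedι k A, twistedι_sq k A⟩

/-- The exterior derivative on Kähler differential forms: the coefficient of `ε` in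
`ω + ε dω`. -/
def extDer : Forms k A →+ Forms k A :=
  (((ExteriorAlgebra.map (LinearMap.snd A A (Ω[A⁄k]))).toLinearMap.comp
    (CliffordAlgebra.contractLeft (LinearMap.fst A A (Ω[A⁄k])))).toAddMonoidHom.comp
    (toTwisted k A).symm.toAddMonoidHom).comp (twistedLift k A).toLinearMap.toAddMonoidHom

lemma extDer_apply (ω : Forms k A) : extDer k A ω =
    ExteriorAlgebra.map (LinearMap.snd A A (Ω[A⁄k]))
      (CliffordAlgebra.contractLeft (LinearMap.fst A A (Ω[A⁄k]))
        ((toTwisted k A).symm (twistedLift k A ω))) := rfl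

variable {A}

/-- The product `db₁ ∧ ⋯ ∧ dbₚ`. -/
def dProd (l : List A) : Forms k A :=
  (l.map fun b => ExteriorAlgebra.ι A (KaehlerDifferential.D k A b)).prod

@[simp] lemma dProd_nil : dProd k ([] : List A) = 1 := rfl

lemma dProd_cons (b : A) (l : List A) :
    dProd k (b :: l) = ExteriorAlgebra.ι A (KaehlerDifferential.D k A b) * dProd k l := rfl

lemma dProd_append (l l' : List A) : dProd k (l ++ l') = dProd k l * dProd k l' := by
  simp [dProd]

lemma forms_induction {C : Forms k A → Prop} (zero : C 0)
    (add : ∀ x y, C x → C y → C (x + y)) (mono : ∀ (a : A) (l : List A), C (a • dProd k l))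
    (ω : Forms k A) : C ω := by
  have h : ω ∈ Submodule.span A (Set.range (dProd k (A := A))) := by
    induction ω using ExteriorAlgebra.induction with
    | algebraMap r =>
      rw [Algebra.algebraMap_eq_smul_one]
      exact Submodule.smul_mem _ _ (Submodule.subset_span ⟨[], rfl⟩)
    | ι v =>
      have hv : v ∈ Submodule.span A (Set.range (KaehlerDifferential.D k A)) := by
        rw [KaehlerDifferential.span_range_derivation]; trivial
      induction hv using Submodule.span_induction with
      | mem x hx =>
        obtain ⟨a, rfl⟩ := hx
        exact Submodule.subset_span ⟨[a], by simp [dProd]⟩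
      | zero => simp
      | add x y _ _ hx hy => rw [map_add]; exact add_mem hx hy
      | smul a x _ hx => rw [map_smul]; exact Submodule.smul_mem _ _ hx
    | mul x y hx hy =>
      have := Submodule.mul_mem_mul hx hy
      rw [Submodule.span_mul_span] at this
      refine Submodule.span_mono ?_ this
      rintro _ ⟨_, ⟨l, rfl⟩, _, ⟨l', rfl⟩, rfl⟩
      exact ⟨l ++ l', dProd_append k l l'⟩
    | add x y hx hy => exact add_mem hx hy
  obtain ⟨c, rfl⟩ := (Finsupp.mem_span_range_iff_exists_finsupp).1 h
  induction c using Finsupp.induction_linear with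
  | zero => simpa using zero
  | add f g hf hg =>
    rw [Finsupp.sum_add_index' (by simp) (by intros; simp [add_smul])]
    refine add _ _ (hf ?_) (hg ?_)
    all_goals
      rw [Finsupp.mem_span_range_iff_exists_finsupp]
      exact ⟨_, rfl⟩
  | single l a => simpa using mono a l

/-- The exterior derivative is given by `d (a db₁ ∧ ⋯ ∧ dbₚ) = da ∧ db₁ ∧ ⋯ ∧ dbₚ`. -/
theorem extDer_smul_dProd (a : A) (l : List A) :
    extDer k A (a • dProd k l) = dProd k (a :: l) := by
  let m : List A → EpsForms k A := fun l => (l.map (epsD k A)).prod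
  have h1 : ∀ l : List A, twistedLift k A (dProd k l) = toTwisted k A (m l) := by
    intro l
    induction l with
    | nil => simp [m]
    | cons b l ih =>
      rw [dProd_cons, map_mul, ih]
      simp only [m, List.map_cons, List.prod_cons, map_mul, twistedLift]
      rw [ExteriorAlgebra.lift_ι_apply, twistedι_D]
  have h2 : ∀ l : List A, CliffordAlgebra.contractLeft (LinearMap.fst A A (Ω[A⁄k])) (m l) = 0 := by
    intro l
    induction l with
    | nil => exact CliffordAlgebra.contractLeft_one _ _
    | cons b l ih =>
      simp only [m, List.map_cons, List.prod_cons]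
      rw [epsD_apply]
      refine (CliffordAlgebra.contractLeft_ι_mul _ _ _).trans ?_
      rw [ih]
      simp
  have h3 : ∀ l : List A, ExteriorAlgebra.map (LinearMap.snd A A (Ω[A⁄k])) (m l) = dProd k l := by
    intro l
    simp only [m, dProd, map_list_prod, List.map_map]
    congr 2
    ext b
    simp [epsD_apply, ExteriorAlgebra.map_apply_ι]
  rw [extDer_apply, map_smul, h1, twisted_smul, RingEquiv.symm_apply_apply, map_add, map_smul, h2,
    smul_zero, zero_add, mul_assoc]
  have : CliffordAlgebra.contractLeft (LinearMap.fst A A (Ω[A⁄k])) (eps k A * m (a :: l)) =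
      m (a :: l) := by
    refine (CliffordAlgebra.contractLeft_ι_mul _ _ _).trans ?_
    rw [h2]
    simp
  have h4 : epsD k A a * m l = m (a :: l) := rfl
  rw [h4, this, h3]

lemma extDer_smul (a : A) (ω : Forms k A) : extDer k A (a • ω) =
    ExteriorAlgebra.ι A (KaehlerDifferential.D k A a) * ω + a • extDer k A ω := by
  induction ω using forms_induction k with
  | zero => simp
  | add x y hx hy => rw [smul_add, map_add, map_add, mul_add, hx, hy, smul_add]; abel
  | mono b l =>
    rw [smul_smul, extDer_smul_dProd, extDer_smul_dProd, dProd_cons, dProd_cons,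
      Derivation.leibniz, map_add, add_mul, map_smul, map_smul, smul_mul_assoc, smul_mul_assoc,
      mul_smul_comm, add_comm]

lemma extDer_extDer (ω : Forms k A) : extDer k A (extDer k A ω) = 0 := by
  induction ω using forms_induction k with
  | zero => simp
  | add x y hx hy => rw [map_add, map_add, hx, hy, add_zero]
  | mono b l =>
    rw [extDer_smul_dProd, ← one_smul A (dProd k (b :: l)), extDer_smul_dProd, dProd_cons]
    simp

lemma extDer_ι_mul (a : A) (ω : Forms k A) :
    extDer k A (ExteriorAlgebra.ι A (KaehlerDifferential.D k A a) * ω) =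
      - (ExteriorAlgebra.ι A (KaehlerDifferential.D k A a) * extDer k A ω) := by
  induction ω using forms_induction k with
  | zero => simp
  | add x y hx hy => rw [mul_add, map_add, map_add, mul_add, hx, hy]; abel
  | mono b l =>
    rw [mul_smul_comm, ← dProd_cons, extDer_smul_dProd, extDer_smul_dProd, dProd_cons, dProd_cons,
      dProd_cons, ← mul_assoc, ← mul_assoc, ι_anticomm, neg_mul]

end KahlerForms

namespace KontsevichLog

open CategoryTheory AlgebraicGeometry TopologicalSpace Opposite
open KahlerForms

/-- Projectivity over `ℂ`: there is a closed immersion into some `ℙᴺ` over `ℂ`. -/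
def IsProjective {X : Scheme.{0}} (str : X ⟶ Spec (CommRingCat.of ℂ)) : Prop :=
  letI (N : ℕ) : GradedAlgebra (MvPolynomial.homogeneousSubmodule (Fin (N + 1)) ℂ) :=
    MvPolynomial.gradedAlgebra
  ∃ (N : ℕ) (i : X ⟶ Proj (MvPolynomial.homogeneousSubmodule (Fin (N + 1)) ℂ)),
    IsClosedImmersion i ∧
      i ≫ Proj.toSpecZero _ ≫ Spec.map (CommRingCat.ofHom (algebraMap ℂ _)) = str

/-- A smooth projective (irreducible) variety `X` over `ℂ` of dimension `dim`, with a nonempty open subvariety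
`U` and a regular function `f` on `U`. -/
structure CompactifiedPair where
  X : Scheme.{0}
  str : X ⟶ Spec (CommRingCat.of ℂ)
  dim : ℕ
  isIntegral : IsIntegral X
  smooth : SmoothOfRelativeDimension dim str
  projective : IsProjective str
  U : X.Opens
  nonempty : Nonempty U
  f : Γ(X, U)

namespace CompactifiedPair

variable (P : CompactifiedPair)

instance : IsIntegral P.X := P.isIntegral
instance : Nonempty P.U := P.nonempty

instance : IsLocallyNoetherian P.X :=
  haveI := P.smooth
  haveI : Smooth P.str := SmoothOfRelativeDimension.smooth P.dim P.str
  LocallyOfFiniteType.isLocallyNoetherian P.str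

/-- The field of rational functions on `X`. -/
abbrev K : Type := P.X.functionField

/-- The structure map `ℂ → Γ(X, 𝒪_X)`. -/
def scalars : ℂ →+* Γ(P.X, ⊤) :=
  P.str.appTop.hom.comp (Scheme.ΓSpecIso (CommRingCat.of ℂ)).inv.hom

instance : Nonempty (⊤ : P.X.Opens) := ⟨⟨genericPoint P.X, trivial⟩⟩

instance : Algebra ℂ P.K := ((P.X.germToFunctionField ⊤).hom.comp P.scalars).toAlgebra

/-- The local ring `𝒪_{X,x}`, as a subring of the function field. -/
def localRing (x : P.X) : Subalgebra ℂ P.K where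
  __ := (algebraMap (P.X.presheaf.stalk x) P.K).range
  algebraMap_mem' c := ⟨P.X.presheaf.germ ⊤ x trivial (P.scalars c),
    Scheme.algebraMap_germ_eq_germToFunctionField P.X (U := ⊤) (x := x) trivial (P.scalars c)⟩

/-- The maximal ideal of the local ring at `x`, as a subset of the function field. -/
def maxIdeal (x : P.X) : Set P.K :=
  algebraMap (P.X.presheaf.stalk x) P.K '' (IsLocalRing.maximalIdeal (P.X.presheaf.stalk x))

instance (x : P.X) : IsLocalRing (P.localRing x) :=
  IsLocalRing.of_surjective' (algebraMap (P.X.presheaf.stalk x) P.K).rangeRestrict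
    (RingHom.rangeRestrict_surjective _)

/-- `f`, regarded as a rational function on `X`. -/
def ratFun : P.K := P.X.germToFunctionField P.U P.f

/-- The multiplicity of the pole divisor `P` of `f` at a point of codimension one. -/
def poleMult (η : P.X) : ℤ := max 0 (-Scheme.ord P.ratFun η)

/-- The multiplicity of the zero divisor `Z` of `f` at a point of codimension one. -/
def zeroMult (η : P.X) : ℤ := max 0 (Scheme.ord P.ratFun η)

/-- The rounded-down divisor `⌊μ P⌋`. -/
def floorPole (μ : ℚ) (η : P.X) : ℤ := ⌊μ * (P.poleMult η : ℚ)⌋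

/-- The support of the pole divisor. -/
def poleSupport : Set P.X := {x | ∃ η : P.X, Order.coheight η = 1 ∧ η ⤳ x ∧ 0 < P.poleMult η}

/-- The stalk at `x` of the ideal of the reduced closed subscheme `S = X ∖ U`: the germs vanishing
at all points of `S` that specialize to `x`. -/
def boundaryIdeal (x : P.X) : Ideal (P.localRing x) :=
  Ideal.span {g | ∀ y : P.X, y ∉ P.U → y ⤳ x → (g : P.K) ∈ P.maxIdeal y}

/-- The rational functions `g` with `div g + D ≥ 0` near `x`, together with `0`. This generates the
stalk at `x` of `𝒪_X(D)`. -/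
def divisorSections (D : P.X → ℤ) (x : P.X) : Set P.K :=
  {g | ∀ η : P.X, Order.coheight η = 1 → η ⤳ x → g = 0 ∨ 0 ≤ Scheme.ord g η + D η}

/-- The stalk at `x` of the invertible sheaf `𝒪_X(D)` for a divisor `D = ∑ D(η) · closure {η}`. -/
def divisorStalk (D : P.X → ℤ) (x : P.X) : Submodule (P.localRing x) P.K :=
  Submodule.span (P.localRing x) (P.divisorSections D x)

/-- The stalk at `x` of the ideal `𝒪_X(-Z)` of the zero divisor of `f`. -/
def zeroIdeal (x : P.X) : Ideal (P.localRing x) :=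
  Ideal.span {g | (g : P.K) ∈ P.divisorSections (fun η => -P.zeroMult η) x}

end CompactifiedPair

/-- `I` is the ideal of a reduced normal crossing divisor in the `ℂ`-algebra `A`, a local ring of a
smooth variety: étale locally there are coordinates `t₁, …, tₙ` such that `I` is generated by the
product of some of them. -/
def IsNormalCrossing {A : Type} [CommRing A] [Algebra ℂ A] [IsLocalRing A] (I : Ideal A) : Prop :=
  ∃ (B : Type) (_ : CommRing B) (_ : Algebra A B) (_ : Algebra ℂ B) (_ : IsScalarTower ℂ A B),
    Algebra.Etale A B ∧ (IsLocalRing.maximalIdeal A).map (algebraMap A B) ≠ ⊤ ∧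
    ∃ (n : ℕ) (t : Fin n → B) (b : Module.Basis (Fin n) B (Ω[B⁄ℂ])) (J : Finset (Fin n)),
      (∀ i, b i = KaehlerDifferential.D ℂ B (t i)) ∧
      I.map (algebraMap A B) = Ideal.span {∏ j ∈ J, t j}

namespace CompactifiedPair

variable (P : CompactifiedPair)

/-- `X` is a non-degenerate compactification of `(U, f)`: the boundary `S = X ∖ U` is a normal
crossing divisor, and on a neighbourhood `V` of the pole divisor, the zero divisor `Z` of `f` is
smooth and `Z + S` is a reduced normal crossing divisor. -/
def IsNondegenerate : Prop :=
  (∀ x, IsNormalCrossing (P.boundaryIdeal x)) ∧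
  ∃ V : P.X.Opens, P.poleSupport ⊆ V ∧
    ∀ x ∈ V, (P.zeroIdeal x = ⊤ ∨ IsRegularLocalRing (P.localRing x ⧸ P.zeroIdeal x)) ∧
      IsNormalCrossing (P.zeroIdeal x * P.boundaryIdeal x)

/-- Rational differential forms on `X`, of all degrees. -/
abbrev RatForms : Type := Forms ℂ P.K

/-- The `1`-form `dg` of a rational function. -/
def dRat (g : P.K) : P.RatForms := ExteriorAlgebra.ι P.K (KaehlerDifferential.D ℂ P.K g)

/-- The stalk at `x` of `Ω^p_X`, spanned over `𝒪_{X,x}` by `db₁ ∧ ⋯ ∧ dbₚ` with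
`bᵢ ∈ 𝒪_{X,x}`. -/
def regForms (p : ℕ) (x : P.X) : Submodule (P.localRing x) P.RatForms :=
  Submodule.span (P.localRing x)
    {ω | ∃ b : Fin p → P.localRing x, ω = dProd ℂ (List.ofFn fun i => (b i : P.K))}

lemma dRat_mul_mem_regForms {p : ℕ} {x : P.X} (a : P.localRing x) {ω : P.RatForms}
    (hω : ω ∈ P.regForms p x) : P.dRat a * ω ∈ P.regForms (p + 1) x := by
  induction hω using Submodule.span_induction with
  | mem ω h =>
    obtain ⟨b, rfl⟩ := h
    refine Submodule.subset_span ⟨Fin.cons a b, ?_⟩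
    rw [List.ofFn_succ, dProd_cons]
    simp [dRat]
  | zero => simp
  | add u v _ _ hu hv => rw [mul_add]; exact add_mem hu hv
  | smul c u _ hu =>
    rw [mul_smul_comm]
    exact Submodule.smul_mem _ _ hu

lemma extDer_subalgebra_smul {x : P.X} (a : P.localRing x) (ω : P.RatForms) :
    extDer ℂ P.K (a • ω) = P.dRat a * ω + a • extDer ℂ P.K ω :=
  extDer_smul ℂ (a : P.K) ω

/-- The stalk at `x` of `Ω^p_X(log S)`: the rational `p`-forms `ω` such that `ω` and `dω` have at
most simple poles along `S` (and no other poles). -/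
def logForms (p : ℕ) (x : P.X) : Submodule (P.localRing x) P.RatForms where
  carrier := {ω | ω ∈ ⋀[P.K]^p (Ω[P.K⁄ℂ]) ∧ ∀ s ∈ P.boundaryIdeal x,
    s • ω ∈ P.regForms p x ∧ s • extDer ℂ P.K ω ∈ P.regForms (p + 1) x}
  zero_mem' := ⟨zero_mem _, fun s _ => by simp⟩
  add_mem' {u v} hu hv := ⟨add_mem hu.1 hv.1, fun s hs => by
    rw [map_add, smul_add, smul_add]
    exact ⟨add_mem (hu.2 s hs).1 (hv.2 s hs).1, add_mem (hu.2 s hs).2 (hv.2 s hs).2⟩⟩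
  smul_mem' a u hu := ⟨Submodule.smul_mem _ (a : P.K) hu.1, fun s hs => by
    refine ⟨?_, ?_⟩
    · rw [smul_comm]
      exact Submodule.smul_mem _ _ (hu.2 s hs).1
    · rw [extDer_subalgebra_smul, smul_add, ← mul_smul_comm, smul_comm s a]
      exact add_mem (P.dRat_mul_mem_regForms a (hu.2 s hs).1)
        (Submodule.smul_mem _ _ (hu.2 s hs).2)⟩

lemma dRat_mul_mem_logForms {p : ℕ} {x : P.X} (a : P.localRing x) {ω : P.RatForms}
    (hω : ω ∈ P.logForms p x) : P.dRat a * ω ∈ P.logForms (p + 1) x := by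
  refine ⟨?_, fun s hs => ⟨?_, ?_⟩⟩
  · have := Submodule.mul_mem_mul
      (LinearMap.mem_range_self (ExteriorAlgebra.ι P.K) (KaehlerDifferential.D ℂ P.K a)) hω.1
    rwa [← pow_succ'] at this
  · rw [← mul_smul_comm]
    exact P.dRat_mul_mem_regForms a (hω.2 s hs).1
  · rw [dRat, extDer_ι_mul, smul_neg, ← mul_smul_comm]
    exact neg_mem (P.dRat_mul_mem_regForms a (hω.2 s hs).2)

/-- The stalk at `x` of `Ω^p_X(log S)(D)`. -/
def logFormsTwist (D : P.X → ℤ) (p : ℕ) (x : P.X) : Submodule (P.localRing x) P.RatForms :=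
  Submodule.span (P.localRing x)
    {ω | ∃ g ∈ P.divisorSections D x, ∃ u ∈ P.logForms p x, ω = g • u}

lemma dRat_mul_mem_logFormsTwist {D : P.X → ℤ} {p : ℕ} {x : P.X} (a : P.localRing x)
    {ω : P.RatForms} (hω : ω ∈ P.logFormsTwist D p x) :
    P.dRat a * ω ∈ P.logFormsTwist D (p + 1) x := by
  induction hω using Submodule.span_induction with
  | mem ω h =>
    obtain ⟨g, hg, u, hu, rfl⟩ := h
    exact Submodule.subset_span ⟨g, hg, _, P.dRat_mul_mem_logForms a hu, mul_smul_comm _ _ _⟩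
  | zero => simp
  | add u v _ _ hu hv => rw [mul_add]; exact add_mem hu hv
  | smul c u _ hu =>
    rw [mul_smul_comm]
    exact Submodule.smul_mem _ _ hu

end CompactifiedPair

/-- The two choices `Θ = d + df` and `Θ = df` of the differential. -/
inductive Flavour
  | deRham
  | higgs

namespace CompactifiedPair

variable (P : CompactifiedPair)

/-- `Θ = d + df` in the de Rham case and `Θ = df` in the Higgs case, on rational forms, where `df`
stands for `ω ↦ df ∧ ω`. -/
def Θ : Flavour → P.RatForms →+ P.RatForms
  | .deRham => extDer ℂ P.K + AddMonoidHom.mulLeft (P.dRat P.ratFun)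
  | .higgs => AddMonoidHom.mulLeft (P.dRat P.ratFun)

lemma dRat_mul_dRat_mul (g : P.K) (ω : P.RatForms) : P.dRat g * (P.dRat g * ω) = 0 := by
  rw [← mul_assoc, dRat, ExteriorAlgebra.ι_sq_zero, zero_mul]

lemma Θ_Θ (t : Flavour) (ω : P.RatForms) : P.Θ t (P.Θ t ω) = 0 := by
  cases t with
  | deRham =>
    simp only [Θ, AddMonoidHom.add_apply, AddMonoidHom.coe_mulLeft, map_add,
      dRat_mul_dRat_mul, extDer_extDer]
    rw [dRat, extDer_ι_mul]
    simp
  | higgs => exact P.dRat_mul_dRat_mul _ _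

lemma Θ_smul (t : Flavour) {x : P.X} (a : P.localRing x) (ω : P.RatForms) :
    ∃ c : ℤ, P.Θ t (a • ω) = c • (P.dRat a * ω) + a • P.Θ t ω := by
  cases t with
  | deRham =>
    refine ⟨1, ?_⟩
    simp only [Θ, AddMonoidHom.add_apply, AddMonoidHom.coe_mulLeft, extDer_subalgebra_smul,
      mul_smul_comm, smul_add, one_smul, add_assoc]
  | higgs =>
    refine ⟨0, ?_⟩
    simp [Θ]

/-- The stalk at `x` of the Kontsevich sheaf `Ω_f^p(α)`, the kernel of
`Θ : Ω^p_X(log S)(⌊αP⌋) → Ω^{p+1}_X(*S) / Ω^{p+1}_X(log S)(⌊αP⌋)`. -/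
def kontsevich (t : Flavour) (α : ℚ) (p : ℕ) (x : P.X) :
    Submodule (P.localRing x) P.RatForms where
  carrier := {ω | ω ∈ P.logFormsTwist (P.floorPole α) p x ∧
    P.Θ t ω ∈ P.logFormsTwist (P.floorPole α) (p + 1) x}
  zero_mem' := ⟨zero_mem _, by simp⟩
  add_mem' hu hv := ⟨add_mem hu.1 hv.1, by rw [map_add]; exact add_mem hu.2 hv.2⟩
  smul_mem' a u hu := ⟨Submodule.smul_mem _ _ hu.1, by
    obtain ⟨c, hc⟩ := P.Θ_smul t a u
    rw [hc]
    exact add_mem (zsmul_mem (P.dRat_mul_mem_logFormsTwist a hu.1) c)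
      (Submodule.smul_mem _ _ hu.2)⟩

/-- The stalk at `x` of the degree `i` term `Ω^i_X(log S)(⌊(i-λ)P⌋)₊` of the complex `F^λ`. -/
def hodgeTerm (l : ℚ) (i : ℕ) (x : P.X) : Submodule (P.localRing x) P.RatForms :=
  if 0 ≤ (i : ℚ) - l then P.logFormsTwist (P.floorPole (i - l)) i x else ⊥

/-- The stalks of the truncation `(Ω_f^•(α))_{• ≥ p}`. -/
def kontsevichTrunc (t : Flavour) (α : ℚ) (p : ℤ) (i : ℕ) (x : P.X) :
    Submodule (P.localRing x) P.RatForms :=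
  if p ≤ (i : ℤ) then P.kontsevich t α i x else ⊥

end CompactifiedPair


namespace CompactifiedPair

variable (P : CompactifiedPair)

section Sheaves

variable {M : Type} [AddCommGroup M] [Module P.K M]
variable (L : (x : P.X) → Submodule (P.localRing x) M)

/-- The value at `y ∈ W` of a function on `W`, as a rational function. -/
def evalAt (W : P.X.Opens) (y : W) : Γ(P.X, W) →+* P.localRing y.1 :=
  (algebraMap (P.X.presheaf.stalk y.1) P.K).rangeRestrict.comp
    (P.X.presheaf.germ W y.1 y.2).hom

lemma evalAt_eq {W : P.X.Opens} (a : Γ(P.X, W)) (y z : W) :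
    (P.evalAt W y a : P.K) = P.evalAt W z a := by
  have : Nonempty W := ⟨y⟩
  exact (Scheme.algebraMap_germ_eq_germToFunctionField P.X y.2 a).trans
    (Scheme.algebraMap_germ_eq_germToFunctionField P.X z.2 a).symm

lemma evalAt_map {V W : P.X.Opens} (i : V ⟶ W) (a : Γ(P.X, W)) (y : V) :
    P.evalAt V y (P.X.presheaf.map i.op a) = P.evalAt W (i y) a := by
  refine Subtype.ext (congrArg (algebraMap (P.X.presheaf.stalk y.1) P.K) ?_)
  exact P.X.presheaf.germ_res_apply i y.1 y.2 a

/-- Locally constant functions on `W` with values in `M`, whose value at each `x` lies in `L x`. -/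
def sectionLocalPredicate : TopCat.LocalPredicate (X := P.X.toTopCat) fun _ : P.X => M where
  pred {W} s := ∀ x : W, ∃ V : Opens P.X, x.1 ∈ V ∧ ∃ m : M, ∀ y : W, y.1 ∈ V → s y = m ∧ m ∈ L y.1
  res {V W} i s h x := by
    obtain ⟨V', hx, m, hm⟩ := h (i x)
    exact ⟨V', hx, m, fun y hy => hm (i y) hy⟩
  locality {W} s h x := by
    obtain ⟨V, hxV, i, h⟩ := h x
    obtain ⟨V', hx, m, hm⟩ := h ⟨x.1, hxV⟩
    exact ⟨V' ⊓ V, ⟨hx, hxV⟩, m, fun y hy => hm ⟨y.1, hy.2⟩ hy.1⟩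

/-- The sections over `W` of the subsheaf of the constant sheaf `M` with stalks `L x`. -/
def secs (W : P.X.Opens) : AddSubgroup (W → M) where
  carrier := {s | (P.sectionLocalPredicate L).pred s}
  zero_mem' x := ⟨⊤, trivial, 0, fun y _ => ⟨rfl, zero_mem _⟩⟩
  add_mem' {s t} hs ht x := by
    obtain ⟨V, hx, m, hm⟩ := hs x
    obtain ⟨V', hx', m', hm'⟩ := ht x
    refine ⟨V ⊓ V', ⟨hx, hx'⟩, m + m', fun y hy => ⟨?_, ?_⟩⟩
    · rw [Pi.add_apply, (hm y hy.1).1, (hm' y hy.2).1]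
    · exact add_mem (hm y hy.1).2 (hm' y hy.2).2
  neg_mem' {s} hs x := by
    obtain ⟨V, hx, m, hm⟩ := hs x
    refine ⟨V, hx, -m, fun y hy => ⟨?_, neg_mem (hm y hy).2⟩⟩
    rw [Pi.neg_apply, (hm y hy).1]

lemma secs_mem {W : P.X.Opens} (s : P.secs L W) (x : W) : s.1 x ∈ L x := by
  obtain ⟨V, hx, m, hm⟩ := s.2 x
  rw [(hm x hx).1]
  exact (hm x hx).2

instance (W : P.X.Opens) : SMul Γ(P.X, W) (P.secs L W) where
  smul a s := ⟨fun y => P.evalAt W y a • s.1 y, fun x => by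
    obtain ⟨V, hx, m, hm⟩ := s.2 x
    refine ⟨V, hx, P.evalAt W x a • m, fun y hy => ⟨?_, ?_⟩⟩
    · change P.evalAt W y a • s.1 y = P.evalAt W x a • m
      rw [(hm y hy).1]
      exact congrArg (· • m) (P.evalAt_eq a y x)
    · have : P.evalAt W x a • m = P.evalAt W y a • m :=
        congrArg (· • m) (P.evalAt_eq a x y)
      rw [this]
      exact Submodule.smul_mem _ _ (hm y hy).2⟩

lemma secs_smul_apply {W : P.X.Opens} (a : Γ(P.X, W)) (s : P.secs L W) (y : W) :
    (a • s).1 y = P.evalAt W y a • s.1 y := rfl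

instance (W : P.X.Opens) : Module Γ(P.X, W) (P.secs L W) where
  one_smul s := Subtype.ext (funext fun y => by rw [secs_smul_apply, map_one, one_smul])
  mul_smul a b s := Subtype.ext (funext fun y => by
    rw [secs_smul_apply, map_mul, mul_smul]; rfl)
  smul_zero a := Subtype.ext (funext fun y => smul_zero _)
  smul_add a s t := Subtype.ext (funext fun y => smul_add _ _ _)
  add_smul a b s := Subtype.ext (funext fun y => by
    rw [secs_smul_apply, map_add, add_smul]; rfl)
  zero_smul s := Subtype.ext (funext fun y => by
    rw [secs_smul_apply, map_zero, zero_smul]; rfl)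

/-- Restriction of sections. -/
def secsRes {V W : P.X.Opens} (i : V ⟶ W) : P.secs L W →+ P.secs L V where
  toFun s := ⟨fun y => s.1 (i y), (P.sectionLocalPredicate L).res i s.1 s.2⟩
  map_zero' := rfl
  map_add' _ _ := rfl

/-- The presheaf of abelian groups `W ↦ secs L W`. -/
def abPresheaf : TopCat.Presheaf AddCommGrpCat.{0} P.X.toTopCat where
  obj W := AddCommGrpCat.of (P.secs L W.unop)
  map i := AddCommGrpCat.ofHom (P.secsRes L i.unop)
  map_id _ := rfl
  map_comp _ _ := rfl

instance (W : (Opens P.X)ᵒᵖ) : Module (P.X.ringCatSheaf.obj.obj W) ((P.abPresheaf L).obj W) :=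
  inferInstanceAs (Module Γ(P.X, W.unop) (P.secs L W.unop))

lemma abPresheaf_isSheaf : Presheaf.IsSheaf (Opens.grothendieckTopology P.X) (P.abPresheaf L) := by
  rw [Presheaf.isSheaf_iff_isSheaf_comp _ _ (forget AddCommGrpCat.{0})]
  exact TopCat.subpresheafToTypes.isSheaf (P.sectionLocalPredicate L)

/-- The `𝒪_X`-module with stalks `L x`: the subsheaf of the constant sheaf `M` whose sections are
the locally constant functions with value at each `x` in `L x`. -/
def sheafOf : P.X.Modules where
  val := PresheafOfModules.ofPresheaf (R := P.X.ringCatSheaf.obj) (P.abPresheaf L)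
    fun V W i r s => by
      refine Subtype.ext (funext fun y => ?_)
      exact congrArg (· • (s : P.secs L V.unop).1 (i.unop y)) (P.evalAt_map i.unop r y).symm
  isSheaf := P.abPresheaf_isSheaf L

end Sheaves

section Complexes

/-- The underlying sheaf of abelian groups of `sheafOf L` (`Θ` is not `𝒪_X`-linear). -/
def abSheaf {M : Type} [AddCommGroup M] [Module P.K M]
    (L : (x : P.X) → Submodule (P.localRing x) M) :
    Sheaf (Opens.grothendieckTopology P.X) AddCommGrpCat.{0} :=
  (SheafOfModules.toSheaf P.X.ringCatSheaf).obj (P.sheafOf L)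

/-- The morphism of sheaves of abelian groups induced by an additive map. -/
def sheafMap {M N : Type} [AddCommGroup M] [Module P.K M] [AddCommGroup N] [Module P.K N]
    {L : (x : P.X) → Submodule (P.localRing x) M} {L' : (x : P.X) → Submodule (P.localRing x) N}
    (T : M →+ N) (h : ∀ x, ∀ m ∈ L x, T m ∈ L' x) : P.abSheaf L ⟶ P.abSheaf L' where
  hom :=
    { app := fun W => AddCommGrpCat.ofHom
        { toFun := fun (s : P.secs L W.unop) => (⟨fun y => T (s.1 y), fun x => by
            obtain ⟨V, hx, m, hm⟩ := s.2 x
            exact ⟨V, hx, T m, fun y hy => ⟨congrArg T (hm y hy).1, h _ _ (hm y hy).2⟩⟩⟩ :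
              P.secs L' W.unop)
          map_zero' := Subtype.ext (funext fun _ => map_zero T)
          map_add' := fun _ _ => Subtype.ext (funext fun _ => map_add T _ _) }
      naturality := fun _ _ _ => rfl }

/-- `Θ` maps `L i` to `L (i + 1)`. -/
def IsSubcomplex (t : Flavour) (L : ℕ → (x : P.X) → Submodule (P.localRing x) P.RatForms) : Prop :=
  ∀ i x, ∀ ω ∈ L i x, P.Θ t ω ∈ L (i + 1) x

variable {L L' : ℕ → (x : P.X) → Submodule (P.localRing x) P.RatForms}

/-- The complex of sheaves on `X` with the terms `L i` and the differential `Θ`. -/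
def complex (t : Flavour) (h : P.IsSubcomplex t L) :
    CochainComplex (Sheaf (Opens.grothendieckTopology P.X) AddCommGrpCat.{0}) ℕ :=
  CochainComplex.of (fun i => P.abSheaf (L i)) (fun i => P.sheafMap (P.Θ t) (h i)) fun i => by
    ext W s
    exact Subtype.ext (funext fun y => P.Θ_Θ t (s.1 y))

/-- The inclusion of complexes of sheaves. -/
def inclusion (t : Flavour) (h : P.IsSubcomplex t L) (h' : P.IsSubcomplex t L')
    (hle : ∀ i x, L i x ≤ L' i x) : P.complex t h ⟶ P.complex t h' :=
  CochainComplex.ofHom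
    (fun i => P.sheafMap (L := L i) (L' := L' i) (AddMonoidHom.id _) fun x m hm => hle i x hm)
    fun i => by
      simp only [complex, CochainComplex.of_d]
      rfl

variable (L L') in
/-- `(L, Θ)` and `(L', Θ)` are complexes of sheaves, the first one is contained in the second one,
and the inclusion is a quasi-isomorphism. -/
def InclusionIsQuasiIso (t : Flavour) : Prop :=
  ∃ (h : P.IsSubcomplex t L) (h' : P.IsSubcomplex t L') (hle : ∀ i x, L i x ≤ L' i x),
    QuasiIso (P.inclusion t h h' hle)

end Complexes

end CompactifiedPair

/-- The `𝒪_X`-module `M` is locally free of rank `r`: locally on `X` there are `r` sections whose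
restrictions form a basis of the sections over every smaller open set. -/
def IsLocallyFreeOfRank {X : Scheme.{0}} (M : X.Modules) (r : ℕ) : Prop :=
  ∀ x : X, ∃ V : X.Opens, x ∈ V ∧ ∃ b : Fin r → Γ(M, V), ∀ (W : X.Opens) (h : W ≤ V),
    Function.Bijective fun c : Fin r → Γ(X, W) =>
      ∑ j, c j • M.presheaf.map (homOfLE h).op (b j)

/-- The tensor product of `𝒪_X`-modules: the sheafification of the tensor product of presheaves of
modules. -/
def tensorSheaf {X : Scheme.{0}} (M N : X.Modules) : X.Modules :=
  (PresheafOfModules.sheafification (𝟙 X.ringCatSheaf.obj)).obj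
    (PresheafOfModules.Monoidal.tensorObj (R := X.presheaf) M.val N.val)

/-- The image of `m ⊗ n` under a morphism `M ⊗ N ⟶ Q`. -/
def applyTmul {X : Scheme.{0}} {M N Q : X.Modules} (e : tensorSheaf M N ⟶ Q) (W : X.Opens)
    (m : Γ(M, W)) (n : Γ(N, W)) : Γ(Q, W) :=
  ((PresheafOfModules.sheafificationHomEquiv (𝟙 X.ringCatSheaf.obj) e).app (op W)).hom
    (show (PresheafOfModules.Monoidal.tensorObj (R := X.presheaf) M.val N.val).obj (op W) from
      TensorProduct.tmul Γ(X, W) m n)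

namespace CompactifiedPair

variable (P : CompactifiedPair)

/-- Multiplication of forms by functions induces an isomorphism `M ⊗ 𝒪_X(D) ≅ N` of
`𝒪_X`-modules, where `M` and `N` are the sheaves of rational forms with stalks `L x` and `L' x`. -/
def TwistIso (L L' : (x : P.X) → Submodule (P.localRing x) P.RatForms) (D : P.X → ℤ) : Prop :=
  ∃ e : tensorSheaf (P.sheafOf L) (P.sheafOf (P.divisorStalk D)) ≅ P.sheafOf L',
    ∀ (W : P.X.Opens) (u : P.secs L W) (g : P.secs (P.divisorStalk D) W) (y : W),
      (applyTmul e.hom W u g : P.secs L' W).1 y = g.1 y • u.1 y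

end CompactifiedPair

end KontsevichLog

end

/-! Let `x` lie on the support of `P`, and let `z` and `s` be local equations of `Z` and `S` there.
Then `g = z / f` is a local equation of `P`, and `z = g f` gives `g df = dz - z dg/g`, a logarithmic
1-form. Non-degeneracy makes it nowhere zero near `x`: if `z` is a unit, its residue along a
component of `S` with multiplicity `k > 0` in `P` is `-k z`, a unit; if `z` vanishes at `x`, then
`z` is a coordinate transversal to `S` and `dz` occurs with a unit coefficient. Hence `g df` is a
member `e_j` of a local frame of the logarithmic 1-forms (`exists_pole_frame`). The rest of the
proposition is a formal consequence of this.

Since `⌊(μ+1)P⌋ = ⌊μP⌋ + P`, the operator `df ∧ = g⁻¹ e_j ∧` maps the `μ`-twist to the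
`(μ+1)`-twist, while `d` preserves every twist, because a local generator `h` of `𝒪(⌊μP⌋)` has
logarithmic `dh/h`. So both choices of `Θ` define the same kernel, and in the frame it is spanned by
the `h e_S` with `j ∈ S` and the `g h e_S` with `j ∉ S` (`kontsevich_eq_span`). This gives local
freeness, and the compatibility with twists follows from the linearity of `df ∧`.

For the quasi-isomorphisms, let `ι` be the contraction dual to `e_j`, so that `ω = e_j ∧ ιω + ι(e_j
∧ ω)`. If `ω` lies in the `ν`-twist with `ν ≤ μ + 1` and `Θω` lies in the `(μ+1)`-twist, then `τ = g
ιω` lies in the `(ν-1)`-twist and `ω - Θτ` in the `μ`-twist (`exists_sub_Θ_mem`). Iterating lowers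
the pole order as far as needed (`exists_sub_Θ_mem_twist`), which is what the stalkwise criterion
`inclusionIsQuasiIso` asks for.

The labour lies in finding the frame. The components of `S` need not be smooth, so coordinates
adapted to `S` exist only over a flat local extension of the local ring, a localized étale algebra.
Normality reduces statements about the local ring to codimension one; flatness transports linear
divisibility conditions; determinants carry a frame back down (`Chart.exists_det_eq`), and Saito's
criterion recognises it (`isLogFrame_of_det`). The divisor `⌊αP⌋` is locally principal because the
integral residues of `dg/g` sort the branches of `S` by their multiplicity in `P`
(`Residues.exists_dvd_iff`). -/

open scoped KaehlerDifferential

noncomputable section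

/-! ### Lattices in exterior algebras, contraction and the Koszul homotopy. -/

namespace ExteriorLattice

open Module

variable {k K V : Type} [CommRing k] [Field K] [Algebra k K] [AddCommGroup V] [Module K V]
variable (A : Subalgebra k K) {n : ℕ}

/-- The `A`-lattice in the exterior algebra of degree one spanned by a family of vectors. -/
def deg1 {I : Type} (e : I → V) : Submodule A (ExteriorAlgebra K V) :=
  Submodule.span A (Set.range fun i => ExteriorAlgebra.ι K (e i))

variable {A}

lemma ι_mem_deg1 {I : Type} (e : I → V) (i : I) : ExteriorAlgebra.ι K (e i) ∈ deg1 A e :=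
  Submodule.subset_span ⟨i, rfl⟩

lemma deg1_pow_le {I : Type} (e : I → V) (p : ℕ) {ω : ExteriorAlgebra K V} (h : ω ∈ deg1 A e ^ p) :
    ω ∈ ⋀[K]^p V := by
  induction p generalizing ω with
  | zero =>
    rw [pow_zero] at h
    obtain ⟨a, rfl⟩ := Submodule.mem_one.1 h
    rw [ExteriorAlgebra.exteriorPower, pow_zero]
    exact Submodule.mem_one.2 ⟨algebraMap A K a, rfl⟩
  | succ p ih =>
    rw [pow_succ'] at h
    rw [ExteriorAlgebra.exteriorPower, pow_succ']
    induction h using Submodule.mul_induction_on' with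
    | mem_mul_mem x hx y hy =>
      refine Submodule.mul_mem_mul ?_ (ih hy)
      have : deg1 A e ≤ (LinearMap.range (ExteriorAlgebra.ι K (M := V))).restrictScalars A := by
        refine Submodule.span_le.2 ?_
        rintro _ ⟨i, rfl⟩
        exact ⟨e i, rfl⟩
      exact this hx
    | add x _ y _ hx hy => exact add_mem hx hy

lemma basis_singleton (e : Basis (Fin n) K V) (i : Fin n) :
    e.ExteriorAlgebra {i} = ExteriorAlgebra.ι K (e i) := by
  rw [ExteriorAlgebra.basis_apply_ofCard e (n := 1) (Finset.card_singleton i)]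
  simp only [ExteriorAlgebra.ιMulti_family, ExteriorAlgebra.ιMulti_apply, List.ofFn_succ,
    List.ofFn_zero, List.prod_cons, List.prod_nil, mul_one, Function.comp]
  congr 2
  have h := Set.powersetCard.ofFinEmbEquiv_symm_apply
    (Set.powersetCard.ofCard (Finset.card_singleton i))
  rw [h]
  exact Finset.mem_singleton.1 (Finset.orderEmbOfFin_mem _ _ _)

/-- The sign is left undetermined: it plays no role for membership in a lattice. -/
lemma basis_mul (e : Basis (Fin n) K V) (S T : Finset (Fin n)) :
    (¬ Disjoint S T → e.ExteriorAlgebra S * e.ExteriorAlgebra T = 0) ∧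
    (Disjoint S T → e.ExteriorAlgebra S * e.ExteriorAlgebra T = e.ExteriorAlgebra (S ∪ T) ∨
      e.ExteriorAlgebra S * e.ExteriorAlgebra T = - e.ExteriorAlgebra (S ∪ T)) := by
  let s : Set.powersetCard (Fin n) S.card := ⟨S, rfl⟩
  let t : Set.powersetCard (Fin n) T.card := ⟨T, rfl⟩
  refine ⟨fun h => ExteriorAlgebra.basis_mul_of_not_disjoint e s t h, fun h => ?_⟩
  have h1 := ExteriorAlgebra.basis_mul_of_disjoint e s t h
  have h2 : ((Set.powersetCard.disjUnion (s := s) (t := t) h : Set.powersetCard (Fin n) _) :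
      Finset (Fin n)) = S ∪ T := by
    rw [← Finset.disjUnion_eq_union _ _ h]; rfl
  rw [h2] at h1
  rcases Int.units_eq_one_or (Set.powersetCard.permOfDisjoint (s := s) (t := t) h).sign with h3 | h3
  · left; rw [← one_smul ℤˣ (e.ExteriorAlgebra (S ∪ T)), ← h3]; exact h1
  · right
    rw [h3] at h1
    refine h1.trans ?_
    rw [Units.smul_def]
    simp

lemma basis_mem_pow (e : Basis (Fin n) K V) (S : Finset (Fin n)) :
    e.ExteriorAlgebra S ∈ deg1 A e ^ S.card := by
  induction S using Finset.induction_on with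
  | empty =>
    rw [Finset.card_empty, pow_zero,
      ExteriorAlgebra.basis_apply_ofCard e (n := 0) Finset.card_empty]
    simp only [ExteriorAlgebra.ιMulti_family, ExteriorAlgebra.ιMulti_apply, List.ofFn_zero,
      List.prod_nil]
    exact Submodule.one_le.1 le_rfl
  | insert i S hi ih =>
    rw [Finset.card_insert_of_notMem hi, pow_succ']
    have h := (basis_mul e {i} S).2 (Finset.disjoint_singleton_left.2 hi)
    have h1 := Submodule.mul_mem_mul (ι_mem_deg1 (A := A) e i) ih
    rw [← basis_singleton] at h1
    rw [Finset.insert_eq]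
    rcases h with h | h
    · rwa [h] at h1
    · rw [h] at h1; simpa using neg_mem h1

/-- The powers of the lattice of degree one, in terms of the basis of the exterior algebra. -/
lemma deg1_pow_eq (e : Basis (Fin n) K V) (p : ℕ) :
    deg1 A e ^ p = Submodule.span A
      (Set.range fun S : {S : Finset (Fin n) // S.card = p} => e.ExteriorAlgebra S.1) := by
  apply le_antisymm
  · induction p with
    | zero =>
      rw [pow_zero, Submodule.one_le]
      refine Submodule.subset_span ⟨⟨∅, rfl⟩, ?_⟩
      dsimp only
      rw [ExteriorAlgebra.basis_apply_ofCard e (n := 0) Finset.card_empty]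
      simp only [ExteriorAlgebra.ιMulti_family, ExteriorAlgebra.ιMulti_apply, List.ofFn_zero,
        List.prod_nil]
    | succ p ih =>
      rw [pow_succ']
      refine (mul_le_mul_right ih _).trans ?_
      rw [deg1, Submodule.span_mul_span, Submodule.span_le]
      rintro _ ⟨_, ⟨i, rfl⟩, _, ⟨S, rfl⟩, rfl⟩
      dsimp only
      rw [← basis_singleton]
      by_cases h : Disjoint {i} S.1
      · have h2 : ({i} ∪ S.1).card = p + 1 := by
          rw [Finset.card_union_of_disjoint h, S.2, Finset.card_singleton, add_comm]
        have h3 : e.ExteriorAlgebra ({i} ∪ S.1) ∈ Submodule.span A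
          (Set.range fun S : {S : Finset (Fin n) // S.card = p + 1} => e.ExteriorAlgebra S.1) :=
          Submodule.subset_span ⟨⟨_, h2⟩, rfl⟩
        rcases (basis_mul e {i} S.1).2 h with h1 | h1 <;> rw [h1]
        · exact h3
        · exact neg_mem h3
      · rw [(basis_mul e {i} S.1).1 h]; exact zero_mem _
  · rw [Submodule.span_le]
    rintro _ ⟨⟨S, rfl⟩, rfl⟩
    exact basis_mem_pow e S

lemma exteriorPower_eq (e : Basis (Fin n) K V) (p : ℕ) :
    ⋀[K]^p V = Submodule.span K
      (Set.range fun S : {S : Finset (Fin n) // S.card = p} => e.ExteriorAlgebra S.1) := by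
  apply le_antisymm
  · intro ω h
    have h1 : deg1 (⊤ : Subalgebra K K) e ^ p ≤ (Submodule.span K
      (Set.range fun S : {S : Finset (Fin n) // S.card = p} =>
        e.ExteriorAlgebra S.1)).restrictScalars (⊤ : Subalgebra K K) := by
      rw [deg1_pow_eq, Submodule.span_le]
      exact Submodule.subset_span
    refine h1 ?_
    clear h1
    rw [ExteriorAlgebra.exteriorPower] at h
    have h2 : ∀ v : V, ExteriorAlgebra.ι K v ∈ deg1 (⊤ : Subalgebra K K) e := by
      intro v
      rw [← e.sum_repr v, map_sum]
      refine sum_mem fun i _ => ?_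
      rw [map_smul]
      exact Submodule.smul_mem (deg1 (⊤ : Subalgebra K K) e)
        (⟨e.repr v i, trivial⟩ : (⊤ : Subalgebra K K)) (ι_mem_deg1 e i)
    induction p generalizing ω with
    | zero =>
      rw [pow_zero] at h ⊢
      obtain ⟨a, rfl⟩ := Submodule.mem_one.1 h
      exact Submodule.mem_one.2 ⟨⟨a, trivial⟩, rfl⟩
    | succ p ih =>
      rw [pow_succ'] at h ⊢
      induction h using Submodule.mul_induction_on' with
      | mem_mul_mem x hx y hy =>
        obtain ⟨v, rfl⟩ := hx
        exact Submodule.mul_mem_mul (h2 v) (ih hy)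
      | add x _ y _ hx hy => exact add_mem hx hy
  · rw [Submodule.span_le]
    rintro _ ⟨⟨S, rfl⟩, rfl⟩
    exact deg1_pow_le (A := (⊤ : Subalgebra K K)) e _ (basis_mem_pow e S)

lemma exteriorPower_eq_bot (e : Basis (Fin n) K V) {p : ℕ} (h : n < p) {ω : ExteriorAlgebra K V}
    (hω : ω ∈ ⋀[K]^p V) : ω = 0 := by
  rw [exteriorPower_eq e] at hω
  have : IsEmpty {S : Finset (Fin n) // S.card = p} :=
    ⟨fun S => by have := Finset.card_le_univ S.1; rw [S.2, Fintype.card_fin] at this; omega⟩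
  rw [Set.range_eq_empty, Submodule.span_empty] at hω
  exact hω

/-- A form whose products with a lattice of complementary degree lie in the lattice of top degree
lies in the lattice. -/
lemma mem_pow_of_mul_mem (e : Basis (Fin n) K V) {p : ℕ} {ω : ExteriorAlgebra K V}
    (hω : ω ∈ ⋀[K]^p V) (h : ∀ η ∈ deg1 A e ^ (n - p), ω * η ∈ deg1 A e ^ n) :
    ω ∈ deg1 A e ^ p := by
  rw [exteriorPower_eq e] at hω
  obtain ⟨c, rfl⟩ := (Finsupp.mem_span_range_iff_exists_finsupp).1 hω
  rw [deg1_pow_eq]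
  refine sum_mem fun S _ => ?_
  suffices hc : c S ∈ A from
    Submodule.smul_mem _ (⟨c S, hc⟩ : A) (Submodule.subset_span ⟨S, rfl⟩)
  -- Multiplication by the complementary basis vector kills every term except the one of `S`, so the
  -- hypothesis isolates the coefficient `c S` up to sign.
  have h1 : e.ExteriorAlgebra S.1ᶜ ∈ deg1 A e ^ (n - p) := by
    have := basis_mem_pow (A := A) e S.1ᶜ
    rwa [Finset.card_compl, S.2, Fintype.card_fin] at this
  have h2 := h _ h1
  rw [Finsupp.sum, Finset.sum_mul, Finset.sum_eq_single S] at h2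
  · rw [deg1_pow_eq] at h2
    have h3 : c S • e.ExteriorAlgebra Finset.univ ∈ Submodule.span A
        (Set.range fun S : {S : Finset (Fin n) // S.card = n} => e.ExteriorAlgebra S.1) := by
      rw [smul_mul_assoc] at h2
      have h4 := (basis_mul e S.1 S.1ᶜ).2 disjoint_compl_right
      rw [Finset.union_compl] at h4
      rcases h4 with h4 | h4 <;> rw [h4] at h2
      · exact h2
      · rw [smul_neg] at h2; simpa using neg_mem h2
    have h5 : (Set.range fun S : {S : Finset (Fin n) // S.card = n} => e.ExteriorAlgebra S.1) =
        {e.ExteriorAlgebra Finset.univ} := by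
      ext x
      constructor
      · rintro ⟨T, rfl⟩
        have : T.1 = Finset.univ := Finset.eq_univ_of_card _ (by rw [T.2, Fintype.card_fin])
        dsimp only
        rw [this]; rfl
      · rintro rfl
        exact ⟨⟨Finset.univ, by simp⟩, rfl⟩
    rw [h5] at h3
    obtain ⟨a, ha⟩ := Submodule.mem_span_singleton.1 h3
    have h6 : (a : K) • e.ExteriorAlgebra Finset.univ = c S • e.ExteriorAlgebra Finset.univ := ha
    have h7 := smul_left_injective K (e.ExteriorAlgebra.ne_zero Finset.univ) h6
    rw [← h7]
    exact a.2
  · intro T _ hT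
    rw [smul_mul_assoc, (basis_mul e T.1 S.1ᶜ).1, smul_zero]
    intro hd
    rw [disjoint_compl_right_iff] at hd
    exact hT (Subtype.ext (Finset.eq_of_subset_of_card_le hd (by rw [T.2, S.2])))
  · intro hS
    rw [Finsupp.notMem_support_iff.1 hS, zero_smul, zero_mul]

/-- Contraction is an antiderivation, so integrality of `φ` on the generators is enough. -/
lemma contractLeft_mem_pow {I : Type} (e : I → V) (φ : Module.Dual K V) (hφ : ∀ i, φ (e i) ∈ A)
    (p : ℕ) {ω : ExteriorAlgebra K V} (hω : ω ∈ deg1 A e ^ (p + 1)) :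
    (CliffordAlgebra.contractLeft φ ω : ExteriorAlgebra K V) ∈ deg1 A e ^ p := by
  have hι : ∀ i (η : ExteriorAlgebra K V),
      (CliffordAlgebra.contractLeft φ (ExteriorAlgebra.ι K (e i) * η) : ExteriorAlgebra K V) =
      φ (e i) • η - ExteriorAlgebra.ι K (e i) * CliffordAlgebra.contractLeft φ η :=
    fun i η => CliffordAlgebra.contractLeft_ι_mul _ _ _
  have hs : ∀ (a : A) (η : ExteriorAlgebra K V),
      (CliffordAlgebra.contractLeft φ (a • η) : ExteriorAlgebra K V) =
        a • CliffordAlgebra.contractLeft φ η := fun a η => map_smul _ (a : K) η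
  -- The exponent `q - 1` is truncated at `q = 0`; there the contraction vanishes, which is recorded
  -- separately because the first induction step needs it.
  have key : ∀ (q : ℕ) (η : ExteriorAlgebra K V), η ∈ deg1 A e ^ q →
      (CliffordAlgebra.contractLeft φ η : ExteriorAlgebra K V) ∈ deg1 A e ^ (q - 1) ∧
      (q = 0 → (CliffordAlgebra.contractLeft φ η : ExteriorAlgebra K V) = 0) := by
    intro q
    induction q with
    | zero =>
      intro η h
      rw [pow_zero] at h
      obtain ⟨a, rfl⟩ := Submodule.mem_one.1 h
      have : (CliffordAlgebra.contractLeft φ (algebraMap A (ExteriorAlgebra K V) a) :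
        ExteriorAlgebra K V) = 0 := CliffordAlgebra.contractLeft_algebraMap _ φ (a : K)
      rw [this]
      exact ⟨zero_mem _, fun _ => rfl⟩
    | succ q ih =>
      intro η h
      refine ⟨?_, by simp⟩
      rw [pow_succ'] at h
      induction h using Submodule.mul_induction_on' with
      | mem_mul_mem x hx y hy =>
        induction hx using Submodule.span_induction with
        | mem x hx =>
          obtain ⟨i, rfl⟩ := hx
          dsimp only
          rw [hι]
          refine sub_mem (Submodule.smul_mem _ (⟨φ (e i), hφ i⟩ : A) hy) ?_
          rcases q with _ | q
          · rw [(ih y hy).2 rfl, mul_zero]; exact zero_mem _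
          · have := Submodule.mul_mem_mul (ι_mem_deg1 (A := A) e i) (ih y hy).1
            rwa [← pow_succ'] at this
        | zero => simp
        | add u v _ _ hu hv => rw [add_mul, map_add]; exact add_mem hu hv
        | smul a u _ hu =>
          rw [smul_mul_assoc, hs]
          exact Submodule.smul_mem _ _ hu
      | add x _ y _ hx hy => rw [map_add]; exact add_mem hx hy
  exact (key (p + 1) ω hω).1

lemma contractLeft_deg_zero {I : Type} (e : I → V) (φ : Module.Dual K V)
    {ω : ExteriorAlgebra K V} (hω : ω ∈ deg1 A e ^ 0) :
    (CliffordAlgebra.contractLeft φ ω : ExteriorAlgebra K V) = 0 := by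
  rw [pow_zero] at hω
  obtain ⟨a, rfl⟩ := Submodule.mem_one.1 hω
  exact CliffordAlgebra.contractLeft_algebraMap _ φ (a : K)

/-- The homotopy formula `ω = θ ∧ ι_φ ω + ι_φ (θ ∧ ω)` for `φ θ = 1`. -/
lemma eq_mul_contractLeft_add (φ : Module.Dual K V) (v : V) (hv : φ v = 1)
    (ω : ExteriorAlgebra K V) :
    ω = ExteriorAlgebra.ι K v * CliffordAlgebra.contractLeft φ ω +
      CliffordAlgebra.contractLeft φ (ExteriorAlgebra.ι K v * ω) := by
  have : (CliffordAlgebra.contractLeft φ (ExteriorAlgebra.ι K v * ω) : ExteriorAlgebra K V) =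
    φ v • ω - ExteriorAlgebra.ι K v * CliffordAlgebra.contractLeft φ ω :=
    CliffordAlgebra.contractLeft_ι_mul _ _ _
  rw [this, hv, one_smul]
  abel

lemma basis_linearIndependent (e : Basis (Fin n) K V) (p : ℕ) :
    LinearIndependent K
      (fun S : {S : Finset (Fin n) // S.card = p} => e.ExteriorAlgebra S.1) :=
  e.ExteriorAlgebra.linearIndependent.comp _ Subtype.val_injective

end ExteriorLattice

/-! ### Commutative algebra: normality of smooth algebras, divisibility in codimension one,
differentials and `𝔪/𝔪²`. -/

namespace NormalDomain

open scoped TensorProduct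

lemma algebraMap_injective_of_flat (R T : Type) [CommRing R] [IsDomain R] [CommRing T]
    [Nontrivial T] [Algebra R T] [Module.Flat R T] : Function.Injective (algebraMap R T) := by
  rw [injective_iff_map_eq_zero]
  intro r hr
  by_contra h0
  have h1 : IsSMulRegular T r :=
    Module.Flat.isSMulRegular_of_isRegular (M := T) (IsRegular.of_ne_zero h0)
  have : r • (1 : T) = r • 0 := by rw [Algebra.smul_def, hr, zero_mul, smul_zero]
  exact one_ne_zero (h1 this)

/-- Over `F = Frac R` the base change `Q` of `T` is étale and a domain, hence a finite field
extension and the fraction field of `T`. Integral closure commutes with smooth base change, so the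
integral closure of `T` in `Q` is generated by that of `R` in `F`, which is `R`. -/
theorem isIntegrallyClosed_of_etale (R T : Type) [CommRing R] [IsDomain R] [IsIntegrallyClosed R]
    [CommRing T] [IsDomain T] [Algebra R T] [Algebra.Etale R T] : IsIntegrallyClosed T := by
  have hinj : Function.Injective (algebraMap R T) := algebraMap_injective_of_flat R T
  let F := FractionRing R
  let Q := T ⊗[R] F
  have hloc : IsLocalization (Algebra.algebraMapSubmonoid T (nonZeroDivisors R)) Q :=
    IsLocalization.tensor F (nonZeroDivisors R)
  have hle : Algebra.algebraMapSubmonoid T (nonZeroDivisors R) ≤ nonZeroDivisors T := by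
    rintro _ ⟨r, hr, rfl⟩
    refine mem_nonZeroDivisors_of_ne_zero ?_
    rw [Ne, map_eq_zero_iff _ hinj]
    exact nonZeroDivisors.ne_zero hr
  have hdom : IsDomain Q := IsLocalization.isDomain_of_le_nonZeroDivisors Q hle
  let _ : Algebra F Q := Algebra.TensorProduct.rightAlgebra
  have het : Algebra.Etale F Q :=
    Algebra.Etale.of_equiv (Algebra.TensorProduct.commRight R F T)
  have hfin : Module.Finite F Q := Algebra.FormallyUnramified.finite_of_free F Q
  have hfield : IsField Q :=
    isField_of_isIntegral_of_isField' (R := F) (S := Q) (Field.toIsField F)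
  have hfrac : IsFractionRing T Q := by
    refine IsLocalization.of_le (Algebra.algebraMapSubmonoid T (nonZeroDivisors R)) _ hle ?_
    intro r hr
    have h0 : algebraMap T Q r ≠ 0 := by
      rw [Ne, map_eq_zero_iff _ (IsLocalization.injective Q hle)]
      exact nonZeroDivisors.ne_zero hr
    obtain ⟨b, hb⟩ := hfield.mul_inv_cancel h0
    exact IsUnit.of_mul_eq_one b hb
  refine (isIntegrallyClosed_iff Q).2 fun {x} hx => ?_
  obtain ⟨y, hy⟩ := (TensorProduct.toIntegralClosure_bijective_of_smooth (R := R) (S := T)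
    (B := F)).2 ⟨x, hx⟩
  have hy' : ((TensorProduct.toIntegralClosure R T F y : integralClosure T Q) : Q) = x :=
    congrArg Subtype.val hy
  rw [← hy']
  clear hy hy' hx
  induction y with
  | zero => exact ⟨0, by simp⟩
  | add u v hu hv =>
    obtain ⟨a, ha⟩ := hu
    obtain ⟨b, hb⟩ := hv
    exact ⟨a + b, by rw [map_add, ha, hb, map_add]; rfl⟩
  | tmul t c =>
    obtain ⟨r, hr⟩ := (IsIntegrallyClosed.isIntegral_iff (R := R)).1 c.2
    refine ⟨r • t, ?_⟩
    have : ((TensorProduct.toIntegralClosure R T F (t ⊗ₜ c) : integralClosure T Q) : Q) =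
        t ⊗ₜ (c : F) := rfl
    rw [this, ← hr, Algebra.algebraMap_eq_smul_one r, TensorProduct.tmul_smul,
      TensorProduct.smul_tmul']
    rfl

/-- Near `p` a smooth algebra is étale over a polynomial ring, which is normal. -/
theorem isIntegrallyClosed_localization_of_smooth (S : Type) [CommRing S] [IsDomain S]
    [Algebra ℂ S] [Algebra.Smooth ℂ S] (p : Ideal S) [p.IsPrime] (L : Type) [CommRing L]
    [Algebra S L] [IsLocalization.AtPrime L p] : IsIntegrallyClosed L := by
  obtain ⟨f, hf, n, _, _, _⟩ :=
    Algebra.IsSmoothAt.exists_isStandardEtale_mvPolynomial (R := ℂ) (p := p)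
  have hf0 : f ≠ 0 := fun h => hf (h ▸ zero_mem p)
  have hle : Submonoid.powers f ≤ nonZeroDivisors S :=
    powers_le_nonZeroDivisors_of_noZeroDivisors hf0
  have : IsDomain (Localization.Away f) :=
    IsLocalization.isDomain_of_le_nonZeroDivisors (Localization.Away f) hle
  have : IsIntegrallyClosed (Localization.Away f) :=
    isIntegrallyClosed_of_etale (MvPolynomial (Fin n) ℂ) (Localization.Away f)
  have hu : ∀ m : Submonoid.powers f, IsUnit (algebraMap S L m) := by
    rintro ⟨_, m, rfl⟩
    simp only [map_pow]
    exact (IsLocalization.map_units L (⟨f, hf⟩ : p.primeCompl)).pow m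
  let _ : Algebra (Localization.Away f) L := (IsLocalization.lift hu).toAlgebra
  have : IsScalarTower S (Localization.Away f) L :=
    IsScalarTower.of_algebraMap_eq' (IsLocalization.lift_comp hu).symm
  have hpl : Submonoid.powers f ≤ p.primeCompl := by
    rintro _ ⟨m, rfl⟩
    exact fun h => hf (Ideal.IsPrime.mem_of_pow_mem inferInstance m h)
  have hL : IsLocalization (p.primeCompl.map (algebraMap S (Localization.Away f))) L :=
    IsLocalization.isLocalization_of_submonoid_le (Localization.Away f) L _ _ hpl
  refine isIntegrallyClosed_of_isLocalization (R := Localization.Away f) L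
    (p.primeCompl.map (algebraMap S (Localization.Away f))) ?_
  rintro _ ⟨r, hr, rfl⟩
  refine mem_nonZeroDivisors_of_ne_zero ?_
  rw [Ne, map_eq_zero_iff _ (IsLocalization.injective _ hle)]
  rintro rfl
  exact hr (zero_mem p)

/-- Algebraic Hartogs: in a normal noetherian domain the associated primes of `A / b` have height
one. If `b` does not divide `a`, one of them contains the annihilator of the class of `a`, against
the hypothesis. -/
theorem dvd_of_forall_height_one {A : Type} [CommRing A] [IsDomain A] [IsNoetherianRing A]
    [IsIntegrallyClosed A] {a b : A} (hb : b ≠ 0)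
    (h : ∀ p : Ideal A, p.IsPrime → p.height = 1 → ∃ c ∉ p, b ∣ c * a) : b ∣ a := by
  by_contra hab
  have h0 : (Ideal.Quotient.mk (Ideal.span {b}) a : A ⧸ Ideal.span {b}) ≠ 0 := by
    rwa [Ne, Ideal.Quotient.eq_zero_iff_mem, Ideal.mem_span_singleton]
  obtain ⟨p, hp, hle⟩ := exists_le_isAssociatedPrime_of_isNoetherianRing A _ h0
  obtain ⟨hprime, x, hx⟩ := Submodule.isAssociatedPrime_iff.1 hp
  obtain ⟨x, rfl⟩ := Ideal.Quotient.mk_surjective x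
  have hmem : ∀ y r : A, r ∈ (⊥ : Submodule A (A ⧸ Ideal.span {b})).colon
      {Ideal.Quotient.mk (Ideal.span {b}) y} ↔ b ∣ r * y := by
    intro y r
    rw [Submodule.mem_colon_singleton, Submodule.mem_bot, Algebra.smul_def,
      Ideal.Quotient.algebraMap_eq, ← map_mul, Ideal.Quotient.eq_zero_iff_mem,
      Ideal.mem_span_singleton]
  have hpx : ∀ r, r ∈ p ↔ b ∣ r * x := fun r => by rw [hx]; exact hmem x r
  have hbx : ¬ b ∣ x := fun h1 => hprime.ne_top ((Ideal.eq_top_iff_one p).2 ((hpx 1).2 (by simpa)))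
  have hbp : b ∈ p := (hpx b).2 (dvd_mul_right _ _)
  have hpbot : p ≠ ⊥ := fun h1 => hb (by rw [h1] at hbp; exact hbp)
  have hheight : p.height = 1 := by
    -- Here `p` is the annihilator of `x` modulo `b`. If multiplication by `x / b` maps `p` into
    -- itself, then `x / b` is integral, hence in `A`, which is absurd.
    by_cases hcase : ∀ r ∈ p, ∀ y, r * x = b * y → y ∈ p
    · exfalso
      let K := FractionRing A
      let N : Submodule A K := Submodule.map (Algebra.linearMap A K) p
      have hbK : algebraMap A K b ≠ 0 := by
        rwa [Ne, map_eq_zero_iff _ (IsFractionRing.injective A K)]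
      have hint : IsIntegral A (algebraMap A K x / algebraMap A K b) := by
        refine isIntegral_of_smul_mem_submodule N ?_ ?_ _ ?_
        · intro h1
          refine hb ?_
          have h2 : algebraMap A K b ∈ N := ⟨b, hbp, rfl⟩
          rw [h1, Submodule.mem_bot] at h2
          exact absurd h2 hbK
        · exact Submodule.FG.map _ (IsNoetherian.noetherian p)
        · rintro _ ⟨r, hr, rfl⟩
          obtain ⟨y, hy⟩ := (hpx r).1 hr
          refine ⟨y, hcase r hr y hy, ?_⟩
          rw [Algebra.linearMap_apply, Algebra.linearMap_apply, smul_eq_mul, div_mul_eq_mul_div,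
            eq_div_iff hbK, ← map_mul, ← map_mul, mul_comm x, hy, mul_comm]
      obtain ⟨y, hy⟩ := IsIntegrallyClosed.isIntegral_iff.1 hint
      rw [eq_div_iff hbK, ← map_mul] at hy
      exact hbx ⟨y, by rw [mul_comm b]; exact (IsFractionRing.injective A K hy).symm⟩
    · push Not at hcase
      obtain ⟨r, hr, y, hy, hyp⟩ := hcase
      -- For `s ∈ p` the product `s y` is a multiple of `r` while `y ∉ p`; so a prime between `(r)`
      -- and `p` contains `s`. Krull's principal ideal theorem then bounds the height.
      have hmin : p ∈ (Ideal.span {r}).minimalPrimes := by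
        refine ⟨⟨hprime, (Ideal.span_singleton_le_iff_mem p).2 hr⟩, fun q ⟨hq, hrq⟩ hqp s hs => ?_⟩
        obtain ⟨t, ht⟩ := (hpx s).1 hs
        have h1 : s * y = r * t := mul_left_cancel₀ hb (by
          calc b * (s * y) = s * (b * y) := by ring
            _ = r * (s * x) := by rw [← hy]; ring
            _ = b * (r * t) := by rw [ht]; ring)
        have h2 : s * y ∈ q := by
          rw [h1]
          exact Ideal.mul_mem_right _ _ (hrq (Ideal.mem_span_singleton_self r))
        exact (hq.mem_or_mem h2).resolve_right fun h3 => hyp (hqp h3)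
      refine le_antisymm (Ideal.height_le_one_of_isPrincipal_of_mem_minimalPrimes _ p hmin) ?_
      rw [Order.one_le_iff_ne_zero, Ne, Ideal.height_eq_zero_iff_eq_bot]
      exact hpbot
  obtain ⟨c, hc, hbc⟩ := h p hprime hheight
  exact hc (hle ((hmem a c).2 hbc))

lemma eq_of_le_of_height_one {A : Type} [CommRing A] [IsDomain A] [IsNoetherianRing A]
    {p q : Ideal A} [hp : p.IsPrime] [hq : q.IsPrime] (h : p.height = 1) (hqp : q ≤ p)
    (h0 : q ≠ ⊥) : q = p := by
  by_contra hne
  have h2 := Ideal.height_strict_mono_of_isPrime_of_isPrime (lt_of_le_of_ne hqp hne)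
  rw [h, Order.lt_one_iff, Ideal.height_eq_zero_iff_eq_bot] at h2
  exact h0 h2

/-- Such primes are minimal over `(a)`. -/
lemma finite_height_one {A : Type} [CommRing A] [IsDomain A] [IsNoetherianRing A] {a : A}
    (ha : a ≠ 0) : {p : Ideal A | p.IsPrime ∧ p.height = 1 ∧ a ∈ p}.Finite := by
  refine (Ideal.finite_minimalPrimes_of_isNoetherianRing A (Ideal.span {a})).subset ?_
  rintro p ⟨hp, h1, hap⟩
  refine ⟨⟨hp, (Ideal.span_singleton_le_iff_mem p).2 hap⟩, fun q ⟨hq, haq⟩ hqp => ?_⟩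
  refine (eq_of_le_of_height_one h1 hqp ?_).ge
  rintro rfl
  exact ha ((Ideal.mem_bot).1 (haq (Ideal.mem_span_singleton_self a)))

lemma isDiscreteValuationRing_of_height_one (L : Type) [CommRing L] [IsDomain L]
    [IsNoetherianRing L] [IsLocalRing L] [IsIntegrallyClosed L]
    (h : (IsLocalRing.maximalIdeal L).height = 1) : IsDiscreteValuationRing L := by
  have hbot : IsLocalRing.maximalIdeal L ≠ ⊥ := by
    rw [Ne, ← Ideal.height_eq_zero_iff_eq_bot, h]; exact one_ne_zero
  refine ((IsDiscreteValuationRing.TFAE L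
    (mt IsLocalRing.isField_iff_maximalIdeal_eq.1 hbot)).out 0 3).2 ?_
  refine ⟨inferInstance, IsLocalRing.maximalIdeal L, ⟨hbot, inferInstance⟩, fun p ⟨hp, _⟩ => ?_⟩
  exact eq_of_le_of_height_one h (IsLocalRing.le_maximalIdeal Ideal.IsPrime.ne_top') hp

/-- In a local `ℂ`-algebra, differentials detect elements of `𝔪` modulo `𝔪²`. -/
lemma mem_sq_of_D_mem (A : Type) [CommRing A] [IsLocalRing A] [Algebra ℂ A]
    [Algebra.EssFiniteType ℂ A] {a : A} (ha : a ∈ IsLocalRing.maximalIdeal A)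
    (h : KaehlerDifferential.D ℂ A a ∈ IsLocalRing.maximalIdeal A • (⊤ : Submodule A (Ω[A⁄ℂ]))) :
    a ∈ IsLocalRing.maximalIdeal A ^ 2 := by
  set m := IsLocalRing.maximalIdeal A
  let κ := A ⧸ m
  let _ : Field κ := Ideal.Quotient.field m
  have hκ : Algebra.FormallySmooth ℂ κ := inferInstance
  let N := A ⧸ m ^ 2
  have hle : m ^ 2 ≤ m := Ideal.pow_le_self two_ne_zero
  let g : N →ₐ[ℂ] κ := Ideal.Quotient.factorₐ ℂ hle
  have hg : Function.Surjective g := Ideal.Quotient.factor_surjective hle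
  have hsq : ∀ x y : N, g x = 0 → g y = 0 → x * y = 0 := by
    intro x y hx hy
    obtain ⟨x, rfl⟩ := Ideal.Quotient.mk_surjective x
    obtain ⟨y, rfl⟩ := Ideal.Quotient.mk_surjective y
    rw [← map_mul, Ideal.Quotient.eq_zero_iff_mem, pow_two]
    exact Ideal.mul_mem_mul (Ideal.Quotient.eq_zero_iff_mem.1 hx)
      (Ideal.Quotient.eq_zero_iff_mem.1 hy)
  have hnil : IsNilpotent (RingHom.ker (g : N →+* κ)) := by
    refine ⟨2, ?_⟩
    refine (pow_two _).trans ?_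
    rw [Ideal.zero_eq_bot, eq_bot_iff, Ideal.mul_le]
    intro x hx y hy
    exact hsq x y hx hy
  -- The residue field is formally smooth over `ℂ`, so `A/𝔪² → κ` has a section.
  let σ : κ →ₐ[ℂ] N := Algebra.FormallySmooth.liftOfSurjective (AlgHom.id ℂ κ) g hg hnil
  have hσ : ∀ x, g (σ x) = x := fun x =>
    Algebra.FormallySmooth.liftOfSurjective_apply (AlgHom.id ℂ κ) g hg hnil x
  let q : A →ₐ[ℂ] N := Ideal.Quotient.mkₐ ℂ (m ^ 2)
  let r : A →ₐ[ℂ] κ := Ideal.Quotient.mkₐ ℂ m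
  have hgq : ∀ x, g (q x) = r x := fun _ => rfl
  let T : A →ₗ[ℂ] N := q.toLinearMap - (σ.comp r).toLinearMap
  have hT : ∀ x, T x = q x - σ (r x) := fun _ => rfl
  have hgT : ∀ x, g (T x) = 0 := fun x => by rw [hT, map_sub, hgq, hσ, sub_self]
  -- The difference between an element and its image under the section lies in `𝔪/𝔪²`, whose square
  -- is zero; this is the Leibniz rule. The derivation kills `𝔪 Ω` and sends an element of `𝔪` to
  -- its class modulo `𝔪²`.
  let d : Derivation ℂ A N := Derivation.mk' T (by
    intro x y
    have h1 := hsq _ _ (hgT x) (hgT y)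
    rw [Algebra.smul_def, Algebra.smul_def]
    change T (x * y) = q x * T y + q y * T x
    rw [hT, hT, hT] at *
    rw [map_mul, map_mul, map_mul]
    linear_combination -h1)
  have hd : ∀ y ∈ (m • (⊤ : Submodule A (Ω[A⁄ℂ]))), d.liftKaehlerDifferential y = 0 := by
    have hrange : ∀ y, g (d.liftKaehlerDifferential y) = 0 := by
      intro y
      have hy : y ∈ Submodule.span A (Set.range (KaehlerDifferential.D ℂ A)) := by
        rw [KaehlerDifferential.span_range_derivation]; trivial
      induction hy using Submodule.span_induction with
      | mem y hy =>
        obtain ⟨b, rfl⟩ := hy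
        rw [Derivation.liftKaehlerDifferential_comp_D]
        exact hgT b
      | zero => simp
      | add u v _ _ hu hv => rw [map_add, map_add, hu, hv, add_zero]
      | smul c u _ hu =>
        rw [map_smul, Algebra.smul_def, map_mul, hu, mul_zero]
    intro y hy
    induction hy using Submodule.smul_induction_on' with
    | smul c hc y _ =>
      rw [map_smul, Algebra.smul_def]
      exact hsq _ _ (Ideal.Quotient.eq_zero_iff_mem.2 hc) (hrange y)
    | add u _ v _ hu hv => rw [map_add, hu, hv, add_zero]
  have h2 := hd _ h
  rw [Derivation.liftKaehlerDifferential_comp_D] at h2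
  have h3 : T a = q a := by
    rw [hT, show r a = 0 from Ideal.Quotient.eq_zero_iff_mem.2 ha, map_zero, sub_zero]
  exact Ideal.Quotient.eq_zero_iff_mem.1 (h3.symm.trans h2)

end NormalDomain

/-! ### Divisibility conditions under flat base change. -/

namespace LogAlgebra

open Matrix

section Flat

variable {A B : Type} [CommRing A] [CommRing B] [Algebra A B] [Module.Flat A B]

/-- Solutions over a flat algebra of a linear system are combinations of solutions over the base. -/
lemma mem_span_of_mulVec_eq_zero {m l : Type} [Fintype m] [Fintype l] [DecidableEq m]
    [DecidableEq l] (C : Matrix m l A) (x : l → B) (hx : C.map (algebraMap A B) *ᵥ x = 0) :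
    x ∈ Submodule.span B {y | ∃ u : l → A, C *ᵥ u = 0 ∧ y = fun i => algebraMap A B (u i)} := by
  let f : (m → A) →ₗ[A] (l → A) := Matrix.toLin' C.transpose
  let X : (l → A) →ₗ[A] B := Fintype.linearCombination A x
  have hX : X ∘ₗ f = 0 := by
    apply LinearMap.pi_ext'
    intro k
    ext
    have h := congrFun hx k
    simp only [X, f, LinearMap.comp_apply, Fintype.linearCombination_apply, Matrix.toLin'_apply,
      LinearMap.single_apply, Matrix.mulVec_single_one, LinearMap.zero_apply]
    simpa [Matrix.mulVec, dotProduct, Algebra.smul_def] using h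
  -- The equational criterion of flatness: the linear form given by `x` kills the rows of `C`, hence
  -- factors through a map to `A ^ N` that kills them already. The coordinates of this map are
  -- solutions over `A`.
  obtain ⟨N, a, y, h1, h2⟩ :=
    Module.Flat.exists_factorization_of_comp_eq_zero_of_free (R := A) (M := B) hX
  have hx1 : x = ∑ k : Fin N, y (Finsupp.single k 1) •
      fun i => algebraMap A B (a (Pi.single i 1) k) := by
    funext i
    have h3 := LinearMap.congr_fun h1 (Pi.single i 1)
    have h4 : X (Pi.single i 1) = x i := by
      simp only [X, Fintype.linearCombination_apply_single, one_smul]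
    rw [h4, LinearMap.comp_apply] at h3
    rw [h3, Finset.sum_apply]
    conv_lhs => rw [← Finsupp.univ_sum_single (a (Pi.single i 1)), map_sum]
    refine Finset.sum_congr rfl fun k _ => ?_
    rw [Pi.smul_apply, smul_eq_mul, mul_comm, ← Algebra.smul_def, ← map_smul,
      Finsupp.smul_single, smul_eq_mul, mul_one]
  rw [hx1]
  refine sum_mem fun k _ => Submodule.smul_mem _ _ (Submodule.subset_span
    ⟨fun i => a (Pi.single i 1) k, ?_, rfl⟩)
  funext j
  have h5 := LinearMap.congr_fun h2 (Pi.single j 1)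
  rw [LinearMap.comp_apply, LinearMap.zero_apply] at h5
  have h6 : f (Pi.single j 1) = ∑ i, C j i • (Pi.single i 1 : l → A) := by
    simp only [f, Matrix.toLin'_apply, Matrix.mulVec_single_one]
    exact pi_eq_sum_univ' (C.transpose.col j)
  rw [h6, map_sum] at h5
  have h7 := DFunLike.congr_fun h5 k
  simpa [Matrix.mulVec, dotProduct, Finsupp.finsetSum_apply] using h7

/-- The quotients by `s` are taken as additional unknowns, which makes the system homogeneous;
afterwards they are projected away. -/
lemma mem_span_of_dvd_mulVec {m l : Type} [Fintype m] [Fintype l] [DecidableEq m]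
    [DecidableEq l] (C : Matrix m l A) (s : A) (x : l → B)
    (hx : ∀ k, algebraMap A B s ∣ (C.map (algebraMap A B) *ᵥ x) k) :
    x ∈ Submodule.span B {y | ∃ u : l → A, (∀ k, s ∣ (C *ᵥ u) k) ∧
      y = fun i => algebraMap A B (u i)} := by
  choose y hy using hx
  let C' : Matrix m (l ⊕ m) A := Matrix.fromCols C (-(Matrix.diagonal fun _ => s))
  have h := mem_span_of_mulVec_eq_zero C' (Sum.elim x y) (by
    rw [Matrix.fromCols_map, Matrix.fromCols_mulVec]
    funext k
    have : (-(Matrix.diagonal fun _ : m => s)).map (algebraMap A B) =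
      -(Matrix.diagonal fun _ : m => algebraMap A B s) := by
      ext i j
      by_cases hij : i = j <;> simp [hij]
    rw [this, Matrix.neg_mulVec]
    simp [hy, Algebra.smul_def])
  let pr : ((l ⊕ m) → B) →ₗ[B] (l → B) := LinearMap.funLeft B B Sum.inl
  have h1 := Submodule.mem_map_of_mem (f := pr) h
  rw [Submodule.map_span] at h1
  refine Submodule.span_mono ?_ h1
  rintro _ ⟨_, ⟨u, hu, rfl⟩, rfl⟩
  refine ⟨fun i => u (Sum.inl i), fun k => ?_, rfl⟩
  have h2 := congrFun hu k
  rw [← Sum.elim_comp_inl_inr u, Matrix.fromCols_mulVec, Matrix.neg_mulVec] at h2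
  simp only [Pi.add_apply, Pi.neg_apply, Matrix.mulVec_diagonal, Pi.zero_apply] at h2
  exact ⟨u (Sum.inr k), eq_of_sub_eq_zero ((sub_eq_add_neg _ _).trans h2)⟩

/-- Flat base change of the ideal of all `a` such that `s` divides `a c_k` for all `k`. -/
lemma mem_span_of_dvd_mul {m : Type} [Fintype m] [DecidableEq m] (c : m → A) (s : A) (x : B)
    (hx : ∀ k, algebraMap A B s ∣ algebraMap A B (c k) * x) :
    x ∈ Ideal.span (algebraMap A B '' {a | ∀ k, s ∣ c k * a}) := by
  have h := mem_span_of_dvd_mulVec (Matrix.of fun k (_ : Unit) => c k) s (fun _ => x) (by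
    intro k
    simpa [Matrix.mulVec, dotProduct] using hx k)
  have h1 := Submodule.mem_map_of_mem (f := (LinearMap.proj () : (Unit → B) →ₗ[B] B)) h
  rw [Submodule.map_span] at h1
  refine Submodule.span_mono ?_ h1
  rintro _ ⟨_, ⟨u, hu, rfl⟩, rfl⟩
  refine ⟨u (), fun k => ?_, rfl⟩
  simpa [Matrix.mulVec, dotProduct] using hu k

/-- A nonzerodivisor modulo `s` remains one after flat base change. -/
lemma dvd_of_dvd_mul_of_flat {b s : A} (h : ∀ a, s ∣ b * a → s ∣ a) {x : B}
    (hx : algebraMap A B s ∣ algebraMap A B b * x) : algebraMap A B s ∣ x := by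
  have h1 := mem_span_of_dvd_mul (fun _ : Unit => b) s x fun _ => hx
  rw [← Ideal.mem_span_singleton]
  refine Ideal.span_le.2 ?_ h1
  rintro _ ⟨a, ha, rfl⟩
  exact Ideal.mem_span_singleton.2 (map_dvd _ (h a (ha ())))

lemma mul_left_cancel_of_flat [IsDomain A] {s : A} (hs : s ≠ 0) {x y : B}
    (h : algebraMap A B s * x = algebraMap A B s * y) : x = y := by
  have h1 : IsSMulRegular B s :=
    Module.Flat.isSMulRegular_of_isRegular (M := B) (IsRegular.of_ne_zero hs)
  apply h1
  change s • x = s • y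
  rw [Algebra.smul_def, Algebra.smul_def, h]

variable [IsLocalRing B] [IsLocalHom (algebraMap A B)]

/-- The ideal of all `x` with `a ∣ b x` generates the unit ideal of `B`. As the homomorphism is
local, the ideal contains a unit. -/
lemma dvd_of_map_dvd {a b : A} (h : algebraMap A B a ∣ algebraMap A B b) : a ∣ b := by
  have h1 := mem_span_of_dvd_mul (fun _ : Unit => b) a (1 : B) fun _ => by rwa [mul_one]
  by_contra hab
  have h2 : Ideal.span (algebraMap A B '' {x | ∀ _ : Unit, a ∣ b * x}) ≤
      IsLocalRing.maximalIdeal B := by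
    rw [Ideal.span_le]
    rintro _ ⟨x, hx, rfl⟩
    refine (IsLocalRing.mem_maximalIdeal _).2 fun hu => ?_
    exact hab (((isUnit_of_map_unit _ _ hu).dvd_mul_right).1 (hx ()))
  exact (IsLocalRing.mem_maximalIdeal _).1 (h2 h1) isUnit_one

/-- An ideal whose extension along a flat local homomorphism is principal is principal. -/
lemma exists_eq_span_of_map_eq_span [IsDomain A] {I : Ideal A} (hI : I ≠ ⊥) {x : B}
    (h : I.map (algebraMap A B) = Ideal.span {x}) : ∃ a, I = Ideal.span {a} := by
  obtain ⟨i, hi, hi0⟩ := Submodule.exists_mem_ne_zero_of_ne_bot hI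
  have hdvd : ∀ a ∈ I, x ∣ algebraMap A B a := fun a ha =>
    Ideal.mem_span_singleton.1 (h ▸ Ideal.mem_map_of_mem _ ha)
  have hreg : ∀ y z : B, x * y = x * z → y = z := by
    intro y z hyz
    obtain ⟨w, hw⟩ := hdvd i hi
    refine mul_left_cancel_of_flat hi0 ?_
    rw [hw, mul_right_comm, hyz, mul_right_comm]
  -- Otherwise all of `I` would map into `x 𝔪_B`, and cancelling `x` would put `1` into `𝔪_B`.
  obtain ⟨a, ha, u, hu, hau⟩ : ∃ a ∈ I, ∃ u, IsUnit u ∧ algebraMap A B a = x * u := by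
    by_contra hcon
    push Not at hcon
    have h1 : I.map (algebraMap A B) ≤ Ideal.span {x} * IsLocalRing.maximalIdeal B := by
      rw [Ideal.map_le_iff_le_comap]
      intro a ha
      obtain ⟨w, hw⟩ := hdvd a ha
      rw [Ideal.mem_comap, hw]
      refine Ideal.mul_mem_mul (Ideal.mem_span_singleton_self x)
        ((IsLocalRing.mem_maximalIdeal _).2 fun hu => hcon a ha w hu hw)
    have h2 : x ∈ I.map (algebraMap A B) := h ▸ Ideal.mem_span_singleton_self x
    obtain ⟨z, hz, hxz⟩ := Ideal.mem_span_singleton_mul.1 (h1 h2)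
    have h3 := hreg z 1 (by rw [hxz, mul_one])
    exact (IsLocalRing.mem_maximalIdeal _).1 hz (h3 ▸ isUnit_one)
  refine ⟨a, le_antisymm (fun b hb => ?_) ((Ideal.span_singleton_le_iff_mem I).2 ha)⟩
  refine Ideal.mem_span_singleton.2 (dvd_of_map_dvd (B := B) ?_)
  rw [hau, hu.mul_right_dvd]
  exact hdvd b hb

end Flat

/-! ### Determinants of logarithmic vectors. -/

section Det

/-- The arguments are replaced by elements of the spanning sets one at a time. -/
lemma multilinear_mem_of_span {B N : Type} [CommRing B] [AddCommGroup N] [Module B N] {n : ℕ}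
    (f : MultilinearMap B (fun _ : Fin n => N) B) (S : Fin n → Set N) (I : Ideal B)
    (h : ∀ u : Fin n → N, (∀ i, u i ∈ S i) → f u ∈ I) (x : Fin n → N)
    (hx : ∀ i, x i ∈ Submodule.span B (S i)) : f x ∈ I := by
  have key : ∀ (T : Finset (Fin n)) (x : Fin n → N), (∀ i ∈ T, x i ∈ Submodule.span B (S i)) →
      (∀ i ∉ T, x i ∈ S i) → f x ∈ I := by
    intro T
    induction T using Finset.induction_on with
    | empty => exact fun x _ h2 => h x fun i => h2 i (Finset.notMem_empty i)
    | insert j T hj ih =>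
      intro x h1 h2
      have h3 := h1 j (Finset.mem_insert_self j T)
      have h4 : ∀ y ∈ Submodule.span B (S j), f (Function.update x j y) ∈ I := by
        intro y hy
        induction hy using Submodule.span_induction with
        | mem y hy =>
          refine ih _ (fun i hi => ?_) fun i hi => ?_
          · rw [Function.update_of_ne (by rintro rfl; exact hj hi)]
            exact h1 i (Finset.mem_insert_of_mem hi)
          · by_cases hij : i = j
            · subst hij; rwa [Function.update_self]
            · rw [Function.update_of_ne hij]
              exact h2 i (by simp [hij, hi])
        | zero => rw [f.map_update_zero]; exact zero_mem I
        | add u v _ _ hu hv => rw [f.map_update_add]; exact add_mem hu hv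
        | smul c u _ hu => rw [f.map_update_smul]; exact Ideal.mul_mem_left _ _ hu
      have := h4 _ h3
      rwa [Function.update_eq_self] at this
  exact key Finset.univ x (fun i _ => hx i) fun i hi => absurd (Finset.mem_univ i) hi

lemma det_updateRow_diagonal {R : Type} [CommRing R] {n : ℕ} (d a : Fin n → R) (i : Fin n) :
    ((Matrix.diagonal d).updateRow i a).det = a i * ∏ j ∈ Finset.univ.erase i, d j := by
  rw [← Matrix.cramer_transpose_apply, Matrix.diagonal_transpose, Matrix.cramer_eq_adjugate_mulVec,
    Matrix.adjugate_diagonal, Matrix.mulVec_diagonal, mul_comm]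

/-- The vectors `η` with `δ ∧ η ≡ 0` modulo `s`. -/
def logVec {R : Type} [CommRing R] {n : ℕ} (δ : Fin n → R) (s : R) : Submodule R (Fin n → R) where
  carrier := {η | ∀ i j, s ∣ δ i * η j - δ j * η i}
  zero_mem' i j := by simp
  add_mem' {x y} hx hy i j := by
    have := dvd_add (hx i j) (hy i j)
    simp only [Pi.add_apply]
    convert! this using 1
    ring
  smul_mem' c x hx i j := by
    have := Dvd.dvd.mul_left (hx i j) c
    simp only [Pi.smul_apply, smul_eq_mul]
    convert! this using 1
    ring

/-- Where `δ i` is invertible, logarithmic vectors are multiples of `δ` modulo `s`; so all columns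
of `N` but the `i`-th can be made divisible by `s`, which gives a factor `s ^ (n - 1)`. The extra
factor `s` avoids the truncated exponent on the left. -/
lemma pow_dvd_mul_det {R : Type} [CommRing R] {n : ℕ} {δ : Fin n → R} {s : R}
    (N : Matrix (Fin n) (Fin n) R) (hN : ∀ k, N k ∈ logVec δ s) (i : Fin n) :
    s ^ n ∣ s * (δ i ^ (n - 1) * N.det) := by
  have h1 : ∀ k j, ∃ y, δ i * N k j - δ j * N k i = s * y := fun k j => hN k i j
  choose y hy using h1
  -- The column operation that replaces the column `N_j`, for `j ≠ i`, by `δ i • N_j - δ j • N_i`.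
  -- Its determinant is `δ i ^ (n - 1)`.
  let C : Matrix (Fin n) (Fin n) R :=
    (Matrix.diagonal fun _ => δ i).updateRow i (Function.update (fun j => - δ j) i 1)
  let Y : Matrix (Fin n) (Fin n) R := Matrix.of fun k j => if j = i then N k i else y k j
  have h2 : N * C = Y * Matrix.diagonal (Function.update (fun _ => s) i 1) := by
    ext k j
    rw [Matrix.mul_diagonal, Matrix.mul_apply, ← Finset.add_sum_erase _ _ (Finset.mem_univ i)]
    have h3 : ∀ l ∈ Finset.univ.erase i, N k l * C l j = if l = j then N k l * δ i else 0 := by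
      intro l hl
      simp only [C]
      rw [Matrix.updateRow_ne (Finset.ne_of_mem_erase hl), Matrix.diagonal_apply]
      split_ifs <;> simp
    rw [Finset.sum_congr rfl h3, Finset.sum_ite_eq']
    simp only [C, Matrix.updateRow_self, Y, Matrix.of_apply]
    by_cases hj : j = i
    · subst hj; simp
    · simp [hj]
      linear_combination hy k j
  have hd : C.det = δ i ^ (n - 1) := by
    simp only [C]
    rw [det_updateRow_diagonal]
    simp
  have hd2 : (Matrix.diagonal (Function.update (fun _ : Fin n => s) i 1)).det = s ^ (n - 1) := by
    rw [Matrix.det_diagonal, ← Finset.mul_prod_erase _ _ (Finset.mem_univ i)]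
    rw [Finset.prod_congr rfl (g := fun _ => s) fun j hj =>
      Function.update_of_ne (Finset.ne_of_mem_erase hj) _ _]
    simp
  have h4 := congrArg Matrix.det h2
  rw [Matrix.det_mul, Matrix.det_mul, hd, hd2] at h4
  refine ⟨Y.det, ?_⟩
  have h5 : s ^ n = s * s ^ (n - 1) := by
    rw [← pow_succ', Nat.sub_add_cancel (Fin.pos i)]
  rw [h5]
  linear_combination s * h4

end Det

end LogAlgebra

/-! ### Logarithmic vectors in coordinates adapted to a normal crossing divisor. -/

namespace LogAlgebra

open Matrix nonZeroDivisors

section NormalCrossing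

variable {B : Type} [CommRing B] {n : ℕ} (t : Fin n → B) (J : Finset (Fin n))

/-- The product `∏_{j ∈ J} t_j`. -/
def eqn : B := ∏ j ∈ J, t j

/-- The coefficient of `dt_j` in the `j`-th basis element of the logarithmic vectors, times
`∏ t`. -/
def logCoef (j : Fin n) : B := if j ∈ J then ∏ i ∈ J.erase j, t i else eqn t J

/-- The partial derivatives of `∏_{j ∈ J} t_j` with respect to the `t_j`. -/
def eqnDer (j : Fin n) : B := if j ∈ J then ∏ i ∈ J.erase j, t i else 0

variable {t J}

lemma mul_logCoef {j : Fin n} (hj : j ∈ J) : t j * logCoef t J j = eqn t J := by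
  rw [logCoef, if_pos hj, eqn, Finset.mul_prod_erase J t hj]

lemma eqnDer_of_mem {j : Fin n} (hj : j ∈ J) : eqnDer t J j = logCoef t J j := by
  rw [eqnDer, logCoef, if_pos hj, if_pos hj]

lemma eqn_dvd_mul {i j : Fin n} (hi : i ∈ J) (hij : i ≠ j) :
    eqn t J ∣ logCoef t J i * logCoef t J j := by
  by_cases hj : j ∈ J
  · rw [← mul_logCoef hi, mul_comm (logCoef t J i)]
    refine mul_dvd_mul_right ?_ _
    rw [logCoef, if_pos hj]
    exact Finset.dvd_prod_of_mem t (Finset.mem_erase.2 ⟨hij, hi⟩)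
  · refine Dvd.dvd.mul_left ?_ _
    rw [logCoef, if_neg hj]

lemma logCoef_dvd (j : Fin n) : logCoef t J j ∣ eqn t J := by
  by_cases hj : j ∈ J
  · exact ⟨t j, by rw [mul_comm, mul_logCoef hj]⟩
  · rw [logCoef, if_neg hj]

/-- The product of the coefficients is morally `eqn ^ (n - 1)`: each `j ∈ J` contributes `eqn / t
j`, every other index `eqn`. This is the determinant in Saito's criterion. -/
lemma prod_logCoef : eqn t J * ∏ j, logCoef t J j = eqn t J ^ n := by
  have h1 : eqn t J * ∏ j ∈ J, logCoef t J j = eqn t J ^ J.card := by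
    conv_lhs => rw [eqn, ← Finset.prod_mul_distrib]
    rw [← Finset.prod_const]
    exact Finset.prod_congr rfl fun j hj => mul_logCoef hj
  have h2 : ∏ j ∈ Jᶜ, logCoef t J j = eqn t J ^ Jᶜ.card := by
    rw [← Finset.prod_const]
    refine Finset.prod_congr rfl fun j hj => ?_
    rw [logCoef, if_neg (Finset.mem_compl.1 hj)]
  rw [← Finset.prod_mul_prod_compl J, ← mul_assoc, h1, h2, ← pow_add, Finset.card_add_card_compl,
    Fintype.card_fin]

variable {G : Matrix (Fin n) (Fin n) B} {v : Fin n → B} {u : B}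

/-- `G` plays the role of the Jacobian of the coordinates. The vector `eqn • v + u • (eqnDer ᵥ* G)`
is the shape of the differential of `eqn * u`; its first summand disappears modulo `eqn`, and 2×2
minors transform linearly under `G`. -/
lemma vecMul_mem_logVec {a : Fin n → B}
    (h : ∀ l j, eqn t J ∣ eqnDer t J l * a j - eqnDer t J j * a l) :
    a ᵥ* G ∈ logVec (eqn t J • v + u • (eqnDer t J ᵥ* G)) (eqn t J) := by
  intro i k
  have h1 : ∑ l, ∑ j, (eqnDer t J l * a j - eqnDer t J j * a l) * (G l i * G j k) =
      (eqnDer t J ᵥ* G) i * (a ᵥ* G) k - (eqnDer t J ᵥ* G) k * (a ᵥ* G) i := by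
    simp only [Matrix.vecMul, dotProduct, Finset.sum_mul_sum]
    rw [Finset.sum_comm (f := fun i_1 j => eqnDer t J i_1 * G i_1 k * (a j * G j i)),
      ← Finset.sum_sub_distrib]
    refine Finset.sum_congr rfl fun l _ => ?_
    rw [← Finset.sum_sub_distrib]
    exact Finset.sum_congr rfl fun j _ => by ring
  have h2 : eqn t J ∣
      (eqnDer t J ᵥ* G) i * (a ᵥ* G) k - (eqnDer t J ᵥ* G) k * (a ᵥ* G) i := by
    rw [← h1]
    exact Finset.dvd_sum fun l _ => Finset.dvd_sum fun j _ => Dvd.dvd.mul_right (h l j) _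
  simp only [Pi.add_apply, Pi.smul_apply, smul_eq_mul]
  have h3 : (eqn t J * v i + u * (eqnDer t J ᵥ* G) i) * (a ᵥ* G) k -
      (eqn t J * v k + u * (eqnDer t J ᵥ* G) k) * (a ᵥ* G) i =
      eqn t J * (v i * (a ᵥ* G) k - v k * (a ᵥ* G) i) +
      u * ((eqnDer t J ᵥ* G) i * (a ᵥ* G) k - (eqnDer t J ᵥ* G) k * (a ᵥ* G) i) := by ring
  rw [h3]
  exact dvd_add (dvd_mul_right _ _) (Dvd.dvd.mul_left h2 _)

lemma logCoef_smul_mem_logVec (j : Fin n) :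
    Pi.single j (logCoef t J j) ᵥ* G ∈
      logVec (eqn t J • v + u • (eqnDer t J ᵥ* G)) (eqn t J) := by
  have key : ∀ l, l ≠ j → eqn t J ∣ eqnDer t J l * logCoef t J j := by
    intro l hl
    by_cases hJ : l ∈ J
    · rw [eqnDer_of_mem hJ]; exact eqn_dvd_mul hJ hl
    · rw [eqnDer, if_neg hJ, zero_mul]; exact dvd_zero _
  refine vecMul_mem_logVec fun l i => ?_
  by_cases hl : l = j
  · subst hl
    by_cases hi : i = l
    · subst hi; simp
    · rw [Pi.single_eq_same, Pi.single_eq_of_ne hi, mul_zero, zero_sub, dvd_neg]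
      exact key i hi
  · rw [Pi.single_eq_of_ne hl, mul_zero, sub_zero]
    by_cases hi : i = j
    · subst hi
      rw [Pi.single_eq_same]; exact key l hl
    · rw [Pi.single_eq_of_ne hi, mul_zero]; exact dvd_zero _

/-- The matrix of the standard logarithmic vectors with the `j`-th one replaced by `a`. -/
def logMatrix (t : Fin n → B) (J : Finset (Fin n)) (G : Matrix (Fin n) (Fin n) B) (j : Fin n)
    (a : Fin n → B) : Matrix (Fin n) (Fin n) B :=
  (Matrix.diagonal (logCoef t J)).updateRow j a * G

lemma logMatrix_self (j : Fin n) (a : Fin n → B) : logMatrix t J G j a j = a ᵥ* G := by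
  funext k
  simp [logMatrix, Matrix.mul_apply, Matrix.vecMul, dotProduct]

lemma logMatrix_of_ne {i j : Fin n} (h : i ≠ j) (a : Fin n → B) :
    logMatrix t J G j a i = Pi.single i (logCoef t J i) ᵥ* G := by
  funext k
  simp [logMatrix, Matrix.mul_apply, Matrix.vecMul, dotProduct, Matrix.updateRow_ne h,
    Matrix.diagonal_apply, Pi.single_apply]

lemma det_logMatrix (j : Fin n) (a : Fin n → B) :
    logCoef t J j * (eqn t J * (logMatrix t J G j a).det) = a j * eqn t J ^ n * G.det := by
  rw [logMatrix, Matrix.det_mul, det_updateRow_diagonal, ← prod_logCoef,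
    ← Finset.mul_prod_erase _ _ (Finset.mem_univ j)]
  ring

/-- Cramer's rule: replacing the `j`-th standard logarithmic vector by `a` replaces the factor
`logCoef t J j` of the determinant by `a j`, and `hdet` bounds the determinant from below. The
property `hdet` comes from the normal base ring, whereas `B` is not assumed to be normal. -/
lemma logCoef_dvd_of_mem_logVec (hG : IsUnit G.det) (hreg : eqn t J ∈ B⁰)
    (hdet : ∀ N : Matrix (Fin n) (Fin n) B,
      (∀ k, N k ∈ logVec (eqn t J • v + u • (eqnDer t J ᵥ* G)) (eqn t J)) →
        eqn t J ^ n ∣ eqn t J * N.det) {a : Fin n → B}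
    (ha : a ᵥ* G ∈ logVec (eqn t J • v + u • (eqnDer t J ᵥ* G)) (eqn t J)) (j : Fin n) :
    logCoef t J j ∣ a j := by
  have h1 := hdet (logMatrix t J G j a) fun k => by
    by_cases hk : k = j
    · subst hk; rwa [logMatrix_self]
    · rw [logMatrix_of_ne hk]; exact logCoef_smul_mem_logVec k
  obtain ⟨y, hy⟩ := h1
  have h2 := det_logMatrix (t := t) (J := J) (G := G) j a
  rw [hy] at h2
  obtain ⟨w, hw⟩ := hG
  refine ⟨y * ↑w⁻¹, ?_⟩
  have h3 : eqn t J ^ n ∈ B⁰ := pow_mem hreg n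
  refine (mul_cancel_left_mem_nonZeroDivisors h3).1 ?_
  have h4 : G.det * ↑w⁻¹ = 1 := by rw [← hw, Units.mul_inv]
  linear_combination (-(↑w⁻¹ : B)) * h2 - a j * eqn t J ^ n * h4

/-- From `t i * b = t j * c` one gets the logarithmic vector `r (b dt_i + c dt_j)`, where `r` is the
product of the other equations. Its `i`-th coefficient `r b` is then divisible by `logCoef t J i = t
j * r`. -/
lemma dvd_of_dvd_mul_eqn (hG : IsUnit G.det) (hreg : eqn t J ∈ B⁰)
    (hdet : ∀ N : Matrix (Fin n) (Fin n) B,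
      (∀ k, N k ∈ logVec (eqn t J • v + u • (eqnDer t J ᵥ* G)) (eqn t J)) →
        eqn t J ^ n ∣ eqn t J * N.det) {i j : Fin n} (hi : i ∈ J) (hj : j ∈ J) (hij : i ≠ j)
    {b : B} (h : t j ∣ t i * b) : t j ∣ b := by
  obtain ⟨c, hc⟩ := h
  set r := ∏ k ∈ (J.erase i).erase j, t k with hr
  have hri : logCoef t J i = t j * r := by
    rw [logCoef, if_pos hi, hr, Finset.mul_prod_erase _ _ (Finset.mem_erase.2 ⟨hij.symm, hj⟩)]
  have hrj : logCoef t J j = t i * r := by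
    rw [logCoef, if_pos hj, hr, Finset.erase_right_comm,
      Finset.mul_prod_erase _ _ (Finset.mem_erase.2 ⟨hij, hi⟩)]
  have hl : ∀ l, l ≠ i → l ≠ j → eqn t J ∣ eqnDer t J l * r := by
    intro l h1 h2
    by_cases hJ : l ∈ J
    · rw [eqnDer_of_mem hJ, ← mul_logCoef hJ, mul_comm (t l)]
      exact mul_dvd_mul_left _ (Finset.dvd_prod_of_mem t (by simp [h1, h2, hJ]))
    · rw [eqnDer, if_neg hJ, zero_mul]; exact dvd_zero _
  have hm : (Pi.single i (r * b) + Pi.single j (r * c) : Fin n → B) ᵥ* G ∈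
      logVec (eqn t J • v + u • (eqnDer t J ᵥ* G)) (eqn t J) := by
    refine vecMul_mem_logVec ?_
    have key : ∀ l k, l ≠ i → l ≠ j → eqn t J ∣ eqnDer t J l *
        (Pi.single i (r * b) + Pi.single j (r * c) : Fin n → B) k -
        eqnDer t J k * (Pi.single i (r * b) + Pi.single j (r * c) : Fin n → B) l := by
      intro l k h1 h2
      simp only [Pi.add_apply, Pi.single_eq_of_ne h1, Pi.single_eq_of_ne h2, add_zero, mul_zero,
        sub_zero]
      have h3 : (Pi.single i (r * b) : Fin n → B) k + (Pi.single j (r * c) : Fin n → B) k =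
        r * ((Pi.single i b : Fin n → B) k + (Pi.single j c : Fin n → B) k) := by
        simp [Pi.single_apply, mul_add]
      rw [h3, ← mul_assoc]
      exact Dvd.dvd.mul_right (hl l h1 h2) _
    intro l k
    by_cases h1 : l ≠ i ∧ l ≠ j
    · exact key l k h1.1 h1.2
    by_cases h2 : k ≠ i ∧ k ≠ j
    · have := key k l h2.1 h2.2
      rw [← dvd_neg, neg_sub]
      exact this
    · have h3 : l = i ∨ l = j := by tauto
      have h4 : k = i ∨ k = j := by tauto
      have h5 : eqnDer t J i * (r * c) - eqnDer t J j * (r * b) = 0 := by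
        rw [eqnDer_of_mem hi, eqnDer_of_mem hj, hri, hrj]
        linear_combination -(r * r) * hc
      rcases h3 with rfl | rfl <;> rcases h4 with rfl | rfl
      · simp
      · simp [hij, hij.symm, h5]
      · simp [hij, hij.symm]
        rw [← dvd_neg, neg_sub, h5]
        exact dvd_zero _
      · simp
  have h1 := logCoef_dvd_of_mem_logVec hG hreg hdet hm i
  simp only [Pi.add_apply, Pi.single_eq_same, Pi.single_eq_of_ne hij, add_zero] at h1
  rw [hri, mul_comm (t j)] at h1
  have h2 : r ∈ B⁰ := by
    have h3 : t i * (t j * r) ∈ B⁰ := by rw [← hri, mul_logCoef hi]; exact hreg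
    exact (mul_mem_nonZeroDivisors.1 (mul_mem_nonZeroDivisors.1 h3).2).2
  exact (dvd_cancel_left_mem_nonZeroDivisors h2).1 h1

lemma prod_dvd_of_forall_dvd {ι : Type} (t : ι → B) (J : Finset ι)
    (hc : ∀ i ∈ J, ∀ j ∈ J, i ≠ j → ∀ b, t j ∣ t i * b → t j ∣ b) {x : B}
    (h : ∀ j ∈ J, t j ∣ x) : ∏ j ∈ J, t j ∣ x := by
  classical
  have key : ∀ T ⊆ J, ∏ j ∈ T, t j ∣ x := by
    intro T
    induction T using Finset.induction_on with
    | empty => intro _; simp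
    | insert j T hj ih =>
      intro hT
      obtain ⟨y, hy⟩ := ih ((Finset.subset_insert j T).trans hT)
      have hjJ := hT (Finset.mem_insert_self j T)
      have h1 : ∀ T' ⊆ T, ∀ b, t j ∣ (∏ i ∈ T', t i) * b → t j ∣ b := by
        intro T'
        induction T' using Finset.induction_on with
        | empty => intro _ b hb; simpa using hb
        | insert i T' hi ih' =>
          intro hT' b hb
          rw [Finset.prod_insert hi, mul_assoc] at hb
          have hiT := hT' (Finset.mem_insert_self i T')
          exact ih' ((Finset.subset_insert i T').trans hT') b
            (hc i (hT (Finset.mem_insert_of_mem hiT)) j hjJ (by rintro rfl; exact hj hiT) _ hb)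
      obtain ⟨z, hz⟩ := h1 T subset_rfl y (hy ▸ h j hjJ)
      rw [Finset.prod_insert hj]
      exact ⟨z, by rw [hy, hz]; ring⟩
  exact key J subset_rfl

end NormalCrossing

end LogAlgebra

/-! ### Charts: local flat extensions with adapted coordinates. -/

namespace LogAlgebra

open Matrix nonZeroDivisors

/-- A flat local extension of `A` to which derivations `∂ i` extend, with a coordinate system
adapted to the ideal `I`. -/
structure Chart {A : Type} [CommRing A] [Algebra ℂ A] {n : ℕ}
    (der : Fin n → Derivation ℂ A A) (I : Ideal A) where
  B : Type
  [commRing : CommRing B]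
  [isLocalRing : IsLocalRing B]
  [algebra : Algebra A B]
  [flat : Module.Flat A B]
  [isLocalHom : IsLocalHom (algebraMap A B)]
  [algebraBase : Algebra ℂ B]
  ext : Fin n → Derivation ℂ B B
  ext_map : ∀ i a, ext i (algebraMap A B a) = algebraMap A B (der i a)
  t : Fin n → B
  J : Finset (Fin n)
  mem : ∀ j ∈ J, t j ∈ IsLocalRing.maximalIdeal B
  isUnit_det : IsUnit (Matrix.of fun j i => ext i (t j)).det
  map_eq : I.map (algebraMap A B) = Ideal.span {eqn t J}

namespace Chart

attribute [instance] commRing isLocalRing algebra flat isLocalHom algebraBase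

end Chart

/-- The étale algebra is localized at a maximal ideal over that of `A`. The result is formally étale
over `A`, so differentials are obtained by base change and the partial derivatives extend. -/
theorem nonempty_chart {A : Type} [CommRing A] [Algebra ℂ A] [IsLocalRing A] {n : ℕ}
    (v : Module.Basis (Fin n) A (Ω[A⁄ℂ])) {I : Ideal A} (hI : KontsevichLog.IsNormalCrossing I) :
    Nonempty (Chart (fun i => (v.coord i).compDer (KaehlerDifferential.D ℂ A)) I) := by
  obtain ⟨B₀, _, _, _, _, _, hm, n₀, t, b, J, hb, hIm⟩ := hI
  obtain ⟨q, hq, hle⟩ := Ideal.exists_le_maximal _ hm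
  let B := Localization.AtPrime q
  have : Module.Flat B₀ B := IsLocalization.flat _ q.primeCompl
  have : Module.Flat A B := Module.Flat.trans A B₀ B
  have : Algebra.FormallyEtale B₀ B := Algebra.FormallyEtale.of_isLocalization q.primeCompl
  have : Algebra.FormallyEtale A B := Algebra.FormallyEtale.comp A B₀ B
  have : IsScalarTower ℂ A B := IsScalarTower.of_algebraMap_eq' (by
    rw [IsScalarTower.algebraMap_eq ℂ B₀ B, IsScalarTower.algebraMap_eq A B₀ B, RingHom.comp_assoc,
      ← IsScalarTower.algebraMap_eq ℂ A B₀])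
  have : IsLocalHom (algebraMap A B) := ⟨fun a ha => by
    by_contra h
    have h1 : algebraMap A B₀ a ∈ q := hle (Ideal.mem_map_of_mem _ h)
    rw [IsScalarTower.algebraMap_apply A B₀ B] at ha
    exact (IsLocalization.AtPrime.isUnit_to_map_iff B q _).1 ha h1⟩
  let e := KaehlerDifferential.tensorKaehlerEquivOfFormallyEtale ℂ A B
  let w : Module.Basis (Fin n) B (Ω[B⁄ℂ]) := (Algebra.TensorProduct.basis B v).map e
  let e₀ := KaehlerDifferential.tensorKaehlerEquivOfFormallyEtale ℂ B₀ B
  let b' : Module.Basis (Fin n₀) B (Ω[B⁄ℂ]) := (Algebra.TensorProduct.basis B b).map e₀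
  -- Both coordinate systems give bases of the differentials of `B`.
  obtain rfl : n₀ = n := by
    have h1 := Module.finrank_eq_card_basis b'
    have h2 := Module.finrank_eq_card_basis w
    simp only [Fintype.card_fin] at h1 h2
    exact h1.symm.trans h2
  have he : ∀ a, e (1 ⊗ₜ KaehlerDifferential.D ℂ A a) =
      KaehlerDifferential.D ℂ B (algebraMap A B a) := by
    intro a
    simp [e]
  have he₀ : ∀ a, e₀ (1 ⊗ₜ KaehlerDifferential.D ℂ B₀ a) =
      KaehlerDifferential.D ℂ B (algebraMap B₀ B a) := by
    intro a
    simp [e₀]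
  have hb' : ∀ j, b' j = KaehlerDifferential.D ℂ B (algebraMap B₀ B (t j)) := by
    intro j
    simp only [b', Module.Basis.map_apply, Algebra.TensorProduct.basis_apply, hb, he₀]
  classical
  let t' : Fin n₀ → B := fun j => algebraMap B₀ B (t j)
  -- Coordinates that become units at the chosen point are dropped from `J`; the ideal is unchanged.
  refine ⟨⟨B, fun i => (w.coord i).compDer (KaehlerDifferential.D ℂ B), fun i a => ?_, t',
    J.filter fun j => t' j ∈ IsLocalRing.maximalIdeal B,
    fun j hj => (Finset.mem_filter.1 hj).2, ?_, ?_⟩⟩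
  · change w.repr (KaehlerDifferential.D ℂ B (algebraMap A B a)) i = _
    rw [← he]
    simp only [w, Module.Basis.map_repr, LinearEquiv.trans_apply, LinearEquiv.symm_apply_apply,
      Algebra.TensorProduct.basis_repr_tmul]
    simp [Module.Basis.coord_apply]
  · have h1 := w.isUnit_det b'
    rw [Module.Basis.det_apply, ← Matrix.det_transpose] at h1
    convert h1 using 3
    ext j i
    simp only [Matrix.of_apply, Matrix.transpose_apply, Module.Basis.toMatrix_apply, hb']
    rfl
  · have h1 : I.map (algebraMap A B) = Ideal.span {∏ j ∈ J, t' j} := by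
      rw [IsScalarTower.algebraMap_eq A B₀ B, ← Ideal.map_map, hIm, Ideal.map_span,
        Set.image_singleton, map_prod]
    have h2 : IsUnit (∏ j ∈ J with ¬ t' j ∈ IsLocalRing.maximalIdeal B, t' j) := by
      rw [IsUnit.prod_iff]
      intro j hj
      simpa using (Finset.mem_filter.1 hj).2
    rw [h1, ← Finset.prod_filter_mul_prod_filter_not J
      (fun j => t' j ∈ IsLocalRing.maximalIdeal B), Ideal.span_singleton_mul_right_unit h2, eqn]

end LogAlgebra

/-! ### Saito's determinant criterion over a normal ring and its descent from a chart. -/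

namespace LogAlgebra

open Matrix nonZeroDivisors

lemma logVec_mul_unit {R : Type} [CommRing R] {n : ℕ} (δ : Fin n → R) (s : R) {u : R}
    (hu : IsUnit u) : logVec δ (s * u) = logVec δ s := by
  ext η
  change (∀ i j, _ ∣ _) ↔ ∀ i j, _ ∣ _
  simp only [hu.mul_right_dvd]

lemma exists_eq_vecMul {R : Type} [CommRing R] {n : ℕ} {G : Matrix (Fin n) (Fin n) R}
    (hG : IsUnit G.det) (x : Fin n → R) : ∃ a, x = a ᵥ* G :=
  ⟨x ᵥ* G⁻¹, by rw [Matrix.vecMul_vecMul, Matrix.nonsing_inv_mul G hG, Matrix.vecMul_one]⟩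

lemma vecMul_injective_of_isUnit_det {R : Type} [CommRing R] {n : ℕ} {G : Matrix (Fin n) (Fin n) R}
    (hG : IsUnit G.det) {a b : Fin n → R} (h : a ᵥ* G = b ᵥ* G) : a = b := by
  have := congrArg (· ᵥ* G⁻¹) h
  simpa [Matrix.vecMul_vecMul, Matrix.mul_nonsing_inv G hG] using this

lemma forall_dvd_vecMul_iff {R : Type} [CommRing R] {n : ℕ} {G : Matrix (Fin n) (Fin n) R}
    (hG : IsUnit G.det) (s : R) (a : Fin n → R) :
    (∀ i, s ∣ (a ᵥ* G) i) ↔ ∀ i, s ∣ a i := by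
  have key : ∀ (H : Matrix (Fin n) (Fin n) R) (a : Fin n → R), (∀ i, s ∣ a i) →
      ∀ i, s ∣ (a ᵥ* H) i := fun H a h i => by
    change s ∣ ∑ j, a j * H j i
    exact Finset.dvd_sum fun j _ => Dvd.dvd.mul_right (h j) _
  refine ⟨fun h => ?_, key G a⟩
  have := key G⁻¹ _ h
  simpa [Matrix.vecMul_vecMul, Matrix.mul_nonsing_inv G hG] using this

/-- The defining condition is a linear system modulo `s`, one equation for each pair of indices. -/
lemma logVec_le_span {A B : Type} [CommRing A] [CommRing B] [Algebra A B] [Module.Flat A B] {n : ℕ}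
    (δ : Fin n → A) (s : A) {x : Fin n → B}
    (hx : x ∈ logVec (fun i => algebraMap A B (δ i)) (algebraMap A B s)) :
    x ∈ Submodule.span B ((fun (η : Fin n → A) i => algebraMap A B (η i)) '' logVec δ s) := by
  have h1 : ∀ (R : Type) [CommRing R] (d y : Fin n → R) (k : Fin n × Fin n),
      ((Matrix.of fun (k : Fin n × Fin n) l =>
        (if l = k.2 then d k.1 else 0) - if l = k.1 then d k.2 else 0) *ᵥ y) k =
      d k.1 * y k.2 - d k.2 * y k.1 := by
    intro R _ d y k
    simp [Matrix.mulVec, dotProduct, sub_mul, Finset.sum_sub_distrib]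
  have h := mem_span_of_dvd_mulVec (Matrix.of fun (k : Fin n × Fin n) l =>
    (if l = k.2 then δ k.1 else 0) - if l = k.1 then δ k.2 else 0) s x (by
      intro k
      have h2 := h1 B (fun i => algebraMap A B (δ i)) x k
      have h3 : (Matrix.of fun (k : Fin n × Fin n) l =>
        (if l = k.2 then δ k.1 else 0) - if l = k.1 then δ k.2 else 0).map (algebraMap A B) =
        Matrix.of fun (k : Fin n × Fin n) l => (if l = k.2 then algebraMap A B (δ k.1) else 0) -
          if l = k.1 then algebraMap A B (δ k.2) else 0 := by
        ext k l
        simp [apply_ite (algebraMap A B)]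
      rw [h3, h2]
      exact hx k.1 k.2)
  refine Submodule.span_mono ?_ h
  rintro _ ⟨u, hu, rfl⟩
  refine ⟨u, fun i j => ?_, rfl⟩
  rw [← h1 A δ u (i, j)]
  exact hu (i, j)

namespace Chart

/-- The Jacobian matrix of the coordinates. -/
def jac {A : Type} [CommRing A] [Algebra ℂ A] {n : ℕ}
    {der : Fin n → Derivation ℂ A A} {I : Ideal A} (C : Chart der I) : Matrix (Fin n) (Fin n) C.B :=
  Matrix.of fun j i => C.ext i (C.t j)

lemma isUnit_det_jac {A : Type} [CommRing A] [Algebra ℂ A] {n : ℕ}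
    {der : Fin n → Derivation ℂ A A} {I : Ideal A} (C : Chart der I) : IsUnit C.jac.det := C.isUnit_det

lemma ext_eqn {A : Type} [CommRing A] [Algebra ℂ A] {n : ℕ}
    {der : Fin n → Derivation ℂ A A} {I : Ideal A} (C : Chart der I) (i : Fin n) :
    C.ext i (eqn C.t C.J) = (eqnDer C.t C.J ᵥ* C.jac) i := by
  have key : ∀ T : Finset (Fin n), C.ext i (∏ j ∈ T, C.t j) =
      ∑ j ∈ T, (∏ k ∈ T.erase j, C.t k) * C.ext i (C.t j) := by
    intro T
    induction T using Finset.induction_on with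
    | empty => simp
    | insert j T hj ih =>
      rw [Finset.prod_insert hj, Derivation.leibniz, ih, Finset.sum_insert hj,
        Finset.erase_insert hj, smul_eq_mul, smul_eq_mul, Finset.mul_sum, add_comm]
      congr 1
      refine Finset.sum_congr rfl fun k hk => ?_
      have hkj : j ≠ k := by rintro rfl; exact hj hk
      rw [Finset.erase_insert_of_ne hkj, Finset.prod_insert fun h => hj (Finset.mem_of_mem_erase h),
        mul_assoc]
  rw [eqn, key]
  simp [Matrix.vecMul, dotProduct, jac, eqnDer, ite_mul, Finset.sum_ite_mem]

end Chart

variable {A : Type} [CommRing A] [Algebra ℂ A] [IsDomain A] {n : ℕ}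

/-- The divisor of `s` is reduced, in terms of derivations. -/
def IsReducedDivisor (der : Fin n → Derivation ℂ A A) (s : A) : Prop :=
  ∀ p : Ideal A, p.IsPrime → p.height = 1 → s ∈ p → ∃ i, der i s ∉ p

variable {der : Fin n → Derivation ℂ A A} {s : A}

/-- At each height one prime containing `s` some derivative of `s` is invertible, so
`pow_dvd_mul_det` applies there; normality does the rest. -/
lemma pow_dvd_mul_det_of_isReducedDivisor [IsNoetherianRing A] [IsIntegrallyClosed A] (hs : s ≠ 0)
    (hred : IsReducedDivisor der s) (N : Matrix (Fin n) (Fin n) A)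
    (hN : ∀ k, N k ∈ logVec (fun i => der i s) s) : s ^ n ∣ s * N.det := by
  refine NormalDomain.dvd_of_forall_height_one (pow_ne_zero n hs) fun p hp h1 => ?_
  by_cases hsp : s ∈ p
  · obtain ⟨i, hi⟩ := hred p hp h1 hsp
    refine ⟨der i s ^ (n - 1), fun h => hi (hp.mem_of_pow_mem _ h), ?_⟩
    have := pow_dvd_mul_det N hN i
    rwa [mul_left_comm]
  · exact ⟨s ^ n, fun h => hsp (hp.mem_of_pow_mem _ h), dvd_mul_right _ _⟩

variable (C : Chart der (Ideal.span {s}))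

namespace Chart

lemma map_mem_nonZeroDivisors {I : Ideal A} (C : Chart der I) {a : A} (ha : a ≠ 0) :
    algebraMap A C.B a ∈ C.B⁰ := by
  refine mem_nonZeroDivisors_iff_left.2 fun x hx => ?_
  exact mul_left_cancel_of_flat ha (by rw [hx, mul_zero])

lemma exists_map_eq (hs : s ≠ 0) : ∃ u, IsUnit u ∧ algebraMap A C.B s = eqn C.t C.J * u := by
  have h := C.map_eq
  rw [Ideal.map_span, Set.image_singleton] at h
  obtain ⟨u, hu⟩ := Ideal.span_singleton_le_span_singleton.1 h.le
  obtain ⟨y, hy⟩ := Ideal.span_singleton_le_span_singleton.1 h.ge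
  refine ⟨u, ?_, hu⟩
  refine IsUnit.of_mul_eq_one y (mul_left_cancel_of_flat hs ?_)
  rw [mul_one, mul_comm u, ← mul_assoc, ← hy, ← hu]

lemma eqn_mem_nonZeroDivisors (hs : s ≠ 0) : eqn C.t C.J ∈ C.B⁰ := by
  obtain ⟨u, -, h⟩ := C.exists_map_eq hs
  have := C.map_mem_nonZeroDivisors hs
  rw [h] at this
  exact (mul_mem_nonZeroDivisors.1 this).1

lemma logCoef_mem_nonZeroDivisors (hs : s ≠ 0) (j : Fin n) : logCoef C.t C.J j ∈ C.B⁰ := by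
  obtain ⟨y, hy⟩ := logCoef_dvd (t := C.t) (J := C.J) j
  have := C.eqn_mem_nonZeroDivisors hs
  rw [hy] at this
  exact (mul_mem_nonZeroDivisors.1 this).1

lemma exists_ext_map_eq (hs : s ≠ 0) : ∃ (u : C.B) (v : Fin n → C.B), IsUnit u ∧
    algebraMap A C.B s = eqn C.t C.J * u ∧ (fun i => algebraMap A C.B (der i s)) =
      eqn C.t C.J • v + u • (eqnDer C.t C.J ᵥ* C.jac) := by
  obtain ⟨u, hu, h⟩ := C.exists_map_eq hs
  refine ⟨u, fun i => C.ext i u, hu, h, ?_⟩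
  funext i
  rw [← C.ext_map, h, Derivation.leibniz, ext_eqn]
  rfl

lemma logCoef_smul_mem (hs : s ≠ 0) (j : Fin n) :
    Pi.single j (logCoef C.t C.J j) ᵥ* C.jac ∈
      logVec (fun i => algebraMap A C.B (der i s)) (algebraMap A C.B s) := by
  obtain ⟨u, v, hu, h, h'⟩ := C.exists_ext_map_eq hs
  rw [h, logVec_mul_unit _ _ hu, h']
  exact logCoef_smul_mem_logVec j

variable [IsNoetherianRing A] [IsIntegrallyClosed A]

/-- The determinant is multilinear and the logarithmic vectors of the chart are spanned by those of
`A`. -/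
lemma map_pow_dvd_mul_det (hs : s ≠ 0) (hred : IsReducedDivisor der s)
    (N : Matrix (Fin n) (Fin n) C.B)
    (hN : ∀ k, N k ∈ logVec (fun i => algebraMap A C.B (der i s)) (algebraMap A C.B s)) :
    algebraMap A C.B s ^ n ∣ algebraMap A C.B s * N.det := by
  have h := multilinear_mem_of_span (algebraMap A C.B s •
    (Matrix.detRowAlternating (R := C.B) (n := Fin n)).toMultilinearMap)
    (fun _ => (fun (η : Fin n → A) i => algebraMap A C.B (η i)) '' logVec (fun i => der i s) s)
    (Ideal.span {algebraMap A C.B s ^ n}) (by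
      intro w hw
      choose η hη hw using hw
      refine Ideal.mem_span_singleton.2 ?_
      have h1 := map_dvd (algebraMap A C.B)
        (pow_dvd_mul_det_of_isReducedDivisor hs hred (Matrix.of η) hη)
      rw [map_pow, map_mul, RingHom.map_det] at h1
      have h2 : (algebraMap A C.B).mapMatrix (Matrix.of η) = Matrix.of w := by
        ext i j
        rw [← funext hw]
        rfl
      rw [h2] at h1
      exact h1) N fun i => logVec_le_span _ _ (hN i)
  exact Ideal.mem_span_singleton.1 h

lemma eqn_pow_dvd_mul_det (hs : s ≠ 0) (hred : IsReducedDivisor der s)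
    (N : Matrix (Fin n) (Fin n) C.B)
    (hN : ∀ k, N k ∈ logVec (fun i => algebraMap A C.B (der i s)) (eqn C.t C.J)) :
    eqn C.t C.J ^ n ∣ eqn C.t C.J * N.det := by
  obtain ⟨u, hu, h⟩ := C.exists_map_eq hs
  have h1 := C.map_pow_dvd_mul_det hs hred N fun k => by
    rw [h, logVec_mul_unit _ _ hu]; exact hN k
  rw [h, mul_pow, (hu.pow n).mul_right_dvd, mul_right_comm, hu.dvd_mul_right] at h1
  exact h1

/-- Determinants that are units up to a power of `s` descend along the chart. -/
lemma exists_det_eq (hs : s ≠ 0) (hred : IsReducedDivisor der s) (S : Fin n → Set (Fin n → A))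
    (hS : ∀ i, S i ⊆ logVec (fun i => der i s) s) (w : Fin n → Fin n → C.B)
    (hw : ∀ i, w i ∈ Submodule.span C.B
      ((fun (η : Fin n → A) i => algebraMap A C.B (η i)) '' S i))
    (hu : ∃ u, IsUnit u ∧ eqn C.t C.J * (Matrix.of w).det = eqn C.t C.J ^ n * u) :
    ∃ η : Fin n → Fin n → A, (∀ i, η i ∈ S i) ∧
      ∃ u, IsUnit u ∧ s * (Matrix.of η).det = s ^ n * u := by
  -- The determinants, multiplied by `s`, of families taken from the `S i` are multiples of `s ^ n`.
  -- If no cofactor were a unit, multilinearity would put `s` times the determinant of `w` into `s ^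
  -- n 𝔪`, against `hu`.
  by_contra hcon
  push Not at hcon
  obtain ⟨u, hu, hu'⟩ := hu
  obtain ⟨u₀, hu₀, h₀⟩ := C.exists_map_eq hs
  have h := multilinear_mem_of_span (algebraMap A C.B s •
    (Matrix.detRowAlternating (R := C.B) (n := Fin n)).toMultilinearMap)
    (fun i => (fun (η : Fin n → A) i => algebraMap A C.B (η i)) '' S i)
    (Ideal.span {algebraMap A C.B s ^ n} * IsLocalRing.maximalIdeal C.B) (by
      intro w hw
      choose η hη hw using hw
      obtain ⟨y, hy⟩ := pow_dvd_mul_det_of_isReducedDivisor hs hred (Matrix.of η)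
        fun k => hS k (hη k)
      have h1 : ¬ IsUnit y := fun hy' => hcon η hη y hy' hy
      have h2 := congrArg (algebraMap A C.B) hy
      rw [map_mul, RingHom.map_det, map_mul, map_pow] at h2
      have h3 : (algebraMap A C.B).mapMatrix (Matrix.of η) = Matrix.of w := by
        ext i j
        rw [← funext hw]
        rfl
      rw [h3] at h2
      have h4 : (algebraMap A C.B s •
        (Matrix.detRowAlternating (R := C.B) (n := Fin n)).toMultilinearMap) w =
        algebraMap A C.B s ^ n * algebraMap A C.B y := h2
      rw [h4]
      refine Ideal.mul_mem_mul (Ideal.mem_span_singleton_self _)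
        ((IsLocalRing.mem_maximalIdeal _).2 fun h5 => h1 (isUnit_of_map_unit _ _ h5))) w hw
  obtain ⟨y, hy, hxy⟩ := Ideal.mem_span_singleton_mul.1 h
  have h1 : algebraMap A C.B s ^ n * y = algebraMap A C.B s * (Matrix.of w).det := hxy
  rw [h₀, mul_right_comm, hu', mul_pow, mul_assoc, mul_assoc] at h1
  have h2 := (mul_cancel_left_mem_nonZeroDivisors
    (pow_mem (C.eqn_mem_nonZeroDivisors hs) n)).1 h1
  refine (IsLocalRing.mem_maximalIdeal _).1 hy ?_
  exact isUnit_of_mul_isUnit_right (h2 ▸ hu.mul hu₀)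

lemma logCoef_dvd_of_mem (hs : s ≠ 0) (hred : IsReducedDivisor der s) {a : Fin n → C.B}
    (ha : a ᵥ* C.jac ∈ logVec (fun i => algebraMap A C.B (der i s)) (algebraMap A C.B s))
    (j : Fin n) : logCoef C.t C.J j ∣ a j := by
  obtain ⟨u, v, hu, h, h'⟩ := C.exists_ext_map_eq hs
  refine logCoef_dvd_of_mem_logVec (v := v) (u := u) C.isUnit_det_jac
    (C.eqn_mem_nonZeroDivisors hs) ?_ ?_ j
  · rw [← h']
    exact C.eqn_pow_dvd_mul_det hs hred
  · rw [← h', ← logVec_mul_unit _ _ hu, ← h]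
    exact ha

lemma dvd_of_dvd_mul (hs : s ≠ 0) (hred : IsReducedDivisor der s) {i j : Fin n} (hi : i ∈ C.J)
    (hj : j ∈ C.J) (hij : i ≠ j) {b : C.B} (h : C.t j ∣ C.t i * b) : C.t j ∣ b := by
  obtain ⟨u, v, hu, h1, h'⟩ := C.exists_ext_map_eq hs
  refine dvd_of_dvd_mul_eqn (v := v) (u := u) C.isUnit_det_jac (C.eqn_mem_nonZeroDivisors hs) ?_ hi
    hj hij h
  rw [← h']
  exact C.eqn_pow_dvd_mul_det hs hred

/-- A logarithmic vector whose `j`-th coefficient in the chart is a unit is part of a basis. -/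
lemma exists_basis_of_isUnit_coef (hs : s ≠ 0) (hred : IsReducedDivisor der s) (j : Fin n)
    {θ : Fin n → A} (hθ : θ ∈ logVec (fun i => der i s) s) {a : Fin n → C.B}
    (ha : (fun i => algebraMap A C.B (θ i)) = a ᵥ* C.jac) {u : C.B} (hu : IsUnit u)
    (hau : a j = logCoef C.t C.J j * u) :
    ∃ η : Fin n → Fin n → A, (∀ i, η i ∈ logVec (fun i => der i s) s) ∧ η j = θ ∧
      ∃ u, IsUnit u ∧ s * (Matrix.of η).det = s ^ n * u := by
  classical
  -- The `j`-th set is the singleton `{θ}`, which forces the `j`-th row of the descended family to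
  -- be `θ`.
  obtain ⟨η, hη, hdet⟩ := C.exists_det_eq hs hred
    (fun i => if i = j then {θ} else logVec (fun i => der i s) s) (fun i => by
      split_ifs
      · exact Set.singleton_subset_iff.2 hθ
      · exact subset_rfl) (fun i => logMatrix C.t C.J C.jac j a i) (fun i => by
      by_cases hij : i = j
      · subst hij
        rw [if_pos rfl, logMatrix_self, ← ha]
        exact Submodule.subset_span ⟨θ, rfl, rfl⟩
      · rw [if_neg hij, logMatrix_of_ne hij]
        exact logVec_le_span _ _ (C.logCoef_smul_mem hs i)) ⟨u * C.jac.det, hu.mul C.isUnit_det_jac,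
      by
        refine (mul_cancel_left_mem_nonZeroDivisors (C.logCoef_mem_nonZeroDivisors hs j)).1 ?_
        refine (det_logMatrix j a).trans ?_
        rw [hau]
        ring⟩
  refine ⟨η, fun i => ?_, ?_, hdet⟩
  · have := hη i
    split_ifs at this
    · rw [this]; exact hθ
    · exact this
  · have := hη j
    simpa using this

/-- The logarithmic vectors have a basis. -/
theorem exists_basis (C : Chart der (Ideal.span {s})) (hs : s ≠ 0) (hred : IsReducedDivisor der s) :
    ∃ η : Fin n → Fin n → A, (∀ i, η i ∈ logVec (fun i => der i s) s) ∧
      ∃ u, IsUnit u ∧ s * (Matrix.of η).det = s ^ n * u := by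
  obtain ⟨η, hη, hdet⟩ := C.exists_det_eq hs hred
    (fun _ => logVec (fun i => der i s) s) (fun _ => subset_rfl)
    (fun i => Pi.single i (logCoef C.t C.J i) ᵥ* C.jac)
    (fun i => logVec_le_span _ _ (C.logCoef_smul_mem hs i)) ⟨C.jac.det, C.isUnit_det_jac, by
      have h1 : (Matrix.of fun i => Pi.single i (logCoef C.t C.J i) ᵥ* C.jac) =
          Matrix.diagonal (logCoef C.t C.J) * C.jac := by
        ext i k
        simp
      rw [h1, Matrix.det_mul, Matrix.det_diagonal, ← mul_assoc, prod_logCoef]⟩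
  exact ⟨η, hη, hdet⟩

end Chart

end LogAlgebra

/-! ### Residues along height one primes; multiplicities of smooth divisors. -/

namespace LogAlgebra

open Matrix nonZeroDivisors

/-- The ideal of all `a` such that `s` divides `a c_i` for all `i`. -/
def denomIdeal {A : Type} [CommRing A] {n : ℕ} (c : Fin n → A) (s : A) : Ideal A where
  carrier := {a | ∀ i, s ∣ c i * a}
  zero_mem' i := by simp
  add_mem' ha hb i := by rw [mul_add]; exact dvd_add (ha i) (hb i)
  smul_mem' x a ha i := by
    rw [smul_eq_mul, mul_left_comm]
    exact Dvd.dvd.mul_left (ha i) x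

lemma isUnit_natCast {B : Type} [CommRing B] [Algebra ℂ B] {k : ℕ} (hk : k ≠ 0) :
    IsUnit (k : B) := by
  have := (IsUnit.mk0 (k : ℂ) (Nat.cast_ne_zero.2 hk)).map (algebraMap ℂ B)
  rwa [map_natCast] at this

lemma isUnit_sub_natCast {B : Type} [CommRing B] [Algebra ℂ B] {k l : ℕ} (h : k ≠ l) :
    IsUnit ((k : B) - l) := by
  have h1 : (k : ℂ) - l ≠ 0 := sub_ne_zero.2 (Nat.cast_injective.ne h)
  have := (IsUnit.mk0 _ h1).map (algebraMap ℂ B)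
  rwa [map_sub, map_natCast, map_natCast] at this

section Prime

variable {A : Type} [CommRing A] [IsDomain A] [IsNoetherianRing A] [IsIntegrallyClosed A] {n : ℕ}

/-- The wedge of `δ` with `γ` equals its wedge with `γ - k δ`, so it is divisible by `s` at each
height one prime. -/
lemma mem_logVec_of_forall_height_one {s : A} (hs : s ≠ 0) {δ γ : Fin n → A} {E : Finset ℕ}
    (h : ∀ p : Ideal A, p.IsPrime → p.height = 1 → s ∈ p →
      ∃ k ∈ E, ∃ c ∉ p, ∀ i, s ∣ (γ i - k * δ i) * c) : γ ∈ logVec δ s := by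
  intro i j
  refine NormalDomain.dvd_of_forall_height_one hs fun p hp h1 => ?_
  by_cases hsp : s ∈ p
  · obtain ⟨k, -, c, hc, hdvd⟩ := h p hp h1 hsp
    refine ⟨c, hc, ?_⟩
    have := dvd_sub ((hdvd j).mul_left (δ i)) ((hdvd i).mul_left (δ j))
    convert! this using 1
    ring
  · exact ⟨s, hsp, dvd_mul_right _ _⟩

/-- A common element of the ideals `denomIdeal (γ - k δ) s` that is a nonzerodivisor modulo `s`. -/
lemma exists_mem_iSup_denomIdeal {s : A} (hs : s ≠ 0) {δ γ : Fin n → A} {E : Finset ℕ}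
    (h : ∀ p : Ideal A, p.IsPrime → p.height = 1 → s ∈ p →
      ∃ k ∈ E, ∃ c ∉ p, ∀ i, s ∣ (γ i - k * δ i) * c) :
    ∃ b ∈ ⨆ k ∈ E, denomIdeal (fun i => γ i - k * δ i) s, ∀ a, s ∣ b * a → s ∣ a := by
  have hfin := NormalDomain.finite_height_one hs
  -- Prime avoidance: only finitely many height one primes contain `s`, and the sum of the ideals
  -- lies in none of them.
  have h1 : ¬ (((⨆ k ∈ E, denomIdeal (fun i => γ i - k * δ i) s : Ideal A) : Set A) ⊆
      ⋃ p ∈ {p : Ideal A | p.IsPrime ∧ p.height = 1 ∧ s ∈ p}, (p : Set A)) := by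
    intro hcon
    obtain ⟨p, hp, hle⟩ := (Ideal.subset_union_prime_finite hfin (f := id) 0 0
      fun p hp _ _ => hp.1).1 hcon
    obtain ⟨k, hk, c, hc, hdvd⟩ := h p hp.1 hp.2.1 hp.2.2
    refine hc (hle ?_)
    exact (le_iSup₂ (f := fun (k : ℕ) (_ : k ∈ E) => denomIdeal (fun i => γ i - k * δ i) s) k hk)
      hdvd
  obtain ⟨b, hb, hb'⟩ := Set.not_subset.1 h1
  refine ⟨b, hb, fun a ha => NormalDomain.dvd_of_forall_height_one hs fun p hp h2 => ?_⟩
  by_cases hsp : s ∈ p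
  · refine ⟨b, fun hbp => hb' ?_, ha⟩
    exact Set.mem_biUnion (x := p) ⟨hp, h2, hsp⟩ hbp
  · exact ⟨s, hsp, dvd_mul_right _ _⟩

end Prime

namespace Chart

section Local

variable {A : Type} [CommRing A] [Algebra ℂ A] {n : ℕ} {der : Fin n → Derivation ℂ A A}
  {I : Ideal A} (C : Chart der I)

lemma not_isUnit {j : Fin n} (hj : j ∈ C.J) : ¬ IsUnit (C.t j) := C.mem j hj

lemma exists_coef (a : C.B) : ∃ x : Fin n → C.B, (fun i => C.ext i a) = x ᵥ* C.jac :=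
  exists_eq_vecMul C.isUnit_det_jac _

lemma exists_isUnit_coef {a : C.B} {x : Fin n → C.B} (hx : (fun i => C.ext i a) = x ᵥ* C.jac)
    {i : Fin n} (hi : IsUnit (C.ext i a)) : ∃ l, IsUnit (x l) := by
  by_contra hcon
  push Not at hcon
  have h1 : C.ext i a = ∑ l, x l * C.jac l i := congrFun hx i
  rw [h1] at hi
  refine (IsLocalRing.mem_maximalIdeal _).1 (sum_mem fun l _ => ?_) hi
  exact Ideal.mul_mem_right _ _ ((IsLocalRing.mem_maximalIdeal _).2 (hcon l))

/-- Differentiating `t l = t j * y` and comparing the coefficients of `dt_l` would make `t j` a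
unit. -/
lemma not_dvd_of_ne {j l : Fin n} (hj : j ∈ C.J) (hjl : j ≠ l) : ¬ C.t j ∣ C.t l := by
  rintro ⟨y, hy⟩
  obtain ⟨x, hx⟩ := C.exists_coef y
  have h1 : (Pi.single l 1 : Fin n → C.B) ᵥ* C.jac =
      (C.t j • x + y • (Pi.single j 1 : Fin n → C.B)) ᵥ* C.jac := by
    rw [Matrix.add_vecMul, Matrix.smul_vecMul, Matrix.smul_vecMul, ← hx]
    funext i
    have h2 := congrArg (C.ext i) hy
    rw [Derivation.leibniz] at h2
    simpa [jac, mul_comm] using h2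
  have h2 := congrFun (vecMul_injective_of_isUnit_det C.isUnit_det_jac h1) l
  simp [hjl.symm] at h2
  exact C.not_isUnit hj (IsUnit.of_mul_eq_one _ h2.symm)

end Local

variable {A : Type} [CommRing A] [Algebra ℂ A] [IsDomain A] {n : ℕ}
  {der : Fin n → Derivation ℂ A A}

lemma isUnit_one_sub_mul {B : Type} [CommRing B] [IsLocalRing B] {a : B} (ha : ¬ IsUnit a) (b : B) :
    IsUnit (1 - a * b) :=
  (IsLocalRing.isUnit_or_isUnit_one_sub_self (a * b)).resolve_left fun h =>
    ha (isUnit_of_mul_isUnit_left h)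

lemma isUnit_add_mul {B : Type} [CommRing B] [IsLocalRing B] {u a : B} (hu : IsUnit u)
    (ha : ¬ IsUnit a) (b : B) : IsUnit (u + a * b) := by
  by_contra h
  have h1 : u ∈ IsLocalRing.maximalIdeal B := by
    have h2 : u = (u + a * b) - a * b := by ring
    rw [h2]
    exact sub_mem ((IsLocalRing.mem_maximalIdeal _).2 h)
      (Ideal.mul_mem_right _ _ ((IsLocalRing.mem_maximalIdeal _).2 ha))
  exact (IsLocalRing.mem_maximalIdeal _).1 h1 hu

/-- The coordinates of `ds` in the chart. -/
lemma exists_coef_map_eq {s : A} (C : Chart der (Ideal.span {s})) (hs : s ≠ 0) :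
    ∃ (u : C.B) (v : Fin n → C.B), IsUnit u ∧
    algebraMap A C.B s = eqn C.t C.J * u ∧ (fun i => algebraMap A C.B (der i s)) =
      (eqn C.t C.J • v + u • eqnDer C.t C.J) ᵥ* C.jac := by
  obtain ⟨u, v, hu, h1, h2⟩ := C.exists_ext_map_eq hs
  obtain ⟨v', rfl⟩ := exists_eq_vecMul C.isUnit_det_jac v
  refine ⟨u, v', hu, h1, h2.trans ?_⟩
  rw [Matrix.add_vecMul, Matrix.smul_vecMul, Matrix.smul_vecMul]

lemma mul_prod_erase_eqn {A : Type} [CommRing A] [Algebra ℂ A] {n : ℕ}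
    {der : Fin n → Derivation ℂ A A} {I : Ideal A} (C : Chart der I) {j : Fin n} (hj : j ∈ C.J) :
    eqn C.t C.J = C.t j * logCoef C.t C.J j := (mul_logCoef hj).symm

/-- A smooth reduced divisor with a multiple that is a normal crossing divisor has multiplicity at
most one. -/
theorem le_one_of_pow {π : A} {m : ℕ} (C : Chart der (Ideal.span {π ^ m})) (h0 : π ≠ 0)
    (hπ : ¬ IsUnit π) (hder : ∃ i, IsUnit (der i π)) : m ≤ 1 := by
  by_contra! hm
  obtain ⟨k, rfl⟩ : ∃ k, m = k + 2 := ⟨m - 2, by omega⟩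
  obtain ⟨u, v, hu, h1, h2⟩ := C.exists_coef_map_eq (pow_ne_zero _ h0)
  obtain ⟨x, hx⟩ := C.exists_coef (algebraMap A C.B π)
  obtain ⟨l, hl⟩ : ∃ l, IsUnit (x l) := by
    obtain ⟨i, hi⟩ := hder
    exact C.exists_isUnit_coef hx (i := i) (by rw [C.ext_map]; exact hi.map _)
  set p := algebraMap A C.B π with hp
  have hpu : ¬ IsUnit p := fun h => hπ (isUnit_of_map_unit _ _ h)
  have hpreg : p ∈ C.B⁰ := C.map_mem_nonZeroDivisors h0
  -- The differential of `π ^ (k + 2)`, once by the power rule and once from the equation of the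
  -- chart.
  have h3 : ((k + 2 : ℕ) * p ^ (k + 1)) • x =
      eqn C.t C.J • v + u • eqnDer C.t C.J := by
    refine vecMul_injective_of_isUnit_det C.isUnit_det_jac ?_
    rw [← h2, Matrix.smul_vecMul, ← hx]
    funext i
    rw [← C.ext_map, map_pow, Derivation.leibniz_pow]
    simp [mul_assoc, nsmul_eq_mul, hp]
  have hk : IsUnit ((k + 2 : ℕ) : C.B) := isUnit_natCast (by omega)
  rw [map_pow] at h1
  have h4 : ∀ i, ((k + 2 : ℕ) : C.B) * p ^ (k + 1) * x i =
      eqn C.t C.J * v i + u * eqnDer C.t C.J i := fun i => congrFun h3 i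
  -- Outside `J` the `l`-th coefficient would be divisible by the equation, so `π ^ (k + 2)` would
  -- divide `π ^ (k + 1)`.
  have hlJ : l ∈ C.J := by
    by_contra hlJ
    have h5 := h4 l
    rw [eqnDer, if_neg hlJ, mul_zero, add_zero] at h5
    have h6 : p ^ (k + 2) ∣ p ^ (k + 1) := by
      rw [← (hk.mul hl).dvd_mul_right, h1, hu.mul_right_dvd]
      exact ⟨v l, by rw [← h5]; ring⟩
    rw [pow_succ p (k + 1)] at h6
    obtain ⟨c, hc⟩ := h6
    refine hpu (IsUnit.of_mul_eq_one c ?_)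
    refine (mul_cancel_left_mem_nonZeroDivisors (pow_mem hpreg (k + 1))).1 ?_
    rw [mul_one, ← mul_assoc]
    exact hc.symm
  set r := logCoef C.t C.J l with hr
  have hel : eqn C.t C.J = C.t l * r := C.mul_prod_erase_eqn hlJ
  have hw : IsUnit (u + C.t l * v l) := isUnit_add_mul hu (C.not_isUnit hlJ) _
  have h5 : p ^ (k + 1) * ((k + 2 : ℕ) * x l) = r * (u + C.t l * v l) := by
    have := h4 l
    rw [eqnDer_of_mem hlJ, ← hr, hel] at this
    linear_combination this
  -- `r` agrees with `π ^ (k + 1)` up to units, so a second branch passes through the point.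
  have hru : ¬ IsUnit r := by
    intro h
    have h6 := h.mul hw
    rw [← h5, pow_succ p k] at h6
    exact hpu (isUnit_of_mul_isUnit_right (isUnit_of_mul_isUnit_left h6))
  obtain ⟨j, hj, hjl⟩ : ∃ j ∈ C.J, j ≠ l := by
    by_contra! hcon
    refine hru ?_
    rw [hr, logCoef, if_pos hlJ]
    have : C.J.erase l = ∅ := by
      ext i; simp; intro h1 h2; exact h1 (hcon i h2)
    rw [this, Finset.prod_empty]
    exact isUnit_one
  set q := ∏ i ∈ (C.J.erase l).erase j, C.t i with hq
  have hrq : r = C.t j * q := by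
    rw [hr, logCoef, if_pos hlJ, hq, Finset.mul_prod_erase _ _ (Finset.mem_erase.2 ⟨hjl, hj⟩)]
  have hjq : logCoef C.t C.J j = C.t l * q := by
    rw [logCoef, if_pos hj, hq, Finset.erase_right_comm,
      Finset.mul_prod_erase _ _ (Finset.mem_erase.2 ⟨hjl.symm, hlJ⟩)]
  have hqreg : q ∈ C.B⁰ := by
    have h6 := C.eqn_mem_nonZeroDivisors (pow_ne_zero (k + 2) h0)
    rw [hel, hrq] at h6
    exact (mul_mem_nonZeroDivisors.1 (mul_mem_nonZeroDivisors.1 h6).2).2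
  obtain ⟨y, hy⟩ : ∃ y, p ^ (k + 1) = r * y := by
    obtain ⟨c, hc⟩ := (hk.mul hl)
    refine ⟨(u + C.t l * v l) * ↑c⁻¹, ?_⟩
    rw [← mul_assoc, ← h5, ← hc, mul_assoc, Units.mul_inv, mul_one]
  -- The comparison of the coefficients of `dt_j`, divided by `q`: all terms except `t l * u`
  -- contain the factor `t j`.
  have h6 : C.t j ∣ C.t l * u := by
    have h7 := h4 j
    rw [eqnDer_of_mem hj, hjq, hy, hel, hrq] at h7
    refine ⟨(k + 2 : ℕ) * y * x j - C.t l * v j, ?_⟩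
    refine (mul_cancel_left_mem_nonZeroDivisors hqreg).1 ?_
    linear_combination -h7
  exact C.not_dvd_of_ne hj hjl (hu.dvd_mul_right.1 h6)

end Chart

end LogAlgebra

/-! ### The form `g df` as a member of a logarithmic basis; integral residues in a chart. -/

namespace LogAlgebra

open Matrix nonZeroDivisors

lemma map_mem_logVec {A B : Type} [CommRing A] [CommRing B] (φ : A →+* B) {n : ℕ}
    {δ γ : Fin n → A} {s : A} (h : γ ∈ logVec δ s) :
    (fun i => φ (γ i)) ∈ logVec (fun i => φ (δ i)) (φ s) := by
  intro i j
  have := map_dvd φ (h i j)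
  simpa using this

/-- With `γ = s dg/g` and `z = g f` this vector represents `s g df`. -/
lemma mem_logVec_pole {A : Type} [CommRing A] [Algebra ℂ A] {n : ℕ}
    {der : Fin n → Derivation ℂ A A} {s z : A} {γ : Fin n → A} (hγ : γ ∈ logVec (fun i => der i s) s) :
    (fun i => s * der i z - z * γ i) ∈ logVec (fun i => der i s) s := by
  intro i j
  obtain ⟨y, hy⟩ := hγ i j
  exact ⟨der i s * der j z - der j s * der i z - z * y, by linear_combination -z * hy⟩

namespace Chart

variable {A : Type} [CommRing A] [Algebra ℂ A] [IsDomain A] {n : ℕ}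
  {der : Fin n → Derivation ℂ A A}

/-- If `z s` defines a normal crossing divisor, `z` and `s` are coprime and `z` is smooth, then
`z` is one of the coordinates of the chart. -/
lemma exists_chart_of_mul {z s : A} (C : Chart der (Ideal.span {z * s})) (hz0 : z ≠ 0) (hs : s ≠ 0)
    (hz : ¬ IsUnit z) (hder : ∃ i, IsUnit (der i z)) (h1 : ∀ a, z ∣ s * a → z ∣ a) :
    ∃ (C' : Chart der (Ideal.span {s})) (j : Fin n) (x : Fin n → C'.B), j ∉ C'.J ∧
      (fun i => C'.ext i (algebraMap A C'.B z)) = x ᵥ* C'.jac ∧ IsUnit (x j) := by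
  obtain ⟨u, v, hu, hzs, h2⟩ := C.exists_coef_map_eq (mul_ne_zero hz0 hs)
  obtain ⟨x, hx⟩ := C.exists_coef (algebraMap A C.B z)
  obtain ⟨y, hy⟩ := C.exists_coef (algebraMap A C.B s)
  obtain ⟨l, hl⟩ : ∃ l, IsUnit (x l) := by
    obtain ⟨i, hi⟩ := hder
    exact C.exists_isUnit_coef hx (i := i) (by rw [C.ext_map]; exact hi.map _)
  have hzu : ¬ IsUnit (algebraMap A C.B z) := fun h => hz (isUnit_of_map_unit _ _ h)
  have hzreg := C.map_mem_nonZeroDivisors hz0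
  have h3 : algebraMap A C.B z • y + algebraMap A C.B s • x =
      eqn C.t C.J • v + u • eqnDer C.t C.J := by
    refine vecMul_injective_of_isUnit_det C.isUnit_det_jac ?_
    rw [← h2, Matrix.add_vecMul, Matrix.smul_vecMul, Matrix.smul_vecMul, ← hx, ← hy]
    funext i
    rw [← C.ext_map, map_mul, Derivation.leibniz]
    rfl
  have h4 : ∀ i, algebraMap A C.B z * y i + algebraMap A C.B s * x i =
      eqn C.t C.J * v i + u * eqnDer C.t C.J i := fun i => congrFun h3 i
  rw [map_mul] at hzs
  have hcop : ∀ b, algebraMap A C.B z ∣ algebraMap A C.B s * b → algebraMap A C.B z ∣ b :=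
    fun b => dvd_of_dvd_mul_of_flat h1
  have hns : ¬ algebraMap A C.B z ∣ algebraMap A C.B s := fun h =>
    hzu (isUnit_of_dvd_one (hcop 1 (by rwa [mul_one])))
  have hdvd : algebraMap A C.B z ∣ eqn C.t C.J := by
    rw [← hu.dvd_mul_right, ← hzs]
    exact dvd_mul_right _ _
  -- Otherwise the coefficient of `dt_l` in the differential of `z s` would be a multiple of the
  -- equation, hence of `z`, and `z` would divide `s`.
  have hlJ : l ∈ C.J := by
    by_contra hlJ
    refine hns (hl.dvd_mul_right.1 ?_)
    have h5 := h4 l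
    rw [eqnDer, if_neg hlJ, mul_zero, add_zero] at h5
    have h6 : algebraMap A C.B s * x l = eqn C.t C.J * v l - algebraMap A C.B z * y l := by
      rw [← h5]; ring
    rw [h6]
    exact dvd_sub (hdvd.mul_right _) (dvd_mul_right _ _)
  set r := logCoef C.t C.J l with hr
  have hel : eqn C.t C.J = C.t l * r := C.mul_prod_erase_eqn hlJ
  have h5 := h4 l
  rw [eqnDer_of_mem hlJ, ← hr] at h5
  -- Multiplying the same coefficient by `t l` shows that `z` divides `s * t l`, and `s` is a
  -- nonzerodivisor modulo `z`.
  obtain ⟨w, hw⟩ : algebraMap A C.B z ∣ C.t l := by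
    have h6 : algebraMap A C.B z ∣ C.t l * (algebraMap A C.B s * x l) := by
      have h7 : C.t l * (algebraMap A C.B s * x l) =
          eqn C.t C.J * (C.t l * v l + u) - algebraMap A C.B z * (C.t l * y l) := by
        rw [hel] at h5 ⊢
        linear_combination C.t l * h5
      rw [h7]
      exact dvd_sub (hdvd.mul_right _) (dvd_mul_right _ _)
    rw [← mul_assoc, hl.dvd_mul_right, mul_comm (C.t l)] at h6
    exact hcop _ h6
  have hsr : algebraMap A C.B s = r * (w * u) := by
    refine (mul_cancel_left_mem_nonZeroDivisors hzreg).1 ?_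
    rw [hzs, hel, hw]
    ring
  -- With `t l = z w` the relation becomes `r u (1 - w x_l) ∈ (z)`. For a nonunit `w` this gives `z
  -- ∣ r`, hence `z ∣ s`.
  have hwu : IsUnit w := by
    by_contra hwn
    have h6 := isUnit_one_sub_mul hwn (x l)
    refine hns (Dvd.dvd.trans ?_ ⟨_, hsr⟩)
    rw [← (h6.mul hu).dvd_mul_right]
    refine ⟨y l - w * r * v l, ?_⟩
    rw [hsr, hel, hw] at h5
    linear_combination -h5
  refine ⟨{ C with
    J := C.J.erase l
    mem := fun j hj => C.mem j (Finset.mem_of_mem_erase hj)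
    map_eq := ?_ }, l, x, Finset.notMem_erase l C.J, hx, hl⟩
  rw [Ideal.map_span, Set.image_singleton, hsr, Ideal.span_singleton_mul_right_unit (hwu.mul hu),
    hr, logCoef, if_pos hlJ, eqn]

variable [IsNoetherianRing A] [IsIntegrallyClosed A] {s : A}

/-- Coefficients of a logarithmic vector in the chart. -/
lemma exists_logCoef_mul (C : Chart der (Ideal.span {s})) (hs : s ≠ 0)
    (hred : IsReducedDivisor der s) {γ : Fin n → A} (hγ : γ ∈ logVec (fun i => der i s) s) :
    ∃ (c : Fin n → C.B) (u : C.B), IsUnit u ∧ algebraMap A C.B s = eqn C.t C.J * u ∧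
      (fun i => algebraMap A C.B (γ i)) = (fun j => logCoef C.t C.J j * c j) ᵥ* C.jac ∧
      ∀ (k : ℕ) (x : C.B), (∀ i, algebraMap A C.B s ∣ algebraMap A C.B (γ i - k * der i s) * x) ↔
        ∀ j ∈ C.J, C.t j ∣ (c j - k * u) * x := by
  obtain ⟨u, v, hu, hsu, hδ⟩ := C.exists_coef_map_eq hs
  obtain ⟨a, ha⟩ := exists_eq_vecMul C.isUnit_det_jac fun i => algebraMap A C.B (γ i)
  have h1 := fun j => C.logCoef_dvd_of_mem hs hred (a := a)
    (ha ▸ map_mem_logVec (algebraMap A C.B) hγ) j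
  choose c hc using h1
  obtain rfl : a = fun j => logCoef C.t C.J j * c j := funext hc
  refine ⟨c, u, hu, hsu, ha, fun k x => ?_⟩
  have h2 : (fun i => algebraMap A C.B (γ i - k * der i s) * x) =
      (x • ((fun j => logCoef C.t C.J j * c j) -
        (k : C.B) • (eqn C.t C.J • v + u • eqnDer C.t C.J))) ᵥ* C.jac := by
    rw [Matrix.smul_vecMul, Matrix.sub_vecMul, Matrix.smul_vecMul, ← ha, ← hδ]
    funext i
    simp [mul_comm]
  have h3 : (∀ i, algebraMap A C.B s ∣ algebraMap A C.B (γ i - k * der i s) * x) ↔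
      ∀ j, eqn C.t C.J ∣ x * (logCoef C.t C.J j * c j -
        k * (eqn C.t C.J * v j + u * eqnDer C.t C.J j)) := by
    rw [hsu]
    simp only [hu.mul_right_dvd]
    refine Iff.trans ?_ (forall_dvd_vecMul_iff C.isUnit_det_jac (eqn C.t C.J) (x •
      ((fun j => logCoef C.t C.J j * c j) - (k : C.B) • (eqn C.t C.J • v + u • eqnDer C.t C.J))))
    rw [← h2]
  rw [h3]
  -- Thus the residue of `γ / s` along the branch `t j` is `c j / u`. The contribution of `v j` is a
  -- multiple of `t j`.
  have h4 : ∀ j ∈ C.J, (eqn C.t C.J ∣ x * (logCoef C.t C.J j * c j -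
        k * (eqn C.t C.J * v j + u * eqnDer C.t C.J j)) ↔ C.t j ∣ (c j - k * u) * x) := by
    intro j hj
    have h5 : x * (logCoef C.t C.J j * c j - k * (eqn C.t C.J * v j + u * eqnDer C.t C.J j)) =
        logCoef C.t C.J j * ((c j - k * u) * x - C.t j * (k * v j * x)) := by
      rw [eqnDer_of_mem hj, C.mul_prod_erase_eqn hj]
      ring
    rw [h5, C.mul_prod_erase_eqn hj, mul_comm (C.t j),
      dvd_cancel_left_mem_nonZeroDivisors (C.logCoef_mem_nonZeroDivisors hs j)]
    exact dvd_sub_left (dvd_mul_right _ _)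
  refine ⟨fun h j hj => (h4 j hj).1 (h j), fun h j => ?_⟩
  by_cases hj : j ∈ C.J
  · exact (h4 j hj).2 (h j hj)
  · rw [logCoef, if_neg hj, eqnDer, if_neg hj]
    exact ⟨x * (c j - k * v j), by ring⟩

/-- The data of a logarithmic vector `γ` with integral residues along the components of `s`. -/
structure Residues (C : Chart der (Ideal.span {s})) (γ : Fin n → A) where
  c : Fin n → C.B
  u : C.B
  isUnit : IsUnit u
  map_eq_mul : algebraMap A C.B s = eqn C.t C.J * u
  coef : (fun i => algebraMap A C.B (γ i)) = (fun j => logCoef C.t C.J j * c j) ᵥ* C.jac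
  k : Fin n → ℕ
  dvd : ∀ j ∈ C.J, C.t j ∣ c j - k j * u
  iff : ∀ (l : ℕ) (x : C.B), (∀ i, algebraMap A C.B s ∣ algebraMap A C.B (γ i - l * der i s) * x) ↔
    ∀ j ∈ C.J, k j ≠ l → C.t j ∣ x

/-- Height one primes of `A` may split into several branches in the chart, so the integrality of
residues has to be transported. A nonzerodivisor `b` modulo `s` from the sum of the denominator
ideals shows that `t j` divides the product of the `c j - l u` over `l ∈ E`. Differences of distinct
integers are units, so at most one factor is a nonunit, and `t j` divides that one. -/
lemma nonempty_residues (C : Chart der (Ideal.span {s})) (hs : s ≠ 0)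
    (hred : IsReducedDivisor der s) {γ : Fin n → A} {E : Finset ℕ}
    (h : ∀ p : Ideal A, p.IsPrime → p.height = 1 → s ∈ p →
      ∃ k ∈ E, ∃ c ∉ p, ∀ i, s ∣ (γ i - k * der i s) * c) : Nonempty (C.Residues γ) := by
  obtain ⟨c, u, hu, hsu, hc, hiff⟩ :=
    C.exists_logCoef_mul hs hred (mem_logVec_of_forall_height_one hs h)
  obtain ⟨b, hb, hbreg⟩ := exists_mem_iSup_denomIdeal hs h
  have h1 : ∀ j ∈ C.J, ∀ x, C.t j ∣ algebraMap A C.B b * x → C.t j ∣ x := by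
    intro j hj x hx
    have h2 : algebraMap A C.B s ∣ algebraMap A C.B b * (logCoef C.t C.J j * x) := by
      rw [hsu, hu.mul_right_dvd, C.mul_prod_erase_eqn hj, mul_left_comm, mul_comm (C.t j)]
      exact mul_dvd_mul_left _ hx
    have h3 := dvd_of_dvd_mul_of_flat hbreg h2
    rwa [hsu, hu.mul_right_dvd, C.mul_prod_erase_eqn hj, mul_comm (C.t j),
      dvd_cancel_left_mem_nonZeroDivisors (C.logCoef_mem_nonZeroDivisors hs j)] at h3
  have h2 : ∀ j ∈ C.J, C.t j ∣ ∏ l ∈ E, (c j - (l : C.B) * u) := by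
    intro j hj
    refine h1 j hj _ ?_
    have h4 : (⨆ k ∈ E, denomIdeal (fun i => γ i - k * der i s) s).map (algebraMap A C.B) ≤
        (Ideal.span {C.t j} : Ideal C.B).colon {∏ l ∈ E, (c j - (l : C.B) * u)} := by
      rw [Ideal.map_le_iff_le_comap]
      refine iSup₂_le fun k hk a ha => ?_
      rw [Ideal.mem_comap, Submodule.mem_colon_singleton, smul_eq_mul, Ideal.mem_span_singleton,
        ← Finset.mul_prod_erase E _ hk, ← mul_assoc, mul_comm (algebraMap A C.B a)]
      refine Dvd.dvd.mul_right ((hiff k _).1 (fun i => ?_) j hj) _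
      rw [← map_mul]
      exact map_dvd _ (ha i)
    have h5 := h4 (Ideal.mem_map_of_mem _ hb)
    rwa [Submodule.mem_colon_singleton, smul_eq_mul, Ideal.mem_span_singleton] at h5
  have h3 : ∀ j, ∃ k : ℕ, j ∈ C.J → C.t j ∣ c j - k * u ∧
      ∀ l, l ≠ k → IsUnit (c j - (l : C.B) * u) := by
    intro j
    by_cases hj : j ∈ C.J
    swap
    · exact ⟨0, fun h => absurd h hj⟩
    obtain ⟨k, hk⟩ : ∃ k ∈ E, ¬ IsUnit (c j - (k : C.B) * u) := by
      by_contra! hcon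
      exact C.not_isUnit hj (isUnit_of_dvd_unit (h2 j hj) (IsUnit.prod_iff.2 hcon))
    have h4 : ∀ l, l ≠ k → IsUnit (c j - (l : C.B) * u) := by
      intro l hl
      have h5 : c j - (l : C.B) * u = (((k : C.B) - l) * u) + (c j - (k : C.B) * u) * 1 := by ring
      rw [h5]
      exact isUnit_add_mul ((isUnit_sub_natCast hl.symm).mul hu) hk.2 1
    refine ⟨k, fun _ => ⟨?_, h4⟩⟩
    have h5 := h2 j hj
    rw [← Finset.mul_prod_erase E _ hk.1] at h5
    exact (IsUnit.dvd_mul_right (IsUnit.prod_iff.2 fun l hl =>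
      h4 l (Finset.ne_of_mem_erase hl))).1 h5
  choose k hk using h3
  refine ⟨⟨c, u, hu, hsu, hc, k, fun j hj => (hk j hj).1, fun l x => (hiff l x).trans ?_⟩⟩
  refine forall₂_congr fun j hj => ?_
  by_cases hkl : k j = l
  · subst hkl
    simp [(hk j hj).1.mul_right]
  · rw [((hk j hj).2 l (Ne.symm hkl)).dvd_mul_left]
    simp [hkl]

/-- The ideals of the parts of the divisor of `s` with a given residue are principal. -/
lemma Residues.exists_dvd_iff {C : Chart der (Ideal.span {s})} {γ : Fin n → A} (R : C.Residues γ)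
    (hs : s ≠ 0) (hred : IsReducedDivisor der s) (l : ℕ) :
    ∃ a, ∀ x, (∀ i, s ∣ (γ i - l * der i s) * x) ↔ a ∣ x := by
  -- In the chart, the denominators are cleared exactly by the product of the branches whose residue
  -- differs from `l`. Principality then descends.
  have h1 : (denomIdeal (fun i => γ i - l * der i s) s).map (algebraMap A C.B) =
      Ideal.span {∏ j ∈ C.J with R.k j ≠ l, C.t j} := by
    refine le_antisymm (Ideal.map_le_iff_le_comap.2 fun a ha => ?_)
      ((Ideal.span_singleton_le_iff_mem _).2 ?_)
    · rw [Ideal.mem_comap, Ideal.mem_span_singleton]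
      have h2 := (R.iff l (algebraMap A C.B a)).1 fun i => by
        rw [← map_mul]; exact map_dvd _ (ha i)
      refine prod_dvd_of_forall_dvd C.t _ (fun i hi j hj hij b => C.dvd_of_dvd_mul hs hred
        (Finset.mem_filter.1 hi).1 (Finset.mem_filter.1 hj).1 hij) fun j hj => ?_
      exact h2 j (Finset.mem_filter.1 hj).1 (Finset.mem_filter.1 hj).2
    · have h2 := (R.iff l (∏ j ∈ C.J with R.k j ≠ l, C.t j)).2 fun j hj hjl =>
        Finset.dvd_prod_of_mem C.t (Finset.mem_filter.2 ⟨hj, hjl⟩)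
      exact mem_span_of_dvd_mul (fun i => γ i - l * der i s) s _ h2
  obtain ⟨a, ha⟩ := exists_eq_span_of_map_eq_span (B := C.B) (fun h => hs (by
    rw [← Ideal.mem_bot, ← h]
    exact fun i => dvd_mul_left _ _)) h1
  refine ⟨a, fun x => ?_⟩
  rw [← Ideal.mem_span_singleton, ← ha]
  exact Iff.rfl

variable {z : A} {γ : Fin n → A} {E : Finset ℕ}

/-- The local structure of logarithmic forms along the pole divisor. -/
theorem exists_basis_pole (C : Chart der (Ideal.span {z * s})) (hz : z ≠ 0) (hs : s ≠ 0)
    (hred : IsReducedDivisor der s) (hzs : ∀ p : Ideal A, p.IsPrime → p.height = 1 → s ∈ p → z ∉ p)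
    (hder : IsUnit z ∨ ∃ i, IsUnit (der i z))
    (h : ∀ p : Ideal A, p.IsPrime → p.height = 1 → s ∈ p →
      ∃ k ∈ E, ∃ c ∉ p, ∀ i, s ∣ (γ i - k * der i s) * c) (hγ : ¬ ∀ i, s ∣ γ i) :
    (∃ j, ∃ η : Fin n → Fin n → A, (∀ i, η i ∈ logVec (fun i => der i s) s) ∧
      (η j = fun i => s * der i z - z * γ i) ∧
      ∃ u, IsUnit u ∧ s * (Matrix.of η).det = s ^ n * u) ∧
    ∀ l : ℕ, ∃ a, ∀ x, (∀ i, s ∣ (γ i - l * der i s) * x) ↔ a ∣ x := by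
  by_cases hzu : IsUnit z
  · have hI : Ideal.span {z * s} = Ideal.span {s} := by
      rw [mul_comm, Ideal.span_singleton_mul_right_unit hzu]
    rw [hI] at C
    obtain ⟨R⟩ := C.nonempty_residues hs hred h
    refine ⟨?_, R.exists_dvd_iff hs hred⟩
    -- If all residues vanished, `γ` would be divisible by `s`. Along a branch with nonzero residue
    -- the coefficient `-z * c j` is a unit.
    obtain ⟨j, hj, hkj⟩ : ∃ j ∈ C.J, R.k j ≠ 0 := by
      by_contra! hcon
      refine hγ fun i => dvd_of_map_dvd (B := C.B) ?_
      have := (R.iff 0 1).2 (fun j hj hj0 => absurd (hcon j hj) hj0) i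
      simpa using this
    obtain ⟨x, hx⟩ := C.exists_coef (algebraMap A C.B z)
    obtain ⟨y, hy⟩ := R.dvd j hj
    have hc : IsUnit (R.c j) := by
      have h1 : R.c j = R.k j * R.u + C.t j * y := by rw [← hy]; ring
      rw [h1]
      exact isUnit_add_mul ((isUnit_natCast hkj).mul R.isUnit) (C.not_isUnit hj) _
    refine ⟨j, C.exists_basis_of_isUnit_coef hs hred j
      (mem_logVec_pole (mem_logVec_of_forall_height_one hs h))
      (a := algebraMap A C.B s • x - algebraMap A C.B z • fun j => logCoef C.t C.J j * R.c j) ?_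
      (u := -(algebraMap A C.B z * R.c j) + C.t j * (R.u * x j)) ?_ ?_⟩
    · rw [Matrix.sub_vecMul, Matrix.smul_vecMul, Matrix.smul_vecMul, ← hx, ← R.coef]
      funext i
      simp [C.ext_map, Algebra.smul_def]
    · exact isUnit_add_mul ((hzu.map (algebraMap A C.B)).mul hc).neg (C.not_isUnit hj) _
    · simp only [Pi.sub_apply, Pi.smul_apply, smul_eq_mul]
      rw [R.map_eq_mul, C.mul_prod_erase_eqn hj]
      ring
  -- Here `z` replaces a coordinate not involved in `s`, and the unit coefficient of the basis
  -- element comes from `dz`.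
  · obtain ⟨C', j, x, hj, hx, hxj⟩ := C.exists_chart_of_mul hz hs hzu (hder.resolve_left hzu)
      fun a ha => NormalDomain.dvd_of_forall_height_one hz fun p hp h1 => by
        by_cases hzp : z ∈ p
        · exact ⟨s, fun hsp => hzs p hp h1 hsp hzp, ha⟩
        · exact ⟨z, hzp, dvd_mul_right _ _⟩
    obtain ⟨R⟩ := C'.nonempty_residues hs hred h
    refine ⟨?_, R.exists_dvd_iff hs hred⟩
    refine ⟨j, C'.exists_basis_of_isUnit_coef hs hred j
      (mem_logVec_pole (mem_logVec_of_forall_height_one hs h))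
      (a := algebraMap A C'.B s • x - algebraMap A C'.B z • fun j => logCoef C'.t C'.J j * R.c j) ?_
      (u := R.u * x j + algebraMap A C'.B z * (-R.c j)) ?_ ?_⟩
    · rw [Matrix.sub_vecMul, Matrix.smul_vecMul, Matrix.smul_vecMul, ← hx, ← R.coef]
      funext i
      simp [C'.ext_map, Algebra.smul_def]
    · exact isUnit_add_mul (R.isUnit.mul hxj) (fun h => hzu (isUnit_of_map_unit _ _ h)) _
    · simp only [Pi.sub_apply, Pi.smul_apply, smul_eq_mul]
      rw [R.map_eq_mul, logCoef, if_neg hj]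
      ring

end Chart

end LogAlgebra

/-! ### Affine models: the scheme described by subrings of its function field. -/

namespace KontsevichLog

open CategoryTheory AlgebraicGeometry TopologicalSpace Opposite
open KahlerForms

namespace CompactifiedPair

variable (P : CompactifiedPair)

/-- The local ring at `x` is isomorphic to the stalk of the structure sheaf. -/
def stalkEquiv (x : P.X) : P.X.presheaf.stalk x ≃+* P.localRing x :=
  RingEquiv.ofBijective (algebraMap (P.X.presheaf.stalk x) P.K).rangeRestrict
    ⟨fun _ _ h => IsFractionRing.injective (P.X.presheaf.stalk x) P.K (congrArg Subtype.val h),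
      RingHom.rangeRestrict_surjective _⟩

lemma stalkEquiv_apply (x : P.X) (a : P.X.presheaf.stalk x) :
    (P.stalkEquiv x a : P.K) = algebraMap (P.X.presheaf.stalk x) P.K a := rfl

instance (x : P.X) : IsNoetherianRing (P.localRing x) :=
  isNoetherianRing_of_ringEquiv _ (P.stalkEquiv x)

instance (x : P.X) : IsFractionRing (P.localRing x) P.K := by
  refine IsFractionRing.of_field _ _ fun z => ?_
  obtain ⟨a, b, h⟩ := IsFractionRing.div_surjective (A := P.X.presheaf.stalk x) z
  exact ⟨P.stalkEquiv x a, P.stalkEquiv x b, h.2.symm⟩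

variable {P}

lemma coe_mem_maxIdeal {x : P.X} (a : P.localRing x) :
    (a : P.K) ∈ P.maxIdeal x ↔ a ∈ IsLocalRing.maximalIdeal (P.localRing x) := by
  obtain ⟨a, rfl⟩ := (P.stalkEquiv x).surjective a
  rw [IsLocalRing.mem_maximalIdeal, mem_nonunits_iff, stalkEquiv_apply,
    MulEquiv.isUnit_map (P.stalkEquiv x)]
  refine ⟨?_, fun h => ⟨a, h, rfl⟩⟩
  rintro ⟨b, hb, hab⟩
  rw [← IsFractionRing.injective (P.X.presheaf.stalk x) P.K hab]
  exact hb

lemma mem_localRing_of_mem_maxIdeal {x : P.X} {g : P.K} (h : g ∈ P.maxIdeal x) :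
    g ∈ P.localRing x := by
  obtain ⟨a, -, rfl⟩ := h
  exact ⟨a, rfl⟩

lemma inv_mem_localRing {x : P.X} {g : P.K} (hg : g ∈ P.localRing x) (h : g ∉ P.maxIdeal x) :
    g⁻¹ ∈ P.localRing x := by
  have h1 : IsUnit (⟨g, hg⟩ : P.localRing x) := by
    by_contra h2
    exact h ((coe_mem_maxIdeal ⟨g, hg⟩).2 h2)
  obtain ⟨b, hb⟩ := h1.exists_right_inv
  have h2 : g * b = 1 := congrArg Subtype.val hb
  rw [inv_eq_of_mul_eq_one_right h2]
  exact b.2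

variable (P) in
/-- The ring of sections of the structure sheaf over `W`, as a subring of the function field. -/
def sectionRing (W : P.X.Opens) [Nonempty W] : Subalgebra ℂ P.K where
  __ := (P.X.germToFunctionField W).hom.range
  algebraMap_mem' c := ⟨P.X.presheaf.map (homOfLE le_top).op (P.scalars c),
    P.X.presheaf.germ_res_apply (homOfLE le_top) _ _ _⟩

/-- An open subset `W` that behaves like the spectrum of the subring `S` of the function field. -/
structure IsAffineModel (W : P.X.Opens) (S : Subalgebra ℂ P.K) : Prop where
  smooth : Algebra.IsStandardSmoothOfRelativeDimension P.dim ℂ S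
  le : ∀ y ∈ W, S ≤ P.localRing y
  exists_eq : ∀ y ∈ W, ∀ g ∈ P.localRing y, ∃ a ∈ S, ∃ b ∈ S, b ∉ P.maxIdeal y ∧ g * b = a
  exists_point : ∀ q : Ideal S, q.IsPrime → ∃ y ∈ W, ∀ a : S, (a : P.K) ∈ P.maxIdeal y ↔ a ∈ q
  exists_notMem : ∀ Z : Set P.X, IsClosed Z → ∀ y ∈ W, y ∉ Z → ∃ a ∈ S, a ∉ P.maxIdeal y ∧
    ∀ z ∈ W, z ∈ Z → a ∈ P.maxIdeal z
  exists_opens : ∀ a ∈ S, ∀ y ∈ W, a ∉ P.maxIdeal y → ∃ V : P.X.Opens, y ∈ V ∧ V ≤ W ∧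
    ∀ z ∈ V, a ∉ P.maxIdeal z

lemma germToFunctionField_mem {W : P.X.Opens} [Nonempty W] {y : P.X} (hy : y ∈ W) (a : Γ(P.X, W)) :
    P.X.germToFunctionField W a ∈ P.localRing y :=
  ⟨P.X.presheaf.germ W y hy a, Scheme.algebraMap_germ_eq_germToFunctionField P.X hy a⟩

lemma germToFunctionField_mem_maxIdeal {W : P.X.Opens} [Nonempty W] {y : P.X} (hy : y ∈ W)
    (a : Γ(P.X, W)) : P.X.germToFunctionField W a ∈ P.maxIdeal y ↔ y ∉ P.X.basicOpen a := by
  rw [Scheme.mem_basicOpen P.X a y hy]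
  have h1 := coe_mem_maxIdeal (P.stalkEquiv y (P.X.presheaf.germ W y hy a))
  rw [stalkEquiv_apply, Scheme.algebraMap_germ_eq_germToFunctionField P.X hy a,
    IsLocalRing.mem_maximalIdeal, mem_nonunits_iff, MulEquiv.isUnit_map (P.stalkEquiv y)] at h1
  exact h1

/-- A standard smooth affine neighbourhood, whose ring of sections embeds into the function field
because `X` is integral. -/
lemma exists_isAffineModel (x : P.X) : ∃ (W : P.X.Opens) (S : Subalgebra ℂ P.K), x ∈ W ∧
    IsAffineModel W S := by
  obtain ⟨U, hU, W, hW, hx, e, hsm⟩ :=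
    P.smooth.exists_isStandardSmoothOfRelativeDimension x
  have : Nonempty W := ⟨⟨x, hx⟩⟩
  -- The spectrum of `ℂ` is a single point.
  obtain rfl : U = ⊤ := by
    have : Subsingleton (Spec (CommRingCat.of ℂ)) :=
      inferInstanceAs (Subsingleton (PrimeSpectrum ℂ))
    ext y
    simp only [Opens.coe_top, Set.mem_univ, iff_true]
    rw [Subsingleton.elim y (P.str x)]
    exact e hx
  refine ⟨W, P.sectionRing W, hx, ⟨?_, ?_, ?_, ?_, ?_, ?_⟩⟩
  · let e₁ : ℂ ≃+* Γ(Spec (CommRingCat.of ℂ), ⊤) :=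
      (Scheme.ΓSpecIso (CommRingCat.of ℂ)).symm.commRingCatIsoToRingEquiv
    let e₂ : Γ(P.X, W) ≃+* P.sectionRing W :=
      RingEquiv.ofBijective (P.X.germToFunctionField W).hom.rangeRestrict
        ⟨fun _ _ h => Scheme.germToFunctionField_injective P.X W (congrArg Subtype.val h),
          RingHom.rangeRestrict_surjective _⟩
    have h1 : RingHom.IsStandardSmoothOfRelativeDimension P.dim
        ((e₂ : Γ(P.X, W) →+* P.sectionRing W).comp ((P.str.appLE ⊤ W e).hom.comp
          (e₁ : ℂ →+* Γ(Spec (CommRingCat.of ℂ), ⊤)))) := by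
      have h2 := RingHom.IsStandardSmoothOfRelativeDimension.comp
        (RingHom.IsStandardSmoothOfRelativeDimension.equiv e₂)
        (hsm.comp (RingHom.IsStandardSmoothOfRelativeDimension.equiv e₁))
      simpa using h2
    rw [← RingHom.isStandardSmoothOfRelativeDimension_algebraMap]
    convert! h1
    ext c
    change P.X.germToFunctionField ⊤ (P.scalars c) = P.X.germToFunctionField W _
    refine (P.X.presheaf.germ_res_apply (homOfLE le_top : W ⟶ ⊤) (genericPoint P.X) _ _).symm.trans
      (congrArg _ ?_)
    rw [Scheme.Hom.appLE]
    rfl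
  · rintro y hy _ ⟨a, rfl⟩
    exact germToFunctionField_mem hy a
  · rintro y hy _ ⟨g, rfl⟩
    let _ := TopCat.Presheaf.algebra_section_stalk P.X.presheaf ⟨y, hy⟩
    have hloc := hW.isLocalization_stalk ⟨y, hy⟩
    obtain ⟨⟨a, b⟩, hab⟩ := IsLocalization.surj (hW.primeIdealOf ⟨y, hy⟩).asIdeal.primeCompl g
    refine ⟨_, ⟨a, rfl⟩, _, ⟨b.1, rfl⟩, ?_, ?_⟩
    · refine (germToFunctionField_mem_maxIdeal hy b.1).not.2 (not_not.2 ?_)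
      rw [Scheme.mem_basicOpen P.X b.1 y hy]
      exact IsLocalization.map_units _ b
    · have h1 := congrArg (algebraMap (P.X.presheaf.stalk y) P.K) hab
      rw [map_mul] at h1
      refine Eq.trans ?_ (h1.trans ?_)
      · congr 1
        exact (Scheme.algebraMap_germ_eq_germToFunctionField P.X hy b.1).symm
      · exact Scheme.algebraMap_germ_eq_germToFunctionField P.X hy a
  · intro q hq
    obtain ⟨q', hq'⟩ : ∃ q' : PrimeSpectrum Γ(P.X, W),
        q'.asIdeal = q.comap (P.X.germToFunctionField W).hom.rangeRestrict := ⟨⟨_, hq.comap _⟩, rfl⟩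
    have hmem : hW.fromSpec q' ∈ W := by
      have h1 : hW.fromSpec q' ∈ Set.range hW.fromSpec := ⟨q', rfl⟩
      rwa [hW.range_fromSpec] at h1
    refine ⟨hW.fromSpec q', hmem, ?_⟩
    rintro ⟨_, a, rfl⟩
    have hloc := hW.isLocalization_stalk' q' hmem
    have : q'.asIdeal.IsPrime := q'.isPrime
    have h1 := @IsLocalization.AtPrime.isUnit_to_map_iff _ _ _ _
      (TopCat.Presheaf.algebra_section_stalk P.X.presheaf ⟨hW.fromSpec q', hmem⟩) q'.asIdeal _ hloc a
    refine (germToFunctionField_mem_maxIdeal hmem a).trans ?_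
    rw [Scheme.mem_basicOpen P.X a _ hmem]
    refine (not_congr h1).trans ?_
    rw [Ideal.mem_primeCompl_iff, not_not, hq']
    rfl
  · intro Z hZ y hy hyZ
    obtain ⟨a, ha, hya⟩ := hW.exists_basicOpen_le (V := ⟨Zᶜ, hZ.isOpen_compl⟩) ⟨y, hyZ⟩ hy
    refine ⟨_, ⟨a, rfl⟩, (germToFunctionField_mem_maxIdeal hy a).not.2 (not_not.2 hya),
      fun z hz hzZ => (germToFunctionField_mem_maxIdeal hz a).2 fun h => ha h hzZ⟩
  · rintro _ ⟨a, rfl⟩ y hy hya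
    refine ⟨P.X.basicOpen a, not_not.1 ((germToFunctionField_mem_maxIdeal hy a).not.1 hya),
      P.X.basicOpen_le a, fun z hz h => ?_⟩
    exact (germToFunctionField_mem_maxIdeal (P.X.basicOpen_le a hz) a).1 h hz

end CompactifiedPair

end KontsevichLog

/-! ### Local rings of the variety: generizations, normality, coordinates. -/

namespace KontsevichLog

open CategoryTheory AlgebraicGeometry TopologicalSpace Opposite
open KahlerForms

namespace CompactifiedPair

variable {P : CompactifiedPair}

lemma mem_maxIdeal_iff {x : P.X} {g : P.K} (h0 : g ≠ 0) :
    g ∈ P.maxIdeal x ↔ g ∈ P.localRing x ∧ g⁻¹ ∉ P.localRing x := by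
  refine ⟨fun h => ⟨mem_localRing_of_mem_maxIdeal h, fun h' => ?_⟩, fun h => ?_⟩
  · have h1 := (coe_mem_maxIdeal ⟨g, mem_localRing_of_mem_maxIdeal h⟩).1 h
    refine (IsLocalRing.mem_maximalIdeal _).1 h1 (IsUnit.of_mul_eq_one ⟨g⁻¹, h'⟩ ?_)
    exact Subtype.ext (mul_inv_cancel₀ h0)
  · by_contra h'
    exact h.2 (inv_mem_localRing h.1 h')

lemma zero_mem_maxIdeal (x : P.X) : (0 : P.K) ∈ P.maxIdeal x :=
  (coe_mem_maxIdeal (0 : P.localRing x)).2 (zero_mem _)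

lemma mul_mem_maxIdeal_iff {x : P.X} {a b : P.K} (ha : a ∈ P.localRing x) (hb : b ∈ P.localRing x) :
    a * b ∈ P.maxIdeal x ↔ a ∈ P.maxIdeal x ∨ b ∈ P.maxIdeal x := by
  have := Ideal.IsPrime.mul_mem_iff_mem_or_mem
    (I := IsLocalRing.maximalIdeal (P.localRing x)) (x := ⟨a, ha⟩) (y := ⟨b, hb⟩)
  rw [← coe_mem_maxIdeal, ← coe_mem_maxIdeal, ← coe_mem_maxIdeal] at this
  exact this inferInstance

/-- A regular germ is regular in a neighbourhood. -/
lemma exists_opens_mem_localRing {x : P.X} {g : P.K} (hg : g ∈ P.localRing x) :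
    ∃ V : P.X.Opens, x ∈ V ∧ ∀ y ∈ V, g ∈ P.localRing y := by
  obtain ⟨W, S, hx, hM⟩ := P.exists_isAffineModel x
  obtain ⟨a, ha, b, hb, hbx, hab⟩ := hM.exists_eq x hx g hg
  obtain ⟨V, hxV, hVW, hV⟩ := hM.exists_opens b hb x hx hbx
  refine ⟨V, hxV, fun y hy => ?_⟩
  have hb0 : b ≠ 0 := fun h => hbx (h ▸ zero_mem_maxIdeal x)
  rw [(eq_mul_inv_iff_mul_eq₀ hb0).2 hab]
  exact mul_mem (hM.le y (hVW hy) ha) (inv_mem_localRing (hM.le y (hVW hy) hb) (hV y hy))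

lemma localRing_mono {η x : P.X} (h : η ⤳ x) : P.localRing x ≤ P.localRing η := by
  intro g hg
  obtain ⟨V, hxV, hV⟩ := exists_opens_mem_localRing hg
  exact hV η (h.mem_open V.isOpen hxV)

lemma mem_maxIdeal_of_specializes {η x : P.X} (h : η ⤳ x) {g : P.K} (hg : g ∈ P.localRing x)
    (h' : g ∈ P.maxIdeal η) : g ∈ P.maxIdeal x := by
  by_cases h0 : g = 0
  · rw [h0]; exact zero_mem_maxIdeal x
  · exact (mem_maxIdeal_iff h0).2 ⟨hg, fun h1 => ((mem_maxIdeal_iff h0).1 h').2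
      (localRing_mono h h1)⟩

/-- The prime ideal of the local ring at `x` defined by a generization. -/
def primeOf {η x : P.X} (h : η ⤳ x) : Ideal (P.localRing x) :=
  (IsLocalRing.maximalIdeal (P.localRing η)).comap (Subalgebra.inclusion (localRing_mono h))

lemma mem_primeOf {η x : P.X} (h : η ⤳ x) (a : P.localRing x) :
    a ∈ primeOf h ↔ (a : P.K) ∈ P.maxIdeal η :=
  (coe_mem_maxIdeal (Subalgebra.inclusion (localRing_mono h) a)).symm

instance {η x : P.X} (h : η ⤳ x) : (primeOf h).IsPrime :=
  inferInstanceAs ((IsLocalRing.maximalIdeal (P.localRing η)).comap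
    (Subalgebra.inclusion (localRing_mono h))).IsPrime

lemma exists_fraction {η x : P.X} (h : η ⤳ x) {g : P.K} (hg : g ∈ P.localRing η) :
    ∃ a b : P.localRing x, b ∉ primeOf h ∧ g * b = a := by
  obtain ⟨W, S, hx, hM⟩ := P.exists_isAffineModel x
  obtain ⟨a, ha, b, hb, hbx, hab⟩ := hM.exists_eq η (h.mem_open W.isOpen hx) g hg
  exact ⟨⟨a, hM.le x hx ha⟩, ⟨b, hM.le x hx hb⟩, fun h' => hbx ((mem_primeOf h _).1 h'), hab⟩

/-- The contraction to an affine model is the prime of a point `y`, which specializes to `x` because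
functions separate `x` from closed sets avoiding it. -/
lemma exists_primeOf_eq {x : P.X} (p : Ideal (P.localRing x)) [hp : p.IsPrime] :
    ∃ (η : P.X) (h : η ⤳ x), p = primeOf h := by
  obtain ⟨W, S, hx, hM⟩ := P.exists_isAffineModel x
  obtain ⟨y, hy, hyq⟩ := hM.exists_point (p.comap (Subalgebra.inclusion (hM.le x hx))) (hp.comap _)
  have h : y ⤳ x := by
    rw [specializes_iff_mem_closure]
    by_contra hcon
    obtain ⟨a, ha, hax, hay⟩ := hM.exists_notMem _ isClosed_closure x hx hcon
    have h1 := (hyq ⟨a, ha⟩).1 (hay y hy (subset_closure rfl))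
    exact hax ((coe_mem_maxIdeal ⟨a, hM.le x hx ha⟩).2 (IsLocalRing.le_maximalIdeal hp.ne_top h1))
  refine ⟨y, h, ?_⟩
  ext g
  rw [mem_primeOf]
  obtain ⟨a, ha, b, hb, hbx, hab⟩ := hM.exists_eq x hx g g.2
  have hby : b ∉ P.maxIdeal y := fun h' => hbx (mem_maxIdeal_of_specializes h (hM.le x hx hb) h')
  have h1 : (g : P.K) ∈ P.maxIdeal y ↔ a ∈ P.maxIdeal y := by
    rw [← hab, mul_mem_maxIdeal_iff (localRing_mono h g.2) (hM.le y hy hb)]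
    simp [hby]
  have h2 : g * ⟨b, hM.le x hx hb⟩ = (⟨a, hM.le x hx ha⟩ : P.localRing x) := Subtype.ext hab
  rw [h1, hyq ⟨a, ha⟩]
  change g ∈ p ↔ (⟨a, hM.le x hx ha⟩ : P.localRing x) ∈ p
  rw [← h2, hp.mul_mem_iff_mem_or_mem]
  refine ⟨Or.inl, fun h3 => h3.resolve_right fun h4 => hbx ?_⟩
  exact (coe_mem_maxIdeal ⟨b, hM.le x hx hb⟩).2 (IsLocalRing.le_maximalIdeal hp.ne_top h4)

lemma isLocalization_primeOf {η x : P.X} (h : η ⤳ x) :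
    let _ := (Subalgebra.inclusion (localRing_mono h)).toRingHom.toAlgebra
    IsLocalization.AtPrime (P.localRing η) (primeOf h) := by
  intro alg
  refine ⟨?_, ?_, ?_⟩
  · rintro ⟨b, hb⟩
    by_contra hcon
    exact hb hcon
  · rintro ⟨g, hg⟩
    obtain ⟨a, b, hb, hab⟩ := exists_fraction h hg
    exact ⟨⟨a, ⟨b, hb⟩⟩, Subtype.ext hab⟩
  · intro a b hab
    refine ⟨1, ?_⟩
    have := congrArg Subtype.val hab
    rw [Subtype.ext (a1 := a) (a2 := b) this]

/-- The local ring at `η` is the localization at this prime, and its dimension is the codimension of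
the point. -/
lemma height_primeOf {η x : P.X} (h : η ⤳ x) :
    ((primeOf h).height : WithBot ℕ∞) = Order.coheight η := by
  let _ := (Subalgebra.inclusion (localRing_mono h)).toRingHom.toAlgebra
  have hloc : IsLocalization.AtPrime (P.localRing η) (primeOf h) := isLocalization_primeOf h
  rw [← IsLocalization.AtPrime.ringKrullDim_eq_height (primeOf h) (P.localRing η),
    ← ringKrullDim_stalk_eq_coheight η]
  exact (ringKrullDim_eq_of_ringEquiv (P.stalkEquiv η)).symm

lemma height_primeOf_eq_one_iff {η x : P.X} (h : η ⤳ x) :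
    (primeOf h).height = 1 ↔ Order.coheight η = 1 := by
  have := height_primeOf h
  rw [WithBot.coe_inj] at this
  rw [this]

lemma IsAffineModel.isLocalization {W : P.X.Opens} {S : Subalgebra ℂ P.K} (hM : IsAffineModel W S)
    {y : P.X} (hy : y ∈ W) :
    let _ := (Subalgebra.inclusion (hM.le y hy)).toRingHom.toAlgebra
    IsLocalization.AtPrime (P.localRing y) ((IsLocalRing.maximalIdeal (P.localRing y)).comap
      (Subalgebra.inclusion (hM.le y hy))) := by
  intro alg
  refine ⟨?_, ?_, ?_⟩
  · rintro ⟨b, hb⟩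
    by_contra hcon
    exact hb hcon
  · rintro ⟨g, hg⟩
    obtain ⟨a, ha, b, hb, hby, hab⟩ := hM.exists_eq y hy g hg
    exact ⟨⟨⟨a, ha⟩, ⟨⟨b, hb⟩, fun h => hby ((coe_mem_maxIdeal ⟨b, hM.le y hy hb⟩).2 h)⟩⟩,
      Subtype.ext hab⟩
  · intro a b hab
    refine ⟨1, ?_⟩
    have := congrArg Subtype.val hab
    rw [Subtype.ext (a1 := a) (a2 := b) this]

instance (x : P.X) : IsIntegrallyClosed (P.localRing x) := by
  obtain ⟨W, S, hx, hM⟩ := P.exists_isAffineModel x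
  let _ := (Subalgebra.inclusion (hM.le x hx)).toRingHom.toAlgebra
  have := hM.isLocalization hx
  have := hM.smooth
  have := Algebra.IsStandardSmoothOfRelativeDimension.isStandardSmooth P.dim (R := ℂ) (S := S)
  exact NormalDomain.isIntegrallyClosed_localization_of_smooth S
    ((IsLocalRing.maximalIdeal (P.localRing x)).comap (Subalgebra.inclusion (hM.le x hx))) _

instance (x : P.X) : Algebra.EssFiniteType ℂ (P.localRing x) := by
  obtain ⟨W, S, hx, hM⟩ := P.exists_isAffineModel x
  let _ := (Subalgebra.inclusion (hM.le x hx)).toRingHom.toAlgebra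
  have := hM.isLocalization hx
  have := hM.smooth
  have := Algebra.IsStandardSmoothOfRelativeDimension.isStandardSmooth P.dim (R := ℂ) (S := S)
  have : IsScalarTower ℂ S (P.localRing x) := IsScalarTower.of_algebraMap_eq' rfl
  have : Algebra.EssFiniteType S (P.localRing x) := Algebra.EssFiniteType.of_isLocalization _
    ((IsLocalRing.maximalIdeal (P.localRing x)).comap
      (Subalgebra.inclusion (hM.le x hx))).primeCompl
  exact Algebra.EssFiniteType.comp ℂ S (P.localRing x)

lemma isDiscreteValuationRing {η : P.X} (h : Order.coheight η = 1) :
    IsDiscreteValuationRing (P.localRing η) := by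
  refine NormalDomain.isDiscreteValuationRing_of_height_one _ ?_
  rw [← WithBot.coe_inj, IsLocalRing.maximalIdeal_height_eq_ringKrullDim,
    ← ringKrullDim_eq_of_ringEquiv (P.stalkEquiv η), ringKrullDim_stalk_eq_coheight η, h]

/-- Coordinates near `x`: a basis of the rational `1`-forms that is a basis of the regular
`1`-forms at every point of a neighbourhood. -/
def IsCoordinates (v : Module.Basis (Fin P.dim) P.K (Ω[P.K⁄ℂ])) (y : P.X) : Prop :=
  ∃ b : Module.Basis (Fin P.dim) (P.localRing y) (Ω[P.localRing y⁄ℂ]),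
    ∀ i, KaehlerDifferential.map ℂ ℂ (P.localRing y) P.K (b i) = v i

/-- A basis of the differentials of an affine model serves for all its points and for the function
field at once, since localizations are formally étale. -/
lemma exists_isCoordinates (x : P.X) : ∃ (W : P.X.Opens) (v : Module.Basis (Fin P.dim) P.K (Ω[P.K⁄ℂ])),
    x ∈ W ∧ ∀ y ∈ W, IsCoordinates v y := by
  obtain ⟨W, S, hx, hM⟩ := P.exists_isAffineModel x
  have := hM.smooth
  have := Algebra.IsStandardSmoothOfRelativeDimension.isStandardSmooth P.dim (R := ℂ) (S := S)
  have hfr : Module.finrank S (Ω[S⁄ℂ]) = P.dim := by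
    rw [Module.finrank,
      Algebra.IsStandardSmoothOfRelativeDimension.rank_kaehlerDifferential (R := ℂ) (S := S) P.dim]
    simp
  let b₀ : Module.Basis (Fin P.dim) S (Ω[S⁄ℂ]) := Module.finBasisOfFinrankEq S (Ω[S⁄ℂ]) hfr
  have hbase : ∀ (T : Type) [CommRing T] [Algebra S T] [Algebra ℂ T] [IsScalarTower ℂ S T]
      [Algebra.FormallyEtale S T], ∃ b : Module.Basis (Fin P.dim) T (Ω[T⁄ℂ]),
      ∀ i, b i = KaehlerDifferential.map ℂ ℂ S T (b₀ i) := by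
    intro T _ _ _ _ _
    refine ⟨(Algebra.TensorProduct.basis T b₀).map
      (KaehlerDifferential.tensorKaehlerEquivOfFormallyEtale ℂ S T), fun i => ?_⟩
    simp
  have : IsFractionRing S P.K := by
    refine IsFractionRing.of_field _ _ fun z => ?_
    obtain ⟨a, b, hab⟩ := IsFractionRing.div_surjective (A := P.localRing x) z
    obtain ⟨a₁, h1, a₂, h2, h3, h4⟩ := hM.exists_eq x hx a a.2
    obtain ⟨b₁, h5, b₂, h6, h7, h8⟩ := hM.exists_eq x hx b b.2
    refine ⟨⟨a₁, h1⟩ * ⟨b₂, h6⟩, ⟨a₂, h2⟩ * ⟨b₁, h5⟩, ?_⟩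
    have ha2 : a₂ ≠ 0 := fun h => h3 (h ▸ zero_mem_maxIdeal x)
    have hb2 : b₂ ≠ 0 := fun h => h7 (h ▸ zero_mem_maxIdeal x)
    rw [← hab.2]
    change (a : P.K) / b = (a₁ * b₂) / (a₂ * b₁)
    rw [← h4, ← h8]
    field_simp
  have : Algebra.FormallyEtale S P.K := Algebra.FormallyEtale.of_isLocalization (nonZeroDivisors S)
  obtain ⟨v, hv⟩ := hbase P.K
  refine ⟨W, v, hx, fun y hy => ?_⟩
  let _ := (Subalgebra.inclusion (hM.le y hy)).toRingHom.toAlgebra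
  have := hM.isLocalization hy
  have : IsScalarTower ℂ S (P.localRing y) := IsScalarTower.of_algebraMap_eq' rfl
  have : IsScalarTower S (P.localRing y) P.K := IsScalarTower.of_algebraMap_eq' rfl
  have : Algebra.FormallyEtale S (P.localRing y) := Algebra.FormallyEtale.of_isLocalization
    ((IsLocalRing.maximalIdeal (P.localRing y)).comap
      (Subalgebra.inclusion (hM.le y hy))).primeCompl
  obtain ⟨b, hb⟩ := hbase (P.localRing y)
  refine ⟨b, fun i => ?_⟩
  rw [hb, hv]
  generalize b₀ i = w
  have hw : w ∈ Submodule.span S (Set.range (KaehlerDifferential.D ℂ S)) := by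
    rw [KaehlerDifferential.span_range_derivation]; trivial
  induction hw using Submodule.span_induction with
  | mem w h =>
    obtain ⟨a, rfl⟩ := h
    simp only [KaehlerDifferential.map_D]
    rw [IsScalarTower.algebraMap_apply S (P.localRing y) P.K]
  | zero => simp
  | add u v _ _ hu hv => simp only [map_add, hu, hv]
  | smul c u _ hu =>
    rw [map_smul, ← algebraMap_smul (P.localRing y) c
      (KaehlerDifferential.map ℂ ℂ S (P.localRing y) u), map_smul, hu, map_smul]
    rfl

end CompactifiedPair

end KontsevichLog

/-! ### Regular hypersurfaces. -/

namespace NormalDomain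

open IsLocalRing in
/-- The equation of a regular divisor is part of a regular system of parameters. -/
lemma notMem_sq_of_isRegularLocalRing {A : Type} [CommRing A] [IsDomain A] [IsLocalRing A]
    [IsNoetherianRing A] {z : A} (hz : z ≠ 0) (hm : z ∈ maximalIdeal A)
    [hreg : IsRegularLocalRing (A ⧸ Ideal.span {z})] : z ∉ maximalIdeal A ^ 2 := by
  intro h2
  have hdim : ringKrullDim (A ⧸ Ideal.span {z}) + 1 = ringKrullDim A :=
    ringKrullDim_quotient_span_singleton_succ_eq_ringKrullDim_of_mem_nonZeroDivisors
      (mem_nonZeroDivisors_of_ne_zero hz) hm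
  obtain ⟨T, hT, hspan⟩ := Submodule.FG.exists_span_finset_card_eq_spanFinrank
    (IsNoetherian.noetherian (maximalIdeal (A ⧸ Ideal.span {z})))
  choose r hr using Ideal.Quotient.mk_surjective (I := Ideal.span {z})
  classical
  have hmap : (maximalIdeal (A ⧸ Ideal.span {z})).comap (Ideal.Quotient.mk (Ideal.span {z})) =
      maximalIdeal A := by
    have : (maximalIdeal (A ⧸ Ideal.span {z})).comap (Ideal.Quotient.mk (Ideal.span {z})) ≠ ⊤ :=
      Ideal.IsPrime.ne_top inferInstance
    refine le_antisymm (le_maximalIdeal this) fun a ha => ?_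
    rw [Ideal.mem_comap, mem_maximalIdeal]
    rintro hu
    obtain ⟨b, hb⟩ := hu.exists_right_inv
    obtain ⟨b, rfl⟩ := Ideal.Quotient.mk_surjective b
    rw [← map_mul, ← map_one (Ideal.Quotient.mk _), Ideal.Quotient.mk_eq_mk_iff_sub_mem] at hb
    have h3 := (Ideal.span_singleton_le_iff_mem _).2 hm hb
    have h4 := sub_mem (Ideal.mul_mem_right b _ ha) h3
    rw [sub_sub_cancel] at h4
    exact (mem_maximalIdeal _).1 h4 isUnit_one
  -- If `z ∈ 𝔪²`, lifts of generators of the maximal ideal modulo `z` generate `𝔪` modulo `𝔪²`,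
  -- hence `𝔪` by Nakayama.
  have hle : maximalIdeal A ≤ Ideal.span (r '' T) ⊔ maximalIdeal A • maximalIdeal A := by
    intro a ha
    have h3 : Ideal.Quotient.mk (Ideal.span {z}) a ∈
        Submodule.span (A ⧸ Ideal.span {z}) (T : Set (A ⧸ Ideal.span {z})) := by
      rw [hspan, ← Ideal.mem_comap, hmap]; exact ha
    have h4 : Submodule.span (A ⧸ Ideal.span {z}) (T : Set (A ⧸ Ideal.span {z})) =
        (Ideal.span (r '' T)).map (Ideal.Quotient.mk (Ideal.span {z})) := by
      rw [Ideal.map_span, ← Set.image_comp]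
      congr 1
      ext y
      simp [hr]
    rw [h4, ← Ideal.mem_comap, Ideal.comap_map_of_surjective _ Ideal.Quotient.mk_surjective,
      ← RingHom.ker_eq_comap_bot, Ideal.mk_ker] at h3
    refine (sup_le_sup_left ?_ (Ideal.span (r '' T)) :
      Ideal.span (r '' T) ⊔ Ideal.span {z} ≤ _) h3
    rw [Ideal.span_singleton_le_iff_mem, smul_eq_mul, ← sq]
    exact h2
  have h3 : maximalIdeal A ≤ Ideal.span (r '' T) :=
    Submodule.le_of_le_smul_of_le_jacobson_bot (IsNoetherian.noetherian _)
      (maximalIdeal_le_jacobson _) hle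
  have h4 : Ideal.span (r '' T) = maximalIdeal A := by
    refine le_antisymm (Ideal.span_le.2 ?_) h3
    rintro _ ⟨y, hy, rfl⟩
    change r y ∈ maximalIdeal A
    rw [← hmap, Ideal.mem_comap, hr, ← hspan]
    exact Submodule.subset_span hy
  -- So `A` needs no more generators than its regular quotient, whose dimension is one less than
  -- that of `A`; this contradicts that the dimension is at most the number of generators.
  have h5 : (maximalIdeal A).spanFinrank ≤ (maximalIdeal (A ⧸ Ideal.span {z})).spanFinrank := by
    have h6 : Submodule.spanFinrank (Ideal.span (r '' T)) ≤ (r '' T).ncard :=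
      Submodule.spanFinrank_span_le_ncard_of_finite (T.finite_toSet.image r)
    rw [h4] at h6
    refine h6.trans ((Set.ncard_image_le T.finite_toSet).trans ?_)
    rw [Set.ncard_coe_finset, hT]
  have h6 := ringKrullDim_le_spanFinrank_maximalIdeal A
  rw [← hdim, ← hreg.spanFinrank_maximalIdeal] at h6
  have h7 : (maximalIdeal (A ⧸ Ideal.span {z})).spanFinrank + 1 ≤ (maximalIdeal A).spanFinrank := by
    exact_mod_cast h6
  omega

end NormalDomain

/-! ### Orders of rational functions at points of codimension one. -/

namespace KontsevichLog

open CategoryTheory AlgebraicGeometry TopologicalSpace Opposite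
open KahlerForms

namespace CompactifiedPair

variable {P : CompactifiedPair}

/-- The order of vanishing of a rational function at a point of codimension one. -/
abbrev ord (g : P.K) (η : P.X) : ℤ := Scheme.ord g η

lemma isDiscreteValuationRing_stalk {η : P.X} (h1 : Order.coheight η = 1) :
    IsDiscreteValuationRing (P.X.presheaf.stalk η) :=
  have := isDiscreteValuationRing h1
  IsDiscreteValuationRing.RingEquivClass.isDiscreteValuationRing (P.stalkEquiv η).symm

lemma ord_nonneg_of_mem {η : P.X} (h1 : Order.coheight η = 1) {g : P.K} (hg : g ∈ P.localRing η) : 0 ≤ ord g η := by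
  by_cases h0 : g = 0
  · rw [h0]; exact (congrFun Scheme.ord_zero η).ge
  have := isDiscreteValuationRing_stalk h1
  obtain ⟨a, rfl⟩ := hg
  rw [Scheme.le_ord_iff h1 h0, ofAdd_zero, WithZero.coe_one]
  exact Ring.ordFrac_ge_one_of_ne_zero fun h => h0 (by rw [h]; exact map_zero _)

lemma ord_inv {g : P.K} (η : P.X) : ord g⁻¹ η = -ord g η := by
  by_cases h0 : g = 0
  · rw [h0, inv_zero, ord, congrFun Scheme.ord_zero η]; rfl
  have := Scheme.ord_mul (x := η) h0 (inv_ne_zero h0)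
  rw [mul_inv_cancel₀ h0] at this
  have h2 := Scheme.ord_mul (x := η) (one_ne_zero (α := P.K)) one_ne_zero
  rw [mul_one] at h2
  have h3 : Scheme.ord (1 : P.K) η = 0 := by omega
  rw [h3] at this
  exact (neg_eq_of_add_eq_zero_right this.symm).symm

lemma ord_pos_of_mem {η : P.X} (h1 : Order.coheight η = 1) {g : P.K} (h0 : g ≠ 0) (hg : g ∈ P.maxIdeal η) : 0 < ord g η := by
  refine lt_of_le_of_ne (ord_nonneg_of_mem h1 (mem_localRing_of_mem_maxIdeal hg)) fun h => ?_
  have := isDiscreteValuationRing_stalk h1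
  obtain ⟨a, ha, rfl⟩ := hg
  refine (IsLocalRing.mem_maximalIdeal a).1 ha ?_
  rw [Ring.isUnit_iff_ordFrac_one_of_isDiscreteValuationRing (K := P.K)]
  rw [eq_comm, Scheme.ord_eq_iff h1 h0] at h
  exact h

lemma mem_localRing_iff_ord {η : P.X} (h1 : Order.coheight η = 1) {g : P.K} (h0 : g ≠ 0) : g ∈ P.localRing η ↔ 0 ≤ ord g η := by
  refine ⟨ord_nonneg_of_mem h1, fun h => ?_⟩
  by_contra hg
  have := isDiscreteValuationRing h1
  rcases ValuationRing.isInteger_or_isInteger (P.localRing η) g with ⟨a, rfl⟩ | ⟨a, ha⟩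
  · exact hg a.2
  · have h2 : g⁻¹ ∈ P.maxIdeal η :=
      (mem_maxIdeal_iff (inv_ne_zero h0)).2 ⟨ha ▸ a.2, by rwa [inv_inv]⟩
    have h3 := ord_pos_of_mem h1 (inv_ne_zero h0) h2
    rw [ord_inv] at h3
    omega

lemma mem_maxIdeal_iff_ord {η : P.X} (h1 : Order.coheight η = 1) {g : P.K} (h0 : g ≠ 0) : g ∈ P.maxIdeal η ↔ 0 < ord g η := by
  rw [mem_maxIdeal_iff h0, mem_localRing_iff_ord h1 h0, mem_localRing_iff_ord h1 (inv_ne_zero h0),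
    ord_inv]
  omega

lemma ord_eq_zero_iff {η : P.X} (h1 : Order.coheight η = 1) {g : P.K} (h0 : g ≠ 0) :
    ord g η = 0 ↔ g ∈ P.localRing η ∧ g ∉ P.maxIdeal η := by
  rw [mem_localRing_iff_ord h1 h0, mem_maxIdeal_iff_ord h1 h0]
  omega

lemma exists_ord_eq_one {η : P.X} (h1 : Order.coheight η = 1) : ∃ π : P.K, π ≠ 0 ∧ π ∈ P.maxIdeal η ∧ ord π η = 1 := by
  have := isDiscreteValuationRing_stalk h1
  obtain ⟨π, hπ⟩ := IsDiscreteValuationRing.exists_irreducible (P.X.presheaf.stalk η)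
  have h0 : algebraMap (P.X.presheaf.stalk η) P.K π ≠ 0 := by
    rw [Ne, IsFractionRing.to_map_eq_zero_iff]; exact hπ.ne_zero
  have h2 : ord (algebraMap (P.X.presheaf.stalk η) P.K π) η = 1 := by
    rw [Scheme.ord_eq_iff h1 h0]
    exact Ring.ordFrac_irreducible hπ
  exact ⟨_, h0, (mem_maxIdeal_iff_ord h1 h0).2 (by rw [h2]; exact one_pos), h2⟩

lemma ord_one (η : P.X) : ord (1 : P.K) η = 0 := by
  have h2 := Scheme.ord_mul (x := η) (one_ne_zero (α := P.K)) one_ne_zero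
  rw [mul_one] at h2
  change Scheme.ord (1 : P.K) η = 0
  omega

lemma ord_div {a b : P.K} (ha : a ≠ 0) (hb : b ≠ 0) (η : P.X) :
    ord (a / b) η = ord a η - ord b η := by
  rw [div_eq_mul_inv, ord, Scheme.ord_mul ha (inv_ne_zero hb), sub_eq_add_neg, ← ord_inv]

lemma ord_prod {ι : Type} (T : Finset ι) {g : ι → P.K} (hg : ∀ i ∈ T, g i ≠ 0) (η : P.X) :
    ord (∏ i ∈ T, g i) η = ∑ i ∈ T, ord (g i) η := by
  classical
  induction T using Finset.induction_on with
  | empty => simp [ord_one]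
  | insert j T hj ih =>
    have h2 := fun i hi => hg i (Finset.mem_insert_of_mem hi)
    rw [Finset.prod_insert hj, Finset.sum_insert hj, ← ih h2]
    exact Scheme.ord_mul (hg j (Finset.mem_insert_self j T)) (Finset.prod_ne_zero_iff.2 h2)

lemma ord_zpow {g : P.K} (hg : g ≠ 0) (k : ℤ) (η : P.X) : ord (g ^ k) η = k * ord g η := by
  induction k using Int.induction_on with
  | zero => simp [ord_one]
  | succ k ih =>
    rw [zpow_add_one₀ hg, ord, Scheme.ord_mul (zpow_ne_zero _ hg) hg, ← ord, ih]
    ring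
  | pred k ih =>
    rw [zpow_sub_one₀ hg, ord, Scheme.ord_mul (zpow_ne_zero _ hg) (inv_ne_zero hg), ← ord, ih,
      ← ord, ord_inv]
    ring

/-- A rational function without poles through `x` is regular at `x`. -/
lemma mem_localRing_of_forall {x : P.X} {g : P.K}
    (h : ∀ η : P.X, Order.coheight η = 1 → η ⤳ x → g ∈ P.localRing η) : g ∈ P.localRing x := by
  obtain ⟨a, b, hb, hab⟩ := IsFractionRing.div_surjective (A := P.localRing x) g
  have hb0 : b ≠ 0 := nonZeroDivisors.ne_zero hb
  have hb0' : (b : P.K) ≠ 0 := fun h => hb0 (Subtype.ext h)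
  have h2 : g * b = a := by
    rw [← hab]
    exact div_mul_cancel₀ _ hb0'
  obtain ⟨c, hc⟩ : b ∣ a := by
    refine NormalDomain.dvd_of_forall_height_one hb0 fun p hp h1 => ?_
    obtain ⟨η, hη, rfl⟩ := exists_primeOf_eq p
    obtain ⟨c, d, hd, hcd⟩ := exists_fraction hη
      (h η ((height_primeOf_eq_one_iff hη).1 h1) hη)
    refine ⟨d, hd, c, Subtype.ext ?_⟩
    change (d : P.K) * a = b * c
    rw [← h2, ← hcd]
    ring
  have h3 : g = c := by
    refine mul_right_cancel₀ hb0' (h2.trans ?_)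
    rw [hc, mul_comm]
    rfl
  rw [h3]
  exact c.2

lemma mem_localRing_iff_forall_ord {x : P.X} {g : P.K} (h0 : g ≠ 0) :
    g ∈ P.localRing x ↔ ∀ η : P.X, Order.coheight η = 1 → η ⤳ x → 0 ≤ ord g η :=
  ⟨fun h _ h1 hη => ord_nonneg_of_mem h1 (localRing_mono hη h),
    fun h => mem_localRing_of_forall fun η h1 hη => (mem_localRing_iff_ord h1 h0).2 (h η h1 hη)⟩

/-- In an affine model the zeros of codimension one correspond to height one primes containing `a`;
injectivity holds since functions separate a point from the closure of another one. -/
lemma finite_zeros {W : P.X.Opens} {S : Subalgebra ℂ P.K} (hM : IsAffineModel W S)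
    {a : P.K} (ha : a ∈ S) (h0 : a ≠ 0) :
    {η : P.X | Order.coheight η = 1 ∧ η ∈ W ∧ a ∈ P.maxIdeal η}.Finite := by
  have := hM.smooth
  have := Algebra.IsStandardSmoothOfRelativeDimension.isStandardSmooth P.dim (R := ℂ) (S := S)
  have : IsNoetherianRing S := Algebra.FiniteType.isNoetherianRing ℂ S
  classical
  let q : P.X → Ideal S := fun η => if hη : η ∈ W then
    (IsLocalRing.maximalIdeal (P.localRing η)).comap (Subalgebra.inclusion (hM.le η hη)) else ⊥
  have hq : ∀ η (hη : η ∈ W) (b : S), b ∈ q η ↔ (b : P.K) ∈ P.maxIdeal η := by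
    intro η hη b
    simp only [q, dif_pos hη]
    exact (coe_mem_maxIdeal (Subalgebra.inclusion (hM.le η hη) b)).symm
  refine Set.Finite.of_finite_image (f := q) ((NormalDomain.finite_height_one (A := S)
    (a := ⟨a, ha⟩) fun h => h0 (congrArg Subtype.val h)).subset ?_) ?_
  · rintro _ ⟨η, ⟨h1, hη, haη⟩, rfl⟩
    refine ⟨?_, ?_, (hq η hη _).2 haη⟩
    · simp only [q, dif_pos hη]
      infer_instance
    · simp only [q, dif_pos hη]
      let _ := (Subalgebra.inclusion (hM.le η hη)).toRingHom.toAlgebra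
      have := hM.isLocalization hη
      rw [← WithBot.coe_inj, ← IsLocalization.AtPrime.ringKrullDim_eq_height _ (P.localRing η),
        ← ringKrullDim_eq_of_ringEquiv (P.stalkEquiv η), ringKrullDim_stalk_eq_coheight η, h1]
  · have key : ∀ η ∈ W, ∀ ζ ∈ W, q η = q ζ → η ⤳ ζ := by
      intro η hη ζ hζ h
      rw [specializes_iff_mem_closure]
      by_contra hcon
      obtain ⟨b, hb, hbζ, hbη⟩ := hM.exists_notMem _ isClosed_closure ζ hζ hcon
      exact hbζ ((hq ζ hζ ⟨b, hb⟩).1 (h ▸ (hq η hη ⟨b, hb⟩).2 (hbη η hη (subset_closure rfl))))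
    rintro η ⟨-, hη, -⟩ ζ ⟨-, hζ, -⟩ h
    exact (key η hη ζ hζ h).antisymm (key ζ hζ η hη h.symm) |>.eq

/-- Near `x`, the zeros and poles of a rational function pass through `x`. -/
lemma exists_opens_specializes_of_finite {x : P.X} {Z : Set P.X} (hZ : Z.Finite) :
    ∃ V : P.X.Opens, x ∈ V ∧ ∀ y ∈ V, ∀ η ∈ Z, η ⤳ y → η ⤳ x := by
  have hfin : {η ∈ Z | ¬ η ⤳ x}.Finite := hZ.subset fun η h => h.1
  have hcl : IsClosed (⋃ η ∈ {η ∈ Z | ¬ η ⤳ x}, closure {η}) :=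
    hfin.isClosed_biUnion fun _ _ => isClosed_closure
  refine ⟨⟨_, hcl.isOpen_compl⟩, ?_, fun y hy η hη hηy => ?_⟩
  · simp only [Opens.mem_mk, Set.mem_compl_iff, Set.mem_iUnion, not_exists]
    rintro η ⟨-, h⟩ hx
    exact h (specializes_iff_mem_closure.2 hx)
  · by_contra hcon
    exact hy (Set.mem_biUnion (x := η) ⟨hη, hcon⟩ (specializes_iff_mem_closure.1 hηy))

/-- On an affine model only finitely many prime divisors occur in the divisor of `g`; the closures
of those not passing through `x` are removed. -/
lemma exists_opens_ord {g : P.K} (h0 : g ≠ 0) (x : P.X) : ∃ V : P.X.Opens, x ∈ V ∧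
    ∀ y ∈ V, ∀ η : P.X, Order.coheight η = 1 → η ⤳ y → ord g η ≠ 0 → η ⤳ x := by
  obtain ⟨W, S, hx, hM⟩ := P.exists_isAffineModel x
  obtain ⟨g₁, g₂, hg₂, hg⟩ := IsFractionRing.div_surjective (A := P.localRing x) g
  obtain ⟨a₁, h1, a₂, h2, h3, h4⟩ := hM.exists_eq x hx g₁ g₁.2
  obtain ⟨b₁, h5, b₂, h6, h7, h8⟩ := hM.exists_eq x hx g₂ g₂.2
  have hg' : (g₁ : P.K) / g₂ = g := hg
  have hne : (g₁ : P.K) ≠ 0 ∧ (g₂ : P.K) ≠ 0 := by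
    rw [← hg'] at h0; exact div_ne_zero_iff.1 h0
  have ha2 : a₂ ≠ 0 := fun h => h3 (h ▸ zero_mem_maxIdeal x)
  have hb2 : b₂ ≠ 0 := fun h => h7 (h ▸ zero_mem_maxIdeal x)
  have ha1 : a₁ ≠ 0 := h4 ▸ mul_ne_zero hne.1 ha2
  have hb1 : b₁ ≠ 0 := h8 ▸ mul_ne_zero hne.2 hb2
  have hgeq : g = (a₁ * b₂) / (a₂ * b₁) := by
    rw [← hg', ← h4, ← h8]; field_simp
  obtain ⟨V, hxV, hV⟩ := exists_opens_specializes_of_finite (x := x)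
    (finite_zeros hM (mul_mem (mul_mem h1 h6) (mul_mem h2 h5))
      (mul_ne_zero (mul_ne_zero ha1 hb2) (mul_ne_zero ha2 hb1)))
  refine ⟨V ⊓ W, ⟨hxV, hx⟩, fun y hy η hη hηy hord => hV y hy.1 η ⟨hη, ?_, ?_⟩ hηy⟩
  · exact hηy.mem_open W.isOpen hy.2
  · have hηW : η ∈ W := hηy.mem_open W.isOpen hy.2
    by_contra hcon
    have hm1 := hM.le η hηW (mul_mem h1 h6)
    have hm2 := hM.le η hηW (mul_mem h2 h5)
    rw [mul_mem_maxIdeal_iff hm1 hm2, not_or] at hcon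
    apply hord
    rw [hgeq, ord_div (mul_ne_zero ha1 hb2) (mul_ne_zero ha2 hb1),
      (ord_eq_zero_iff hη (mul_ne_zero ha1 hb2)).2 ⟨hm1, hcon.1⟩,
      (ord_eq_zero_iff hη (mul_ne_zero ha2 hb1)).2 ⟨hm2, hcon.2⟩, sub_zero]

end CompactifiedPair

end KontsevichLog

/-! ### Partial derivatives, and germs with prescribed orders. -/

namespace KontsevichLog

open CategoryTheory AlgebraicGeometry TopologicalSpace Opposite
open KahlerForms LogAlgebra

namespace CompactifiedPair

variable {P : CompactifiedPair} {v : Module.Basis (Fin P.dim) P.K (Ω[P.K⁄ℂ])}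

/-- The partial derivatives with respect to a basis of the rational `1`-forms. -/
def coordDer (v : Module.Basis (Fin P.dim) P.K (Ω[P.K⁄ℂ])) (i : Fin P.dim) : Derivation ℂ P.K P.K :=
  (v.coord i).compDer (KaehlerDifferential.D ℂ P.K)

lemma coordDer_apply (i : Fin P.dim) (a : P.K) :
    coordDer v i a = v.repr (KaehlerDifferential.D ℂ P.K a) i := rfl

lemma sum_coordDer (a : P.K) : KaehlerDifferential.D ℂ P.K a = ∑ i, coordDer v i a • v i :=
  (v.sum_repr _).symm

namespace IsCoordinates

variable {y : P.X} (hv : IsCoordinates v y)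

/-- The basis of the differentials of the local ring. -/
def basis : Module.Basis (Fin P.dim) (P.localRing y) (Ω[P.localRing y⁄ℂ]) := hv.choose

lemma map_basis (i : Fin P.dim) :
    KaehlerDifferential.map ℂ ℂ (P.localRing y) P.K (hv.basis i) = v i := hv.choose_spec i

/-- The partial derivatives of regular germs. -/
def der (i : Fin P.dim) : Derivation ℂ (P.localRing y) (P.localRing y) :=
  (hv.basis.coord i).compDer (KaehlerDifferential.D ℂ (P.localRing y))

lemma D_eq_sum (a : P.localRing y) :
    KaehlerDifferential.D ℂ (P.localRing y) a = ∑ i, hv.der i a • hv.basis i :=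
  (hv.basis.sum_repr _).symm

lemma coe_der (i : Fin P.dim) (a : P.localRing y) : (hv.der i a : P.K) = coordDer v i a := by
  have h := congrArg (KaehlerDifferential.map ℂ ℂ (P.localRing y) P.K) (hv.D_eq_sum a)
  rw [KaehlerDifferential.map_D, map_sum] at h
  have h2 : KaehlerDifferential.D ℂ P.K (a : P.K) = ∑ i, (hv.der i a : P.K) • v i := by
    refine h.trans (Finset.sum_congr rfl fun j _ => ?_)
    rw [map_smul, hv.map_basis]
    rfl
  rw [coordDer_apply, h2, v.repr_sum_self]

lemma coordDer_mem (hv : IsCoordinates v y) (i : Fin P.dim) {a : P.K} (ha : a ∈ P.localRing y) :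
    coordDer v i a ∈ P.localRing y := by
  rw [← hv.coe_der i ⟨a, ha⟩]
  exact (hv.der i ⟨a, ha⟩).2

/-- If all partial derivatives were nonunits, `da` would lie in `𝔪 Ω`, which forces `a ∈ 𝔪²`. -/
lemma exists_isUnit_der {a : P.localRing y} (ha : a ∈ IsLocalRing.maximalIdeal (P.localRing y))
    (ha2 : a ∉ IsLocalRing.maximalIdeal (P.localRing y) ^ 2) : ∃ i, IsUnit (hv.der i a) := by
  by_contra! hcon
  refine ha2 (NormalDomain.mem_sq_of_D_mem _ ha ?_)
  rw [hv.D_eq_sum]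
  exact sum_mem fun i _ => Submodule.smul_mem_smul
    ((IsLocalRing.mem_maximalIdeal _).2 (hcon i)) trivial

end IsCoordinates

lemma notMem_sq_of_ord_eq_one {η : P.X} (h1 : Order.coheight η = 1) {a : P.localRing η}
    (ha : ord (a : P.K) η = 1) : a ∉ IsLocalRing.maximalIdeal (P.localRing η) ^ 2 := by
  have key : ∀ b c : P.localRing η, b ∈ IsLocalRing.maximalIdeal (P.localRing η) →
      c ∈ IsLocalRing.maximalIdeal (P.localRing η) →
      (a : P.K)⁻¹ * b ∈ P.localRing η ∧ (a : P.K)⁻¹ * (b * c) ∈ P.maxIdeal η := by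
    intro b c hb hc
    have ha0 : (a : P.K) ≠ 0 := by
      intro h
      rw [h, ord, congrFun Scheme.ord_zero η] at ha
      exact zero_ne_one ha
    have h2 : (a : P.K)⁻¹ * b ∈ P.localRing η := by
      by_cases hb0 : (b : P.K) = 0
      · rw [hb0, mul_zero]; exact zero_mem _
      · rw [mem_localRing_iff_ord h1 (mul_ne_zero (inv_ne_zero ha0) hb0), ord,
          Scheme.ord_mul (inv_ne_zero ha0) hb0, ← ord, ← ord, ord_inv, ha]
        have := ord_pos_of_mem h1 hb0 ((coe_mem_maxIdeal b).2 hb)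
        omega
    refine ⟨h2, ?_⟩
    rw [← mul_assoc, mul_mem_maxIdeal_iff h2 c.2]
    exact Or.inr ((coe_mem_maxIdeal c).2 hc)
  intro h
  have h2 : ∀ x ∈ IsLocalRing.maximalIdeal (P.localRing η) ^ 2,
      (a : P.K)⁻¹ * x ∈ P.maxIdeal η := by
    intro x hx
    rw [sq] at hx
    induction hx using Submodule.mul_induction_on' with
    | mem_mul_mem b hb c hc => exact (key b c hb hc).2
    | add x hx y hy hx' hy' =>
      have e : (a : P.K)⁻¹ * ((x + y : P.localRing η) : P.K) =
        ((⟨_, mem_localRing_of_mem_maxIdeal hx'⟩ + ⟨_, mem_localRing_of_mem_maxIdeal hy'⟩ :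
          P.localRing η) : P.K) := mul_add _ _ _
      rw [e, coe_mem_maxIdeal]
      exact add_mem ((coe_mem_maxIdeal _).1 hx') ((coe_mem_maxIdeal _).1 hy')
  have h3 := h2 a h
  have ha0 : (a : P.K) ≠ 0 := by
    intro h
    rw [h, ord, congrFun Scheme.ord_zero η] at ha
    exact zero_ne_one ha
  rw [inv_mul_cancel₀ ha0] at h3
  exact (IsLocalRing.mem_maximalIdeal _).1 ((coe_mem_maxIdeal (1 : P.localRing η)).1 h3) isUnit_one

/-- `v` is a coordinate basis at all generizations of `x`. -/
def IsLocalCoordinates (v : Module.Basis (Fin P.dim) P.K (Ω[P.K⁄ℂ])) (x : P.X) : Prop :=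
  ∀ η, η ⤳ x → IsCoordinates v η

lemma exists_isLocalCoordinates (x : P.X) :
    ∃ (W : P.X.Opens) (v : Module.Basis (Fin P.dim) P.K (Ω[P.K⁄ℂ])),
    x ∈ W ∧ ∀ y ∈ W, IsLocalCoordinates v y := by
  obtain ⟨W, v, hx, h⟩ := exists_isCoordinates x
  exact ⟨W, v, hx, fun y hy η hη => h η (hη.mem_open W.isOpen hy)⟩

lemma IsLocalCoordinates.isCoordinates {x : P.X} (hv : IsLocalCoordinates v x) :
    IsCoordinates v x := hv x specializes_rfl

lemma IsLocalCoordinates.exists_coordDer_notMem {x η : P.X} (hv : IsLocalCoordinates v x)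
    (hη : η ⤳ x) (h1 : Order.coheight η = 1) {a : P.K} (ha : ord a η = 1) :
    ∃ i, coordDer v i a ∉ P.maxIdeal η := by
  have ha0 : a ≠ 0 := by
    rintro rfl
    rw [ord, congrFun Scheme.ord_zero η] at ha
    exact zero_ne_one ha
  have hm : a ∈ P.maxIdeal η := (mem_maxIdeal_iff_ord h1 ha0).2 (by rw [ha]; exact one_pos)
  obtain ⟨i, hi⟩ := (hv η hη).exists_isUnit_der
    (a := ⟨a, mem_localRing_of_mem_maxIdeal hm⟩) ((coe_mem_maxIdeal _).1 hm)
    (notMem_sq_of_ord_eq_one h1 ha)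
  refine ⟨i, fun h => ?_⟩
  rw [← (hv η hη).coe_der i ⟨a, mem_localRing_of_mem_maxIdeal hm⟩, coe_mem_maxIdeal] at h
  exact (IsLocalRing.mem_maximalIdeal _).1 h hi

lemma IsLocalCoordinates.isReducedDivisor {x : P.X} (hv : IsLocalCoordinates v x)
    {s : P.localRing x} (hs : (s : P.K) ≠ 0)
    (h : ∀ η, Order.coheight η = 1 → η ⤳ x → ord (s : P.K) η ≤ 1) :
    IsReducedDivisor hv.isCoordinates.der s := by
  intro p hp hp1 hsp
  obtain ⟨η, hη, rfl⟩ := exists_primeOf_eq p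
  have h1 := (height_primeOf_eq_one_iff hη).1 hp1
  have h2 := ord_pos_of_mem h1 hs ((mem_primeOf hη s).1 hsp)
  obtain ⟨i, hi⟩ := hv.exists_coordDer_notMem hη h1 (a := (s : P.K))
    (le_antisymm (h η h1 hη) (by omega))
  refine ⟨i, fun h' => hi ?_⟩
  rw [← hv.isCoordinates.coe_der]
  exact (mem_primeOf hη _).1 h'

lemma dvd_iff {x : P.X} {a b : P.localRing x} (ha : (a : P.K) ≠ 0) :
    a ∣ b ↔ (b : P.K) / a ∈ P.localRing x := by
  refine ⟨?_, fun h => ⟨⟨_, h⟩, Subtype.ext (mul_div_cancel₀ _ ha).symm⟩⟩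
  rintro ⟨c, rfl⟩
  have : ((a * c : P.localRing x) : P.K) / a = c := mul_div_cancel_left₀ _ ha
  rw [this]
  exact c.2

lemma dvd_of_forall_ord {x : P.X} {a b : P.localRing x} (ha : (a : P.K) ≠ 0) (hb : (b : P.K) ≠ 0)
    (h : ∀ η, Order.coheight η = 1 → η ⤳ x → ord (a : P.K) η ≤ ord (b : P.K) η) : a ∣ b := by
  rw [dvd_iff ha, mem_localRing_iff_forall_ord (div_ne_zero hb ha)]
  intro η h1 hη
  rw [ord_div hb ha]
  have := h η h1 hη
  omega

lemma ord_le_of_dvd {x : P.X} {a b : P.localRing x} (hb : (b : P.K) ≠ 0) (h : a ∣ b) {η : P.X}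
    (h1 : Order.coheight η = 1) (hη : η ⤳ x) : ord (a : P.K) η ≤ ord (b : P.K) η := by
  obtain ⟨c, rfl⟩ := h
  have h2 : (a : P.K) * c ≠ 0 := hb
  have h3 := ord_nonneg_of_mem h1 (localRing_mono hη c.2)
  have h4 : ord ((a * c : P.localRing x) : P.K) η = ord (a : P.K) η + ord (c : P.K) η :=
    Scheme.ord_mul (mul_ne_zero_iff.1 h2).1 (mul_ne_zero_iff.1 h2).2
  omega

/-- A germ with a simple zero at a given generization. -/
lemma exists_mem_ord_eq_one {x η : P.X} (hη : η ⤳ x) (h1 : Order.coheight η = 1) :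
    ∃ a : P.localRing x, (a : P.K) ≠ 0 ∧ ord (a : P.K) η = 1 := by
  obtain ⟨π, hπ0, hπ, hord⟩ := exists_ord_eq_one h1
  obtain ⟨a, b, hb, hab⟩ := exists_fraction hη (mem_localRing_of_mem_maxIdeal hπ)
  have hb' : (b : P.K) ∉ P.maxIdeal η := fun h => hb ((mem_primeOf hη b).2 h)
  have hb0 : (b : P.K) ≠ 0 := fun h => hb' (h ▸ zero_mem_maxIdeal η)
  refine ⟨a, hab ▸ mul_ne_zero hπ0 hb0, ?_⟩
  rw [← hab, ord, Scheme.ord_mul hπ0 hb0, ← ord, ← ord, hord,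
    (ord_eq_zero_iff h1 hb0).2 ⟨localRing_mono hη b.2, hb'⟩, add_zero]

/-- Distinct primes of height one are incomparable. -/
lemma exists_mem_maxIdeal_notMem {x η ζ : P.X} (hη : η ⤳ x) (hζ : ζ ⤳ x)
    (h1 : Order.coheight η = 1) (h1' : Order.coheight ζ = 1) (hne : η ≠ ζ) :
    ∃ a : P.localRing x, (a : P.K) ∈ P.maxIdeal ζ ∧ (a : P.K) ∉ P.maxIdeal η := by
  by_contra! hcon
  have hle : primeOf hζ ≤ primeOf hη := fun a ha =>
    (mem_primeOf hη a).2 (hcon a ((mem_primeOf hζ a).1 ha))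
  have hbot : primeOf hζ ≠ ⊥ := by
    rw [Ne, ← Ideal.height_eq_zero_iff_eq_bot, (height_primeOf_eq_one_iff hζ).2 h1']
    exact one_ne_zero
  have heq := NormalDomain.eq_of_le_of_height_one ((height_primeOf_eq_one_iff hη).2 h1) hle hbot
  have key : ∀ {η ζ : P.X} (hη : η ⤳ x) (hζ : ζ ⤳ x), primeOf hη = primeOf hζ → η ⤳ ζ := by
    intro η ζ hη hζ h
    obtain ⟨W, S, hx, hM⟩ := P.exists_isAffineModel x
    rw [specializes_iff_mem_closure]
    by_contra hcon
    obtain ⟨b, hb, hbζ, hbη⟩ := hM.exists_notMem _ isClosed_closure ζ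
      (hζ.mem_open W.isOpen hx) hcon
    have h3 := hbη η (hη.mem_open W.isOpen hx) (subset_closure rfl)
    have h4 : (⟨b, hM.le x hx hb⟩ : P.localRing x) ∈ primeOf hη := (mem_primeOf hη _).2 h3
    rw [h] at h4
    exact hbζ ((mem_primeOf hζ _).1 h4)
  exact hne (((key hη hζ heq.symm).antisymm (key hζ hη heq)).eq)

lemma finite_ord_pos {x : P.X} {g : P.K} (h0 : g ≠ 0) :
    {η : P.X | Order.coheight η = 1 ∧ η ⤳ x ∧ ord g η ≠ 0}.Finite := by
  obtain ⟨W, S, hx, hM⟩ := P.exists_isAffineModel x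
  obtain ⟨g₁, g₂, hg₂, hg⟩ := IsFractionRing.div_surjective (A := P.localRing x) g
  have hg' : (g₁ : P.K) / g₂ = g := hg
  have hne : (g₁ : P.K) ≠ 0 ∧ (g₂ : P.K) ≠ 0 := by
    rw [← hg'] at h0; exact div_ne_zero_iff.1 h0
  have key : ∀ a : P.localRing x, (a : P.K) ≠ 0 →
      {η : P.X | Order.coheight η = 1 ∧ η ⤳ x ∧ ord (a : P.K) η ≠ 0}.Finite := by
    intro a ha
    obtain ⟨a₁, h1, a₂, h2, h3, h4⟩ := hM.exists_eq x hx a a.2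
    have ha2 : a₂ ≠ 0 := fun h => h3 (h ▸ zero_mem_maxIdeal x)
    refine (finite_zeros hM h1 (h4 ▸ mul_ne_zero ha ha2)).subset fun η ⟨hη1, hη, hord⟩ => ?_
    have hηW := hη.mem_open W.isOpen hx
    refine ⟨hη1, hηW, ?_⟩
    rw [← h4, mul_mem_maxIdeal_iff (localRing_mono hη a.2) (hM.le η hηW h2)]
    refine Or.inl ((mem_maxIdeal_iff_ord hη1 ha).2 ?_)
    have := ord_nonneg_of_mem hη1 (localRing_mono hη a.2)
    omega
  refine ((key g₁ hne.1).union (key g₂ hne.2)).subset fun η ⟨hη1, hη, hord⟩ => ?_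
  rw [← hg', ord_div hne.1 hne.2] at hord
  by_cases h : ord (g₁ : P.K) η = 0
  · exact Or.inr ⟨hη1, hη, fun h' => hord (by omega)⟩
  · exact Or.inl ⟨hη1, hη, h⟩

/-- A germ with high order at given points of codimension one, not vanishing at another one. -/
lemma exists_ord_ge {x η : P.X} (hη : η ⤳ x) (h1 : Order.coheight η = 1) {T : Set P.X}
    (hT : T.Finite) (hT' : ∀ ζ ∈ T, Order.coheight ζ = 1 ∧ ζ ⤳ x ∧ ζ ≠ η) (m : P.X → ℕ) :
    ∃ c : P.localRing x, (c : P.K) ≠ 0 ∧ ord (c : P.K) η = 0 ∧ ∀ ζ ∈ T, (m ζ : ℤ) ≤ ord (c : P.K) ζ := by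
  induction T, hT using Set.Finite.induction_on with
  | empty => exact ⟨1, one_ne_zero, ord_one η, fun ζ hζ => absurd hζ (Set.notMem_empty ζ)⟩
  | @insert ζ T hζT hfin ih =>
    obtain ⟨c, hc0, hc, hcT⟩ := ih fun ζ' h => hT' ζ' (Set.mem_insert_of_mem _ h)
    obtain ⟨hζ1, hζ, hne⟩ := hT' ζ (Set.mem_insert _ _)
    obtain ⟨a, haζ, haη⟩ := exists_mem_maxIdeal_notMem hη hζ h1 hζ1 hne.symm
    have ha0 : (a : P.K) ≠ 0 := fun h => haη (h ▸ zero_mem_maxIdeal η)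
    have hmul : ∀ ξ, ord ((a ^ m ζ * c : P.localRing x) : P.K) ξ =
        m ζ * ord (a : P.K) ξ + ord (c : P.K) ξ := by
      intro ξ
      have h2 := ord_zpow ha0 (m ζ) ξ
      rw [zpow_natCast] at h2
      rw [← h2]
      exact Scheme.ord_mul (pow_ne_zero _ ha0) hc0
    have haη' := (ord_eq_zero_iff h1 ha0).2 ⟨localRing_mono hη a.2, haη⟩
    refine ⟨a ^ m ζ * c, mul_ne_zero (pow_ne_zero _ ha0) hc0, ?_, ?_⟩
    · rw [hmul, haη', hc]; simp
    · intro ξ hξ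
      rw [hmul]
      obtain ⟨hξ1, hξx, -⟩ := hT' ξ hξ
      have h2 := ord_nonneg_of_mem hξ1 (localRing_mono hξx a.2)
      have h3 := ord_nonneg_of_mem hξ1 (localRing_mono hξx c.2)
      rcases hξ with rfl | hξ
      · have h4 := ord_pos_of_mem hξ1 ha0 haζ
        nlinarith
      · have h4 := hcT ξ hξ
        nlinarith [mul_nonneg (Nat.cast_nonneg (α := ℤ) (m ζ)) h2]

end CompactifiedPair

end KontsevichLog

/-! ### Local equations of the boundary and of the zero divisor. -/

namespace KontsevichLog

open CategoryTheory AlgebraicGeometry TopologicalSpace Opposite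
open KahlerForms LogAlgebra

namespace CompactifiedPair

variable {P : CompactifiedPair} {v : Module.Basis (Fin P.dim) P.K (Ω[P.K⁄ℂ])}

lemma ord_mul {a b : P.K} (ha : a ≠ 0) (hb : b ≠ 0) (η : P.X) : ord (a * b) η = ord a η + ord b η :=
  Scheme.ord_mul ha hb

/-- A germ with prescribed order at one point and high order at finitely many others. -/
lemma exists_ord_eq {x η : P.X} (hη : η ⤳ x) (h1 : Order.coheight η = 1) {T : Set P.X}
    (hT : T.Finite) (hT' : ∀ ζ ∈ T, Order.coheight ζ = 1 ∧ ζ ⤳ x ∧ ζ ≠ η) (k : ℕ) (m : P.X → ℕ) :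
    ∃ c : P.localRing x, (c : P.K) ≠ 0 ∧ ord (c : P.K) η = k ∧
      ∀ ζ ∈ T, (m ζ : ℤ) ≤ ord (c : P.K) ζ := by
  obtain ⟨c, hc0, hc, hcT⟩ := exists_ord_ge hη h1 hT hT' m
  obtain ⟨a, ha0, ha⟩ := exists_mem_ord_eq_one hη h1
  have hmul : ∀ ξ, ord ((a ^ k * c : P.localRing x) : P.K) ξ =
      k * ord (a : P.K) ξ + ord (c : P.K) ξ := by
    intro ξ
    have h2 := ord_zpow ha0 k ξ
    rw [zpow_natCast] at h2
    rw [← h2]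
    exact ord_mul (pow_ne_zero _ ha0) hc0 _
  refine ⟨a ^ k * c, mul_ne_zero (pow_ne_zero _ ha0) hc0, ?_, fun ζ hζ => ?_⟩
  · rw [hmul, ha, hc]; simp
  · rw [hmul]
    have h2 := ord_nonneg_of_mem (hT' ζ hζ).1 (localRing_mono (hT' ζ hζ).2.1 a.2)
    have h3 := hcT ζ hζ
    nlinarith [mul_nonneg (Nat.cast_nonneg (α := ℤ) k) h2]

lemma eq_of_specializes {η ζ : P.X} (h : ζ ⤳ η) (h1 : Order.coheight η = 1)
    (h1' : Order.coheight ζ = 1) : ζ = η := by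
  by_contra hne
  obtain ⟨a, ha, ha'⟩ := exists_mem_maxIdeal_notMem specializes_rfl h h1 h1' (Ne.symm hne)
  exact ha' (mem_maxIdeal_of_specializes h a.2 ha)

/-- The spanning set is an intersection of prime ideals, hence already an ideal. -/
lemma mem_boundaryIdeal {x : P.X} {a : P.localRing x} :
    a ∈ P.boundaryIdeal x ↔ ∀ y, y ∉ P.U → y ⤳ x → (a : P.K) ∈ P.maxIdeal y := by
  refine ⟨fun h y hy hyx => ?_, fun h => Ideal.subset_span h⟩
  refine (mem_primeOf hyx a).1 ((Ideal.span_le (I := primeOf hyx)).2 ?_ h)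
  exact fun b hb => (mem_primeOf hyx b).2 (hb y hy hyx)

lemma exists_mem_boundaryIdeal {x η : P.X} (hη : η ⤳ x) (hU : η ∈ P.U) :
    ∃ a ∈ P.boundaryIdeal x, (a : P.K) ∉ P.maxIdeal η := by
  obtain ⟨W, S, hx, hM⟩ := P.exists_isAffineModel x
  obtain ⟨b, hb, h1, h2⟩ := hM.exists_notMem (P.U : Set P.X)ᶜ P.U.isOpen.isClosed_compl η
    (hη.mem_open W.isOpen hx) (fun h => h hU)
  exact ⟨⟨b, hM.le x hx hb⟩, mem_boundaryIdeal.2 fun y hy hyx =>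
    h2 y (hyx.mem_open W.isOpen hx) hy, h1⟩

lemma genericPoint_mem_U : genericPoint P.X ∈ P.U := by
  obtain ⟨⟨y, hy⟩⟩ := P.nonempty
  exact (genericPoint_specializes y).mem_open P.U.isOpen hy

lemma boundaryIdeal_ne_bot (x : P.X) : P.boundaryIdeal x ≠ ⊥ := by
  obtain ⟨a, ha, ha'⟩ := exists_mem_boundaryIdeal (genericPoint_specializes x) P.genericPoint_mem_U
  exact fun h => ha' (by
    rw [h, Ideal.mem_bot] at ha
    rw [ha]; exact zero_mem_maxIdeal _)

/-- Near `x`, the points of codimension one outside `U` specialize to `x`. -/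
lemma exists_opens_boundary (x : P.X) : ∃ V : P.X.Opens, x ∈ V ∧
    ∀ y ∈ V, ∀ η : P.X, Order.coheight η = 1 → η ⤳ y → η ∉ P.U → η ⤳ x := by
  obtain ⟨W, S, hx, hM⟩ := P.exists_isAffineModel x
  obtain ⟨b, hb, h1, h2⟩ := hM.exists_notMem (P.U : Set P.X)ᶜ P.U.isOpen.isClosed_compl _
    ((genericPoint_specializes x).mem_open W.isOpen hx) (fun h => h P.genericPoint_mem_U)
  obtain ⟨V, hV, h⟩ := exists_opens_specializes_of_finite (x := x)
    (finite_zeros hM hb (fun h0 => h1 (h0 ▸ zero_mem_maxIdeal _)))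
  refine ⟨V ⊓ W, ⟨hV, hx⟩, fun y hy η hη1 hη hU => h y hy.1 η ?_ hη⟩
  have := hη.mem_open W.isOpen hy.2
  exact ⟨hη1, this, h2 η this hU⟩

/-- `s` is a local equation at `x` of the reduced boundary divisor. -/
structure IsBoundaryEquation (s : P.K) (x : P.X) : Prop where
  ne_zero : s ≠ 0
  ord_eq_zero : ∀ η, Order.coheight η = 1 → η ⤳ x → η ∈ P.U → ord s η = 0
  ord_eq_one : ∀ η, Order.coheight η = 1 → η ⤳ x → η ∉ P.U → ord s η = 1

namespace IsBoundaryEquation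

variable {s : P.K} {x : P.X}

lemma ord_le_one (hs : IsBoundaryEquation s x) {η : P.X} (h1 : Order.coheight η = 1) (hη : η ⤳ x) :
    ord s η ≤ 1 := by
  by_cases h : η ∈ P.U
  · rw [hs.ord_eq_zero η h1 hη h]; exact zero_le_one
  · exact (hs.ord_eq_one η h1 hη h).le

lemma ord_nonneg (hs : IsBoundaryEquation s x) {η : P.X} (h1 : Order.coheight η = 1) (hη : η ⤳ x) :
    0 ≤ ord s η := by
  by_cases h : η ∈ P.U
  · exact (hs.ord_eq_zero η h1 hη h).ge
  · rw [hs.ord_eq_one η h1 hη h]; exact zero_le_one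

lemma mem (hs : IsBoundaryEquation s x) : s ∈ P.localRing x :=
  (mem_localRing_iff_forall_ord hs.ne_zero).2 fun _ h1 hη => hs.ord_nonneg h1 hη

lemma mono (hs : IsBoundaryEquation s x) {y : P.X} (h : y ⤳ x) : IsBoundaryEquation s y :=
  ⟨hs.ne_zero, fun η h1 hη => hs.ord_eq_zero η h1 (hη.trans h),
    fun η h1 hη => hs.ord_eq_one η h1 (hη.trans h)⟩

end IsBoundaryEquation

/-- Principality descends from a chart. The generator has order zero at points of `U`, where some
element of the ideal does not vanish, and order one along the boundary because the ideal is radical.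
-/
lemma exists_boundaryIdeal_eq (hP : ∀ x, IsNormalCrossing (P.boundaryIdeal x)) (x : P.X) :
    ∃ s : P.localRing x, IsBoundaryEquation (s : P.K) x ∧ P.boundaryIdeal x = Ideal.span {s} := by
  obtain ⟨W, v, hx, hv⟩ := exists_isCoordinates x
  obtain ⟨C⟩ := nonempty_chart (hv x hx).basis (hP x)
  obtain ⟨s, hs⟩ := exists_eq_span_of_map_eq_span (boundaryIdeal_ne_bot x) C.map_eq
  have hs0 : (s : P.K) ≠ 0 := fun h => boundaryIdeal_ne_bot x (by
    rw [hs, Ideal.span_singleton_eq_bot]; exact Subtype.ext h)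
  have hmem := mem_boundaryIdeal.1 (hs ▸ Ideal.mem_span_singleton_self s)
  refine ⟨s, ⟨hs0, fun η h1 hη hU => ?_, fun η h1 hη hU => ?_⟩, hs⟩
  · obtain ⟨a, ha, ha'⟩ := exists_mem_boundaryIdeal hη hU
    have ha0 : (a : P.K) ≠ 0 := fun h => ha' (h ▸ zero_mem_maxIdeal η)
    rw [hs, Ideal.mem_span_singleton] at ha
    have h2 := ord_le_of_dvd ha0 ha h1 hη
    rw [(ord_eq_zero_iff h1 ha0).2 ⟨localRing_mono hη a.2, ha'⟩] at h2
    exact le_antisymm h2 (ord_nonneg_of_mem h1 (localRing_mono hη s.2))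
  · have hfin := (finite_ord_pos (x := x) hs0).subset
      (t := {ζ | (Order.coheight ζ = 1 ∧ ζ ⤳ x ∧ ord (s : P.K) ζ ≠ 0) ∧ ζ ≠ η}) fun ζ h => h.1
    -- A germ with order exactly one at `η`, vanishing along all other components of the divisor of
    -- `s`. Some power of it is divisible by `s`, so it lies in the ideal and bounds the order of
    -- `s` at `η` by one.
    obtain ⟨a, ha0, ha, haT⟩ := exists_ord_eq hη h1 hfin
      (fun ζ hζ => ⟨hζ.1.1, hζ.1.2.1, hζ.2⟩) 1 fun _ => 1
    have hb : ∃ N : ℕ, ∀ ζ, Order.coheight ζ = 1 → ζ ⤳ x → ord (s : P.K) ζ ≤ N := by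
      obtain ⟨M, hM⟩ := ((finite_ord_pos (x := x) hs0).image (ord (s : P.K))).bddAbove
      refine ⟨M.toNat, fun ζ hζ1 hζ => ?_⟩
      by_cases h : ord (s : P.K) ζ = 0
      · rw [h]; exact Nat.cast_nonneg _
      · exact (hM ⟨ζ, ⟨hζ1, hζ, h⟩, rfl⟩).trans (Int.self_le_toNat M)
    obtain ⟨N, hN⟩ := hb
    have hdvd : s ∣ a ^ N := by
      refine dvd_of_forall_ord hs0 (pow_ne_zero N ha0) fun ζ hζ1 hζ => ?_
      have h2 := ord_zpow ha0 N ζ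
      rw [zpow_natCast] at h2
      change _ ≤ ord ((a : P.K) ^ N) ζ
      rw [h2]
      have h4 : 0 ≤ ord (a : P.K) ζ := ord_nonneg_of_mem hζ1 (localRing_mono hζ a.2)
      by_cases h : ord (s : P.K) ζ = 0
      · rw [h]; positivity
      · have h3 := hN ζ hζ1 hζ
        have h5 : 1 ≤ ord (a : P.K) ζ := by
          by_cases hne : ζ = η
          · rw [hne, ha]; rfl
          · simpa using haT ζ ⟨⟨hζ1, hζ, h⟩, hne⟩
        nlinarith
    have ha2 : a ∈ P.boundaryIdeal x := mem_boundaryIdeal.2 fun y hy hyx => by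
      obtain ⟨c, hc⟩ := hdvd
      have h3 : a ^ N ∈ primeOf hyx := by
        rw [hc]
        exact Ideal.mul_mem_right _ _ ((mem_primeOf hyx s).2 (hmem y hy hyx))
      exact (mem_primeOf hyx a).1 (Ideal.IsPrime.mem_of_pow_mem inferInstance N h3)
    rw [hs, Ideal.mem_span_singleton] at ha2
    have h2 := ord_le_of_dvd ha0 ha2 h1 hη
    have h3 := ord_pos_of_mem h1 hs0 (hmem η hU hη)
    have h4 : ord (a : P.K) η = 1 := ha
    omega

lemma IsBoundaryEquation.boundaryIdeal_eq (hP : ∀ x, IsNormalCrossing (P.boundaryIdeal x))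
    {s : P.K} {x : P.X} (hs : IsBoundaryEquation s x) :
    P.boundaryIdeal x = Ideal.span {(⟨s, hs.mem⟩ : P.localRing x)} := by
  obtain ⟨s', hs', h⟩ := exists_boundaryIdeal_eq hP x
  rw [h, Ideal.span_singleton_eq_span_singleton]
  have key : ∀ η, Order.coheight η = 1 → η ⤳ x → ord (s' : P.K) η = ord s η := by
    intro η h1 hη
    by_cases hU : η ∈ P.U
    · rw [hs.ord_eq_zero η h1 hη hU, hs'.ord_eq_zero η h1 hη hU]
    · rw [hs.ord_eq_one η h1 hη hU, hs'.ord_eq_one η h1 hη hU]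
  exact associated_of_dvd_dvd
    (dvd_of_forall_ord hs'.ne_zero hs.ne_zero fun η h1 hη => (key η h1 hη).le)
    (dvd_of_forall_ord hs.ne_zero hs'.ne_zero fun η h1 hη => (key η h1 hη).ge)

/-- Functions with the same divisor at `x` have the same divisor near `x`. -/
lemma exists_opens_ord_eq {x : P.X} {g : P.K} (h0 : g ≠ 0) (D : P.X → ℤ)
    (hD : ∀ η, Order.coheight η = 1 → η ∈ P.U → D η = 0)
    (h : ∀ η, Order.coheight η = 1 → η ⤳ x → ord g η = D η) : ∃ V : P.X.Opens, x ∈ V ∧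
    ∀ y ∈ V, ∀ η, Order.coheight η = 1 → η ⤳ y → ord g η = D η := by
  obtain ⟨V, hx, hV⟩ := exists_opens_ord h0 x
  obtain ⟨V', hx', hV'⟩ := P.exists_opens_boundary x
  refine ⟨V ⊓ V', ⟨hx, hx'⟩, fun y hy η h1 hη => ?_⟩
  by_cases hηx : η ⤳ x
  · exact h η h1 hηx
  have hU : η ∈ P.U := by
    by_contra hU
    exact hηx (hV' y hy.2 η h1 hη hU)
  rw [hD η h1 hU]
  by_contra h2
  exact hηx (hV y hy.1 η h1 hη h2)

lemma IsBoundaryEquation.exists_opens {s : P.K} {x : P.X} (hs : IsBoundaryEquation s x) :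
    ∃ V : P.X.Opens, x ∈ V ∧ ∀ y ∈ V, IsBoundaryEquation s y := by
  classical
  obtain ⟨V, hx, hV⟩ := exists_opens_ord_eq hs.ne_zero (fun η => if η ∈ P.U then 0 else 1)
    (fun η _ hη => if_pos hη) fun η h1 hη => by
      split_ifs with hU
      · exact hs.ord_eq_zero η h1 hη hU
      · exact hs.ord_eq_one η h1 hη hU
  exact ⟨V, hx, fun y hy => ⟨hs.ne_zero, fun η h1 hη hU => (hV y hy η h1 hη).trans (if_pos hU),
    fun η h1 hη hU => (hV y hy η h1 hη).trans (if_neg hU)⟩⟩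

lemma ratFun_mem {η : P.X} (hU : η ∈ P.U) : P.ratFun ∈ P.localRing η :=
  germToFunctionField_mem hU P.f

lemma poleMult_nonneg (η : P.X) : 0 ≤ P.poleMult η := le_max_left _ _

lemma poleMult_eq_zero {η : P.X} (h1 : Order.coheight η = 1) (hU : η ∈ P.U) : P.poleMult η = 0 :=
  max_eq_left (neg_nonpos.2 (ord_nonneg_of_mem h1 (ratFun_mem hU)))

/-- The divisor sections together with zero form an ideal, so passing to the span adds nothing. Sums
are handled by dividing by a power of a uniformizer. -/
lemma mem_zeroIdeal {x : P.X} {a : P.localRing x} :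
    a ∈ P.zeroIdeal x ↔ (a : P.K) = 0 ∨
      ∀ η, Order.coheight η = 1 → η ⤳ x → P.zeroMult η ≤ ord (a : P.K) η := by
  let I : Ideal (P.localRing x) :=
    { carrier := {a | (a : P.K) = 0 ∨
        ∀ η, Order.coheight η = 1 → η ⤳ x → P.zeroMult η ≤ ord (a : P.K) η}
      zero_mem' := Or.inl rfl
      add_mem' := by
        intro a b ha hb
        by_cases ha0 : (a : P.K) = 0
        · have : a = 0 := Subtype.ext ha0
          rwa [this, zero_add]
        by_cases hb0 : (b : P.K) = 0
        · have : b = 0 := Subtype.ext hb0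
          rwa [this, add_zero]
        by_cases hab : ((a + b : P.localRing x) : P.K) = 0
        · exact Or.inl hab
        refine Or.inr fun η h1 hη => ?_
        have ha := ha.resolve_left ha0 η h1 hη
        have hb := hb.resolve_left hb0 η h1 hη
        obtain ⟨π, hπ0, hπ, hord⟩ := exists_ord_eq_one h1
        have hz : π ^ P.zeroMult η ≠ 0 := zpow_ne_zero _ hπ0
        have key : ∀ c : P.K, c ≠ 0 → (P.zeroMult η ≤ ord c η ↔
            c / π ^ P.zeroMult η ∈ P.localRing η) := by
          intro c hc
          rw [mem_localRing_iff_ord h1 (div_ne_zero hc hz), ord_div hc hz, ord_zpow hπ0, hord]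
          omega
        rw [key _ hab]
        have e : ((a + b : P.localRing x) : P.K) / π ^ P.zeroMult η =
          a / π ^ P.zeroMult η + b / π ^ P.zeroMult η := add_div _ _ _
        rw [e]
        exact add_mem ((key _ ha0).1 ha) ((key _ hb0).1 hb)
      smul_mem' := by
        intro c a ha
        by_cases h0 : ((c • a : P.localRing x) : P.K) = 0
        · exact Or.inl h0
        have h0' : (c : P.K) * a ≠ 0 := h0
        refine Or.inr fun η h1 hη => ?_
        have h2 := ha.resolve_left (mul_ne_zero_iff.1 h0').2 η h1 hη
        have h3 := ord_nonneg_of_mem h1 (localRing_mono hη c.2)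
        have h4 : ord ((c • a : P.localRing x) : P.K) η = ord (c : P.K) η + ord (a : P.K) η :=
          ord_mul (mul_ne_zero_iff.1 h0').1 (mul_ne_zero_iff.1 h0').2 η
        omega }
  have hset : ∀ b : P.localRing x, (b : P.K) ∈ P.divisorSections (fun η => -P.zeroMult η) x ↔
      b ∈ I := by
    intro b
    refine ⟨fun h => ?_, fun h η h1 hη => ?_⟩
    · by_cases h0 : (b : P.K) = 0
      · exact Or.inl h0
      · refine Or.inr fun η h1 hη => ?_
        have : 0 ≤ Scheme.ord (b : P.K) η + -P.zeroMult η := (h η h1 hη).resolve_left h0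
        change P.zeroMult η ≤ Scheme.ord (b : P.K) η
        omega
    · refine Or.imp_right (fun h => ?_) h
      have := h η h1 hη
      change P.zeroMult η ≤ Scheme.ord (b : P.K) η at this
      change 0 ≤ Scheme.ord (b : P.K) η + -P.zeroMult η
      omega
  refine ⟨fun h => (Ideal.span_le (I := I)).2 (fun b hb => (hset b).1 hb) h,
    fun h => Ideal.subset_span ((hset a).2 h)⟩

lemma ratFun_ne_zero_of_zeroMult {η : P.X} (h : P.zeroMult η ≠ 0) : P.ratFun ≠ 0 := by
  intro h0
  rw [zeroMult, h0, congrFun Scheme.ord_zero η] at h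
  exact h rfl

/-- The normal crossing condition makes the product of the two ideals principal; cancelling the
boundary equation shows that the ideal of the zero divisor is principal. -/
lemma exists_zeroIdeal_eq {x : P.X} {s : P.localRing x} (hs : IsBoundaryEquation (s : P.K) x)
    (hb : P.boundaryIdeal x = Ideal.span {s})
    (hNC : IsNormalCrossing (P.zeroIdeal x * P.boundaryIdeal x)) :
    ∃ z : P.localRing x, (z : P.K) ≠ 0 ∧ P.zeroIdeal x = Ideal.span {z} ∧
      ∀ η, Order.coheight η = 1 → η ⤳ x → ord (z : P.K) η = P.zeroMult η := by
  have hfin : {η : P.X | Order.coheight η = 1 ∧ η ⤳ x ∧ P.zeroMult η ≠ 0}.Finite := by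
    by_cases h0 : P.ratFun = 0
    · convert! Set.finite_empty
      refine Set.eq_empty_of_forall_notMem fun η h => ratFun_ne_zero_of_zeroMult h.2.2 h0
    · refine (finite_ord_pos (x := x) h0).subset fun η h => ⟨h.1, h.2.1, fun h' => h.2.2 ?_⟩
      rw [zeroMult]
      change max 0 (ord P.ratFun η) = 0
      rw [h', max_self]
  have hnn : ∀ η, 0 ≤ P.zeroMult η := fun η => le_max_left _ _
  -- The minimal order at `η` is attained within the ideal, so a generator has exactly this order.
  have hex : ∀ η, Order.coheight η = 1 → η ⤳ x → ∃ a ∈ P.zeroIdeal x, (a : P.K) ≠ 0 ∧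
      ord (a : P.K) η = P.zeroMult η := by
    intro η h1 hη
    obtain ⟨a, ha0, ha, haT⟩ := exists_ord_eq hη h1 (hfin.subset
      (t := {ζ | (Order.coheight ζ = 1 ∧ ζ ⤳ x ∧ P.zeroMult ζ ≠ 0) ∧ ζ ≠ η}) fun ζ h => h.1)
      (fun ζ hζ => ⟨hζ.1.1, hζ.1.2.1, hζ.2⟩) (P.zeroMult η).toNat fun ζ => (P.zeroMult ζ).toNat
    rw [Int.toNat_of_nonneg (hnn η)] at ha
    refine ⟨a, mem_zeroIdeal.2 (Or.inr fun ζ hζ1 hζ => ?_), ha0, ha⟩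
    by_cases hne : ζ = η
    · rw [hne, ha]
    · by_cases hz : P.zeroMult ζ = 0
      · rw [hz]; exact ord_nonneg_of_mem hζ1 (localRing_mono hζ a.2)
      · have := haT ζ ⟨⟨hζ1, hζ, hz⟩, hne⟩
        rwa [Int.toNat_of_nonneg (hnn ζ)] at this
  have hne : P.zeroIdeal x ≠ ⊥ := by
    by_cases hηx : ∃ η : P.X, Order.coheight η = 1 ∧ η ⤳ x
    · obtain ⟨η, h1, hη⟩ := hηx
      obtain ⟨a, ha, ha0, -⟩ := hex η h1 hη
      intro h
      rw [h, Ideal.mem_bot] at ha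
      exact ha0 (congrArg Subtype.val ha)
    · push Not at hηx
      intro h
      have h2 : (1 : P.localRing x) ∈ P.zeroIdeal x :=
        mem_zeroIdeal.2 (Or.inr fun η h1 hη => absurd hη (hηx η h1))
      rw [h, Ideal.mem_bot] at h2
      exact one_ne_zero h2
  have hs0 : s ≠ 0 := fun h => hs.ne_zero (congrArg Subtype.val h)
  have hprod : P.zeroIdeal x * P.boundaryIdeal x ≠ ⊥ := by
    rw [Ne, Ideal.mul_eq_bot]
    exact not_or.2 ⟨hne, boundaryIdeal_ne_bot x⟩
  obtain ⟨W, v, hx, hv⟩ := exists_isCoordinates x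
  obtain ⟨C⟩ := nonempty_chart (hv x hx).basis hNC
  obtain ⟨w, hw⟩ := exists_eq_span_of_map_eq_span hprod C.map_eq
  rw [hb] at hw
  have hw' : w ∈ P.zeroIdeal x * Ideal.span {s} := hw ▸ Ideal.mem_span_singleton_self w
  obtain ⟨z, hz, rfl⟩ := Ideal.mem_mul_span_singleton.1 hw'
  have hzI : P.zeroIdeal x = Ideal.span {z} := by
    refine le_antisymm (fun a ha => ?_) ((Ideal.span_singleton_le_iff_mem _).2 hz)
    have h2 : a * s ∈ P.zeroIdeal x * Ideal.span {s} :=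
      Ideal.mul_mem_mul ha (Ideal.mem_span_singleton_self s)
    rw [hw, Ideal.mem_span_singleton] at h2
    rw [Ideal.mem_span_singleton]
    exact (mul_dvd_mul_iff_right hs0).1 h2
  have hz0 : (z : P.K) ≠ 0 := fun h => hne (by
    rw [hzI, Ideal.span_singleton_eq_bot]; exact Subtype.ext h)
  refine ⟨z, hz0, hzI, fun η h1 hη => le_antisymm ?_ ((mem_zeroIdeal.1 hz).resolve_left hz0 η h1 hη)⟩
  obtain ⟨a, ha, ha0, haη⟩ := hex η h1 hη
  rw [hzI, Ideal.mem_span_singleton] at ha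
  exact haη ▸ ord_le_of_dvd ha0 ha h1 hη

/-- The zero divisor and the boundary have no common component near the pole divisor. -/
lemma zeroMult_eq_zero (hP : ∀ x, IsNormalCrossing (P.boundaryIdeal x)) {η : P.X}
    (h1 : Order.coheight η = 1) (hU : η ∉ P.U)
    (hNC : IsNormalCrossing (P.zeroIdeal η * P.boundaryIdeal η)) : P.zeroMult η = 0 := by
  obtain ⟨s, hs, hb⟩ := exists_boundaryIdeal_eq hP η
  obtain ⟨z, hz0, hz, hord⟩ := exists_zeroIdeal_eq hs hb hNC
  have hs1 := hs.ord_eq_one η h1 specializes_rfl hU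
  obtain ⟨k, hk⟩ : ∃ k : ℕ, P.zeroMult η = k := ⟨_, (Int.toNat_of_nonneg (le_max_left _ _)).symm⟩
  -- At `η` itself the only point of codimension one is `η`, so both divisors are multiples of it
  -- and `z s` generates the same ideal as `s ^ (k + 1)`. A normal crossing divisor is reduced,
  -- which gives `k = 0`.
  have hpow : ∀ ζ, Order.coheight ζ = 1 → ζ ⤳ η →
      ord ((z * s : P.localRing η) : P.K) ζ = ord ((s ^ (k + 1) : P.localRing η) : P.K) ζ := by
    intro ζ h1' hζ
    rw [eq_of_specializes hζ h1 h1']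
    have h2 := ord_zpow hs.ne_zero (k + 1 : ℕ) η
    rw [zpow_natCast] at h2
    refine Eq.trans ?_ h2.symm
    refine (ord_mul hz0 hs.ne_zero η).trans ?_
    rw [hord η h1 specializes_rfl, hs1, hk]
    simp
  have heq : P.zeroIdeal η * P.boundaryIdeal η = Ideal.span {s ^ (k + 1)} := by
    rw [hz, hb, Ideal.span_singleton_mul_span_singleton, Ideal.span_singleton_eq_span_singleton]
    exact associated_of_dvd_dvd
      (dvd_of_forall_ord (mul_ne_zero hz0 hs.ne_zero) (pow_ne_zero _ hs.ne_zero)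
        fun ζ h1' hζ => (hpow ζ h1' hζ).le)
      (dvd_of_forall_ord (pow_ne_zero _ hs.ne_zero) (mul_ne_zero hz0 hs.ne_zero)
        fun ζ h1' hζ => (hpow ζ h1' hζ).ge)
  rw [heq] at hNC
  obtain ⟨W, v, hx, hv⟩ := exists_isCoordinates η
  obtain ⟨C⟩ := nonempty_chart (hv η hx).basis hNC
  have hmem : s ∈ IsLocalRing.maximalIdeal (P.localRing η) := by
    rw [← coe_mem_maxIdeal, mem_maxIdeal_iff_ord h1 hs.ne_zero, hs1]
    exact one_pos
  have := C.le_one_of_pow (fun h => hs.ne_zero (congrArg Subtype.val h))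
    ((IsLocalRing.mem_maximalIdeal _).1 hmem)
    ((hv η hx).exists_isUnit_der hmem (notMem_sq_of_ord_eq_one h1 hs1))
  omega

end CompactifiedPair

end KontsevichLog

/-! ### Lattices of multivectors in terms of coefficients and determinants. -/

namespace ExteriorLattice

open Module

variable {k K V : Type} [CommRing k] [Field K] [Algebra k K] [AddCommGroup V] [Module K V]
variable {A : Subalgebra k K} {n : ℕ}

lemma repr_eq_zero (e : Basis (Fin n) K V) {p : ℕ} {ω : ExteriorAlgebra K V} (hω : ω ∈ ⋀[K]^p V)
    {S : Finset (Fin n)} (hS : S.card ≠ p) : e.ExteriorAlgebra.repr ω S = 0 := by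
  rw [exteriorPower_eq e] at hω
  induction hω using Submodule.span_induction with
  | mem x hx =>
    obtain ⟨T, rfl⟩ := hx
    rw [Basis.repr_self, Finsupp.single_apply, if_neg]
    rintro rfl
    exact hS T.2
  | zero => simp
  | add x y _ _ hx hy => rw [map_add, Finsupp.add_apply, hx, hy, add_zero]
  | smul a x _ hx => rw [map_smul, Finsupp.smul_apply, hx, smul_zero]

/-- Membership in the lattice of `p`-vectors in terms of coefficients. -/
lemma mem_deg1_pow_iff (e : Basis (Fin n) K V) {p : ℕ} {ω : ExteriorAlgebra K V} :
    ω ∈ deg1 A e ^ p ↔ ω ∈ ⋀[K]^p V ∧ ∀ S, e.ExteriorAlgebra.repr ω S ∈ A := by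
  refine ⟨fun h => ⟨deg1_pow_le e p h, fun S => ?_⟩, fun ⟨h, hS⟩ => ?_⟩
  · rw [deg1_pow_eq] at h
    induction h using Submodule.span_induction with
    | mem x hx =>
      obtain ⟨T, rfl⟩ := hx
      rw [Basis.repr_self, Finsupp.single_apply]
      split_ifs
      · exact one_mem A
      · exact zero_mem A
    | zero => rw [map_zero]; exact zero_mem A
    | add x y _ _ hx hy => rw [map_add, Finsupp.add_apply]; exact add_mem hx hy
    | smul a x _ hx =>
      have : e.ExteriorAlgebra.repr (a • x) S = (a : K) * e.ExteriorAlgebra.repr x S := by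
        change e.ExteriorAlgebra.repr ((a : K) • x) S = _
        rw [map_smul]; rfl
      rw [this]
      exact mul_mem a.2 hx
  · rw [← e.ExteriorAlgebra.sum_repr ω]
    refine sum_mem fun S _ => ?_
    by_cases hc : S.card = p
    · rw [deg1_pow_eq]
      exact Submodule.smul_mem _ (⟨_, hS S⟩ : A) (Submodule.subset_span ⟨⟨S, hc⟩, rfl⟩)
    · rw [repr_eq_zero e h hc, zero_smul]
      exact zero_mem _

/-- The vector `w` need not lie in the lattice. It is moved past `a`, up to sign, so that the
hypothesis on `w ∧ ω` applies. -/
lemma ι_mul_mul_mem {I : Type} (e : I → V) {w : V} {p q r : ℕ} {a ω : ExteriorAlgebra K V}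
    (ha : a ∈ deg1 A e ^ p) (hω : ExteriorAlgebra.ι K w * ω ∈ deg1 A e ^ q) (hr : p + q = r) :
    ExteriorAlgebra.ι K w * (a * ω) ∈ deg1 A e ^ r := by
  subst hr
  induction ha using Submodule.pow_induction_on_left' with
  | algebraMap a =>
    rw [zero_add, ← Algebra.smul_def, mul_smul_comm]
    exact Submodule.smul_mem _ _ hω
  | add x y i _ _ hx hy => rw [add_mul, mul_add]; exact add_mem hx hy
  | mem_mul m hm i x _ hx =>
    have h1 : ∀ m ∈ deg1 A e, ExteriorAlgebra.ι K w * m = - (m * ExteriorAlgebra.ι K w) := by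
      intro m hm
      induction hm using Submodule.span_induction with
      | mem m hm =>
        obtain ⟨i, rfl⟩ := hm
        exact eq_neg_of_add_eq_zero_left (ExteriorAlgebra.ι_add_mul_swap _ _)
      | zero => simp
      | add x y _ _ hx hy => rw [mul_add, add_mul, hx, hy, neg_add]
      | smul c x _ hx => rw [mul_smul_comm, smul_mul_assoc, hx, smul_neg]
    rw [mul_assoc m, ← mul_assoc, h1 m hm, neg_mul, mul_assoc, show i.succ + q = (i + q) + 1 by omega,
      pow_succ']
    exact neg_mem (Submodule.mul_mem_mul hm hx)

/-- The top exterior power of a basis. -/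
lemma basis_univ_eq (e v : Basis (Fin n) K V) :
    e.ExteriorAlgebra Finset.univ = v.det e • v.ExteriorAlgebra Finset.univ := by
  have key : ∀ b : Basis (Fin n) K V, b.ExteriorAlgebra Finset.univ =
      ExteriorAlgebra.ιMulti K n b := by
    intro b
    rw [ExteriorAlgebra.basis_apply_ofCard b (n := n) (Finset.card_fin n)]
    have h : (Set.powersetCard.ofFinEmbEquiv.symm
        (Set.powersetCard.ofCard (Finset.card_fin n)) : Fin n → Fin n) = id := by
      refine ((OrderEmbedding.strictMono _).range_inj strictMono_id).1 ?_
      rw [Set.range_id, Set.range_eq_univ]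
      exact Finite.injective_iff_surjective.1 (EmbeddingLike.injective _)
    rw [ExteriorAlgebra.ιMulti_family, h, Function.comp_id]
  let φ : V [⋀^Fin n]→ₗ[K] K := (v.ExteriorAlgebra.coord Finset.univ).compAlternatingMap
    (ExteriorAlgebra.ιMulti K n)
  have h1 : v.ExteriorAlgebra.repr (e.ExteriorAlgebra Finset.univ) Finset.univ = v.det e := by
    have h2 : φ e = φ v * v.det e := by
      conv_lhs => rw [φ.eq_smul_basis_det v]
      rfl
    have h3 : φ v = 1 := by
      change v.ExteriorAlgebra.repr (ExteriorAlgebra.ιMulti K n v) Finset.univ = 1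
      rw [← key v, Basis.repr_self, Finsupp.single_eq_same]
    rw [h3, one_mul] at h2
    rw [key e]
    exact h2
  have h2 : e.ExteriorAlgebra Finset.univ ∈ ⋀[K]^n V := by
    rw [exteriorPower_eq e]
    exact Submodule.subset_span ⟨⟨Finset.univ, Finset.card_fin n⟩, rfl⟩
  rw [← v.ExteriorAlgebra.sum_repr (e.ExteriorAlgebra Finset.univ), Finset.sum_eq_single Finset.univ,
    h1]
  · intro S _ hS
    rw [repr_eq_zero v h2 (fun h => hS ((Finset.card_eq_iff_eq_univ S).1 (by simpa using h))),
      zero_smul]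
  · exact fun h => absurd (Finset.mem_univ _) h

lemma mem_deg1_pow_card_iff (e : Basis (Fin n) K V) {ω : ExteriorAlgebra K V} :
    ω ∈ deg1 A e ^ n ↔ ∃ a ∈ A, ω = a • e.ExteriorAlgebra Finset.univ := by
  rw [deg1_pow_eq]
  have : (Set.range fun S : {S : Finset (Fin n) // S.card = n} => e.ExteriorAlgebra S.1) =
      {e.ExteriorAlgebra Finset.univ} := by
    refine Set.eq_singleton_iff_unique_mem.2 ⟨⟨⟨Finset.univ, Finset.card_fin n⟩, rfl⟩, ?_⟩
    rintro _ ⟨S, rfl⟩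
    exact congrArg e.ExteriorAlgebra
      ((Finset.card_eq_iff_eq_univ S.1).1 (by rw [S.2, Fintype.card_fin]))
  rw [this, Submodule.mem_span_singleton]
  exact ⟨fun ⟨a, h⟩ => ⟨a, a.2, h.symm⟩, fun ⟨a, ha, h⟩ => ⟨⟨a, ha⟩, h.symm⟩⟩

end ExteriorLattice

/-! ### The Leibniz rule for products with 1-forms. -/

namespace KahlerForms

variable {k A : Type} [CommRing k] [CommRing A] [Algebra k A]

lemma extDer_one : extDer k A 1 = 0 := by
  have h := extDer_smul_dProd k (1 : A) []
  rw [one_smul] at h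
  rw [← dProd_nil k, h, dProd_cons]
  simp

lemma extDer_ι_D (a : A) : extDer k A (ExteriorAlgebra.ι A (KaehlerDifferential.D k A a)) = 0 := by
  have h := extDer_ι_mul k a 1
  rwa [mul_one, extDer_one, mul_zero, neg_zero] at h

lemma extDer_ι_mul_eq (w : Ω[A⁄k]) (ω : Forms k A) :
    extDer k A (ExteriorAlgebra.ι A w * ω) =
      extDer k A (ExteriorAlgebra.ι A w) * ω - ExteriorAlgebra.ι A w * extDer k A ω := by
  have hw : w ∈ Submodule.span A (Set.range (KaehlerDifferential.D k A)) := by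
    rw [KaehlerDifferential.span_range_derivation]; trivial
  induction hw using Submodule.span_induction with
  | mem x hx =>
    obtain ⟨a, rfl⟩ := hx
    rw [extDer_ι_mul, extDer_ι_D, zero_mul, zero_sub]
  | zero => simp
  | add x y _ _ hx hy => rw [map_add, add_mul, map_add, hx, hy, map_add]; noncomm_ring
  | smul a x _ hx =>
    rw [map_smul, smul_mul_assoc, extDer_smul, hx, extDer_smul, add_mul, smul_mul_assoc, smul_sub,
      smul_mul_assoc, mul_assoc]
    abel

end KahlerForms

/-! ### Regular and logarithmic forms by local equations. -/

namespace KontsevichLog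

open CategoryTheory AlgebraicGeometry TopologicalSpace Opposite
open KahlerForms LogAlgebra ExteriorLattice

namespace CompactifiedPair

variable {P : CompactifiedPair} {v : Module.Basis (Fin P.dim) P.K (Ω[P.K⁄ℂ])}

lemma deg1_eq_span_dRat {y : P.X} (hv : IsCoordinates v y) : deg1 (P.localRing y) v =
    Submodule.span (P.localRing y) (Set.range fun a : P.localRing y => P.dRat a) := by
  apply le_antisymm <;> rw [deg1, Submodule.span_le]
  · rintro _ ⟨i, rfl⟩
    have h : hv.basis i ∈ Submodule.span (P.localRing y)
        (Set.range (KaehlerDifferential.D ℂ (P.localRing y))) := by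
      rw [KaehlerDifferential.span_range_derivation]; trivial
    let φ : Ω[P.localRing y⁄ℂ] →ₗ[P.localRing y] P.RatForms :=
      ((ExteriorAlgebra.ι P.K).restrictScalars (P.localRing y)).comp
        (KaehlerDifferential.map ℂ ℂ (P.localRing y) P.K)
    have h2 := Submodule.mem_map_of_mem (f := φ) h
    rw [Submodule.map_span, ← Set.range_comp] at h2
    have h3 : φ (hv.basis i) = ExteriorAlgebra.ι P.K (v i) :=
      congrArg (ExteriorAlgebra.ι P.K) (hv.map_basis i)
    rw [h3] at h2
    refine (congrArg (fun T : Set P.RatForms => ExteriorAlgebra.ι P.K (v i) ∈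
      Submodule.span (P.localRing y) T) (congrArg Set.range (funext fun a => ?_))).mp h2
    exact (congrArg (ExteriorAlgebra.ι P.K) (KaehlerDifferential.map_D ℂ ℂ (P.localRing y) P.K a))
  · rintro _ ⟨a, rfl⟩
    change P.dRat a ∈ _
    rw [dRat, sum_coordDer (v := v), map_sum]
    refine sum_mem fun i _ => ?_
    rw [map_smul]
    exact Submodule.smul_mem _ (⟨_, hv.coordDer_mem i a.2⟩ : P.localRing y) (ι_mem_deg1 _ i)

/-- Turns the generators `db₁ ∧ ⋯ ∧ dbₚ` into a free lattice, so that membership can be read off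
from coefficients. -/
lemma regForms_eq {y : P.X} (hv : IsCoordinates v y) (p : ℕ) :
    P.regForms p y = deg1 (P.localRing y) v ^ p := by
  rw [deg1_eq_span_dRat hv, Submodule.span_pow, regForms]
  congr 1
  ext ω
  rw [Set.mem_pow]
  constructor
  · rintro ⟨b, rfl⟩
    refine ⟨fun i => ⟨P.dRat (b i), b i, rfl⟩, ?_⟩
    rw [dProd, List.map_ofFn]
    rfl
  · rintro ⟨f, rfl⟩
    choose b hb using fun i => (f i).2
    refine ⟨b, ?_⟩
    rw [dProd, List.map_ofFn]
    congr 2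
    funext i
    exact (hb i).symm

lemma extDer_mem_regForms {y : P.X} {p : ℕ} {ω : P.RatForms} (h : ω ∈ P.regForms p y) :
    extDer ℂ P.K ω ∈ P.regForms (p + 1) y := by
  induction h using Submodule.span_induction with
  | mem x hx =>
    obtain ⟨b, rfl⟩ := hx
    rw [← one_smul P.K (dProd ℂ _), extDer_smul_dProd]
    refine Submodule.subset_span ⟨Fin.cons 1 b, ?_⟩
    rw [List.ofFn_succ]
    rfl
  | zero => simp
  | add x y _ _ hx hy => rw [map_add]; exact add_mem hx hy
  | smul a x hx' hx =>
    rw [extDer_subalgebra_smul]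
    exact add_mem (P.dRat_mul_mem_regForms a hx') (Submodule.smul_mem _ _ hx)

/-- Logarithmic forms are the forms `ω` such that `s ω` and `ds ∧ ω` are regular. -/
lemma mem_logForms_iff {y : P.X} {s : P.localRing y} (hs : P.boundaryIdeal y = Ideal.span {s})
    {p : ℕ} {ω : P.RatForms} : ω ∈ P.logForms p y ↔ ω ∈ ⋀[P.K]^p (Ω[P.K⁄ℂ]) ∧
      s • ω ∈ P.regForms p y ∧ P.dRat s * ω ∈ P.regForms (p + 1) y := by
  have key : extDer ℂ P.K (s • ω) = P.dRat s * ω + s • extDer ℂ P.K ω :=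
    extDer_subalgebra_smul P s ω
  constructor
  · rintro ⟨h1, h2⟩
    obtain ⟨h3, h4⟩ := h2 s (hs ▸ Ideal.mem_span_singleton_self s)
    refine ⟨h1, h3, ?_⟩
    rw [eq_sub_of_add_eq key.symm]
    exact sub_mem (extDer_mem_regForms h3) h4
  · rintro ⟨h1, h3, h4⟩
    refine ⟨h1, fun a ha => ?_⟩
    rw [hs, Ideal.mem_span_singleton'] at ha
    obtain ⟨c, rfl⟩ := ha
    rw [mul_smul, mul_smul]
    refine ⟨Submodule.smul_mem _ _ h3, Submodule.smul_mem _ _ ?_⟩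
    rw [eq_sub_of_add_eq' key.symm]
    exact sub_mem (extDer_mem_regForms h3) h4

lemma extDer_mem_exteriorPower {p : ℕ} {ω : P.RatForms} (h : ω ∈ ⋀[P.K]^p (Ω[P.K⁄ℂ])) :
    extDer ℂ P.K ω ∈ ⋀[P.K]^(p + 1) (Ω[P.K⁄ℂ]) := by
  have hι : ∀ w : Ω[P.K⁄ℂ], ExteriorAlgebra.ι P.K w ∈ LinearMap.range (ExteriorAlgebra.ι P.K) :=
    fun w => ⟨w, rfl⟩
  have h2 : ∀ w : Ω[P.K⁄ℂ], extDer ℂ P.K (ExteriorAlgebra.ι P.K w) ∈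
      LinearMap.range (ExteriorAlgebra.ι P.K (M := Ω[P.K⁄ℂ])) ^ 2 := by
    intro w
    have hw : w ∈ Submodule.span P.K (Set.range (KaehlerDifferential.D ℂ P.K)) := by
      rw [KaehlerDifferential.span_range_derivation]; trivial
    induction hw using Submodule.span_induction with
    | mem x hx =>
      obtain ⟨a, rfl⟩ := hx
      rw [extDer_ι_D]
      exact zero_mem _
    | zero => simp
    | add x y _ _ hx hy => rw [map_add, map_add]; exact add_mem hx hy
    | smul a x _ hx =>
      rw [map_smul, extDer_smul]
      refine add_mem ?_ (Submodule.smul_mem _ _ hx)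
      rw [pow_two]
      exact Submodule.mul_mem_mul (hι _) (hι _)
  induction h using Submodule.pow_induction_on_left' with
  | algebraMap r =>
    rw [Algebra.algebraMap_eq_smul_one, extDer_smul, extDer_one, smul_zero, add_zero, mul_one,
      zero_add]
    change _ ∈ LinearMap.range (ExteriorAlgebra.ι P.K) ^ 1
    rw [pow_one]
    exact hι _
  | add x y i _ _ hx hy => rw [map_add]; exact add_mem hx hy
  | mem_mul m hm i x hx' hx =>
    obtain ⟨w, rfl⟩ := hm
    rw [extDer_ι_mul_eq]
    refine sub_mem ?_ ?_
    · have := Submodule.mul_mem_mul (h2 w) hx'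
      rw [← pow_add, add_comm 2] at this
      exact this
    · change _ ∈ LinearMap.range (ExteriorAlgebra.ι P.K) ^ (i.succ + 1)
      rw [pow_succ']
      exact Submodule.mul_mem_mul (hι w) hx

lemma extDer_mem_logForms {y : P.X} {p : ℕ} {ω : P.RatForms} (h : ω ∈ P.logForms p y) :
    extDer ℂ P.K ω ∈ P.logForms (p + 1) y := by
  refine ⟨extDer_mem_exteriorPower h.1, fun s hs => ⟨(h.2 s hs).2, ?_⟩⟩
  rw [extDer_extDer, smul_zero]
  exact zero_mem _

end CompactifiedPair

end KontsevichLog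

/-! ### Products of logarithmic forms; Saito's criterion. -/

namespace KontsevichLog

open CategoryTheory AlgebraicGeometry TopologicalSpace Opposite
open KahlerForms LogAlgebra ExteriorLattice

namespace CompactifiedPair

variable {P : CompactifiedPair} {v : Module.Basis (Fin P.dim) P.K (Ω[P.K⁄ℂ])}

lemma mul_mem_regForms {y : P.X} {p q : ℕ} {ω ω' : P.RatForms} (h : ω ∈ P.regForms p y)
    (h' : ω' ∈ P.regForms q y) : ω * ω' ∈ P.regForms (p + q) y := by
  obtain ⟨W, v, hy, hv⟩ := exists_isCoordinates y
  rw [regForms_eq (hv y hy)] at h h' ⊢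
  rw [pow_add]
  exact Submodule.mul_mem_mul h h'

lemma mem_exteriorPower_of_mem_regForms {y : P.X} {p : ℕ} {ω : P.RatForms}
    (h : ω ∈ P.regForms p y) : ω ∈ ⋀[P.K]^p (Ω[P.K⁄ℂ]) := by
  obtain ⟨W, v, hy, hv⟩ := exists_isCoordinates y
  rw [regForms_eq (hv y hy)] at h
  exact deg1_pow_le _ _ h

/-- Regularity of differential forms is decided in codimension one. -/
lemma mem_regForms_of_forall {y : P.X} (hv : IsLocalCoordinates v y) {p : ℕ} {ω : P.RatForms}
    (hω : ω ∈ ⋀[P.K]^p (Ω[P.K⁄ℂ]))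
    (h : ∀ η, Order.coheight η = 1 → η ⤳ y → ω ∈ P.regForms p η) : ω ∈ P.regForms p y := by
  rw [regForms_eq hv.isCoordinates, mem_deg1_pow_iff]
  refine ⟨hω, fun S => mem_localRing_of_forall fun η h1 hη => ?_⟩
  have := h η h1 hη
  rw [regForms_eq (hv η hη), mem_deg1_pow_iff] at this
  exact this.2 S

lemma isBoundaryEquation_one {y : P.X} (hy : y ∈ P.U) : IsBoundaryEquation (1 : P.K) y :=
  ⟨one_ne_zero, fun η _ _ _ => ord_one η,
    fun _ _ hη h => absurd (hη.mem_open P.U.isOpen hy) h⟩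

lemma logForms_iff (hP : ∀ x, IsNormalCrossing (P.boundaryIdeal x)) {s : P.K} {y : P.X}
    (hs : IsBoundaryEquation s y) {p : ℕ} {ω : P.RatForms} :
    ω ∈ P.logForms p y ↔ ω ∈ ⋀[P.K]^p (Ω[P.K⁄ℂ]) ∧
      s • ω ∈ P.regForms p y ∧ P.dRat s * ω ∈ P.regForms (p + 1) y :=
  mem_logForms_iff (hs.boundaryIdeal_eq hP)

lemma dRat_mul_mem_exteriorPower (g : P.K) {p : ℕ} {ω : P.RatForms}
    (hω : ω ∈ ⋀[P.K]^p (Ω[P.K⁄ℂ])) : P.dRat g * ω ∈ ⋀[P.K]^(p + 1) (Ω[P.K⁄ℂ]) := by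
  have := Submodule.mul_mem_mul
    (LinearMap.mem_range_self (ExteriorAlgebra.ι P.K) (KaehlerDifferential.D ℂ P.K g)) hω
  rwa [← pow_succ'] at this

lemma mem_logForms_of_forall (hP : ∀ x, IsNormalCrossing (P.boundaryIdeal x)) {s : P.K} {y : P.X}
    (hs : IsBoundaryEquation s y) {p : ℕ} {ω : P.RatForms}
    (hω : ω ∈ ⋀[P.K]^p (Ω[P.K⁄ℂ]))
    (h : ∀ η, Order.coheight η = 1 → η ⤳ y → ω ∈ P.logForms p η) : ω ∈ P.logForms p y := by
  obtain ⟨W, v, hy, hv⟩ := exists_isLocalCoordinates y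
  refine (logForms_iff hP hs).2 ⟨hω, mem_regForms_of_forall (hv y hy) (Submodule.smul_mem _ s hω)
    fun η h1 hη => ((logForms_iff hP (hs.mono hη)).1 (h η h1 hη)).2.1,
    mem_regForms_of_forall (hv y hy) (dRat_mul_mem_exteriorPower s hω)
    fun η h1 hη => ((logForms_iff hP (hs.mono hη)).1 (h η h1 hη)).2.2⟩

lemma logForms_mono (hP : ∀ x, IsNormalCrossing (P.boundaryIdeal x)) {s : P.K} {y : P.X}
    (hs : IsBoundaryEquation s y) {η : P.X} (hη : η ⤳ y) {p : ℕ} {ω : P.RatForms}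
    (h : ω ∈ P.logForms p y) : ω ∈ P.logForms p η := by
  have hmono : ∀ {q : ℕ} {ω : P.RatForms}, ω ∈ P.regForms q y → ω ∈ P.regForms q η := by
    intro q ω h
    induction h using Submodule.span_induction with
    | mem x hx =>
      obtain ⟨b, rfl⟩ := hx
      exact Submodule.subset_span ⟨fun i => ⟨b i, localRing_mono hη (b i).2⟩, rfl⟩
    | zero => exact zero_mem _
    | add x y _ _ hx hy => exact add_mem hx hy
    | smul a x _ hx => exact Submodule.smul_mem _ (⟨a, localRing_mono hη a.2⟩ : P.localRing η) hx
  rw [logForms_iff hP hs] at h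
  exact (logForms_iff hP (hs.mono hη)).2 ⟨h.1, hmono h.2.1, hmono h.2.2⟩

/-- With `φ(ds) = 1` write `ω = ds ∧ ιω + ι(ds ∧ ω)`: the second summand is regular and the first is
a multiple of `ds` with a simple pole. Hence the product with `ω'` again has only a simple pole,
although naively the poles would add up. -/
lemma mul_mem_logForms_of_coheight (hP : ∀ x, IsNormalCrossing (P.boundaryIdeal x)) {η : P.X}
    (h1 : Order.coheight η = 1) {p q : ℕ} {ω ω' : P.RatForms} (h : ω ∈ P.logForms p η)
    (h' : ω' ∈ P.logForms q η) : ω * ω' ∈ P.logForms (p + q) η := by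
  have hdeg : ω * ω' ∈ ⋀[P.K]^(p + q) (Ω[P.K⁄ℂ]) := by
    have := Submodule.mul_mem_mul h.1 h'.1
    rwa [← pow_add] at this
  by_cases hU : η ∈ P.U
  · have hs := isBoundaryEquation_one hU
    rw [logForms_iff hP hs] at h h' ⊢
    rw [one_smul] at h h'
    refine ⟨hdeg, ?_, ?_⟩
    · rw [one_smul]; exact mul_mem_regForms h.2.1 h'.2.1
    · simp [dRat]
  obtain ⟨W, v, hη, hv⟩ := exists_isLocalCoordinates η
  have hc := (hv η hη).isCoordinates
  obtain ⟨s, hs, -⟩ := exists_boundaryIdeal_eq hP η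
  -- The boundary is reduced at `η`, so some partial derivative `c` of `s` is a unit and `φ` can be
  -- taken as `c⁻¹` times a coordinate form.
  obtain ⟨l, hl⟩ := (hv η hη).exists_coordDer_notMem specializes_rfl h1
    (hs.ord_eq_one η h1 specializes_rfl hU)
  have hcmem := hc.coordDer_mem l s.2
  have hinv := inv_mem_localRing hcmem hl
  set c := coordDer v l s
  have hc0 : c ≠ 0 := fun h => hl (h ▸ zero_mem_maxIdeal η)
  set D := KaehlerDifferential.D ℂ P.K (s : P.K)
  let φ : Module.Dual P.K (Ω[P.K⁄ℂ]) := c⁻¹ • v.coord l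
  have hφ : φ D = 1 := by
    change c⁻¹ * v.repr D l = 1
    exact inv_mul_cancel₀ hc0
  have hφv : ∀ i, φ (v i) ∈ P.localRing η := by
    intro i
    change c⁻¹ * v.repr (v i) l ∈ _
    rw [v.repr_self, Finsupp.single_apply]
    split_ifs
    · rw [mul_one]; exact hinv
    · rw [mul_zero]; exact zero_mem _
  clear_value φ
  have e0 : ω = ExteriorAlgebra.ι P.K D * CliffordAlgebra.contractLeft φ ω +
      CliffordAlgebra.contractLeft φ (ExteriorAlgebra.ι P.K D * ω) := eq_mul_contractLeft_add φ D hφ ω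
  rw [logForms_iff hP hs] at h h' ⊢
  obtain ⟨-, ha, hb⟩ := h
  obtain ⟨-, ha', hb'⟩ := h'
  rw [regForms_eq hc] at ha hb ha' hb'
  rw [regForms_eq hc, regForms_eq hc]
  refine ⟨hdeg, ?_, ?_⟩
  · have e1 : (s : P.K) • (ω * ω') = ExteriorAlgebra.ι P.K D *
        (CliffordAlgebra.contractLeft φ ((s : P.K) • ω) * ω') +
        CliffordAlgebra.contractLeft φ (ExteriorAlgebra.ι P.K D * ω) * ((s : P.K) • ω') := by
      conv_lhs => rw [e0]
      rw [add_mul, smul_add, map_smul, smul_mul_assoc, mul_smul_comm, mul_smul_comm, mul_assoc]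
    rw [e1]
    refine add_mem ?_ ?_
    · cases p with
      | zero =>
        rw [contractLeft_deg_zero v φ ha, zero_mul, mul_zero]
        exact zero_mem _
      | succ p =>
        exact ι_mul_mul_mem v (contractLeft_mem_pow v φ hφv p ha) hb' (by omega)
    · rw [pow_add]
      exact Submodule.mul_mem_mul (contractLeft_mem_pow v φ hφv p hb) ha'
  · have e1 : P.dRat s * (ω * ω') = ExteriorAlgebra.ι P.K D *
        (CliffordAlgebra.contractLeft φ (ExteriorAlgebra.ι P.K D * ω) * ω') := by
      conv_lhs => rw [e0]
      rw [add_mul, mul_add, mul_assoc, dRat, ← mul_assoc, ExteriorAlgebra.ι_sq_zero, zero_mul,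
        zero_add]
    rw [e1]
    exact ι_mul_mul_mem v (contractLeft_mem_pow v φ hφv p hb) hb' (by omega)

/-- Logarithmic forms are determined in codimension one, so the previous case suffices. -/
lemma mul_mem_logForms (hP : ∀ x, IsNormalCrossing (P.boundaryIdeal x)) {y : P.X} {p q : ℕ}
    {ω ω' : P.RatForms} (h : ω ∈ P.logForms p y) (h' : ω' ∈ P.logForms q y) :
    ω * ω' ∈ P.logForms (p + q) y := by
  obtain ⟨s, hs, -⟩ := exists_boundaryIdeal_eq hP y
  refine mem_logForms_of_forall hP hs ?_ fun η h1 hη =>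
    mul_mem_logForms_of_coheight hP h1 (logForms_mono hP hs hη h) (logForms_mono hP hs hη h')
  have := Submodule.mul_mem_mul h.1 h'.1
  rwa [← pow_add] at this

/-- `e` is a frame of the logarithmic forms at `y`. -/
def IsLogFrame (e : Module.Basis (Fin P.dim) P.K (Ω[P.K⁄ℂ])) (y : P.X) : Prop :=
  ∀ p, P.logForms p y = deg1 (P.localRing y) e ^ p

/-- Saito's criterion. -/
theorem isLogFrame_of_det (hP : ∀ x, IsNormalCrossing (P.boundaryIdeal x)) {s : P.K} {y : P.X}
    (hv : IsLocalCoordinates v y) (hs : IsBoundaryEquation s y)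
    {e : Module.Basis (Fin P.dim) P.K (Ω[P.K⁄ℂ])}
    (he : ∀ i, ExteriorAlgebra.ι P.K (e i) ∈ P.logForms 1 y)
    (hdet : ∀ η, Order.coheight η = 1 → η ⤳ y → ord (s * v.det e) η = 0) : IsLogFrame e y := by
  have hle : ∀ p, deg1 (P.localRing y) e ^ p ≤ P.logForms p y := by
    intro p
    induction p with
    | zero =>
      intro ω hω
      rw [pow_zero] at hω
      obtain ⟨a, rfl⟩ := Submodule.mem_one.1 hω
      have h1 : algebraMap (P.localRing y) P.RatForms a ∈ P.regForms 0 y := by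
        rw [regForms_eq hv.isCoordinates, pow_zero]
        exact Submodule.algebraMap_mem a
      refine (logForms_iff hP hs).2 ⟨mem_exteriorPower_of_mem_regForms h1,
        Submodule.smul_mem _ (⟨s, hs.mem⟩ : P.localRing y) h1,
        P.dRat_mul_mem_regForms ⟨s, hs.mem⟩ h1⟩
    | succ p ih =>
      rw [pow_succ', Submodule.mul_le]
      intro m hm ω hω
      rw [add_comm p]
      refine mul_mem_logForms hP ?_ (ih hω)
      refine (Submodule.span_le.2 ?_ : deg1 (P.localRing y) e ≤ _) hm
      rintro _ ⟨i, rfl⟩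
      exact he i
  refine fun p => le_antisymm (fun ω hω => ?_) (hle p)
  by_cases hp : P.dim < p
  · rw [exteriorPower_eq_bot e hp hω.1]
    exact zero_mem _
  -- Duality with the complementary degree reduces to top degree. There `s` times a logarithmic form
  -- is regular, and the top form of the frame `e` is `s⁻¹` times the regular one up to a unit.
  refine mem_pow_of_mul_mem e hω.1 fun η hη => ?_
  have h1 := mul_mem_logForms hP hω (hle _ hη)
  rw [Nat.add_sub_cancel' (not_lt.1 hp), logForms_iff hP hs] at h1
  obtain ⟨-, h2, -⟩ := h1
  rw [regForms_eq hv.isCoordinates, mem_deg1_pow_card_iff] at h2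
  obtain ⟨a, ha, h2⟩ := h2
  have hd0 : v.det e ≠ 0 := (v.isUnit_det e).ne_zero
  have h0 : s * v.det e ≠ 0 := mul_ne_zero hs.ne_zero hd0
  rw [mem_deg1_pow_card_iff]
  refine ⟨a * (s * v.det e)⁻¹, mul_mem ha ?_, ?_⟩
  · rw [mem_localRing_iff_forall_ord (inv_ne_zero h0)]
    intro ζ h1 hζ
    rw [ord_inv, hdet ζ h1 hζ, neg_zero]
  · rw [basis_univ_eq e v, smul_smul, mul_inv, mul_assoc, mul_assoc, inv_mul_cancel₀ hd0, mul_one,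
      mul_comm, mul_smul, ← h2, smul_smul, inv_mul_cancel₀ hs.ne_zero, one_smul]

/-- Regular forms at `x` are regular near `x`. -/
lemma exists_opens_mem_regForms {x : P.X} {p : ℕ} {ω : P.RatForms} (h : ω ∈ P.regForms p x) :
    ∃ V : P.X.Opens, x ∈ V ∧ ∀ y ∈ V, ω ∈ P.regForms p y := by
  induction h using Submodule.span_induction with
  | mem ω hω =>
    obtain ⟨b, rfl⟩ := hω
    choose V hx hV using fun i => exists_opens_mem_localRing (b i).2
    refine ⟨⟨⋂ i, V i, isOpen_iInter_of_finite fun i => (V i).isOpen⟩, Set.mem_iInter.2 hx,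
      fun y hy => Submodule.subset_span ⟨fun i => ⟨b i, hV i y (Set.mem_iInter.1 hy i)⟩, rfl⟩⟩
  | zero => exact ⟨⊤, trivial, fun y _ => zero_mem _⟩
  | add ω ω' _ _ hω hω' =>
    obtain ⟨V, hx, hV⟩ := hω
    obtain ⟨V', hx', hV'⟩ := hω'
    exact ⟨V ⊓ V', ⟨hx, hx'⟩, fun y hy => add_mem (hV y hy.1) (hV' y hy.2)⟩
  | smul a ω _ hω =>
    obtain ⟨V, hx, hV⟩ := hω
    obtain ⟨V', hx', hV'⟩ := exists_opens_mem_localRing a.2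
    exact ⟨V ⊓ V', ⟨hx, hx'⟩, fun y hy =>
      Submodule.smul_mem _ (⟨a, hV' y hy.2⟩ : P.localRing y) (hV y hy.1)⟩

lemma exists_opens_mem_logForms (hP : ∀ x, IsNormalCrossing (P.boundaryIdeal x)) {x : P.X} {p : ℕ}
    {ω : P.RatForms} (h : ω ∈ P.logForms p x) :
    ∃ V : P.X.Opens, x ∈ V ∧ ∀ y ∈ V, ω ∈ P.logForms p y := by
  obtain ⟨s, hs, -⟩ := exists_boundaryIdeal_eq hP x
  rw [logForms_iff hP hs] at h
  obtain ⟨V₁, h1, hV₁⟩ := exists_opens_mem_regForms h.2.1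
  obtain ⟨V₂, h2, hV₂⟩ := exists_opens_mem_regForms h.2.2
  obtain ⟨V₃, h3, hV₃⟩ := hs.exists_opens
  exact ⟨V₁ ⊓ V₂ ⊓ V₃, ⟨⟨h1, h2⟩, h3⟩, fun y hy => (logForms_iff hP (hV₃ y hy.2)).2
    ⟨h.1, hV₁ y hy.1.1, hV₂ y hy.1.2⟩⟩

/-- A log frame at `x` obtained from Saito's criterion is a log frame near `x`. -/
theorem exists_opens_isLogFrame (hP : ∀ x, IsNormalCrossing (P.boundaryIdeal x)) {s : P.K} {x : P.X}
    {W : P.X.Opens} (hxW : x ∈ W) (hv : ∀ y ∈ W, IsLocalCoordinates v y)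
    (hs : IsBoundaryEquation s x) {e : Module.Basis (Fin P.dim) P.K (Ω[P.K⁄ℂ])}
    (he : ∀ i, ExteriorAlgebra.ι P.K (e i) ∈ P.logForms 1 x)
    (hdet : ∀ η, Order.coheight η = 1 → η ⤳ x → ord (s * v.det e) η = 0) :
    ∃ V : P.X.Opens, x ∈ V ∧ ∀ y ∈ V, IsLogFrame e y := by
  choose V hx hV using fun i => exists_opens_mem_logForms hP (he i)
  obtain ⟨V', hx', hV'⟩ := hs.exists_opens
  obtain ⟨V'', hx'', hV''⟩ := exists_opens_ord_eq
    (mul_ne_zero hs.ne_zero (v.isUnit_det e).ne_zero) (fun _ => 0) (fun _ _ _ => rfl) hdet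
  refine ⟨⟨⋂ i, V i, isOpen_iInter_of_finite fun i => (V i).isOpen⟩ ⊓ W ⊓ V' ⊓ V'',
    ⟨⟨⟨Set.mem_iInter.2 hx, hxW⟩, hx'⟩, hx''⟩, fun y hy => ?_⟩
  exact isLogFrame_of_det hP (hv y hy.1.1.2) (hV' y hy.1.2)
    (fun i => hV i y (Set.mem_iInter.1 hy.1.1.1 i)) (hV'' y hy.2)

end CompactifiedPair

end KontsevichLog

/-! ### Logarithmic differentials and logarithmic frames. -/

namespace KontsevichLog

open CategoryTheory AlgebraicGeometry TopologicalSpace Opposite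
open KahlerForms LogAlgebra ExteriorLattice

namespace CompactifiedPair

variable {P : CompactifiedPair} {v : Module.Basis (Fin P.dim) P.K (Ω[P.K⁄ℂ])}

/-- The logarithmic differential of a rational function. -/
def dlog (φ : P.K) : Ω[P.K⁄ℂ] := φ⁻¹ • KaehlerDifferential.D ℂ P.K φ

lemma dlog_mul {a b : P.K} (ha : a ≠ 0) (hb : b ≠ 0) : dlog (a * b) = dlog a + dlog b := by
  rw [dlog, Derivation.leibniz, smul_add, smul_smul, smul_smul, add_comm]
  congr 2
  · rw [mul_inv, mul_assoc, inv_mul_cancel₀ hb, mul_one]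
  · rw [mul_inv, mul_comm a⁻¹, mul_assoc, inv_mul_cancel₀ ha, mul_one]

lemma dlog_zpow {a : P.K} (ha : a ≠ 0) (k : ℤ) : dlog (a ^ k) = k • dlog a := by
  have h1 : dlog (1 : P.K) = 0 := by rw [dlog]; simp
  induction k using Int.induction_on with
  | zero => rw [zpow_zero, zero_smul, h1]
  | succ k ih => rw [zpow_add_one₀ ha, dlog_mul (zpow_ne_zero _ ha) ha, ih, add_smul, one_smul]
  | pred k ih =>
    have h2 := dlog_mul (zpow_ne_zero (-(k : ℤ) - 1) ha) ha
    rw [← zpow_add_one₀ ha, sub_add_cancel, ih] at h2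
    rw [sub_smul, h2, one_smul, add_sub_cancel_right]

lemma repr_dlog (φ : P.K) (i : Fin P.dim) : v.repr (dlog φ) i = φ⁻¹ * coordDer v i φ := by
  rw [dlog, map_smul]; rfl

lemma repr_dlog_mem {η : P.X} (hv : IsCoordinates v η) (h1 : Order.coheight η = 1) {φ : P.K}
    (h0 : φ ≠ 0) (h : ord φ η = 0) (i : Fin P.dim) : v.repr (dlog φ) i ∈ P.localRing η := by
  obtain ⟨h2, h3⟩ := (ord_eq_zero_iff h1 h0).1 h
  rw [repr_dlog]
  exact mul_mem (inv_mem_localRing h2 h3) (hv.coordDer_mem i h2)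

/-- The residue of `dφ / φ` is the order of `φ`. -/
lemma repr_dlog_sub_mem {η : P.X} (hv : IsCoordinates v η) (h1 : Order.coheight η = 1) {φ s : P.K}
    (h0 : φ ≠ 0) (hs0 : s ≠ 0) (hs : ord s η = 1) (i : Fin P.dim) :
    v.repr (dlog φ) i - (ord φ η : P.K) * v.repr (dlog s) i ∈ P.localRing η := by
  have h2 := zpow_ne_zero (-ord φ η) hs0
  have h3 := repr_dlog_mem hv h1 (mul_ne_zero h0 h2) (by
    rw [ord_mul h0 h2, ord_zpow hs0, hs]; ring) i
  rw [dlog_mul h0 h2, dlog_zpow hs0, map_add, Finsupp.add_apply, neg_smul, map_neg,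
    Finsupp.neg_apply, map_zsmul, Finsupp.smul_apply, zsmul_eq_mul, ← sub_eq_add_neg] at h3
  exact h3

lemma ι_mem_regForms_iff {y : P.X} (hv : IsCoordinates v y) {w : Ω[P.K⁄ℂ]}
    (h : ∀ i, v.repr w i ∈ P.localRing y) : ExteriorAlgebra.ι P.K w ∈ P.regForms 1 y := by
  rw [regForms_eq hv, pow_one, ← v.sum_repr w, map_sum]
  refine sum_mem fun i _ => ?_
  rw [map_smul]
  exact Submodule.smul_mem _ (⟨_, h i⟩ : P.localRing y) (ι_mem_deg1 _ i)

lemma regForms_le_logForms (hP : ∀ x, IsNormalCrossing (P.boundaryIdeal x)) {y : P.X} {p : ℕ} :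
    P.regForms p y ≤ P.logForms p y := by
  intro ω h
  obtain ⟨s, hs, -⟩ := exists_boundaryIdeal_eq hP y
  exact (logForms_iff hP hs).2 ⟨mem_exteriorPower_of_mem_regForms h,
    Submodule.smul_mem _ s h, P.dRat_mul_mem_regForms s h⟩

lemma ι_mem_exteriorPower (w : Ω[P.K⁄ℂ]) :
    ExteriorAlgebra.ι P.K w ∈ ⋀[P.K]^1 (Ω[P.K⁄ℂ]) := by
  change _ ∈ LinearMap.range (ExteriorAlgebra.ι P.K) ^ 1
  rw [pow_one]
  exact ⟨w, rfl⟩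

lemma ι_dlog_boundary_mem (hP : ∀ x, IsNormalCrossing (P.boundaryIdeal x)) {s : P.K} {y : P.X}
    (hs : IsBoundaryEquation s y) : ExteriorAlgebra.ι P.K (dlog s) ∈ P.logForms 1 y := by
  refine (logForms_iff hP hs).2 ⟨ι_mem_exteriorPower _, ?_, ?_⟩
  · rw [dlog, map_smul, smul_smul, mul_inv_cancel₀ hs.ne_zero, one_smul]
    have := P.dRat_mul_mem_regForms ⟨s, hs.mem⟩ (p := 0) (ω := 1)
      (Submodule.subset_span ⟨Fin.elim0, by simp⟩)
    rwa [mul_one] at this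
  · rw [dlog, map_smul, mul_smul_comm, dRat, ExteriorAlgebra.ι_sq_zero, smul_zero]
    exact zero_mem _

/-- The logarithmic differential of a function without zeros and poles in `U`. -/
lemma ι_dlog_mem (hP : ∀ x, IsNormalCrossing (P.boundaryIdeal x)) {y : P.X} {φ : P.K} (h0 : φ ≠ 0)
    (h : ∀ η, Order.coheight η = 1 → η ⤳ y → η ∈ P.U → ord φ η = 0) :
    ExteriorAlgebra.ι P.K (dlog φ) ∈ P.logForms 1 y := by
  obtain ⟨s, hs, -⟩ := exists_boundaryIdeal_eq hP y
  refine mem_logForms_of_forall hP hs (ι_mem_exteriorPower _) fun η h1 hη => ?_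
  obtain ⟨W, v, hηW, hv⟩ := exists_isCoordinates η
  have hv := hv η hηW
  by_cases hU : η ∈ P.U
  · exact regForms_le_logForms hP (ι_mem_regForms_iff hv fun i =>
      repr_dlog_mem hv h1 h0 (h η h1 hη hU) i)
  -- Subtracting the residue times `ds / s` leaves a regular form.
  · have h2 : dlog φ = (dlog φ - ord φ η • dlog (s : P.K)) + ord φ η • dlog (s : P.K) := by abel
    rw [h2, map_add, map_zsmul]
    refine add_mem (regForms_le_logForms hP (ι_mem_regForms_iff hv fun i => ?_))
      (zsmul_mem (ι_dlog_boundary_mem hP (hs.mono hη)) _)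
    have := repr_dlog_sub_mem hv h1 h0 hs.ne_zero (hs.ord_eq_one η h1 hη hU) i
    rw [map_sub, Finsupp.sub_apply, map_zsmul, Finsupp.smul_apply, zsmul_eq_mul]
    exact this

/-- Passes from vectors to forms: the entries of `logVec` are the 2×2 minors of `ds` and `η`, and `η
/ s` is logarithmic once `ds ∧ η` is divisible by `s`. -/
lemma ι_mem_logForms_of_logVec (hP : ∀ x, IsNormalCrossing (P.boundaryIdeal x)) {x : P.X}
    (hv : IsCoordinates v x) {s : P.localRing x} (hs : IsBoundaryEquation (s : P.K) x)
    {c : Fin P.dim → P.localRing x} (hc : c ∈ logVec (fun i => hv.der i s) s) :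
    ExteriorAlgebra.ι P.K ((s : P.K)⁻¹ • ∑ j, (c j : P.K) • v j) ∈ P.logForms 1 x := by
  refine (logForms_iff hP hs).2 ⟨ι_mem_exteriorPower _, ?_, ?_⟩
  · rw [map_smul, smul_smul, mul_inv_cancel₀ hs.ne_zero, one_smul, map_sum, regForms_eq hv, pow_one]
    refine sum_mem fun i _ => ?_
    rw [map_smul]
    exact Submodule.smul_mem _ (c i) (ι_mem_deg1 _ i)
  · choose b hb using hc
    let V : Fin P.dim → P.RatForms := fun i => ExteriorAlgebra.ι P.K (v i)
    have hanti : ∀ i j, V i * V j = - (V j * V i) := fun i j =>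
      eq_neg_of_add_eq_zero_left (ExteriorAlgebra.ι_add_mul_swap _ _)
    have h1 : P.dRat s * ExteriorAlgebra.ι P.K ((s : P.K)⁻¹ • ∑ j, (c j : P.K) • v j) =
        (s : P.K)⁻¹ • ∑ i, ∑ j, ((hv.der i s : P.K) * c j) • (V i * V j) := by
      rw [dRat, sum_coordDer (v := v), map_sum, map_smul, mul_smul_comm, map_sum, Finset.sum_mul]
      congr 1
      refine Finset.sum_congr rfl fun i _ => ?_
      rw [Finset.mul_sum]
      refine Finset.sum_congr rfl fun j _ => ?_
      rw [map_smul, map_smul, smul_mul_smul_comm, hv.coe_der]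
    -- The double sum counts each pair of indices twice with opposite signs, so the minors appear
    -- only after doubling; `2` is inverted by means of the scalars.
    have h2 : (2 : P.K) • ∑ i, ∑ j, ((hv.der i s : P.K) * c j) • (V i * V j) =
        (s : P.K) • ∑ i, ∑ j, (b i j : P.K) • (V i * V j) := by
      have h3 : ∑ i, ∑ j, ((hv.der i s : P.K) * c j) • (V i * V j) =
          - ∑ i, ∑ j, ((hv.der j s : P.K) * c i) • (V i * V j) := by
        rw [Finset.sum_comm, ← Finset.sum_neg_distrib]
        refine Finset.sum_congr rfl fun i _ => ?_
        rw [← Finset.sum_neg_distrib]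
        refine Finset.sum_congr rfl fun j _ => ?_
        rw [hanti, smul_neg]
      rw [two_smul]
      nth_rw 2 [h3]
      rw [← sub_eq_add_neg, ← Finset.sum_sub_distrib, Finset.smul_sum]
      refine Finset.sum_congr rfl fun i _ => ?_
      rw [← Finset.sum_sub_distrib, Finset.smul_sum]
      refine Finset.sum_congr rfl fun j _ => ?_
      rw [← sub_smul, smul_smul]
      exact congrArg (· • (V i * V j)) (congrArg Subtype.val (hb i j))
    have h20 : (2 : P.K) ≠ 0 := by
      have : CharZero P.K := charZero_of_injective_algebraMap (algebraMap ℂ P.K).injective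
      exact two_ne_zero
    have h3 : P.dRat s * ExteriorAlgebra.ι P.K ((s : P.K)⁻¹ • ∑ j, (c j : P.K) • v j) =
        algebraMap ℂ (P.localRing x) (1 / 2) • ∑ i, ∑ j, (b i j : P.K) • (V i * V j) := by
      rw [h1]
      have e : ((algebraMap ℂ (P.localRing x) (1 / 2) : P.localRing x) : P.K) = 2⁻¹ := by
        change algebraMap ℂ P.K (1 / 2) = _
        rw [one_div, map_inv₀, map_ofNat]
      refine Eq.trans ?_ (congrArg (fun t : P.K => t • ∑ i, ∑ j, (b i j : P.K) • (V i * V j)) e.symm)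
      rw [eq_inv_smul_iff₀ h20, smul_comm, h2, smul_smul, inv_mul_cancel₀ hs.ne_zero, one_smul]
    rw [h3, regForms_eq hv, pow_two]
    exact Submodule.smul_mem _ _ (sum_mem fun i _ => sum_mem fun j _ =>
      Submodule.smul_mem _ (b i j) (Submodule.mul_mem_mul (ι_mem_deg1 _ i) (ι_mem_deg1 _ j)))

/-- A basis of rational `1`-forms from a matrix of germs. -/
lemma exists_basis_of_matrix {x : P.X} {s : P.localRing x}
    (hs : (s : P.K) ≠ 0) (c : Fin P.dim → Fin P.dim → P.localRing x) {u : P.localRing x}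
    (hu : IsUnit u) (h : s * (Matrix.of c).det = s ^ P.dim * u) :
    ∃ e : Module.Basis (Fin P.dim) P.K (Ω[P.K⁄ℂ]),
      (∀ i, e i = (s : P.K)⁻¹ • ∑ j, (c i j : P.K) • v j) ∧ (s : P.K) * v.det e = u := by
  let w : Fin P.dim → Ω[P.K⁄ℂ] := fun i => (s : P.K)⁻¹ • ∑ j, (c i j : P.K) • v j
  have h1 : (s : P.K) * v.det w = u := by
    have h2 : v.toMatrix w = (s : P.K)⁻¹ • ((Matrix.of c).map (P.localRing x).val).transpose := by
      ext i j
      rw [Module.Basis.toMatrix_apply]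
      simp only [w, map_smul, Finsupp.smul_apply, v.repr_sum_self, smul_eq_mul]
      rfl
    have h3 : ((Matrix.of c).map (P.localRing x).val).det = ((Matrix.of c).det : P.localRing x) :=
      ((P.localRing x).val.map_det _).symm
    have h4 : (s : P.K) * ((Matrix.of c).det : P.localRing x) = (s : P.K) ^ P.dim * u :=
      congrArg Subtype.val h
    rw [Module.Basis.det_apply, h2, Matrix.det_smul, Matrix.det_transpose, h3, mul_left_comm, h4,
      Fintype.card_fin, ← mul_assoc, ← mul_pow, inv_mul_cancel₀ hs, one_pow, one_mul]
  have hu0 : (u : P.K) ≠ 0 := fun h => hu.ne_zero (Subtype.ext h)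
  have h2 : IsUnit (v.det w) := (right_ne_zero_of_mul (h1 ▸ hu0)).isUnit
  obtain ⟨hli, hsp⟩ := (Module.Basis.is_basis_iff_det v).2 h2
  have he : ⇑(Module.Basis.mk hli hsp.ge) = w := Module.Basis.coe_mk _ _
  exact ⟨Module.Basis.mk hli hsp.ge, fun i => congrFun he i, by rw [he]; exact h1⟩

lemma ord_eq_zero_of_isUnit {x : P.X} {u : P.localRing x} (hu : IsUnit u) {η : P.X}
    (h1 : Order.coheight η = 1) (hη : η ⤳ x) : ord (u : P.K) η = 0 := by
  obtain ⟨u, rfl⟩ := hu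
  have h0 : ((u : P.localRing x) : P.K) ≠ 0 := fun h => u.isUnit.ne_zero (Subtype.ext h)
  have h2 := ord_nonneg_of_mem h1 (localRing_mono hη (u : P.localRing x).2)
  have h3 := ord_nonneg_of_mem h1 (localRing_mono hη ((u⁻¹ : (P.localRing x)ˣ) : P.localRing x).2)
  have h4 : (((u⁻¹ : (P.localRing x)ˣ) : P.localRing x) : P.K) = ((u : P.localRing x) : P.K)⁻¹ :=
    eq_inv_of_mul_eq_one_left (congrArg Subtype.val (u.inv_mul))
  rw [h4, ord_inv] at h3
  omega

/-- The logarithmic forms have a frame at each point. -/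
lemma exists_isLogFrame (hP : ∀ x, IsNormalCrossing (P.boundaryIdeal x)) (x : P.X) :
    ∃ (e : Module.Basis (Fin P.dim) P.K (Ω[P.K⁄ℂ])) (V : P.X.Opens), x ∈ V ∧
      ∀ y ∈ V, IsLogFrame e y := by
  obtain ⟨W, v, hx, hv⟩ := exists_isLocalCoordinates x
  have hc := (hv x hx).isCoordinates
  obtain ⟨s, hs, hb⟩ := exists_boundaryIdeal_eq hP x
  obtain ⟨C⟩ := nonempty_chart hc.basis (hb ▸ hP x)
  obtain ⟨c, hcs, u, hu, hdet⟩ := C.exists_basis (fun h => hs.ne_zero (congrArg Subtype.val h))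
    ((hv x hx).isReducedDivisor hs.ne_zero fun η h1 hη => hs.ord_le_one h1 hη)
  obtain ⟨e, he, hed⟩ := exists_basis_of_matrix (v := v) hs.ne_zero c hu hdet
  exact ⟨e, exists_opens_isLogFrame hP hx hv hs
    (fun i => (he i).symm ▸ ι_mem_logForms_of_logVec hP hc hs (hcs i))
    fun η h1 hη => hed ▸ ord_eq_zero_of_isUnit hu h1 hη⟩

end CompactifiedPair

end KontsevichLog

/-! ### The frame along the pole divisor and generators of the twists. -/

namespace KontsevichLog

open CategoryTheory AlgebraicGeometry TopologicalSpace Opposite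
open KahlerForms LogAlgebra ExteriorLattice

namespace CompactifiedPair

variable {P : CompactifiedPair} {v : Module.Basis (Fin P.dim) P.K (Ω[P.K⁄ℂ])}

/-- `h` is a local generator at `x` of the invertible sheaf `𝒪_X(D)`. -/
structure IsTwistGenerator (D : P.X → ℤ) (h : P.K) (x : P.X) : Prop where
  ne_zero : h ≠ 0
  ord_eq : ∀ η, Order.coheight η = 1 → η ⤳ x → ord h η = - D η

lemma floorPole_eq_zero (α : ℚ) {η : P.X} (h : P.poleMult η = 0) : P.floorPole α η = 0 := by
  rw [floorPole, h, Int.cast_zero, mul_zero, Int.floor_zero]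

lemma floorPole_neg_one (η : P.X) : P.floorPole (-1) η = - P.poleMult η := by
  rw [floorPole, neg_one_mul, ← Int.cast_neg, Int.floor_intCast]

lemma IsTwistGenerator.exists_opens {α : ℚ} {h : P.K} {x : P.X}
    (hh : IsTwistGenerator (P.floorPole α) h x) :
    ∃ V : P.X.Opens, x ∈ V ∧ ∀ y ∈ V, IsTwistGenerator (P.floorPole α) h y := by
  obtain ⟨V, hx, hV⟩ := exists_opens_ord_eq hh.ne_zero (fun η => - P.floorPole α η)
    (fun η h1 hU => by rw [floorPole_eq_zero α (poleMult_eq_zero h1 hU), neg_zero]) hh.ord_eq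
  exact ⟨V, hx, fun y hy => ⟨hh.ne_zero, hV y hy⟩⟩

/-- The germs `a` such that `a · (dg / g - l ds / s)` is regular, for the order `l` of a pole. -/
structure IsResidueDivisor (a : P.K) (s : P.K) (l : ℤ) (x : P.X) : Prop where
  ne_zero : a ≠ 0
  ord_eq_zero : ∀ η, Order.coheight η = 1 → η ⤳ x → (η ∈ P.U ∨ P.poleMult η = l) → ord a η = 0
  ord_eq_one : ∀ η, Order.coheight η = 1 → η ⤳ x → η ∉ P.U → P.poleMult η ≠ l → ord a η = 1

/-- Let `S_k` be the part of the boundary where `P` has multiplicity `k`; it has the equation `s / a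
k`. Near `x` the divisor `⌊αP⌋` is the sum of the `⌊α k⌋ S_k`. -/
lemma exists_isTwistGenerator {s : P.K} {x : P.X} (hs : IsBoundaryEquation s x) (E : Finset ℕ)
    (hE : ∀ η, Order.coheight η = 1 → η ⤳ x → η ∉ P.U → (P.poleMult η).toNat ∈ E)
    (h : ∀ l : ℕ, ∃ a, IsResidueDivisor a s l x) (α : ℚ) :
    ∃ h, IsTwistGenerator (P.floorPole α) h x := by
  choose a ha using h
  have h0 : ∀ k ∈ E, (s / a k) ^ (-⌊α * k⌋) ≠ 0 := fun k _ =>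
    zpow_ne_zero _ (div_ne_zero hs.ne_zero (ha k).ne_zero)
  refine ⟨∏ k ∈ E, (s / a k) ^ (-⌊α * k⌋), Finset.prod_ne_zero_iff.2 h0, fun η h1 hη => ?_⟩
  rw [ord_prod E h0]
  have hord : ∀ k, ord ((s / a k) ^ (-⌊α * k⌋)) η = -⌊α * k⌋ * (ord s η - ord (a k) η) := fun k => by
    rw [ord_zpow (div_ne_zero hs.ne_zero (ha k).ne_zero), ord_div hs.ne_zero (ha k).ne_zero]
  by_cases hU : η ∈ P.U
  · rw [floorPole_eq_zero α (poleMult_eq_zero h1 hU), neg_zero]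
    refine Finset.sum_eq_zero fun k _ => ?_
    rw [hord, hs.ord_eq_zero η h1 hη hU, (ha k).ord_eq_zero η h1 hη (Or.inl hU), sub_zero, mul_zero]
  · have hk : ((P.poleMult η).toNat : ℤ) = P.poleMult η := Int.toNat_of_nonneg (poleMult_nonneg η)
    rw [Finset.sum_eq_single_of_mem _ (hE η h1 hη hU)]
    · rw [hord, hs.ord_eq_one η h1 hη hU, (ha _).ord_eq_zero η h1 hη (Or.inr hk.symm), sub_zero,
        mul_one, floorPole]
      have hq : (P.poleMult η : ℚ) = ((P.poleMult η).toNat : ℕ) := by exact_mod_cast hk.symm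
      rw [hq]
    · intro k _ hne
      rw [hord, hs.ord_eq_one η h1 hη hU, (ha k).ord_eq_one η h1 hη hU (fun h => hne (by omega)),
        sub_self, mul_zero]

/-- The local structure of a non-degenerate compactification along the pole divisor. -/
theorem exists_pole_frame (hP : P.IsNondegenerate) {x : P.X} (hx : x ∈ P.poleSupport) :
    ∃ (e : Module.Basis (Fin P.dim) P.K (Ω[P.K⁄ℂ])) (V : P.X.Opens), x ∈ V ∧
      (∀ y ∈ V, IsLogFrame e y) ∧
      (∃ g j, IsTwistGenerator (P.floorPole (-1)) g x ∧
        e j = g • KaehlerDifferential.D ℂ P.K P.ratFun) ∧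
      ∀ α, ∃ h, IsTwistGenerator (P.floorPole α) h x := by
  obtain ⟨hNC, V₀, hsub, hV₀⟩ := hP
  have hxV := hsub hx
  obtain ⟨W, v, hxW, hv⟩ := exists_isLocalCoordinates x
  have hvx := hv x hxW
  have hc := hvx.isCoordinates
  obtain ⟨s, hs, hb⟩ := exists_boundaryIdeal_eq hNC x
  obtain ⟨hreg, hNCx⟩ := hV₀ x hxV
  obtain ⟨z, hz0, hzI, hzord⟩ := exists_zeroIdeal_eq hs hb hNCx
  obtain ⟨η₀, h1₀, hη₀, hpos⟩ := hx
  have hs0 : s ≠ 0 := fun h => hs.ne_zero (congrArg Subtype.val h)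
  have hz0' : z ≠ 0 := fun h => hz0 (congrArg Subtype.val h)
  have hf0 : P.ratFun ≠ 0 := by
    intro h
    rw [poleMult, h, congrFun Scheme.ord_zero η₀] at hpos
    exact lt_irrefl _ hpos
  -- the equation of the pole divisor
  set g : P.K := z / P.ratFun with hg
  have hg0 : g ≠ 0 := div_ne_zero hz0 hf0
  have hgord : ∀ η, Order.coheight η = 1 → η ⤳ x → ord g η = P.poleMult η := by
    intro η h1 hη
    rw [hg, ord_div hz0 hf0, hzord η h1 hη, zeroMult, poleMult]
    change max 0 (ord P.ratFun η) - ord P.ratFun η = max 0 (-ord P.ratFun η)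
    omega
  have hgmem : g ∈ P.localRing x := (mem_localRing_iff_forall_ord hg0).2 fun η h1 hη => by
    rw [hgord η h1 hη]; exact poleMult_nonneg η
  -- logarithmic derivatives
  have hres : ∀ η, Order.coheight η = 1 → η ⤳ x → η ∉ P.U → ∀ i,
      v.repr (dlog g) i - (P.poleMult η : P.K) * v.repr (dlog (s : P.K)) i ∈ P.localRing η := by
    intro η h1 hη hU i
    rw [← hgord η h1 hη]
    exact repr_dlog_sub_mem (hvx η hη) h1 hg0 hs.ne_zero (hs.ord_eq_one η h1 hη hU) i
  have hresU : ∀ η, Order.coheight η = 1 → η ⤳ x → η ∈ P.U → ∀ i,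
      v.repr (dlog g) i ∈ P.localRing η ∧ v.repr (dlog (s : P.K)) i ∈ P.localRing η := by
    intro η h1 hη hU i
    exact ⟨repr_dlog_mem (hvx η hη) h1 hg0 (by rw [hgord η h1 hη, poleMult_eq_zero h1 hU]) i,
      repr_dlog_mem (hvx η hη) h1 hs.ne_zero (hs.ord_eq_zero η h1 hη hU) i⟩
  have hsds : ∀ i, (s : P.K) * v.repr (dlog (s : P.K)) i = coordDer v i s := fun i => by
    rw [repr_dlog, mul_inv_cancel_left₀ hs.ne_zero]
  have hγmem : ∀ i, (s : P.K) * v.repr (dlog g) i ∈ P.localRing x := by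
    intro i
    refine mem_localRing_of_forall fun η h1 hη => ?_
    have hsη := localRing_mono hη s.2
    by_cases hU : η ∈ P.U
    · exact mul_mem hsη (hresU η h1 hη hU i).1
    · have h2 := add_mem (mul_mem hsη (hres η h1 hη hU i))
        (mul_mem (intCast_mem (P.localRing η) (P.poleMult η)) ((hvx η hη).coordDer_mem i hsη))
      rw [mul_sub, mul_left_comm, hsds, sub_add_cancel] at h2
      exact h2
  -- The vector of `s dg/g`; its residues along the boundary are the multiplicities of `P`.
  let γ : Fin P.dim → P.localRing x := fun i => ⟨_, hγmem i⟩
  have hdvd : ∀ (l : ℤ) (i) (a : P.localRing x), s ∣ (γ i - l * hc.der i s) * a ↔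
      (v.repr (dlog g) i - (l : P.K) * v.repr (dlog (s : P.K)) i) * a ∈ P.localRing x := by
    intro l i a
    rw [dvd_iff hs.ne_zero]
    have e : (((γ i - l * hc.der i s) * a : P.localRing x) : P.K) =
        ((s : P.K) * v.repr (dlog g) i - l * coordDer v i s) * a := by
      rw [← hc.coe_der]; simp [γ]
    rw [e, ← hsds, mul_left_comm, ← mul_sub, mul_assoc, mul_div_cancel_left₀ _ hs.ne_zero]
  -- `ds / s` has a genuine pole along the boundary, so a function that clears it must vanish there.
  have hsnot : ∀ η, Order.coheight η = 1 → η ⤳ x → η ∉ P.U → ∀ b : P.K, b ≠ 0 →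
      (∀ i, b * v.repr (dlog (s : P.K)) i ∈ P.localRing η) → 0 < ord b η := by
    intro η h1 hη hU b hb0 h
    obtain ⟨i, hi⟩ := hvx.exists_coordDer_notMem hη h1 (hs.ord_eq_one η h1 hη hU)
    have hmem := (hvx η hη).coordDer_mem i (localRing_mono hη s.2)
    have h2 := mul_mem (h i) (inv_mem_localRing hmem hi)
    have hd0 : coordDer v i s ≠ 0 := fun h => hi (h ▸ zero_mem_maxIdeal η)
    rw [repr_dlog, mul_assoc, mul_assoc, mul_inv_cancel₀ hd0, mul_one, ← div_eq_mul_inv,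
      mem_localRing_iff_ord h1 (div_ne_zero hb0 hs.ne_zero), ord_div hb0 hs.ne_zero,
      hs.ord_eq_one η h1 hη hU] at h2
    omega
  have hfin : {η : P.X | Order.coheight η = 1 ∧ η ⤳ x ∧ η ∉ P.U}.Finite :=
    (finite_ord_pos (x := x) hs.ne_zero).subset fun η h =>
      ⟨h.1, h.2.1, by rw [hs.ord_eq_one η h.1 h.2.1 h.2.2]; exact one_ne_zero⟩
  let E : Finset ℕ := hfin.toFinset.image fun η => (P.poleMult η).toNat
  have hE : ∀ η, Order.coheight η = 1 → η ⤳ x → η ∉ P.U → (P.poleMult η).toNat ∈ E :=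
    fun η h1 hη hU => Finset.mem_image_of_mem _ (hfin.mem_toFinset.2 ⟨h1, hη, hU⟩)
  have hnat : ∀ η, (((P.poleMult η).toNat : ℕ) : ℤ) = P.poleMult η := fun η =>
    Int.toNat_of_nonneg (poleMult_nonneg η)
  have hspU : ∀ η, Order.coheight η = 1 → ∀ hη : η ⤳ x, s ∈ primeOf hη → η ∉ P.U := by
    intro η h1 hη hsp hU
    have := ord_pos_of_mem h1 hs.ne_zero ((mem_primeOf hη s).1 hsp)
    rw [hs.ord_eq_zero η h1 hη hU] at this
    exact lt_irrefl _ this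
  have H1 : ∀ p : Ideal (P.localRing x), p.IsPrime → p.height = 1 → s ∈ p → z ∉ p := by
    intro p hp hp1 hsp hzp
    obtain ⟨η, hη, rfl⟩ := exists_primeOf_eq p
    have h1 := (height_primeOf_eq_one_iff hη).1 hp1
    have h2 := zeroMult_eq_zero hNC h1 (hspU η h1 hη hsp) (hV₀ η (hη.mem_open V₀.isOpen hxV)).2
    have h3 := ord_pos_of_mem h1 hz0 ((mem_primeOf hη z).1 hzp)
    rw [hzord η h1 hη, h2] at h3
    exact lt_irrefl _ h3
  have H2 : IsUnit z ∨ ∃ i, IsUnit (hc.der i z) := by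
    by_cases hzu : IsUnit z
    · exact Or.inl hzu
    · have hreg' : IsRegularLocalRing (P.localRing x ⧸ Ideal.span {z}) := by
        rw [hzI] at hreg
        exact hreg.resolve_left fun h => hzu (Ideal.span_singleton_eq_top.1 h)
      exact Or.inr (hc.exists_isUnit_der hzu
        (NormalDomain.notMem_sq_of_isRegularLocalRing hz0' hzu))
  -- At `η` the form `dg/g - k ds/s`, with `k` the multiplicity of `P`, is regular; a product of
  -- denominators of its coefficients outside the prime clears it at `x`.
  have H3 : ∀ p : Ideal (P.localRing x), p.IsPrime → p.height = 1 → s ∈ p →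
      ∃ k ∈ E, ∃ c ∉ p, ∀ i, s ∣ (γ i - (k : P.localRing x) * hc.der i s) * c := by
    intro p hp hp1 hsp
    obtain ⟨η, hη, rfl⟩ := exists_primeOf_eq p
    have h1 := (height_primeOf_eq_one_iff hη).1 hp1
    have hU := hspU η h1 hη hsp
    refine ⟨_, hE η h1 hη hU, ?_⟩
    choose a b hb hab using fun i => exists_fraction hη (hres η h1 hη hU i)
    refine ⟨∏ i, b i, fun h => ?_, fun i => ?_⟩
    · obtain ⟨i, -, hi⟩ := (Ideal.IsPrime.prod_mem_iff (hp := inferInstance)).1 h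
      exact hb i hi
    · have h2 := (hdvd (P.poleMult η) i (b i)).2 (hab i ▸ (a i).2)
      have e : (((P.poleMult η).toNat : ℕ) : P.localRing x) = ((P.poleMult η : ℤ) : P.localRing x) := by
        rw [← Int.cast_natCast, hnat]
      rw [e]
      rw [← Finset.mul_prod_erase _ _ (Finset.mem_univ i), ← mul_assoc]
      exact Dvd.dvd.mul_right h2 _
  -- Along `η₀` the residue of `dg/g` is a positive integer, hence a unit.
  have H4 : ¬ ∀ i, s ∣ γ i := by
    intro h
    have hU₀ : η₀ ∉ P.U := fun hU => hpos.ne' (poleMult_eq_zero h1₀ hU)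
    have hk0 : (P.poleMult η₀ : P.K) ≠ 0 := by
      have : CharZero P.K := charZero_of_injective_algebraMap (algebraMap ℂ P.K).injective
      exact Int.cast_ne_zero.2 hpos.ne'
    have h3 := hsnot η₀ h1₀ hη₀ hU₀ _ hk0 fun i => by
      have h2 := (hdvd 0 i 1).1 (by simpa using h i)
      simp only [Int.cast_zero, zero_mul, sub_zero, OneMemClass.coe_one, mul_one] at h2
      have := sub_mem (localRing_mono hη₀ h2) (hres η₀ h1₀ hη₀ hU₀ i)
      rwa [sub_sub_cancel] at this
    have h4 : ord (P.poleMult η₀ : P.K) η₀ = 0 := by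
      refine (ord_eq_zero_iff h1₀ hk0).2 ⟨intCast_mem _ _, fun h => ?_⟩
      have h5 := (mem_maxIdeal_iff hk0).1 h
      refine h5.2 ?_
      have e : (P.poleMult η₀ : P.K)⁻¹ = algebraMap ℂ P.K ((P.poleMult η₀ : ℂ)⁻¹) := by
        rw [map_inv₀, map_intCast]
      rw [e]
      exact Subalgebra.algebraMap_mem _ _
    omega
  obtain ⟨C⟩ := nonempty_chart hc.basis hNCx
  rw [hzI, hb, Ideal.span_singleton_mul_span_singleton] at C
  obtain ⟨⟨j, c, hcs, hcj, u, hu, hdet⟩, hdiv⟩ := C.exists_basis_pole hz0' hs0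
    (hvx.isReducedDivisor hs.ne_zero fun η h1 hη => hs.ord_le_one h1 hη) H1 H2 H3 H4
  obtain ⟨e, he, hed⟩ := exists_basis_of_matrix (v := v) hs.ne_zero c hu hdet
  obtain ⟨V, hxV', hV⟩ := exists_opens_isLogFrame hNC hxW hv hs
    (fun i => (he i).symm ▸ ι_mem_logForms_of_logVec hNC hc hs (hcs i))
    (fun η h1 hη => hed ▸ ord_eq_zero_of_isUnit hu h1 hη)
  refine ⟨e, V, hxV', hV, ⟨g, j, ⟨hg0, fun η h1 hη => ?_⟩, ?_⟩,
    exists_isTwistGenerator hs E hE fun l => ?_⟩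
  · rw [hgord η h1 hη, floorPole_neg_one, neg_neg]
  · rw [he]
    have h2 : ∀ i, (c j i : P.K) = (s : P.K) * (coordDer v i z - z * v.repr (dlog g) i) := by
      intro i
      rw [hcj]
      change (s : P.K) * hc.der i z - z * (s * v.repr (dlog g) i) = _
      rw [hc.coe_der]
      ring
    -- The identity `g df = dz - z dg/g`, from `z = g f`.
    have h3 : g • KaehlerDifferential.D ℂ P.K P.ratFun =
        KaehlerDifferential.D ℂ P.K (z : P.K) - (z : P.K) • dlog g := by
      have e1 : (z : P.K) = g * P.ratFun := (div_mul_cancel₀ _ hf0).symm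
      rw [e1, Derivation.leibniz, dlog, smul_smul, mul_right_comm, mul_inv_cancel₀ hg0, one_mul,
        add_sub_cancel_right]
    rw [h3, Finset.smul_sum, ← v.sum_repr (KaehlerDifferential.D ℂ P.K (z : P.K) - _)]
    refine Finset.sum_congr rfl fun i _ => ?_
    rw [h2, smul_smul, inv_mul_cancel_left₀ hs.ne_zero, map_sub, map_smul]
    rfl
  -- The generator `a` clears the poles of `dg/g - l ds/s`, which lie exactly on the boundary
  -- components of multiplicity different from `l`.
  · obtain ⟨a, ha⟩ := hdiv l
    have hcast : ∀ (i) (b : P.localRing x), s ∣ (γ i - (l : P.localRing x) * hc.der i s) * b ↔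
        (v.repr (dlog g) i - (l : P.K) * v.repr (dlog (s : P.K)) i) * b ∈ P.localRing x := by
      intro i b
      simpa using hdvd l i b
    have has : a ∣ s := (ha s).1 fun i => dvd_mul_left _ _
    have ha0 : (a : P.K) ≠ 0 := by
      intro h
      have : a = 0 := Subtype.ext h
      rw [this, zero_dvd_iff] at has
      exact hs0 has
    have hle : ∀ η, Order.coheight η = 1 → η ⤳ x → ord (a : P.K) η ≤ ord (s : P.K) η :=
      fun η h1 hη => ord_le_of_dvd hs.ne_zero has h1 hη
    have hge : ∀ η, Order.coheight η = 1 → η ⤳ x → 0 ≤ ord (a : P.K) η :=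
      fun η h1 hη => ord_nonneg_of_mem h1 (localRing_mono hη a.2)
    refine ⟨a, ha0, fun η h1 hη h => le_antisymm ?_ (hge η h1 hη), fun η h1 hη hU hl =>
      le_antisymm ((hle η h1 hη).trans (hs.ord_le_one h1 hη)) ?_⟩
    · rcases h with hU | hl
      · exact (hle η h1 hη).trans (hs.ord_eq_zero η h1 hη hU).le
      -- A germ that vanishes on all other boundary components but not at `η`. It also clears the
      -- poles, so `a` divides it and does not vanish at `η`.
      · obtain ⟨b, hb0, hbη, hbT⟩ := exists_ord_ge hη h1 (hfin.subset
          (t := {ζ | (Order.coheight ζ = 1 ∧ ζ ⤳ x ∧ ζ ∉ P.U) ∧ ζ ≠ η}) fun ζ h => h.1)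
          (fun ζ hζ => ⟨hζ.1.1, hζ.1.2.1, hζ.2⟩) fun _ => 1
        refine hbη ▸ ord_le_of_dvd hb0 ((ha b).1 fun i => (hcast i b).2 ?_) h1 hη
        refine mem_localRing_of_forall fun ζ h1' hζ => ?_
        have hbζ := localRing_mono hζ b.2
        by_cases hU : ζ ∈ P.U
        · obtain ⟨h2, h3⟩ := hresU ζ h1' hζ hU i
          exact mul_mem (sub_mem h2 (mul_mem (natCast_mem _ l) h3)) hbζ
        · by_cases hne : ζ = η
          · subst hne
            have := hres ζ h1' hζ hU i
            rw [hl, Int.cast_natCast] at this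
            exact mul_mem this hbζ
          · have h2 : (b : P.K) / s ∈ P.localRing ζ := by
              rw [mem_localRing_iff_ord h1' (div_ne_zero hb0 hs.ne_zero), ord_div hb0 hs.ne_zero,
                hs.ord_eq_one ζ h1' hζ hU]
              have := hbT ζ ⟨⟨h1', hζ, hU⟩, hne⟩
              push_cast at this
              omega
            have h3 : (v.repr (dlog g) i - (l : P.K) * v.repr (dlog (s : P.K)) i) * b =
                ((s : P.K) * v.repr (dlog g) i - l * coordDer v i s) * (b / s) := by
              rw [← hsds]
              field_simp [hs.ne_zero]
            rw [h3]
            exact mul_mem (sub_mem (localRing_mono hζ (hγmem i)) (mul_mem (natCast_mem _ l)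
              ((hvx ζ hζ).coordDer_mem i (localRing_mono hζ s.2)))) h2
    -- Comparison with the true residue shows that `a` clears a nonzero integer multiple of `ds /
    -- s`, hence vanishes at `η`.
    · have hkl : ((P.poleMult η - l : ℤ) : P.K) ≠ 0 := by
        have : CharZero P.K := charZero_of_injective_algebraMap (algebraMap ℂ P.K).injective
        exact Int.cast_ne_zero.2 (sub_ne_zero.2 hl)
      refine hsnot η h1 hη hU _ ha0 fun i => ?_
      have h2 := localRing_mono hη ((hcast i a).1 ((ha a).2 dvd_rfl i))
      have h3 := mul_mem (hres η h1 hη hU i) (localRing_mono hη a.2)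
      have h4 := sub_mem h2 h3
      have e : (algebraMap ℂ P.K (((P.poleMult η - l : ℤ) : ℂ)⁻¹)) =
          ((P.poleMult η - l : ℤ) : P.K)⁻¹ := by
        rw [map_inv₀, map_intCast]
      have h5 := mul_mem (Subalgebra.algebraMap_mem (P.localRing η)
        (((P.poleMult η - l : ℤ) : ℂ)⁻¹)) h4
      rw [e] at h5
      convert! h5 using 1
      rw [eq_inv_mul_iff_mul_eq₀ hkl]
      push_cast
      ring

end CompactifiedPair

end KontsevichLog

/-! ### The action of `Θ` on twisted logarithmic forms; reduction of the pole order. -/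

namespace KontsevichLog

open CategoryTheory AlgebraicGeometry TopologicalSpace Opposite
open KahlerForms LogAlgebra ExteriorLattice

namespace CompactifiedPair

variable {P : CompactifiedPair}

/-- Off the pole divisor `f` is regular and every twist is trivial with generator `1`. The two
alternatives of the last clause recur in all arguments below. -/
lemma exists_frame (hP : P.IsNondegenerate) (x : P.X) :
    ∃ (e : Module.Basis (Fin P.dim) P.K (Ω[P.K⁄ℂ])) (V : P.X.Opens), x ∈ V ∧
      (∀ y ∈ V, IsLogFrame e y) ∧ (∀ α, ∃ h, IsTwistGenerator (P.floorPole α) h x) ∧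
      ((P.ratFun ∈ P.localRing x ∧ ∀ η, Order.coheight η = 1 → η ⤳ x → P.poleMult η = 0) ∨
      ∃ g j, IsTwistGenerator (P.floorPole (-1)) g x ∧
        e j = g • KaehlerDifferential.D ℂ P.K P.ratFun) := by
  by_cases hx : x ∈ P.poleSupport
  · obtain ⟨e, V, hxV, hV, hg, hh⟩ := exists_pole_frame hP hx
    exact ⟨e, V, hxV, hV, hh, Or.inr hg⟩
  · obtain ⟨e, V, hxV, hV⟩ := exists_isLogFrame hP.1 x
    have h0 : ∀ η, Order.coheight η = 1 → η ⤳ x → P.poleMult η = 0 := fun η h1 hη =>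
      le_antisymm (not_lt.1 fun h => hx ⟨η, h1, hη, h⟩) (poleMult_nonneg η)
    refine ⟨e, V, hxV, hV, fun α => ⟨1, one_ne_zero, fun η h1 hη => ?_⟩, Or.inl ⟨?_, h0⟩⟩
    · rw [ord_one, floorPole_eq_zero α (h0 η h1 hη), neg_zero]
    · by_cases hf : P.ratFun = 0
      · rw [hf]; exact zero_mem _
      · refine (mem_localRing_iff_forall_ord hf).2 fun η h1 hη => ?_
        have := h0 η h1 hη
        rw [poleMult] at this
        have h2 := le_max_right 0 (-ord P.ratFun η)
        change max 0 (-ord P.ratFun η) = 0 at this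
        omega

section Twist

variable {D : P.X → ℤ} {h : P.K} {x : P.X}

lemma mem_divisorSections_iff (hh : IsTwistGenerator D h x) {g : P.K} :
    g ∈ P.divisorSections D x ↔ h⁻¹ * g ∈ P.localRing x := by
  by_cases h0 : g = 0
  · rw [h0, mul_zero]
    exact ⟨fun _ => zero_mem _, fun _ η _ _ => Or.inl rfl⟩
  rw [mem_localRing_iff_forall_ord (mul_ne_zero (inv_ne_zero hh.ne_zero) h0)]
  have key : ∀ η, Order.coheight η = 1 → η ⤳ x → ord (h⁻¹ * g) η = ord g η + D η := by
    intro η h1 hη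
    rw [ord_mul (inv_ne_zero hh.ne_zero) h0, ord_inv, hh.ord_eq η h1 hη]
    ring
  exact ⟨fun H η h1 hη => by rw [key η h1 hη]; exact (H η h1 hη).resolve_left h0,
    fun H η h1 hη => Or.inr (by rw [← key η h1 hη]; exact H η h1 hη)⟩

lemma mem_divisorStalk_iff (hh : IsTwistGenerator D h x) {g : P.K} :
    g ∈ P.divisorStalk D x ↔ h⁻¹ * g ∈ P.localRing x := by
  refine ⟨fun H => ?_, fun H => Submodule.subset_span ((mem_divisorSections_iff hh).2 H)⟩
  induction H using Submodule.span_induction with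
  | mem g hg => exact (mem_divisorSections_iff hh).1 hg
  | zero => rw [mul_zero]; exact zero_mem _
  | add a b _ _ ha hb => rw [mul_add]; exact add_mem ha hb
  | smul c a _ ha =>
    have : h⁻¹ * c • a = c * (h⁻¹ * a) := mul_left_comm _ _ _
    rw [this]
    exact mul_mem c.2 ha

lemma mem_logFormsTwist_iff (hh : IsTwistGenerator D h x) {p : ℕ} {ω : P.RatForms} :
    ω ∈ P.logFormsTwist D p x ↔ h⁻¹ • ω ∈ P.logForms p x := by
  constructor
  · intro H
    induction H using Submodule.span_induction with
    | mem ω hω =>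
      obtain ⟨g, hg, u, hu, rfl⟩ := hω
      rw [smul_smul]
      exact Submodule.smul_mem _ (⟨_, (mem_divisorSections_iff hh).1 hg⟩ : P.localRing x) hu
    | zero => rw [smul_zero]; exact zero_mem _
    | add a b _ _ ha hb => rw [smul_add]; exact add_mem ha hb
    | smul c a _ ha =>
      rw [smul_comm]
      exact Submodule.smul_mem _ c ha
  · intro H
    refine Submodule.subset_span ⟨h, (mem_divisorSections_iff hh).2 ?_, _, H, ?_⟩
    · rw [inv_mul_cancel₀ hh.ne_zero]; exact one_mem _
    · rw [smul_smul, mul_inv_cancel₀ hh.ne_zero, one_smul]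

lemma logFormsTwist_mono {D D' : P.X → ℤ} {x : P.X} (hD : ∀ η, Order.coheight η = 1 → η ⤳ x → D η ≤ D' η)
    (p : ℕ) : P.logFormsTwist D p x ≤ P.logFormsTwist D' p x := by
  refine Submodule.span_mono ?_
  rintro _ ⟨g, hg, u, hu, rfl⟩
  refine ⟨g, fun η h1 hη => (hg η h1 hη).imp_right fun H => H.trans ?_, u, hu, rfl⟩
  have := hD η h1 hη
  omega

end Twist

lemma floorPole_mono {μ ν : ℚ} (h : μ ≤ ν) (η : P.X) : P.floorPole μ η ≤ P.floorPole ν η :=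
  Int.floor_mono (mul_le_mul_of_nonneg_right h (Int.cast_nonneg (poleMult_nonneg η)))

lemma twist_mono {μ ν : ℚ} (h : μ ≤ ν) (p : ℕ) (x : P.X) :
    P.logFormsTwist (P.floorPole μ) p x ≤ P.logFormsTwist (P.floorPole ν) p x :=
  logFormsTwist_mono (fun η _ _ => floorPole_mono h η) p

lemma IsTwistGenerator.ι_dlog_mem (hP : P.IsNondegenerate) {α : ℚ} {h : P.K} {x : P.X}
    (hh : IsTwistGenerator (P.floorPole α) h x) :
    ExteriorAlgebra.ι P.K (dlog h) ∈ P.logForms 1 x :=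
  CompactifiedPair.ι_dlog_mem hP.1 hh.ne_zero fun η h1 hη hU => by
    rw [hh.ord_eq η h1 hη, floorPole_eq_zero α (poleMult_eq_zero h1 hU), neg_zero]

lemma mul_mem_twist (hP : P.IsNondegenerate) {μ : ℚ} {p : ℕ} {x : P.X} {ω τ : P.RatForms}
    (hτ : τ ∈ P.logForms 1 x) (hω : ω ∈ P.logFormsTwist (P.floorPole μ) p x) :
    τ * ω ∈ P.logFormsTwist (P.floorPole μ) (p + 1) x := by
  obtain ⟨e, V, hxV, hV, hh, -⟩ := exists_frame hP x
  obtain ⟨h, hh⟩ := hh μ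
  rw [mem_logFormsTwist_iff hh] at hω ⊢
  rw [← mul_smul_comm, add_comm]
  exact mul_mem_logForms hP.1 hτ hω

/-- For a local generator `h` one has `d(h u) = h (dh/h ∧ u + du)`, and `dh/h` is logarithmic. -/
lemma extDer_mem_twist (hP : P.IsNondegenerate) {μ : ℚ} {p : ℕ} {x : P.X} {ω : P.RatForms}
    (hω : ω ∈ P.logFormsTwist (P.floorPole μ) p x) :
    extDer ℂ P.K ω ∈ P.logFormsTwist (P.floorPole μ) (p + 1) x := by
  obtain ⟨e, V, hxV, hV, hh, -⟩ := exists_frame hP x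
  obtain ⟨h, hh⟩ := hh μ
  have h1 := (mem_logFormsTwist_iff hh).1 hω
  obtain ⟨u, rfl⟩ : ∃ u, ω = h • u :=
    ⟨h⁻¹ • ω, by rw [smul_smul, mul_inv_cancel₀ hh.ne_zero, one_smul]⟩
  rw [smul_smul, inv_mul_cancel₀ hh.ne_zero, one_smul] at h1
  rw [mem_logFormsTwist_iff hh, extDer_smul, smul_add, smul_smul, inv_mul_cancel₀ hh.ne_zero,
    one_smul, ← smul_mul_assoc, ← map_smul]
  refine add_mem ?_ (extDer_mem_logForms h1)
  rw [add_comm p]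
  exact mul_mem_logForms hP.1 (hh.ι_dlog_mem hP) h1

/-- `⌊(μ+1)P⌋ = ⌊μP⌋ + P`, as `P` has integral coefficients, and `g` is an equation of `P`. -/
lemma smul_mem_twist_iff (hP : P.IsNondegenerate) {μ : ℚ} {p : ℕ} {x : P.X} {ω : P.RatForms}
    {g : P.K} (hg : IsTwistGenerator (P.floorPole (-1)) g x) :
    g • ω ∈ P.logFormsTwist (P.floorPole μ) p x ↔
      ω ∈ P.logFormsTwist (P.floorPole (μ + 1)) p x := by
  obtain ⟨e, V, hxV, hV, hh, -⟩ := exists_frame hP x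
  obtain ⟨h, hh⟩ := hh (μ + 1)
  have hgh : IsTwistGenerator (P.floorPole μ) (g * h) x := by
    refine ⟨mul_ne_zero hg.ne_zero hh.ne_zero, fun η h1 hη => ?_⟩
    rw [ord_mul hg.ne_zero hh.ne_zero, hg.ord_eq η h1 hη, hh.ord_eq η h1 hη, floorPole_neg_one,
      floorPole, floorPole, add_mul, one_mul, Int.floor_add_intCast]
    ring
  rw [mem_logFormsTwist_iff hh, mem_logFormsTwist_iff hgh, mul_inv, mul_comm, mul_smul, smul_smul g⁻¹,
    inv_mul_cancel₀ hg.ne_zero, one_smul]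

lemma twist_eq_of_poleMult_eq_zero {x : P.X}
    (h : ∀ η, Order.coheight η = 1 → η ⤳ x → P.poleMult η = 0) (μ ν : ℚ) (p : ℕ) :
    P.logFormsTwist (P.floorPole μ) p x = P.logFormsTwist (P.floorPole ν) p x := by
  have key : ∀ μ ν : ℚ, P.logFormsTwist (P.floorPole μ) p x ≤ P.logFormsTwist (P.floorPole ν) p x :=
    fun μ ν => logFormsTwist_mono (fun η h1 hη => by
      rw [floorPole_eq_zero μ (h η h1 hη), floorPole_eq_zero ν (h η h1 hη)]) p
  exact le_antisymm (key μ ν) (key ν μ)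

/-- Along the poles `df = g⁻¹ e_j` with `e_j` logarithmic, which costs exactly one copy of `P`. -/
lemma dRat_ratFun_mul_mem (hP : P.IsNondegenerate) {μ : ℚ} {p : ℕ} {x : P.X} {ω : P.RatForms}
    (hω : ω ∈ P.logFormsTwist (P.floorPole μ) p x) :
    P.dRat P.ratFun * ω ∈ P.logFormsTwist (P.floorPole (μ + 1)) (p + 1) x := by
  obtain ⟨e, V, hxV, hV, -, ⟨hf, h0⟩ | ⟨g, j, hg, hj⟩⟩ := exists_frame hP x
  · rw [twist_eq_of_poleMult_eq_zero h0 (μ + 1) μ]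
    exact P.dRat_mul_mem_logFormsTwist ⟨_, hf⟩ hω
  · rw [← smul_mem_twist_iff hP hg, ← smul_mul_assoc, dRat, ← map_smul, ← hj]
    refine mul_mem_twist hP ?_ hω
    rw [hV x hxV 1, pow_one]
    exact ι_mem_deg1 _ j

lemma Θ_mem_twist (hP : P.IsNondegenerate) (t : Flavour) {μ : ℚ} {p : ℕ} {x : P.X}
    {ω : P.RatForms} (hω : ω ∈ P.logFormsTwist (P.floorPole μ) p x) :
    P.Θ t ω ∈ P.logFormsTwist (P.floorPole (μ + 1)) (p + 1) x := by
  cases t with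
  | deRham =>
    exact add_mem (twist_mono (by linarith) _ _ (extDer_mem_twist hP hω))
      (dRat_ratFun_mul_mem hP hω)
  | higgs => exact dRat_ratFun_mul_mem hP hω

/-- The operator `d` does not increase the twist, so only `df ∧` matters. This is why both flavours
can be treated together. -/
lemma Θ_mem_iff (hP : P.IsNondegenerate) (t : Flavour) {μ ν : ℚ} (h : μ ≤ ν) {p : ℕ} {x : P.X}
    {ω : P.RatForms} (hω : ω ∈ P.logFormsTwist (P.floorPole μ) p x) :
    P.Θ t ω ∈ P.logFormsTwist (P.floorPole ν) (p + 1) x ↔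
      P.dRat P.ratFun * ω ∈ P.logFormsTwist (P.floorPole ν) (p + 1) x := by
  cases t with
  | deRham => exact Submodule.add_mem_iff_right _ (twist_mono h _ _ (extDer_mem_twist hP hω))
  | higgs => exact Iff.rfl

lemma mem_kontsevich_iff (hP : P.IsNondegenerate) {t : Flavour} {α : ℚ} {p : ℕ} {x : P.X}
    {ω : P.RatForms} : ω ∈ P.kontsevich t α p x ↔ ω ∈ P.logFormsTwist (P.floorPole α) p x ∧
      P.dRat P.ratFun * ω ∈ P.logFormsTwist (P.floorPole α) (p + 1) x :=
  and_congr_right fun h => Θ_mem_iff hP t le_rfl h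

theorem kontsevich_deRham_eq_higgs (hP : P.IsNondegenerate) (α : ℚ) (p : ℕ) :
    P.kontsevich .deRham α p = P.kontsevich .higgs α p := by
  funext x
  ext ω
  rw [mem_kontsevich_iff hP, mem_kontsevich_iff hP]

lemma Θ_sub_Θ (t : Flavour) (ω τ : P.RatForms) : P.Θ t (ω - P.Θ t τ) = P.Θ t ω := by
  rw [map_sub, Θ_Θ, sub_zero]

/-- Reduction of the pole order by at most one, in degree zero. -/
lemma mem_twist_of_Θ_mem_zero (hP : P.IsNondegenerate) (t : Flavour) {μ ν : ℚ} (h' : ν ≤ μ + 1)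
    {x : P.X} {ω : P.RatForms} (hω : ω ∈ P.logFormsTwist (P.floorPole ν) 0 x)
    (hΘ : P.Θ t ω ∈ P.logFormsTwist (P.floorPole (μ + 1)) 1 x) :
    ω ∈ P.logFormsTwist (P.floorPole μ) 0 x := by
  obtain ⟨e, V, hxV, hV, hh, ⟨hf, h0⟩ | ⟨g, j, hg, hj⟩⟩ := exists_frame hP x
  · rwa [twist_eq_of_poleMult_eq_zero h0 μ ν]
  have hφ : ∀ i, e.coord j (e i) ∈ P.localRing x := by
    intro i
    rw [e.coord_apply, e.repr_self, Finsupp.single_apply]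
    split_ifs
    exacts [one_mem _, zero_mem _]
  have hφj : e.coord j (e j) = 1 := by simp
  rw [Θ_mem_iff hP t h' hω, ← smul_mem_twist_iff hP hg, ← smul_mul_assoc, dRat, ← map_smul, ← hj]
    at hΘ
  obtain ⟨hν, hhν⟩ := hh ν
  obtain ⟨hμ, hhμ⟩ := hh μ
  rw [mem_logFormsTwist_iff hhν, hV x hxV] at hω
  rw [mem_logFormsTwist_iff hhμ, hV x hxV] at hΘ ⊢
  -- In degree zero the contraction vanishes, so the homotopy formula needs no correction term.
  have h1 := contractLeft_deg_zero e (e.coord j) hω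
  rw [map_smul, smul_eq_zero, or_iff_right (inv_ne_zero hhν.ne_zero)] at h1
  have h2 := contractLeft_mem_pow e (e.coord j) hφ 0 hΘ
  rw [map_smul] at h2
  rw [eq_mul_contractLeft_add (e.coord j) (e j) hφj ω, h1, mul_zero, zero_add]
  exact h2

/-- Reduction of the pole order by at most one. -/
lemma exists_sub_Θ_mem (hP : P.IsNondegenerate) (t : Flavour) {μ ν : ℚ} (h' : ν ≤ μ + 1)
    {p : ℕ} {x : P.X} {ω : P.RatForms} (hω : ω ∈ P.logFormsTwist (P.floorPole ν) (p + 1) x)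
    (hΘ : P.Θ t ω ∈ P.logFormsTwist (P.floorPole (μ + 1)) (p + 2) x) :
    ∃ τ ∈ P.logFormsTwist (P.floorPole (ν - 1)) p x,
      ω - P.Θ t τ ∈ P.logFormsTwist (P.floorPole μ) (p + 1) x := by
  obtain ⟨e, V, hxV, hV, hh, ⟨hf, h0⟩ | ⟨g, j, hg, hj⟩⟩ := exists_frame hP x
  · refine ⟨0, zero_mem _, ?_⟩
    rw [map_zero, sub_zero]
    rwa [twist_eq_of_poleMult_eq_zero h0 μ ν]
  have hφ : ∀ i, e.coord j (e i) ∈ P.localRing x := by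
    intro i
    rw [e.coord_apply, e.repr_self, Finsupp.single_apply]
    split_ifs
    exacts [one_mem _, zero_mem _]
  have hφj : e.coord j (e j) = 1 := by simp
  rw [Θ_mem_iff hP t h' hω, ← smul_mem_twist_iff hP hg, ← smul_mul_assoc, dRat, ← map_smul, ← hj]
    at hΘ
  obtain ⟨hν, hhν⟩ := hh ν
  obtain ⟨hμ, hhμ⟩ := hh μ
  rw [mem_logFormsTwist_iff hhν, hV x hxV] at hω
  rw [mem_logFormsTwist_iff hhμ, hV x hxV] at hΘ
  have h1 := contractLeft_mem_pow e (e.coord j) hφ p hω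
  have h2 := contractLeft_mem_pow e (e.coord j) hφ (p + 1) hΘ
  rw [map_smul, ← hV x hxV, ← mem_logFormsTwist_iff hhν] at h1
  rw [map_smul, ← hV x hxV, ← mem_logFormsTwist_iff hhμ] at h2
  -- The factor `g` makes `df ∧ τ = e_j ∧ ιω` and lowers the twist of `τ` to `ν - 1`.
  have hτ : g • CliffordAlgebra.contractLeft (e.coord j) ω ∈
      P.logFormsTwist (P.floorPole (ν - 1)) p x := by
    rw [smul_mem_twist_iff hP hg, sub_add_cancel]
    exact h1
  refine ⟨_, hτ, ?_⟩
  -- The correction `dτ` stays in the `(ν-1)`-twist; this is where `ν ≤ μ + 1` enters.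
  have h3 := twist_mono (show ν - 1 ≤ μ by linarith) _ _ (extDer_mem_twist hP hτ)
  have h4 : ω - P.dRat P.ratFun * (g • CliffordAlgebra.contractLeft (e.coord j) ω) =
      CliffordAlgebra.contractLeft (e.coord j) (ExteriorAlgebra.ι P.K (e j) * ω) := by
    rw [mul_smul_comm, ← smul_mul_assoc, dRat, ← map_smul, ← hj, sub_eq_iff_eq_add']
    exact eq_mul_contractLeft_add (e.coord j) (e j) hφj ω
  cases t with
  | deRham =>
    change ω - (extDer ℂ P.K _ + P.dRat P.ratFun * _) ∈ _
    rw [sub_add_eq_sub_sub_swap, h4]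
    exact sub_mem h2 h3
  | higgs =>
    change ω - P.dRat P.ratFun * _ ∈ _
    rw [h4]
    exact h2

/-- Reduction of the pole order in degree zero. -/
theorem mem_twist_of_Θ_mem (hP : P.IsNondegenerate) (t : Flavour) {μ ν : ℚ} (h : μ ≤ ν)
    {x : P.X} {ω : P.RatForms} (hω : ω ∈ P.logFormsTwist (P.floorPole ν) 0 x)
    (hΘ : P.Θ t ω ∈ P.logFormsTwist (P.floorPole (μ + 1)) 1 x) :
    ω ∈ P.logFormsTwist (P.floorPole μ) 0 x := by
  obtain ⟨N, hN⟩ := exists_nat_ge (ν - μ - 1)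
  -- `N` bounds the number of further steps; each one lowers `ν` by one.
  induction N generalizing ν with
  | zero => exact mem_twist_of_Θ_mem_zero hP t (by simpa [sub_sub, add_comm] using hN) hω hΘ
  | succ N ih =>
    by_cases h2 : ν ≤ μ + 1
    · exact mem_twist_of_Θ_mem_zero hP t h2 hω hΘ
    · refine ih (ν := ν - 1) (by linarith) (mem_twist_of_Θ_mem_zero hP t (by linarith) hω
        (twist_mono (by linarith) _ _ hΘ)) ?_
      push_cast at hN
      linarith

/-- Reduction of the pole order. -/
theorem exists_sub_Θ_mem_twist (hP : P.IsNondegenerate) (t : Flavour) {μ ν : ℚ} (h : μ ≤ ν)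
    {p : ℕ} {x : P.X} {ω : P.RatForms} (hω : ω ∈ P.logFormsTwist (P.floorPole ν) (p + 1) x)
    (hΘ : P.Θ t ω ∈ P.logFormsTwist (P.floorPole (μ + 1)) (p + 2) x) :
    ∃ τ ∈ P.logFormsTwist (P.floorPole (ν - 1)) p x,
      ω - P.Θ t τ ∈ P.logFormsTwist (P.floorPole μ) (p + 1) x := by
  obtain ⟨N, hN⟩ := exists_nat_ge (ν - μ - 1)
  induction N generalizing ν ω with
  | zero => exact exists_sub_Θ_mem hP t (by simpa [sub_sub, add_comm] using hN) hω hΘ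
  | succ N ih =>
    by_cases h2 : ν ≤ μ + 1
    · exact exists_sub_Θ_mem hP t h2 hω hΘ
    -- Subtracting `Θτ` does not change `Θω`, so the hypothesis survives and the induction continues
    -- with `ω - Θτ`.
    · obtain ⟨τ, hτ, h3⟩ := exists_sub_Θ_mem hP t (μ := ν - 1) (by linarith) hω
        (twist_mono (by linarith) _ _ hΘ)
      obtain ⟨τ', hτ', h4⟩ := ih (ν := ν - 1) (by linarith) h3 (by rwa [Θ_sub_Θ]) (by
        push_cast at hN
        linarith)
      refine ⟨τ + τ', add_mem hτ (twist_mono (by linarith) _ _ hτ'), ?_⟩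
      rwa [map_add, ← sub_sub]

end CompactifiedPair

end KontsevichLog

/-! ### Lattices with rescaled basis vectors. -/

namespace ExteriorLattice

open Module

variable {k K V : Type} [CommRing k] [Field K] [Algebra k K] [AddCommGroup V] [Module K V]
variable {A : Subalgebra k K} {n : ℕ}

lemma mem_span_smul_iff (e : Basis (Fin n) K V) {p : ℕ} {c : Finset (Fin n) → K}
    (hc : ∀ S, c S ≠ 0) {ω : ExteriorAlgebra K V} :
    ω ∈ Submodule.span A (Set.range fun S : {S : Finset (Fin n) // S.card = p} =>
      c S.1 • e.ExteriorAlgebra S.1) ↔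
      ω ∈ ⋀[K]^p V ∧ ∀ S, (c S)⁻¹ * e.ExteriorAlgebra.repr ω S ∈ A := by
  constructor
  · intro h
    induction h using Submodule.span_induction with
    | mem x hx =>
      obtain ⟨T, rfl⟩ := hx
      refine ⟨?_, fun S => ?_⟩
      · rw [exteriorPower_eq e]
        exact Submodule.smul_mem _ _ (Submodule.subset_span ⟨T, rfl⟩)
      · rw [map_smul, Finsupp.smul_apply, Basis.repr_self, Finsupp.single_apply]
        split_ifs with h
        · rw [h, smul_eq_mul, mul_one, inv_mul_cancel₀ (hc S)]
          exact one_mem A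
        · rw [smul_zero, mul_zero]
          exact zero_mem A
    | zero => exact ⟨zero_mem _, fun S => by simp⟩
    | add x y _ _ hx hy =>
      refine ⟨add_mem hx.1 hy.1, fun S => ?_⟩
      rw [map_add, Finsupp.add_apply, mul_add]
      exact add_mem (hx.2 S) (hy.2 S)
    | smul a x _ hx =>
      refine ⟨Submodule.smul_mem _ (a : K) hx.1, fun S => ?_⟩
      have : e.ExteriorAlgebra.repr (a • x) S = (a : K) * e.ExteriorAlgebra.repr x S := by
        change e.ExteriorAlgebra.repr ((a : K) • x) S = _
        rw [map_smul]; rfl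
      rw [this, mul_left_comm]
      exact mul_mem a.2 (hx.2 S)
  · rintro ⟨h, hS⟩
    rw [← e.ExteriorAlgebra.sum_repr ω]
    refine sum_mem fun S _ => ?_
    by_cases hS' : S.card = p
    · have := Submodule.smul_mem (Submodule.span A (Set.range
        fun S : {S : Finset (Fin n) // S.card = p} => c S.1 • e.ExteriorAlgebra S.1))
        (⟨_, hS S⟩ : A) (Submodule.subset_span ⟨⟨S, hS'⟩, rfl⟩)
      refine (congrArg (· ∈ _) ?_).mp this
      change ((c S)⁻¹ * e.ExteriorAlgebra.repr ω S) • c S • e.ExteriorAlgebra S = _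
      rw [smul_smul, mul_right_comm, inv_mul_cancel₀ (hc S), one_mul]
    · rw [repr_eq_zero e h hS', zero_smul]
      exact zero_mem _

lemma repr_ι_mul_of_notMem (e : Basis (Fin n) K V) {j : Fin n} {S : Finset (Fin n)} (hS : j ∉ S)
    (ω : ExteriorAlgebra K V) :
    e.ExteriorAlgebra.repr (ExteriorAlgebra.ι K (e j) * ω) S = 0 := by
  rw [← basis_singleton, ← e.ExteriorAlgebra.sum_repr ω, Finset.mul_sum, map_sum,
    Finsupp.finsetSum_apply]
  refine Finset.sum_eq_zero fun T _ => ?_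
  rw [mul_smul_comm, map_smul, Finsupp.smul_apply]
  obtain ⟨h1, h2⟩ := basis_mul e {j} T
  have hne : insert j T ≠ S := fun h => hS (h ▸ Finset.mem_insert_self j T)
  by_cases hT : Disjoint {j} T
  · rcases h2 hT with h | h <;> rw [h] <;> simp [hne]
  · rw [h1 hT]; simp

end ExteriorLattice

/-! ### Local bases of the Kontsevich sheaves. -/

namespace KontsevichLog

open CategoryTheory AlgebraicGeometry TopologicalSpace Opposite
open KahlerForms LogAlgebra ExteriorLattice

namespace CompactifiedPair

variable {P : CompactifiedPair}

/-- Elements of the stalk at `x` lie in the stalks near `x`. -/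
def IsOpenFamily {M : Type} [AddCommGroup M] [Module P.K M]
    (L : (x : P.X) → Submodule (P.localRing x) M) : Prop :=
  ∀ x, ∀ m ∈ L x, ∃ V : P.X.Opens, x ∈ V ∧ ∀ y ∈ V, m ∈ L y

lemma isOpenFamily_twist (hP : P.IsNondegenerate) (α : ℚ) (p : ℕ) :
    IsOpenFamily (P.logFormsTwist (P.floorPole α) p) := by
  intro x ω hω
  obtain ⟨e, V, hxV, hV, hh, -⟩ := exists_frame hP x
  obtain ⟨h, hh⟩ := hh α
  obtain ⟨V', hx', hV'⟩ := hh.exists_opens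
  obtain ⟨V'', hx'', hV''⟩ := exists_opens_mem_logForms hP.1 ((mem_logFormsTwist_iff hh).1 hω)
  exact ⟨V' ⊓ V'', ⟨hx', hx''⟩, fun y hy => (mem_logFormsTwist_iff (hV' y hy.1)).2 (hV'' y hy.2)⟩

lemma isOpenFamily_kontsevich (hP : P.IsNondegenerate) (t : Flavour) (α : ℚ) (p : ℕ) :
    IsOpenFamily (P.kontsevich t α p) := by
  intro x ω hω
  obtain ⟨V, hx, hV⟩ := isOpenFamily_twist hP α p x ω hω.1
  obtain ⟨V', hx', hV'⟩ := isOpenFamily_twist hP α (p + 1) x _ hω.2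
  exact ⟨V ⊓ V', ⟨hx, hx'⟩, fun y hy => ⟨hV y hy.1, hV' y hy.2⟩⟩

lemma isOpenFamily_bot {M : Type} [AddCommGroup M] [Module P.K M] :
    IsOpenFamily fun x : P.X => (⊥ : Submodule (P.localRing x) M) := by
  intro x m hm
  exact ⟨⊤, trivial, fun y _ => (Submodule.mem_bot _).2 ((Submodule.mem_bot _).1 hm)⟩

lemma isOpenFamily_hodgeTerm (hP : P.IsNondegenerate) (l : ℚ) (i : ℕ) :
    IsOpenFamily (P.hodgeTerm l i) := by
  unfold hodgeTerm
  split_ifs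
  exacts [isOpenFamily_twist hP _ _, isOpenFamily_bot]

lemma isOpenFamily_kontsevichTrunc (hP : P.IsNondegenerate) (t : Flavour) (α : ℚ) (p : ℤ) (i : ℕ) :
    IsOpenFamily (P.kontsevichTrunc t α p i) := by
  unfold kontsevichTrunc
  split_ifs
  exacts [isOpenFamily_kontsevich hP _ _ _, isOpenFamily_bot]

/-- Locally, `L` is spanned by `r` linearly independent elements. -/
def IsLocallySpanned {M : Type} [AddCommGroup M] [Module P.K M]
    (L : (x : P.X) → Submodule (P.localRing x) M) (r : ℕ) : Prop :=
  ∀ x, ∃ (W : P.X.Opens) (b : Fin r → M), x ∈ W ∧ LinearIndependent P.K b ∧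
    ∀ y ∈ W, L y = Submodule.span (P.localRing y) (Set.range b)

lemma mem_twist_iff_repr {x : P.X} {e : Module.Basis (Fin P.dim) P.K (Ω[P.K⁄ℂ])}
    (he : IsLogFrame e x) {D : P.X → ℤ} {h : P.K} (hh : IsTwistGenerator D h x) {p : ℕ}
    {ω : P.RatForms} : ω ∈ P.logFormsTwist D p x ↔ ω ∈ ⋀[P.K]^p (Ω[P.K⁄ℂ]) ∧
      ∀ S, h⁻¹ * e.ExteriorAlgebra.repr ω S ∈ P.localRing x := by
  rw [mem_logFormsTwist_iff hh, he p, mem_deg1_pow_iff,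
    Submodule.smul_mem_iff _ (inv_ne_zero hh.ne_zero)]
  refine and_congr_right fun _ => forall_congr' fun S => ?_
  rw [map_smul]
  rfl

/-- A basis of the Kontsevich forms. -/
lemma kontsevich_eq_span (hP : P.IsNondegenerate) (t : Flavour) {α : ℚ} {p : ℕ} {x : P.X}
    {e : Module.Basis (Fin P.dim) P.K (Ω[P.K⁄ℂ])} (he : IsLogFrame e x) {h : P.K}
    (hh : IsTwistGenerator (P.floorPole α) h x) {g : P.K} {j : Fin P.dim}
    (hg : IsTwistGenerator (P.floorPole (-1)) g x)
    (hj : e j = g • KaehlerDifferential.D ℂ P.K P.ratFun) :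
    P.kontsevich t α p x = Submodule.span (P.localRing x)
      (Set.range fun S : {S : Finset (Fin P.dim) // S.card = p} =>
        (if j ∈ S.1 then h else g * h) • e.ExteriorAlgebra S.1) := by
  have hφ : ∀ i, e.coord j (e i) ∈ P.localRing x := by
    intro i
    rw [e.coord_apply, e.repr_self, Finsupp.single_apply]
    split_ifs
    exacts [one_mem _, zero_mem _]
  have hφj : e.coord j (e j) = 1 := by simp
  have hgmem : g ∈ P.localRing x := (mem_localRing_iff_forall_ord hg.ne_zero).2 fun η h1 hη => by
    rw [hg.ord_eq η h1 hη, floorPole_neg_one, neg_neg]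
    exact poleMult_nonneg η
  have hdf : ∀ ω : P.RatForms, P.dRat P.ratFun * ω = g⁻¹ • (ExteriorAlgebra.ι P.K (e j) * ω) := by
    intro ω
    rw [hj, map_smul, smul_mul_assoc, smul_smul, inv_mul_cancel₀ hg.ne_zero, one_smul, dRat]
  ext ω
  have hc : ∀ S : Finset (Fin P.dim), (if j ∈ S then h else g * h) ≠ 0 := fun S => by
    split_ifs
    exacts [hh.ne_zero, mul_ne_zero hg.ne_zero hh.ne_zero]
  constructor
  · intro hω
    obtain ⟨h1, h2⟩ := (mem_kontsevich_iff hP).1 hω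
    have h1' := (mem_twist_iff_repr he hh).1 h1
    refine (mem_span_smul_iff e hc).2 ⟨h1'.1, fun S => ?_⟩
    split_ifs with hjS
    · exact h1'.2 S
    -- For `S` without `j` the coefficient of `ω` equals that of `ι(e_j ∧ ω)`, and `e_j ∧ ω = g df ∧
    -- ω` is divisible by `g h`.
    rw [hdf, mem_logFormsTwist_iff hh, he, smul_smul, ← mul_inv, mul_comm] at h2
    have h3 := contractLeft_mem_pow e (e.coord j) hφ p h2
    rw [map_smul] at h3
    have h4 := (mem_deg1_pow_iff e).1 h3
    have h5 := h4.2 S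
    have h6 := congrArg (fun ω => e.ExteriorAlgebra.repr ω S)
      (eq_mul_contractLeft_add (e.coord j) (e j) hφj ω)
    simp only [map_add, Finsupp.add_apply] at h6
    rw [repr_ι_mul_of_notMem e hjS, zero_add] at h6
    rw [h6]
    rw [map_smul, Finsupp.smul_apply, smul_eq_mul] at h5
    exact h5
  · intro hω
    refine (Submodule.span_le.2 ?_ : Submodule.span (P.localRing x) _ ≤ P.kontsevich t α p x) hω
    rintro _ ⟨⟨S, hS⟩, rfl⟩
    have hbase : h • e.ExteriorAlgebra S ∈ P.logFormsTwist (P.floorPole α) p x := by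
      rw [mem_logFormsTwist_iff hh, he, smul_smul, inv_mul_cancel₀ hh.ne_zero, one_smul, ← hS]
      exact basis_mem_pow e S
    refine (mem_kontsevich_iff hP).2 ?_
    simp only
    split_ifs with hjS
    -- For `j ∈ S` the wedge with `df`, a multiple of `e_j`, is zero, so no condition arises.
    · refine ⟨hbase, ?_⟩
      rw [mul_smul_comm, hdf, ← basis_singleton, (basis_mul e {j} S).1
        (fun h => Finset.disjoint_singleton_left.1 h hjS), smul_zero, smul_zero]
      exact zero_mem _
    -- For `j ∉ S` the factor `g` cancels the pole of `df`.
    · rw [mul_smul]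
      refine ⟨Submodule.smul_mem _ (⟨g, hgmem⟩ : P.localRing x) hbase, ?_⟩
      rw [mul_smul_comm, hdf, smul_smul, mul_inv_cancel₀ hg.ne_zero, one_smul]
      refine mul_mem_twist hP ?_ hbase
      rw [he 1, pow_one]
      exact ι_mem_deg1 _ j

lemma exists_fin_reindex {e : Module.Basis (Fin P.dim) P.K (Ω[P.K⁄ℂ])} {p : ℕ}
    {c : Finset (Fin P.dim) → P.K} (hc : ∀ S, c S ≠ 0) :
    ∃ b : Fin (P.dim.choose p) → P.RatForms, LinearIndependent P.K b ∧
      Set.range b = Set.range fun S : {S : Finset (Fin P.dim) // S.card = p} =>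
        c S.1 • e.ExteriorAlgebra S.1 := by
  have hcard : Fintype.card {S : Finset (Fin P.dim) // S.card = p} = P.dim.choose p := by
    rw [Fintype.card_finset_len, Fintype.card_fin]
  let E := (Fintype.equivFinOfCardEq hcard).symm
  refine ⟨_ ∘ E, LinearIndependent.comp ?_ E E.injective, E.surjective.range_comp _⟩
  exact (basis_linearIndependent e p).units_smul fun S => Units.mk0 (c S.1) (hc S.1)

/-- Off the poles of `f` the kernel condition is empty near `x`, and all the `h e_S` span; along the
poles `kontsevich_eq_span` applies throughout a neighbourhood. -/
theorem isLocallySpanned_kontsevich (hP : P.IsNondegenerate) (t : Flavour) (α : ℚ) (p : ℕ) :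
    IsLocallySpanned (P.kontsevich t α p) (P.dim.choose p) := by
  intro x
  obtain ⟨e, V, hxV, hV, hh, hcase⟩ := exists_frame hP x
  obtain ⟨h, hh⟩ := hh α
  obtain ⟨V', hx', hV'⟩ := hh.exists_opens
  rcases hcase with ⟨hf, h0⟩ | ⟨g, j, hg, hj⟩
  · have h1 : IsTwistGenerator (P.floorPole (-1)) 1 x := ⟨one_ne_zero, fun η h1 hη => by
      rw [ord_one, floorPole_eq_zero _ (h0 η h1 hη), neg_zero]⟩
    obtain ⟨W, hxW, hW⟩ := h1.exists_opens
    obtain ⟨W', hxW', hW'⟩ := exists_opens_mem_localRing hf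
    obtain ⟨b, hb, hr⟩ := exists_fin_reindex (e := e) (p := p) (c := fun _ => h)
      fun _ => hh.ne_zero
    refine ⟨V ⊓ V' ⊓ W ⊓ W', b, ⟨⟨⟨hxV, hx'⟩, hxW⟩, hxW'⟩, hb, fun y hy => ?_⟩
    rw [hr]
    ext ω
    rw [mem_span_smul_iff e (fun _ => hh.ne_zero),
      ← mem_twist_iff_repr (hV y hy.1.1.1) (hV' y hy.1.1.2)]
    refine ⟨fun H => H.1, fun H => (mem_kontsevich_iff hP).2 ⟨H, ?_⟩⟩
    exact P.dRat_mul_mem_logFormsTwist ⟨_, hW' y hy.2⟩ H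
  · obtain ⟨W, hxW, hW⟩ := hg.exists_opens
    obtain ⟨b, hb, hr⟩ := exists_fin_reindex (e := e) (p := p)
      (c := fun S => if j ∈ S then h else g * h) fun S => by
        split_ifs
        exacts [hh.ne_zero, mul_ne_zero hg.ne_zero hh.ne_zero]
    exact ⟨V ⊓ V' ⊓ W, b, ⟨⟨hxV, hx'⟩, hxW⟩, hb, fun y hy => by
      rw [hr, kontsevich_eq_span hP t (hV y hy.1.1) (hV' y hy.1.2) (hW y hy.2) hj]⟩

/-- Twisting the Kontsevich forms. -/
lemma mem_kontsevich_iff_smul (hP : P.IsNondegenerate) (t : Flavour) {α : ℚ} {p : ℕ} {x : P.X}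
    {h : P.K} (hh : IsTwistGenerator (P.floorPole α) h x) {ω : P.RatForms} :
    ω ∈ P.kontsevich t α p x ↔ h⁻¹ • ω ∈ P.kontsevich t 0 p x := by
  have h0 : IsTwistGenerator (P.floorPole 0) 1 x := ⟨one_ne_zero, fun η h1 hη => by
    rw [ord_one, floorPole, zero_mul, Int.floor_zero, neg_zero]⟩
  rw [mem_kontsevich_iff hP, mem_kontsevich_iff hP, mem_logFormsTwist_iff hh,
    mem_logFormsTwist_iff hh, mem_logFormsTwist_iff h0, mem_logFormsTwist_iff h0, inv_one, one_smul,
    one_smul, mul_smul_comm]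

end CompactifiedPair

end KontsevichLog

/-! ### Sections of the sheaves; local freeness. -/

namespace KontsevichLog

open CategoryTheory AlgebraicGeometry TopologicalSpace Opposite
open KahlerForms LogAlgebra ExteriorLattice

namespace CompactifiedPair

variable {P : CompactifiedPair}

lemma evalAt_injective {W : P.X.Opens} (y : W) : Function.Injective (P.evalAt W y) := by
  intro a b h
  have : Nonempty W := ⟨y⟩
  refine Scheme.germToFunctionField_injective P.X W ?_
  refine (Scheme.algebraMap_germ_eq_germToFunctionField P.X y.2 a).symm.trans ?_
  exact (congrArg Subtype.val h).trans (Scheme.algebraMap_germ_eq_germToFunctionField P.X y.2 b)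

/-- A rational function that is regular at all points of `W` is a section over `W`. -/
lemma exists_evalAt_eq {W : P.X.Opens} {g : P.K} (hg : ∀ y ∈ W, g ∈ P.localRing y) :
    ∃ a : Γ(P.X, W), ∀ y : W, (P.evalAt W y a : P.K) = g := by
  have key : ∀ y : W, ∃ (V : P.X.Opens) (_ : y.1 ∈ V) (_ : V ≤ W) (b : Γ(P.X, V)),
      ∀ z : V, (P.evalAt V z b : P.K) = g := by
    intro y
    obtain ⟨t, ht⟩ := hg y.1 y.2
    obtain ⟨V, hyV, b, rfl⟩ := P.X.presheaf.exists_germ_eq t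
    refine ⟨V ⊓ W, ⟨hyV, y.2⟩, inf_le_right, P.X.presheaf.map (homOfLE inf_le_left).op b,
      fun z => ?_⟩
    rw [evalAt_map, evalAt_eq P b _ ⟨y.1, hyV⟩]
    exact ht
  choose V hyV hVW b hb using key
  have hcompat : TopCat.Presheaf.IsCompatible P.X.sheaf.1 V b := by
    intro i j
    by_cases hne : Nonempty (V i ⊓ V j : Opens P.X)
    · obtain ⟨z⟩ := hne
      refine evalAt_injective z (Subtype.ext ?_)
      refine (congrArg Subtype.val (evalAt_map P (Opens.infLELeft (V i) (V j)) (b i) z)).trans ?_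
      refine Eq.trans ?_
        (congrArg Subtype.val (evalAt_map P (Opens.infLERight (V i) (V j)) (b j) z)).symm
      rw [hb, hb]
    · have : (V i ⊓ V j : Opens P.X) = ⊥ :=
        Opens.ext (Set.eq_empty_of_forall_notMem fun z hz => hne ⟨⟨z, hz⟩⟩)
      have hs : Subsingleton Γ(P.X, V i ⊓ V j) := by
        rw [this]; infer_instance
      exact hs.elim _ _
  obtain ⟨a, ha, -⟩ := P.X.sheaf.existsUnique_gluing' V W (fun i => homOfLE (hVW i))
    (fun y hy => Opens.mem_iSup.2 ⟨⟨y, hy⟩, hyV _⟩) b hcompat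
  refine ⟨a, fun y => ?_⟩
  rw [← hb y ⟨y.1, hyV y⟩, ← ha y]
  exact (congrArg Subtype.val (evalAt_map P (homOfLE (hVW y)) a ⟨y.1, hyV y⟩)).symm

section Sections

variable {M : Type} [AddCommGroup M] [Module P.K M]
variable {L : (x : P.X) → Submodule (P.localRing x) M}

/-- Sections of `sheafOf L` are constant, since `X` is irreducible. -/
lemma secs_eq {W : P.X.Opens} (s : P.secs L W) (y z : W) : s.1 y = s.1 z := by
  have hη : genericPoint P.X ∈ W := (genericPoint_specializes y.1).mem_open W.isOpen y.2
  obtain ⟨V, hy, m, hm⟩ := s.2 y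
  obtain ⟨V', hz, m', hm'⟩ := s.2 z
  rw [(hm y hy).1, (hm' z hz).1,
    ← (hm ⟨_, hη⟩ ((genericPoint_specializes y.1).mem_open V.isOpen hy)).1,
    ← (hm' ⟨_, hη⟩ ((genericPoint_specializes z.1).mem_open V'.isOpen hz)).1]

variable (L) in
/-- The section with the value `m`. -/
def constSec (W : P.X.Opens) (m : M) (h : ∀ y ∈ W, m ∈ L y) : P.secs L W :=
  ⟨fun _ => m, fun _ => ⟨W, by simp, m, fun y hy => ⟨rfl, h y.1 hy⟩⟩⟩

/-- A sheaf that is locally spanned by `r` linearly independent elements is locally free. -/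
theorem isLocallyFreeOfRank_sheafOf {r : ℕ} (h : IsLocallySpanned L r) :
    IsLocallyFreeOfRank (P.sheafOf L) r := by
  intro x
  obtain ⟨V, b, hx, hli, hV⟩ := h x
  have hb : ∀ j, ∀ y ∈ V, b j ∈ L y := fun j y hy => by
    rw [hV y hy]; exact Submodule.subset_span ⟨j, rfl⟩
  refine ⟨V, hx, fun j => constSec L V (b j) (hb j), fun W hW => ?_⟩
  have key : ∀ (c : Fin r → Γ(P.X, W)) (y : W), ((∑ j, c j • (P.sheafOf L).presheaf.map
      (homOfLE hW).op (constSec L V (b j) (hb j)) : Γ(P.sheafOf L, W)) : P.secs L W).1 y =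
      ∑ j, (P.evalAt W y (c j) : P.K) • b j := by
    intro c y
    let ev : P.secs L W →+ M := (Pi.evalAddMonoidHom (fun _ : W => M) y).comp
      (P.secs L W).subtype
    exact map_sum ev (fun j => c j • constSec L W (b j) fun y hy => hb j y (hW hy)) Finset.univ
  constructor
  · intro c c' hcc
    by_cases hne : Nonempty W
    · obtain ⟨y⟩ := hne
      have h1 := key c y
      rw [show (∑ j, c j • (P.sheafOf L).presheaf.map (homOfLE hW).op
        (constSec L V (b j) (hb j)) : Γ(P.sheafOf L, W)) = _ from hcc, key c' y] at h1
      funext j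
      refine evalAt_injective y (Subtype.ext ?_)
      have h2 : ∑ j, ((P.evalAt W y (c' j) : P.K) - P.evalAt W y (c j)) • b j = 0 := by
        simp only [sub_smul, Finset.sum_sub_distrib, h1, sub_self]
      exact (sub_eq_zero.1 (Fintype.linearIndependent_iff.1 hli _ h2 j)).symm
    · have : W = ⊥ := Opens.ext (Set.eq_empty_of_forall_notMem fun z hz => hne ⟨⟨z, hz⟩⟩)
      have hs : Subsingleton Γ(P.X, W) := by rw [this]; infer_instance
      exact Subsingleton.elim _ _
  · intro s
    by_cases hne : Nonempty W
    · obtain ⟨z⟩ := hne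
      set m := (s : P.secs L W).1 z with hm
      have hmem : ∀ y ∈ W, ∃ c : Fin r → P.localRing y, ∑ j, (c j : P.K) • b j = m := by
        intro y hy
        have := P.secs_mem L s ⟨y, hy⟩
        rw [secs_eq s ⟨y, hy⟩ z, hV y (hW hy)] at this
        exact (Submodule.mem_span_range_iff_exists_fun _).1 this
      obtain ⟨c, hc⟩ := hmem z.1 z.2
      -- Coefficients are unique over the function field, so those found at `z` agree with those at
      -- every `y` and are regular on all of `W`.
      have hcmem : ∀ j, ∀ y ∈ W, (c j : P.K) ∈ P.localRing y := by
        intro j y hy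
        obtain ⟨c', hc'⟩ := hmem y hy
        have h2 : ∑ j, ((c j : P.K) - c' j) • b j = 0 := by
          simp only [sub_smul, Finset.sum_sub_distrib, hc, hc', sub_self]
        rw [sub_eq_zero.1 (Fintype.linearIndependent_iff.1 hli _ h2 j)]
        exact (c' j).2
      choose a ha using fun j => exists_evalAt_eq (hcmem j)
      refine ⟨a, ?_⟩
      refine Subtype.ext (funext fun y => ?_)
      refine (key a y).trans ?_
      simp only [ha, hc]
      exact secs_eq s z y
    · refine ⟨0, ?_⟩
      refine Subtype.ext (funext fun y => (hne ⟨y⟩).elim)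

end Sections

end CompactifiedPair

end KontsevichLog

/-! ### The tensor product with an invertible sheaf. -/

namespace KontsevichLog

open CategoryTheory AlgebraicGeometry TopologicalSpace Opposite
open KahlerForms LogAlgebra ExteriorLattice

lemma isIso_homEquiv_symm {C : Type} [Category.{0} C] {J : GrothendieckTopology C}
    [HasWeakSheafify J AddCommGrpCat.{0}] {Q : Cᵒᵖ ⥤ AddCommGrpCat.{0}}
    {F : Sheaf J AddCommGrpCat.{0}} (φ : Q ⟶ F.obj)
    (h : IsIso ((presheafToSheaf J AddCommGrpCat.{0}).map φ)) :
    IsIso (((sheafificationAdjunction J AddCommGrpCat.{0}).homEquiv Q F).symm φ) := by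
  rw [Adjunction.homEquiv_counit]
  infer_instance

/-- A locally bijective map from a presheaf to a sheaf induces an isomorphism from the
sheafification; this can be tested on underlying abelian sheaves. -/
lemma isIso_sheafificationHomEquiv_symm {C : Type} [Category.{0} C] {J : GrothendieckTopology C}
    {R₀ : Cᵒᵖ ⥤ RingCat.{0}} {R : Sheaf J RingCat.{0}} (α : R₀ ⟶ R.obj)
    [Presheaf.IsLocallyInjective J α] [Presheaf.IsLocallySurjective J α]
    [J.WEqualsLocallyBijective AddCommGrpCat.{0}] [HasWeakSheafify J AddCommGrpCat.{0}]
    {Q : PresheafOfModules.{0} R₀} {F : SheafOfModules.{0} R}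
    (g : Q ⟶ (PresheafOfModules.restrictScalars α).obj ((SheafOfModules.forget _).obj F))
    (h₁ : Presheaf.IsLocallyInjective J ((PresheafOfModules.toPresheaf _).map g))
    (h₂ : Presheaf.IsLocallySurjective J ((PresheafOfModules.toPresheaf _).map g)) :
    IsIso ((PresheafOfModules.sheafificationHomEquiv α).symm g) := by
  have hW := J.W_of_isLocallyBijective ((PresheafOfModules.toPresheaf _).map g)
  rw [GrothendieckTopology.W_iff] at hW
  have : IsIso ((SheafOfModules.toSheaf _).map
      ((PresheafOfModules.sheafificationHomEquiv α).symm g)) := by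
    rw [PresheafOfModules.toSheaf_map_sheafificationHomEquiv_symm]
    exact isIso_homEquiv_symm (F := (SheafOfModules.toSheaf R).obj F) _ hW
  exact isIso_of_reflects_iso _ (SheafOfModules.toSheaf _)

namespace CompactifiedPair

variable {P : CompactifiedPair}

variable {L L' : (x : P.X) → Submodule (P.localRing x) P.RatForms} {D : P.X → ℤ}

/-- The product of a form and a function. -/
def mulSec (h : ∀ x, ∀ u ∈ L x, ∀ g ∈ P.divisorStalk D x, g • u ∈ L' x) {W : P.X.Opens}
    (u : P.secs L W) (g : P.secs (P.divisorStalk D) W) : P.secs L' W :=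
  ⟨fun y => g.1 y • u.1 y, fun y => ⟨W, y.2, g.1 y • u.1 y, fun z _ => by
    change g.1 z • u.1 z = g.1 y • u.1 y ∧ _
    rw [secs_eq u y z, secs_eq g y z]
    exact ⟨rfl, h _ _ (P.secs_mem L u z) _ (P.secs_mem _ g z)⟩⟩⟩

/-- Multiplication of forms by functions. -/
def mulLin (h : ∀ x, ∀ u ∈ L x, ∀ g ∈ P.divisorStalk D x, g • u ∈ L' x) (W : P.X.Opens) :
    TensorProduct Γ(P.X, W) (P.secs L W) (P.secs (P.divisorStalk D) W) →ₗ[Γ(P.X, W)]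
      P.secs L' W :=
  TensorProduct.lift <| LinearMap.mk₂ _ (mulSec h)
    (fun _ _ _ => Subtype.ext (funext fun _ => smul_add _ _ _))
    (fun c u g => Subtype.ext (funext fun y =>
      (smul_comm (P.evalAt W y c : P.K) (g.1 y) (u.1 y)).symm))
    (fun _ _ _ => Subtype.ext (funext fun _ => add_smul _ _ _))
    (fun c u g => Subtype.ext (funext fun y => mul_smul (P.evalAt W y c : P.K) (g.1 y) (u.1 y)))

/-- Multiplication of forms by functions, as a morphism of presheaves of modules. -/
def mulHom (h : ∀ x, ∀ u ∈ L x, ∀ g ∈ P.divisorStalk D x, g • u ∈ L' x) :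
    PresheafOfModules.Monoidal.tensorObj (R := P.X.presheaf) (P.sheafOf L).val
      (P.sheafOf (P.divisorStalk D)).val ⟶
    (PresheafOfModules.restrictScalars (𝟙 P.X.ringCatSheaf.obj)).obj
      ((SheafOfModules.forget _).obj (P.sheafOf L')) where
  app W := show ModuleCat.of Γ(P.X, W.unop) (TensorProduct Γ(P.X, W.unop) (P.secs L W.unop)
    (P.secs (P.divisorStalk D) W.unop)) ⟶ ModuleCat.of Γ(P.X, W.unop) (P.secs L' W.unop) from
    ModuleCat.ofHom (mulLin h W.unop)
  naturality {V W} f := by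
    refine ModuleCat.MonoidalCategory.tensor_ext fun u g => ?_
    rfl

/-- Over an open set on which `𝒪(D)` is generated by `h`, every element of the tensor product is
a pure tensor with second factor `h`. -/
lemma exists_eq_tmul {W : P.X.Opens} {h : P.K} (hW : ∀ y ∈ W, IsTwistGenerator D h y)
    (t : TensorProduct Γ(P.X, W) (P.secs L W) (P.secs (P.divisorStalk D) W))
    (hmem : ∀ y ∈ W, h ∈ P.divisorStalk D y) :
    ∃ u, t = TensorProduct.tmul _ u (constSec (P.divisorStalk D) W h hmem) := by
  by_cases hne : Nonempty W
  · obtain ⟨z⟩ := hne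
    induction t using TensorProduct.induction_on with
    | zero => exact ⟨0, (TensorProduct.zero_tmul _ _).symm⟩
    | tmul u g =>
      obtain ⟨a, ha⟩ := exists_evalAt_eq (W := W) (g := h⁻¹ * g.1 z) fun y hy => by
        rw [← mem_divisorStalk_iff (hW y hy), secs_eq g z ⟨y, hy⟩]
        exact P.secs_mem _ g ⟨y, hy⟩
      refine ⟨a • u, ?_⟩
      rw [TensorProduct.smul_tmul]
      congr 1
      refine Subtype.ext (funext fun y => ?_)
      refine (secs_eq g y z).trans (Eq.trans ?_ (congrArg (· * h) (ha y)).symm)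
      rw [mul_right_comm, inv_mul_cancel₀ (hW z.1 z.2).ne_zero, one_mul]
    | add t t' ht ht' =>
      obtain ⟨u, rfl⟩ := ht
      obtain ⟨u', rfl⟩ := ht'
      exact ⟨u + u', (TensorProduct.add_tmul _ _ _).symm⟩
  · have hs : Subsingleton (P.secs L W) :=
      ⟨fun s s' => Subtype.ext (funext fun y => (hne ⟨y⟩).elim)⟩
    have : Subsingleton (TensorProduct Γ(P.X, W) (P.secs L W) (P.secs (P.divisorStalk D) W)) := by
      infer_instance
    exact ⟨0, Subsingleton.elim _ _⟩

/-- If `𝒪(D)` is locally generated by one function `h` and locally `L' = h • L`, then multiplication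
induces an isomorphism. -/
theorem twistIso_of_generators
    (hgen : ∀ x, ∃ (W : P.X.Opens) (h : P.K), x ∈ W ∧ ∀ y ∈ W, IsTwistGenerator D h y)
    (hL : ∀ {x h}, IsTwistGenerator D h x → ∀ ω, ω ∈ L' x ↔ h⁻¹ • ω ∈ L x) :
    P.TwistIso L L' D := by
  have h : ∀ x, ∀ u ∈ L x, ∀ g ∈ P.divisorStalk D x, g • u ∈ L' x := by
    intro x u hu g hg
    obtain ⟨W, h, hx, hW⟩ := hgen x
    rw [hL (hW x hx), smul_smul]
    exact (L x).smul_mem ⟨_, (mem_divisorStalk_iff (hW x hx)).1 hg⟩ hu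
  have hmem : ∀ {W : P.X.Opens} {h : P.K}, (∀ y ∈ W, IsTwistGenerator D h y) →
      ∀ y ∈ W, h ∈ P.divisorStalk D y := by
    intro W h hW y hy
    rw [mem_divisorStalk_iff (hW y hy), inv_mul_cancel₀ (hW y hy).ne_zero]
    exact one_mem _
  -- Locally both elements are of the form `u ⊗ k` with the same generator `k`, and `k` can be
  -- cancelled.
  have h₁ : Presheaf.IsLocallyInjective (Opens.grothendieckTopology P.X)
      ((PresheafOfModules.toPresheaf _).map (mulHom h)) := by
    refine ⟨fun {W} s t hst => ?_⟩
    intro x hx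
    obtain ⟨V, k, hxV, hV⟩ := hgen x
    have hV' : ∀ y ∈ W.unop ⊓ V, IsTwistGenerator D k y := fun y hy => hV y hy.2
    let T := PresheafOfModules.Monoidal.tensorObj (R := P.X.presheaf) (P.sheafOf L).val
      (P.sheafOf (P.divisorStalk D)).val
    let i : W.unop ⊓ V ⟶ W.unop := homOfLE inf_le_left
    refine ⟨W.unop ⊓ V, i, ?_, ⟨hx, hxV⟩⟩
    change T.presheaf.map i.op s = T.presheaf.map i.op t
    have hnat : ∀ r : T.presheaf.obj W, mulLin h (W.unop ⊓ V) (T.presheaf.map i.op r) =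
        P.secsRes L' i (mulLin h W.unop r) := fun r =>
      NatTrans.naturality_apply ((PresheafOfModules.toPresheaf _).map (mulHom h)) i.op r
    have hst' : mulLin h (W.unop ⊓ V) (T.presheaf.map i.op s) =
        mulLin h (W.unop ⊓ V) (T.presheaf.map i.op t) :=
      (hnat s).trans ((congrArg (P.secsRes L' i) hst).trans (hnat t).symm)
    obtain ⟨u, hu⟩ := exists_eq_tmul hV' (T.presheaf.map i.op s) (hmem hV')
    obtain ⟨u', hu'⟩ := exists_eq_tmul hV' (T.presheaf.map i.op t) (hmem hV')
    rw [hu, hu'] at hst' ⊢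
    congr 1
    refine Subtype.ext (funext fun y => ?_)
    have := congrArg (fun r : P.secs L' (W.unop ⊓ V) => r.1 y) hst'
    exact smul_right_injective _ (hV' y y.2).ne_zero this
  -- Locally a section `m` is the image of `k⁻¹ m ⊗ k`.
  have h₂ : Presheaf.IsLocallySurjective (Opens.grothendieckTopology P.X)
      ((PresheafOfModules.toPresheaf _).map (mulHom h)) := by
    refine ⟨fun {W} s => ?_⟩
    intro x hx
    obtain ⟨V, k, hxV, hV⟩ := hgen x
    have hk : ∀ y ∈ W ⊓ V, k⁻¹ • (s : P.secs L' W).1 ⟨x, hx⟩ ∈ L y := fun y hy => by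
      rw [← hL (hV y hy.2), secs_eq s ⟨x, hx⟩ ⟨y, hy.1⟩]
      exact P.secs_mem _ s ⟨y, hy.1⟩
    refine ⟨W ⊓ V, homOfLE inf_le_left, ⟨TensorProduct.tmul _ (constSec L (W ⊓ V) _ hk)
      (constSec (P.divisorStalk D) (W ⊓ V) k fun y hy => hmem hV y hy.2), ?_⟩, ⟨hx, hxV⟩⟩
    refine Subtype.ext (funext fun y => ?_)
    change k • k⁻¹ • (s : P.secs L' W).1 ⟨x, hx⟩ = (s : P.secs L' W).1 ⟨y.1, y.2.1⟩
    rw [smul_smul, mul_inv_cancel₀ (hV x hxV).ne_zero, one_smul]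
    exact secs_eq s _ _
  have hiso := isIso_sheafificationHomEquiv_symm (𝟙 P.X.ringCatSheaf.obj) (mulHom h) h₁ h₂
  refine ⟨@asIso _ _ _ _ _ hiso, fun W u g y => ?_⟩
  unfold applyTmul
  change (((PresheafOfModules.sheafificationHomEquiv (𝟙 P.X.ringCatSheaf.obj)
    ((PresheafOfModules.sheafificationHomEquiv (𝟙 P.X.ringCatSheaf.obj)).symm (mulHom h))).app
      (op W)).hom (TensorProduct.tmul Γ(P.X, W) u g) : P.secs L' W).1 y = _
  erw [Equiv.apply_symm_apply]
  rfl

theorem twistIso_kontsevich (hP : P.IsNondegenerate) (t : Flavour) (α : ℚ) (p : ℕ) :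
    P.TwistIso (P.kontsevich t 0 p) (P.kontsevich t α p) (P.floorPole α) := by
  refine twistIso_of_generators (fun x => ?_) fun hh ω => mem_kontsevich_iff_smul hP t hh
  obtain ⟨-, -, -, -, hh, -⟩ := exists_frame hP x
  obtain ⟨h, hh⟩ := hh α
  obtain ⟨V, hx, hV⟩ := hh.exists_opens
  exact ⟨V, h, hx, hV⟩

end CompactifiedPair

end KontsevichLog

/-! ### Quasi-isomorphism criteria for complexes of sheaves. -/

section

open CategoryTheory Limits

/-- A criterion for quasi-isomorphisms of cochain complexes in an abelian category. -/
lemma CochainComplex.quasiIso_of_refinements {C : Type*} [Category* C] [Abelian C]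
    {K L : CochainComplex C ℕ} (φ : K ⟶ L) [∀ i, Mono (φ.f i)]
    (h : ∀ (i : ℕ) ⦃A : C⦄ (y : A ⟶ L.X i) (z : A ⟶ K.X (i + 1)),
      y ≫ L.d i (i + 1) = z ≫ φ.f (i + 1) →
      ∃ (A' : C) (π : A' ⟶ A) (_ : Epi π) (c : A' ⟶ K.X i)
        (t : A' ⟶ L.X ((ComplexShape.up ℕ).prev i)), π ≫ y = c ≫ φ.f i + t ≫ L.d _ i) :
    QuasiIso φ := by
  refine ⟨fun j => ?_⟩
  rw [quasiIsoAt_iff_isIso_homologyMap]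
  have hnext : (ComplexShape.up ℕ).next j = j + 1 := ComplexShape.next_eq' _ rfl
  -- A cycle of `K` that bounds some `y` in `L` bounds in `K` after changing `y` by a boundary. In
  -- degree zero there is no incoming differential: `prev 0 = 0` and the differential is zero.
  have h₁ : Mono (HomologicalComplex.homologyMap φ j) := by
    cases j with
    | zero =>
      rw [HomologicalComplex.mono_homologyMap_iff_up_to_refinements φ _ 0 _ rfl hnext]
      intro A x hx y hxy
      have : L.d ((ComplexShape.up ℕ).prev 0) 0 = 0 := L.shape _ _ (by simp)
      rw [this, comp_zero] at hxy
      refine ⟨A, 𝟙 A, inferInstance, 0, ?_⟩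
      rw [Category.id_comp, zero_comp, ← cancel_mono (φ.f 0), hxy, zero_comp]
    | succ k =>
      have hprev : (ComplexShape.up ℕ).prev (k + 1) = k := ComplexShape.prev_eq' _ rfl
      rw [HomologicalComplex.mono_homologyMap_iff_up_to_refinements φ _ _ _ hprev hnext]
      intro A x hx y hxy
      obtain ⟨A', π, hπ, c, t, hct⟩ := h k y x hxy.symm
      refine ⟨A', π, hπ, c, ?_⟩
      have := congrArg (· ≫ L.d k (k + 1)) hct
      simp only [Preadditive.add_comp, Category.assoc, L.d_comp_d, comp_zero, add_zero] at this
      rw [← cancel_mono (φ.f (k + 1)), Category.assoc, hxy, this, Category.assoc, φ.comm]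
  -- The case `z = 0` of the hypothesis: each cycle of `L` is a cycle of `K` up to a boundary.
  have h₂ : Epi (HomologicalComplex.homologyMap φ j) := by
    rw [HomologicalComplex.epi_homologyMap_iff_up_to_refinements φ _ j _ rfl hnext]
    intro A y hy
    obtain ⟨A', π, hπ, c, t, hct⟩ := h j y 0 (by rw [hy, zero_comp])
    refine ⟨A', π, hπ, c, ?_, t, hct⟩
    have := congrArg (· ≫ L.d j (j + 1)) hct
    simp only [Preadditive.add_comp, Category.assoc, L.d_comp_d, comp_zero, add_zero, hy] at this
    rw [← cancel_mono (φ.f (j + 1)), Category.assoc, ← φ.comm, ← this, zero_comp]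
  exact isIso_of_mono_of_epi _

namespace SheafExact

open TopologicalSpace Opposite

variable {T : Type} [TopologicalSpace T]

variable (T) in
/-- Sheaves of abelian groups on `T`. -/
abbrev AbSheaf : Type 1 := Sheaf (Opens.grothendieckTopology T) AddCommGrpCat.{0}

lemma app_injective {F G : AbSheaf T} (f : F ⟶ G) [Mono f] (U : Opens T) :
    Function.Injective (f.hom.app (op U)) := by
  have h₁ : Mono ((sheafToPresheaf _ _).map f) := inferInstance
  have h₂ : Mono (((sheafToPresheaf _ _).map f).app (op U)) := inferInstance
  exact (AddCommGrpCat.mono_iff_injective _).1 h₂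

/-- A short complex of sheaves of abelian groups is exact if cycles are locally boundaries. -/
lemma exact_of_locally (S : ShortComplex (AbSheaf T))
    (h : ∀ (U : Opens T) (s : S.X₂.obj.obj (op U)), S.g.hom.app (op U) s = 0 → ∀ x ∈ U,
      ∃ (V : Opens T) (i : V ⟶ U), x ∈ V ∧ ∃ t : S.X₁.obj.obj (op V),
        S.f.hom.app (op V) t = S.X₂.obj.map i.op s) : S.Exact := by
  rw [S.exact_iff_epi_toCycles, ← Sheaf.isLocallySurjective_iff_epi']
  refine ⟨fun {U} z x hx => ?_⟩
  have hz : S.g.hom.app (op U) (S.iCycles.hom.app (op U) z) = 0 := by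
    have := congrArg (fun f : S.cycles ⟶ S.X₃ => f.hom.app (op U) z) S.iCycles_g
    exact this
  obtain ⟨V, i, hxV, t, ht⟩ := h U _ hz x hx
  refine ⟨V, i, ⟨t, ?_⟩, hxV⟩
  refine app_injective S.iCycles V ?_
  have h₁ := congrArg (fun f : S.X₁ ⟶ S.X₂ => f.hom.app (op V) t) S.toCycles_i
  refine Eq.trans h₁ (ht.trans ?_)
  exact (NatTrans.naturality_apply S.iCycles.hom i.op z).symm

lemma biprod_ext {F G : AbSheaf T} {U : Opens T} {s t : (F ⊞ G).obj.obj (op U)}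
    (h₁ : (biprod.fst : F ⊞ G ⟶ F).hom.app (op U) s = (biprod.fst : F ⊞ G ⟶ F).hom.app (op U) t)
    (h₂ : (biprod.snd : F ⊞ G ⟶ G).hom.app (op U) s = (biprod.snd : F ⊞ G ⟶ G).hom.app (op U) t) :
    s = t := by
  have key : ∀ s : (F ⊞ G).obj.obj (op U), s =
      (biprod.inl : F ⟶ F ⊞ G).hom.app (op U) ((biprod.fst : F ⊞ G ⟶ F).hom.app (op U) s) +
      (biprod.inr : G ⟶ F ⊞ G).hom.app (op U) ((biprod.snd : F ⊞ G ⟶ G).hom.app (op U) s) :=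
    fun s => (congrArg (fun f : F ⊞ G ⟶ F ⊞ G => f.hom.app (op U) s)
      (biprod.total (X := F) (Y := G))).symm
  rw [key s, key t, h₁, h₂]

/-- A criterion for quasi-isomorphisms of complexes of sheaves of abelian groups. -/
lemma quasiIso_of_locally {K L : CochainComplex (AbSheaf T) ℕ} (φ : K ⟶ L) [∀ i, Mono (φ.f i)]
    (h : ∀ (i : ℕ) (U : Opens T) (s : (L.X i).obj.obj (op U)) (z : (K.X (i + 1)).obj.obj (op U)),
      (L.d i (i + 1)).hom.app (op U) s = (φ.f (i + 1)).hom.app (op U) z → ∀ x ∈ U,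
      ∃ (V : Opens T) (j : V ⟶ U), x ∈ V ∧ ∃ (c : (K.X i).obj.obj (op V))
        (i' : ℕ) (_ : (ComplexShape.up ℕ).prev i = i') (t : (L.X i').obj.obj (op V)),
        (φ.f i).hom.app (op V) c + (L.d i' i).hom.app (op V) t = (L.X i).obj.map j.op s) :
    QuasiIso φ := by
  refine CochainComplex.quasiIso_of_refinements φ fun i A y z hyz => ?_
  -- A piece of the mapping cone up to signs. Its exactness in the middle gives the required
  -- refinements, and exactness can be checked locally on sections.
  let S : ShortComplex (AbSheaf T) :=
    { X₁ := K.X i ⊞ L.X ((ComplexShape.up ℕ).prev i)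
      X₂ := L.X i ⊞ K.X (i + 1)
      X₃ := L.X (i + 1)
      f := biprod.desc (biprod.lift (φ.f i) (K.d i (i + 1))) (biprod.lift (L.d _ i) 0)
      g := biprod.desc (L.d i (i + 1)) (-φ.f (i + 1))
      zero := by refine biprod.hom_ext' _ _ ?_ ?_ <;> simp }
  have hS : S.Exact := by
    refine exact_of_locally S fun U s hs x hx => ?_
    set a := (biprod.fst : L.X i ⊞ K.X (i + 1) ⟶ _).hom.app (op U) s with ha
    set b := (biprod.snd : L.X i ⊞ K.X (i + 1) ⟶ _).hom.app (op U) s with hb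
    have hab : (L.d i (i + 1)).hom.app (op U) a = (φ.f (i + 1)).hom.app (op U) b := by
      have h₁ : S.g = biprod.fst ≫ L.d i (i + 1) - biprod.snd ≫ φ.f (i + 1) := by
        refine biprod.hom_ext' _ _ ?_ ?_ <;> simp [S]
      have h₂ := congrArg (fun f : S.X₂ ⟶ S.X₃ => f.hom.app (op U) s) h₁
      exact sub_eq_zero.1 (h₂.symm.trans hs)
    obtain ⟨V, j, hxV, c, _, rfl, t, hct⟩ := h i U a b hab x hx
    refine ⟨V, j, hxV, (biprod.inl : K.X i ⟶ K.X i ⊞ _).hom.app (op V) c +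
      (biprod.inr : _ ⟶ K.X i ⊞ L.X ((ComplexShape.up ℕ).prev i)).hom.app (op V) t, ?_⟩
    have e₁ : ∀ {G : AbSheaf T} (ψ : S.X₁ ⟶ G), ψ.hom.app (op V)
        ((biprod.inl : K.X i ⟶ K.X i ⊞ _).hom.app (op V) c +
        (biprod.inr : _ ⟶ K.X i ⊞ L.X ((ComplexShape.up ℕ).prev i)).hom.app (op V) t) =
        (biprod.inl ≫ ψ).hom.app (op V) c + (biprod.inr ≫ ψ).hom.app (op V) t := fun ψ =>
      map_add (ψ.hom.app (op V)).hom _ _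
    have e₂ : (biprod.fst : S.X₂ ⟶ L.X i).hom.app (op V) (S.X₂.obj.map j.op s) =
        (L.X i).obj.map j.op a := NatTrans.naturality_apply
          (biprod.fst : L.X i ⊞ K.X (i + 1) ⟶ L.X i).hom j.op s
    have e₃ : (biprod.snd : S.X₂ ⟶ K.X (i + 1)).hom.app (op V) (S.X₂.obj.map j.op s) =
        (K.X (i + 1)).obj.map j.op b := NatTrans.naturality_apply
          (biprod.snd : L.X i ⊞ K.X (i + 1) ⟶ K.X (i + 1)).hom j.op s
    have e₄ : biprod.inl ≫ S.f ≫ biprod.fst = φ.f i := by simp [S]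
    have e₅ : biprod.inr ≫ S.f ≫ biprod.fst = L.d _ i := by simp [S]
    have e₆ : biprod.inl ≫ S.f ≫ biprod.snd = K.d i (i + 1) := by simp [S]
    have e₇ : biprod.inr ≫ S.f ≫ biprod.snd = 0 := by simp [S]
    refine biprod_ext ?_ ?_
    · refine Eq.trans (e₁ (S.f ≫ biprod.fst)) ?_
      rw [e₄, e₅]
      exact hct.trans e₂.symm
    · refine Eq.trans (e₁ (S.f ≫ biprod.snd)) ?_
      rw [e₆, e₇]
      refine Eq.trans ?_ e₃.symm
      refine Eq.trans (add_zero _) ?_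
      -- The second component follows from the first one, because `φ` is a monomorphism and the
      -- differential of the boundary term vanishes.
      refine app_injective (φ.f (i + 1)) V ?_
      have f₁ := congrArg (fun f => f.hom.app (op V) c) (φ.comm i (i + 1))
      refine Eq.trans f₁.symm ?_
      refine Eq.trans ?_ (NatTrans.naturality_apply (φ.f (i + 1)).hom j.op b).symm
      refine Eq.trans ?_ (congrArg ((L.X (i + 1)).obj.map j.op) hab)
      refine Eq.trans ?_ (NatTrans.naturality_apply (L.d i (i + 1)).hom j.op a)
      have f₂ := congrArg ((L.d i (i + 1)).hom.app (op V)) hct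
      refine Eq.trans ?_ f₂
      refine Eq.trans ?_ (map_add ((L.d i (i + 1)).hom.app (op V)).hom _ _).symm
      have f₃ := congrArg (fun f => f.hom.app (op V) t) (L.d_comp_d _ i (i + 1))
      exact (((congrArg _ f₃).trans (add_zero _))).symm
  obtain ⟨A', π, hπ, x₁, hx₁⟩ := hS.exact_up_to_refinements (biprod.lift y z)
    (by simp [S, hyz])
  refine ⟨A', π, hπ, x₁ ≫ biprod.fst, x₁ ≫ biprod.snd, ?_⟩
  have h₁ := congrArg (· ≫ biprod.fst) hx₁
  simp only [Category.assoc, biprod.lift_fst] at h₁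
  rw [h₁]
  have h₂ : S.f ≫ biprod.fst = biprod.fst ≫ φ.f i + biprod.snd ≫ L.d _ i := by
    refine biprod.hom_ext' _ _ ?_ ?_ <;> simp [S]
  rw [h₂, Preadditive.comp_add, Category.assoc, Category.assoc]

end SheafExact

end

/-! ### The inclusions of complexes. -/

namespace KontsevichLog

open CategoryTheory AlgebraicGeometry TopologicalSpace Opposite
open KahlerForms LogAlgebra ExteriorLattice

namespace CompactifiedPair

variable {P : CompactifiedPair}

section Criterion

variable {C D : ℕ → (x : P.X) → Submodule (P.localRing x) P.RatForms}

lemma mono_inclusion_f (t : Flavour) (h : P.IsSubcomplex t C) (h' : P.IsSubcomplex t D)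
    (hle : ∀ i x, C i x ≤ D i x) (i : ℕ) : Mono ((P.inclusion t h h' hle).f i) := by
  have h₁ : Mono ((sheafToPresheaf _ _).map ((P.inclusion t h h' hle).f i)) := by
    have : ∀ W, Mono (((sheafToPresheaf _ _).map ((P.inclusion t h h' hle).f i)).app W) := by
      intro W
      refine (AddCommGrpCat.mono_iff_injective _).2 fun s s' hs => ?_
      refine Subtype.ext (funext fun y => ?_)
      exact congrArg (fun r : P.secs (D i) W.unop => r.1 y) hs
    exact NatTrans.mono_of_mono_app _
  exact (sheafToPresheaf _ _).mono_of_mono_map h₁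

lemma complex_d_apply (t : Flavour) (h : P.IsSubcomplex t C) (i : ℕ) {W : P.X.Opens}
    (s : P.secs (C i) W) (y : W) :
    (((P.complex t h).d i (i + 1)).hom.app (op W) s : P.secs (C (i + 1)) W).1 y =
      P.Θ t (s.1 y) := by
  have e : (P.complex t h).d i (i + 1) = P.sheafMap (P.Θ t) (h i) :=
    CochainComplex.of_d (fun i => P.abSheaf (C i)) (fun i => P.sheafMap (P.Θ t) (h i)) i
  exact congrArg (fun f : P.abSheaf (C i) ⟶ P.abSheaf (C (i + 1)) =>
    (f.hom.app (op W) s : P.secs (C (i + 1)) W).1 y) e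

/-- A stalkwise criterion for the inclusion of complexes to be a quasi-isomorphism. -/
theorem inclusionIsQuasiIso (t : Flavour) (h : P.IsSubcomplex t C) (h' : P.IsSubcomplex t D)
    (hle : ∀ i x, C i x ≤ D i x) (hC : ∀ i, IsOpenFamily (C i)) (hD : ∀ i, IsOpenFamily (D i))
    (h₀ : ∀ x, ∀ ω ∈ D 0 x, P.Θ t ω ∈ C 1 x → ω ∈ C 0 x)
    (h₁ : ∀ k x, ∀ ω ∈ D (k + 1) x, P.Θ t ω ∈ C (k + 2) x →
      ∃ τ ∈ D k x, ω - P.Θ t τ ∈ C (k + 1) x) :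
    P.InclusionIsQuasiIso C D t := by
  refine ⟨h, h', hle, ?_⟩
  have := mono_inclusion_f t h h' hle
  refine SheafExact.quasiIso_of_locally _ fun i U s z hsz x hx => ?_
  -- Sections are constant, so everything is decided by the value at `x`; the openness of the
  -- families spreads the stalkwise solution to a neighbourhood.
  have hΘ : P.Θ t ((s : P.secs (D i) U).1 ⟨x, hx⟩) = (z : P.secs (C (i + 1)) U).1 ⟨x, hx⟩ :=
    (complex_d_apply t h' i s ⟨x, hx⟩).symm.trans
      (congrArg (fun r : P.secs (D (i + 1)) U => r.1 ⟨x, hx⟩) hsz)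
  have hs := P.secs_mem (D i) s ⟨x, hx⟩
  have hz := P.secs_mem (C (i + 1)) z ⟨x, hx⟩
  rw [← hΘ] at hz
  cases i with
  | zero =>
    obtain ⟨V, hxV, hV⟩ := hC 0 x _ (h₀ x _ hs hz)
    refine ⟨U ⊓ V, homOfLE inf_le_left, ⟨hx, hxV⟩,
      constSec (C 0) (U ⊓ V) _ fun y hy => hV y hy.2, _, rfl, 0, ?_⟩
    have hd : (P.complex t h').d ((ComplexShape.up ℕ).prev 0) 0 = 0 :=
      HomologicalComplex.shape _ _ _ (by simp)
    rw [hd, map_zero, add_zero]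
    exact Subtype.ext (funext fun y => secs_eq s ⟨x, hx⟩ ⟨y.1, y.2.1⟩)
  | succ k =>
    obtain ⟨τ, hτ, hω⟩ := h₁ k x _ hs hz
    obtain ⟨V, hxV, hV⟩ := hC (k + 1) x _ hω
    obtain ⟨V', hxV', hV'⟩ := hD k x _ hτ
    refine ⟨U ⊓ (V ⊓ V'), homOfLE inf_le_left, ⟨hx, hxV, hxV'⟩,
      constSec (C (k + 1)) (U ⊓ (V ⊓ V')) _ fun y hy => hV y hy.2.1, k,
      ComplexShape.prev_eq' _ rfl,
      constSec (D k) (U ⊓ (V ⊓ V')) τ fun y hy => hV' y hy.2.2, ?_⟩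
    refine Subtype.ext (funext fun y => ?_)
    have e := complex_d_apply t h' k
      (constSec (D k) (U ⊓ (V ⊓ V')) τ fun y hy => hV' y hy.2.2) y
    refine Eq.trans (congrArg (((s : P.secs (D (k + 1)) U).1 ⟨x, hx⟩ - P.Θ t τ) + ·) e) ?_
    refine (sub_add_cancel _ _).trans ?_
    exact secs_eq s ⟨x, hx⟩ ⟨y.1, y.2.1⟩

end Criterion

lemma isSubcomplex_hodgeTerm (hP : P.IsNondegenerate) (t : Flavour) (l : ℚ) :
    P.IsSubcomplex t (P.hodgeTerm l) := by
  intro i x ω hω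
  unfold hodgeTerm at hω ⊢
  split_ifs at hω with h
  · have e : ((i + 1 : ℕ) : ℚ) - l = (i - l) + 1 := by push_cast; ring
    rw [if_pos (by rw [e]; positivity), e]
    exact Θ_mem_twist hP t hω
  · rw [(Submodule.mem_bot _).1 hω, map_zero]
    exact zero_mem _

lemma isSubcomplex_kontsevich (t : Flavour) (α : ℚ) : P.IsSubcomplex t (P.kontsevich t α) := by
  intro i x ω hω
  refine ⟨hω.2, ?_⟩
  rw [Θ_Θ]
  exact zero_mem _

lemma isSubcomplex_kontsevichTrunc (t : Flavour) (α : ℚ) (p : ℤ) :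
    P.IsSubcomplex t (P.kontsevichTrunc t α p) := by
  intro i x ω hω
  unfold kontsevichTrunc at hω ⊢
  split_ifs at hω with h
  · rw [if_pos (by push_cast; omega)]
    exact isSubcomplex_kontsevich t α i x ω hω
  · rw [(Submodule.mem_bot _).1 hω, map_zero]
    exact zero_mem _

lemma hodgeTerm_of_nonneg {l μ : ℚ} {i : ℕ} (h : i - l = μ) (hμ : 0 ≤ μ) (x : P.X) :
    P.hodgeTerm l i x = P.logFormsTwist (P.floorPole μ) i x := by
  subst h
  exact if_pos hμ

/-- In degree `i` the two complexes have the twists `i` and `i + α`. Pole reduction with `μ = i`, `ν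
= i + α` gives both conditions of the criterion; the form `τ` of twist `ν - 1` lands in degree `i -
1` of the larger complex. -/
theorem hodge_inclusionIsQuasiIso (hP : P.IsNondegenerate) (t : Flavour) {α : ℚ} (hα : 0 ≤ α) :
    P.InclusionIsQuasiIso (P.hodgeTerm 0) (P.hodgeTerm (-α)) t := by
  have hC : ∀ (i : ℕ) x, P.hodgeTerm 0 i x = P.logFormsTwist (P.floorPole i) i x := fun i x =>
    hodgeTerm_of_nonneg (sub_zero _) (by positivity) x
  have hD : ∀ (i : ℕ) x, P.hodgeTerm (-α) i x = P.logFormsTwist (P.floorPole (i + α)) i x :=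
    fun i x => hodgeTerm_of_nonneg (sub_neg_eq_add _ _) (by positivity) x
  refine inclusionIsQuasiIso t (isSubcomplex_hodgeTerm hP t _) (isSubcomplex_hodgeTerm hP t _)
    (fun i x => ?_) (isOpenFamily_hodgeTerm hP _) (isOpenFamily_hodgeTerm hP _)
    (fun x ω hω hΘ => ?_) fun k x ω hω hΘ => ?_
  · rw [hC, hD]
    exact twist_mono (by linarith) i x
  · rw [hC] at hΘ ⊢
    rw [hD] at hω
    refine mem_twist_of_Θ_mem hP t (by simpa using hα) hω ?_
    simpa using hΘ
  · rw [hC] at hΘ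
    rw [hD] at hω
    have e : (((k + 2 : ℕ) : ℚ)) = ((k + 1 : ℕ) : ℚ) + 1 := by push_cast; ring
    rw [e] at hΘ
    obtain ⟨τ, hτ, hτ'⟩ := exists_sub_Θ_mem_twist hP t (by linarith) hω hΘ
    refine ⟨τ, ?_, ?_⟩
    · rw [hD]
      convert hτ using 3
      push_cast; ring
    · rw [hC]
      exact hτ'

/-- In degree `i ≥ p` the twist `i - p + α` is reduced to `α`; the new form keeps the old `Θω`,
which already lies in the `α`-twist, so it is a Kontsevich form. The alternative in `hp` also covers
the untruncated complex for arbitrary `α ≥ 0`. -/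
theorem kontsevichTrunc_inclusionIsQuasiIso (hP : P.IsNondegenerate) (t : Flavour) {α : ℚ}
    (hα : 0 ≤ α) {p : ℤ} (hp : α < 1 ∨ p ≤ 0) :
    P.InclusionIsQuasiIso (P.kontsevichTrunc t α p) (P.hodgeTerm (-α + p)) t := by
  have hC : ∀ (i : ℕ) x, p ≤ i → P.kontsevichTrunc t α p i x = P.kontsevich t α i x :=
    fun i x hi => if_pos hi
  have hC' : ∀ {i : ℕ} {x ω}, ω ∈ P.kontsevichTrunc t α p i x →
      ω ∈ P.logFormsTwist (P.floorPole α) i x := fun {i x ω} h => by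
    unfold kontsevichTrunc at h
    split_ifs at h
    · exact h.1
    · rw [(Submodule.mem_bot _).1 h]
      exact zero_mem _
  have hD : ∀ (i : ℕ) x, p ≤ i → P.hodgeTerm (-α + p) i x =
      P.logFormsTwist (P.floorPole (i - p + α)) i x := fun i x hi => by
    have : (p : ℚ) ≤ i := by exact_mod_cast hi
    exact hodgeTerm_of_nonneg (by ring) (by linarith) x
  have hD' : ∀ (i : ℕ) x, ¬ p ≤ i → P.hodgeTerm (-α + p) i x = ⊥ := fun i x hi => by
    have h₁ : ((i + 1 : ℤ) : ℚ) ≤ (p : ℚ) := by exact_mod_cast not_le.1 hi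
    -- The bound guarantees that the larger complex, too, starts in degree `p`: for `i ≤ p - 1` the
    -- index `i - p + α` is negative.
    have h₂ : α < 1 := hp.resolve_right (by omega)
    push_cast at h₁
    exact if_neg (by linarith)
  refine inclusionIsQuasiIso t (isSubcomplex_kontsevichTrunc t _ _)
    (isSubcomplex_hodgeTerm hP t _) (fun i x => ?_) (isOpenFamily_kontsevichTrunc hP t _ _)
    (isOpenFamily_hodgeTerm hP _) (fun x ω hω hΘ => ?_) fun k x ω hω hΘ => ?_
  · by_cases hi : p ≤ i
    · rw [hD i x hi]
      have : (p : ℚ) ≤ i := by exact_mod_cast hi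
      exact fun ω hω => twist_mono (by linarith) i x (hC' hω)
    · exact (if_neg hi).le.trans bot_le
  · by_cases hi : p ≤ (0 : ℕ)
    · rw [hC 0 x hi]
      rw [hD 0 x hi] at hω
      have : (p : ℚ) ≤ 0 := by exact_mod_cast hi
      exact ⟨mem_twist_of_Θ_mem hP t (by push_cast; linarith) hω
        (twist_mono (by linarith) 1 x (hC' hΘ)), hC' hΘ⟩
    · rw [hD' 0 x hi] at hω
      rw [(Submodule.mem_bot _).1 hω]
      exact zero_mem _
  · by_cases hi : p ≤ (k + 1 : ℕ)
    · rw [hD _ x hi] at hω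
      have key : ∀ τ, ω - P.Θ t τ ∈ P.logFormsTwist (P.floorPole α) (k + 1) x →
          ω - P.Θ t τ ∈ P.kontsevichTrunc t α p (k + 1) x := fun τ hτ => by
        rw [hC _ x hi]
        refine ⟨hτ, ?_⟩
        rw [map_sub, Θ_Θ, sub_zero]
        exact hC' hΘ
      by_cases hk : p ≤ k
      · have : (p : ℚ) ≤ k := by exact_mod_cast hk
        obtain ⟨τ, hτ, hτ'⟩ := exists_sub_Θ_mem_twist hP t (by push_cast; linarith) hω
          (twist_mono (show α ≤ α + 1 by linarith) (k + 2) x (hC' hΘ))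
        refine ⟨τ, ?_, key τ hτ'⟩
        rw [hD k x hk]
        convert hτ using 3
        push_cast; ring
      -- In the lowest degree `p` the twist is already `α`, so nothing has to be subtracted, and no
      -- form of lower degree would be available.
      · have hk' : p = k + 1 := by push_cast at hi; omega
        refine ⟨0, zero_mem _, key 0 ?_⟩
        rw [map_zero, sub_zero]
        convert hω using 3
        rw [hk']; push_cast; ring
    · rw [hD' _ x hi] at hω
      refine ⟨0, zero_mem _, ?_⟩
      rw [(Submodule.mem_bot _).1 hω, map_zero, sub_zero]
      exact zero_mem _

theorem kontsevich_inclusionIsQuasiIso (hP : P.IsNondegenerate) (t : Flavour) {α : ℚ}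
    (hα : 0 ≤ α) : P.InclusionIsQuasiIso (P.kontsevich t α) (P.hodgeTerm (-α)) t := by
  have h := kontsevichTrunc_inclusionIsQuasiIso hP t hα (p := 0) (Or.inr le_rfl)
  rw [Int.cast_zero, add_zero] at h
  have e : P.kontsevichTrunc t α 0 = P.kontsevich t α :=
    funext fun i => funext fun x => if_pos (by positivity)
  rwa [e] at h

end CompactifiedPair

end KontsevichLog

theorem proposition2p1 (P : KontsevichLog.CompactifiedPair) (hP : P.IsNondegenerate) :
    (∀ (t : KontsevichLog.Flavour) (α : ℚ) (p : ℕ),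
      KontsevichLog.IsLocallyFreeOfRank (P.sheafOf (P.kontsevich t α p)) (P.dim.choose p) ∧
      P.TwistIso (P.kontsevich t 0 p) (P.kontsevich t α p) (P.floorPole α)) ∧
    (∀ (α : ℚ) (p : ℕ), P.kontsevich .deRham α p = P.kontsevich .higgs α p) ∧
    (∀ t : KontsevichLog.Flavour,
      (∀ α : ℚ, 0 ≤ α → P.InclusionIsQuasiIso (P.hodgeTerm 0) (P.hodgeTerm (-α)) t) ∧
      (∀ α : ℚ, 0 ≤ α → P.InclusionIsQuasiIso (P.kontsevich t α) (P.hodgeTerm (-α)) t) ∧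
      (∀ (α : ℚ) (p : ℤ), 0 ≤ α → α < 1 →
        P.InclusionIsQuasiIso (P.kontsevichTrunc t α p) (P.hodgeTerm (-α + p)) t)) := by
  exact ⟨fun t α p =>
      ⟨KontsevichLog.CompactifiedPair.isLocallyFreeOfRank_sheafOf
        (KontsevichLog.CompactifiedPair.isLocallySpanned_kontsevich hP t α p),
      KontsevichLog.CompactifiedPair.twistIso_kontsevich hP t α p⟩,
    KontsevichLog.CompactifiedPair.kontsevich_deRham_eq_higgs hP,
    fun t => ⟨fun α hα => KontsevichLog.CompactifiedPair.hodge_inclusionIsQuasiIso hP t hα,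
      fun α hα => KontsevichLog.CompactifiedPair.kontsevich_inclusionIsQuasiIso hP t hα,
      fun α p hα hα' => KontsevichLog.CompactifiedPair.kontsevichTrunc_inclusionIsQuasiIso hP t hα
        (Or.inl hα')⟩⟩

end
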